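/- **Setting.** Let $(U,g)$ be a smooth Riemannian manifold of dimension $n$ without boundary, with Riemannian volume $dV$, and let $\varphi:U\to\mathbb R$ be a limiting Carleman weight: $\varphi$ is smooth, $d\varphi\neq 0$ everywhere, and the semiclassical principal symbol $p_\varphi(x,\xi)=g^{jk}(\xi_j+i\partial_j\varphi)(\xi_k+i\partial_k\varphi)$ of $e^{\varphi/h}h^2\Delta e^{-\varphi/h}$ satisfies $\{\operatorname{Re}p_\varphi,\operatorname{Im}p_\varphi\}=0$ at all points of $T^*U$ where $p_\varphi=0$. Here $\Delta u=d^*du=-|g|^{-1/2}\partial_j\big(|g|^{1/2}g^{jk}\partial_k u\big)$ is the nonnegative Laplacian, acting componentwise on vector-valued functions. Let $M\subset U$ be a compact subset which is a domain with smooth boundary, that is, a compact manifold with boundary of dimension $n$, and let $M^{int}$ be its interior. For a section $v$ of a Hermitian bundle $E$ with connection $\nabla$ and $h>0$ put $$\|v\|_{L^2(M;E)}^2=\int_M|v|^2\,dV,\qquad \|v\|_{H^1_{scl}(M;E)}=\Big(\|v\|^2_{L^2(M;E)}+h^2\|\nabla v\|^2_{L^2(M;T^*M\otimes E)}\Big)^{1/2},$$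 with $\nabla=d$ for the trivial bundle $\mathbb C^m$. **Theorem.** (1) Let $X$ be an $m\times m$ matrix of complex vector fields, smooth on $M$, and $q$ an $m\times m$ matrix of complex functions, smooth on $M$. Then there are constants $C>0$ and $h_0>0$ such that for all $0<h\le h_0$ and all $u\in C_c^\infty(M^{int};\mathbb C^m)$ $$\|e^{\varphi/h}u\|_{H^1_{scl}(M;\mathbb C^m)}\le C\,h\,\|e^{\varphi/h}(\Delta+X+q)u\|_{L^2(M;\mathbb C^m)} .$$ (2) Let $E$ be a smooth Hermitian vector bundle of finite rank over $U$ with a smooth (complex linear) connection $A$ with covariant derivative $d_A$, let $d_A^*$ be the formal adjoint of $d_A$ in $L^2$, and let $Q$ be a section of $\operatorname{End}E$ that is smooth on $M$. Then there are constants $C'>0$ and $h_0'>0$ such that for all $0<h\le h_0'$ and all $u\in C_c^\infty(M^{int};E)$ $$\|e^{\varphi/h}u\|_{H^1_{scl}(M;E)}\le C'\,h\,\|e^{\varphi/h}(d_A^*d_A+Q)u\|_{L^2(M;E)} ,$$ where the $H^1_{scl}$ norm is formed with $\nabla=d_A$. -/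

import Mathlib

open Set Filter Topology MeasureTheory Bundle
open scoped Manifold ContDiff

noncomputable section

namespace Carleman

/-! ### Local coordinates, the Riemannian volume, the Laplacian -/

section Metric

variable {n : ℕ} {U : Type*} [TopologicalSpace U] [ChartedSpace (EuclideanSpace ℝ (Fin n)) U]
  [IsManifold (𝓡 n) ∞ U]

/-- The `i`-th standard basis vector of `ℝⁿ`. -/
abbrev stdVec (i : Fin n) : EuclideanSpace ℝ (Fin n) := EuclideanSpace.single i 1

/-- The coordinate vector `∂/∂xⁱ` at the point `y`, for the coordinates given by the preferred
chart at `x₀` (meaningful for `y` in the domain of this chart, where it is the image of the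
`i`-th standard basis vector under the derivative of the inverse of the chart). -/
def coordVec (x₀ y : U) (i : Fin n) : TangentSpace (𝓡 n) y :=
  (trivializationAt (EuclideanSpace ℝ (Fin n)) (TangentSpace (𝓡 n) : U → Type _) x₀).symmL ℝ y
    (stdVec i)

variable [RiemannianBundle (fun x : U => TangentSpace (𝓡 n) x)]

variable (n) in
/-- The matrix `(g_{ij})` of the metric at `y` in the coordinates given by the chart at `x₀`. -/
def gram (x₀ y : U) : Matrix (Fin n) (Fin n) ℝ :=
  Matrix.of fun i j => inner ℝ (coordVec x₀ y i) (coordVec x₀ y j)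

/-- The metric matrix `(g_{ij})` as a function of the coordinates `z`. -/
def metricAt (x₀ : U) (z : EuclideanSpace ℝ (Fin n)) : Matrix (Fin n) (Fin n) ℝ :=
  gram n x₀ ((chartAt (EuclideanSpace ℝ (Fin n)) x₀).symm z)

/-- The partial derivative `∂f/∂xʲ` of a function of the coordinates. -/
def pderiv {W : Type*} [NormedAddCommGroup W] [NormedSpace ℝ W] (j : Fin n)
    (f : EuclideanSpace ℝ (Fin n) → W) (z : EuclideanSpace ℝ (Fin n)) : W :=
  fderiv ℝ f z (stdVec j)

/-- The nonnegative Laplacian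
`Δu = -|g|^{-1/2} ∂_j (|g|^{1/2} g^{jk} ∂_k u)`, computed at `x` in the preferred chart at `x`;
it acts on vector-valued functions componentwise. -/
def laplacian {W : Type*} [NormedAddCommGroup W] [NormedSpace ℝ W] (u : U → W) (x : U) : W :=
  let c := chartAt (EuclideanSpace ℝ (Fin n)) x
  (-(√(metricAt x (c x)).det)⁻¹) • ∑ j : Fin n,
    pderiv j (fun z => √(metricAt (n := n) x z).det •
      ∑ k : Fin n, (metricAt x z)⁻¹ j k • pderiv k (fun z' => u (c.symm z')) z) (c x)

/-- The Hermitian inner product `g^{ij} ⟨α_i, β_j⟩` of two covectors at `x` with values in a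
complex inner product space. As in Mathlib, it is antilinear in the first argument. -/
def formInner {W : Type*} [NormedAddCommGroup W] [InnerProductSpace ℂ W] (x : U)
    (α β : TangentSpace (𝓡 n) x →L[ℝ] W) : ℂ :=
  ∑ i : Fin n, ∑ j : Fin n,
    (((gram n x x)⁻¹ i j : ℝ) : ℂ) * inner ℂ (α (coordVec x x i)) (β (coordVec x x j))

variable [MeasurableSpace U] [BorelSpace U]

variable (n) in
/-- The measure `|g|^{1/2} dx` on the domain of the chart at `x₀`, extended by zero. -/
def chartVolume (x₀ : U) : Measure U :=
  ((volume.restrict (chartAt (EuclideanSpace ℝ (Fin n)) x₀).target).withDensity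
    (fun z => ENNReal.ofReal (√(metricAt (n := n) x₀ z).det))).map
      (chartAt (EuclideanSpace ℝ (Fin n)) x₀).symm

variable (n U) in
/-- The Riemannian volume measure: the measures `|g|^{1/2} dx` of the charts, glued by a smooth
partition of unity subordinate to the charts (the result does not depend on the partition). -/
def riemannianVolume [T2Space U] [SigmaCompactSpace U] : Measure U :=
  Measure.sum fun i : U => (chartVolume n i).withDensity fun x =>
    ENNReal.ofReal
      ((SmoothPartitionOfUnity.exists_isSubordinate_chartAt_source (𝓡 n) U).choose i x)

end Metric

/-! ### Limiting Carleman weights and domains -/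

section Weights

variable {n : ℕ} {U : Type*} [TopologicalSpace U] [ChartedSpace (EuclideanSpace ℝ (Fin n)) U]
  [IsManifold (𝓡 n) ∞ U]

/-- The Poisson bracket `∑ⱼ ∂a/∂ξⱼ ∂b/∂xʲ - ∂a/∂xʲ ∂b/∂ξⱼ` of two functions of the canonical
coordinates `(x, ξ)` of the cotangent bundle. -/
def poissonBracket (a b : EuclideanSpace ℝ (Fin n) → EuclideanSpace ℝ (Fin n) → ℝ)
    (z ξ : EuclideanSpace ℝ (Fin n)) : ℝ :=
  ∑ j : Fin n,
    (pderiv j (fun η => a z η) ξ * pderiv j (fun y => b y ξ) z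
      - pderiv j (fun y => a y ξ) z * pderiv j (fun η => b z η) ξ)

/-- `M` is a domain with smooth boundary: near each of its boundary points it is a sublevel set
`{ρ ≤ 0}` of a smooth function whose differential does not vanish there. A closed such set is a
manifold with boundary of the same dimension as the ambient manifold, whose manifold interior is
the topological interior. -/
def IsSmoothDomain (n : ℕ) {U : Type*} [TopologicalSpace U]
    [ChartedSpace (EuclideanSpace ℝ (Fin n)) U] (M : Set U) : Prop :=
  ∀ x ∈ frontier M, ∃ ρ : U → ℝ, ContMDiff (𝓡 n) 𝓘(ℝ, ℝ) ∞ ρ ∧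
    mfderiv (𝓡 n) 𝓘(ℝ, ℝ) ρ x ≠ 0 ∧ ∀ᶠ y in 𝓝 x, y ∈ M ↔ ρ y ≤ 0

variable [RiemannianBundle (fun x : U => TangentSpace (𝓡 n) x)]

/-- The semiclassical principal symbol `g^{jk} (ξ_j + i ∂_jφ) (ξ_k + i ∂_kφ)` of
`e^{φ/h} h² Δ e^{-φ/h}`, in the canonical coordinates of the cotangent bundle induced by the
chart at `x₀`. -/
def conjSymbol (φ : U → ℝ) (x₀ : U) (z ξ : EuclideanSpace ℝ (Fin n)) : ℂ :=
  let dφ : Fin n → ℝ := fun j =>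
    pderiv j (fun z' => φ ((chartAt (EuclideanSpace ℝ (Fin n)) x₀).symm z')) z
  ∑ j : Fin n, ∑ k : Fin n, (((metricAt x₀ z)⁻¹ j k : ℝ) : ℂ) *
    ((ξ j : ℂ) + Complex.I * (dφ j : ℂ)) * ((ξ k : ℂ) + Complex.I * (dφ k : ℂ))

variable (n) in
/-- Limiting Carleman weights: smooth real functions without critical points such that
`{Re p, Im p} = 0` wherever `p = 0`, for `p` the principal symbol above. (The Poisson bracket
on the cotangent bundle is the same in all canonical coordinates.) -/
structure IsLCW (φ : U → ℝ) : Prop where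
  contMDiff : ContMDiff (𝓡 n) 𝓘(ℝ, ℝ) ∞ φ
  mfderiv_ne_zero : ∀ x, mfderiv (𝓡 n) 𝓘(ℝ, ℝ) φ x ≠ 0
  bracket : ∀ x₀ : U, ∀ z ∈ (chartAt (EuclideanSpace ℝ (Fin n)) x₀).target,
    ∀ ξ : EuclideanSpace ℝ (Fin n), conjSymbol φ x₀ z ξ = 0 →
      poissonBracket (fun y η => (conjSymbol φ x₀ y η).re)
        (fun y η => (conjSymbol φ x₀ y η).im) z ξ = 0

end Weights

/-! ### Norms -/

section Norms

variable {n : ℕ} {U : Type*} [TopologicalSpace U] [ChartedSpace (EuclideanSpace ℝ (Fin n)) U]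
  [IsManifold (𝓡 n) ∞ U] [RiemannianBundle (fun x : U => TangentSpace (𝓡 n) x)]
  [MeasurableSpace U] [BorelSpace U] [T2Space U] [SigmaCompactSpace U]
  {V : U → Type*} [∀ x, NormedAddCommGroup (V x)] [∀ x, InnerProductSpace ℂ (V x)]

variable (n) in
/-- The `L²(M; V)` norm of a section `s` of `V`. -/
def l2Norm (M : Set U) (s : Π x, V x) : ℝ :=
  √(∫ x in M, ‖s x‖ ^ 2 ∂(riemannianVolume n U))

/-- The `L²(M; T*M ⊗ V)` norm of a `V`-valued one-form `α`. -/
def l2NormForm (M : Set U) (α : Π x, TangentSpace (𝓡 n) x →L[ℝ] V x) : ℝ :=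
  √(∫ x in M, (formInner x (α x) (α x)).re ∂(riemannianVolume n U))

/-- The semiclassical `H¹(M; V)` norm `(‖s‖² + h² ‖∇s‖²)^{1/2}` of a section `s` whose covariant
derivative is the `V`-valued one-form `ds`. -/
def h1sclNorm (h : ℝ) (M : Set U) (s : Π x, V x)
    (ds : Π x, TangentSpace (𝓡 n) x →L[ℝ] V x) : ℝ :=
  √(l2Norm n M s ^ 2 + h ^ 2 * l2NormForm M ds ^ 2)

end Norms

/-! ### Systems on the trivial bundle -/

section Trivial

variable {n m : ℕ} {U : Type*} [TopologicalSpace U] [ChartedSpace (EuclideanSpace ℝ (Fin n)) U]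

/-- The action of an `m × m` matrix of complex vector fields `X_{kl} = Y_{kl} + i Z_{kl}` (with
`Y`, `Z` real vector fields): `(Xu)_k = ∑ₗ X_{kl} u_l`. -/
def vecFieldAction (Y Z : Fin m → Fin m → Π x : U, TangentSpace (𝓡 n) x)
    (u : U → EuclideanSpace ℂ (Fin m)) (x : U) : EuclideanSpace ℂ (Fin m) :=
  WithLp.toLp 2 fun k => ∑ l : Fin m,
    (mvfderiv (𝓡 n) (fun y => u y l) x (Y k l x)
      + Complex.I * mvfderiv (𝓡 n) (fun y => u y l) x (Z k l x))

/-- The action of a matrix function: `(qu)_k = ∑ₗ q_{kl} u_l`. -/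
def potentialAction (q : U → Matrix (Fin m) (Fin m) ℂ) (u : U → EuclideanSpace ℂ (Fin m))
    (x : U) : EuclideanSpace ℂ (Fin m) :=
  WithLp.toLp 2 ((q x).mulVec (u x).ofLp)

end Trivial

/-! ### Connections on Hermitian bundles -/

section Bundles

variable {n : ℕ} {U : Type*} [TopologicalSpace U] [ChartedSpace (EuclideanSpace ℝ (Fin n)) U]
  {F : Type*} [NormedAddCommGroup F] [NormedSpace ℂ F]
  {V : U → Type*} [TopologicalSpace (TotalSpace F V)]
  [∀ x, NormedAddCommGroup (V x)] [∀ x, InnerProductSpace ℂ (V x)] [FiberBundle F V]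

variable (n F) in
/-- Smooth sections of `V`. -/
def SmoothSection (s : Π x, V x) : Prop :=
  ContMDiff (𝓡 n) ((𝓡 n).prod 𝓘(ℝ, F)) ∞ (fun x => TotalSpace.mk' F x (s x))

variable (n F V) in
/-- The Hermitian metric of `V` is smooth: pairings of smooth sections are smooth functions. -/
def IsSmoothHermitian : Prop :=
  ∀ s t : Π x, V x, SmoothSection n F s → SmoothSection n F t →
    ContMDiff (𝓡 n) 𝓘(ℝ, ℂ) ∞ fun x => (inner ℂ (s x) (t x) : ℂ)

/-- The support of a section. -/
def secSupport (s : Π x, V x) : Set U := closure {x | s x ≠ 0}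

/-- A covariant derivative on a complex bundle is complex linear. (Mathlib's covariant
derivatives over a real manifold are only required to be real linear.) -/
def IsComplexLinear (A : CovariantDerivative (𝓡 n) F V) : Prop :=
  ∀ (s : Π x, V x) (x : U),
    MDifferentiableAt (𝓡 n) ((𝓡 n).prod 𝓘(ℝ, F)) (fun y => TotalSpace.mk' F y (s y)) x →
    ∀ v : TangentSpace (𝓡 n) x, A (fun y => Complex.I • s y) x v = Complex.I • A s x v

variable [IsManifold (𝓡 n) ∞ U] [RiemannianBundle (fun x : U => TangentSpace (𝓡 n) x)]
  [MeasurableSpace U] [BorelSpace U] [T2Space U] [SigmaCompactSpace U]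

/-- The smooth section `w` is the image of the `V`-valued one-form `α` under the formal adjoint
`d_A^*` of `d_A`: `(w, v) = (α, d_A v)` in `L²` for all smooth compactly supported `v`. -/
def IsFormalAdjointOf (A : CovariantDerivative (𝓡 n) F V)
    (α : Π x, TangentSpace (𝓡 n) x →L[ℝ] V x) (w : Π x, V x) : Prop :=
  SmoothSection n F w ∧ ∀ v : Π x, V x, SmoothSection n F v → IsCompact (secSupport v) →
    ∫ x, inner ℂ (v x) (w x) ∂(riemannianVolume n U) =
      ∫ x, formInner x (A v x) (α x) ∂(riemannianVolume n U)

open Classical in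
/-- The formal adjoint `d_A^*` of `d_A`, on smooth `V`-valued one-forms. (The smooth section with
the defining property is unique.) -/
def formalAdjoint (A : CovariantDerivative (𝓡 n) F V)
    (α : Π x, TangentSpace (𝓡 n) x →L[ℝ] V x) : Π x, V x :=
  if hw : ∃ w, IsFormalAdjointOf A α w then hw.choose else 0

/-- The connection Laplacian `d_A^* d_A`. -/
def connLaplacian (A : CovariantDerivative (𝓡 n) F V) (u : Π x, V x) : Π x, V x :=
  formalAdjoint A (A u)

end Bundles

end Carleman

end

/-!
Both estimates follow from one Carleman estimate for sections `u` of a real vector bundle with a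
smooth metric and a connection `A`, for the operator `A^* A` and with a weight that is slightly more
convex than `e^{φ/h}`: with `τ = 1/h` the weight is `W = e^{τ φ + φ²/(2ε)}` (`carlemanWeight`), and
the estimate (`carleman_estimate_section`) reads

  `τ² ‖W u‖² + ‖W A u‖² ≤ C ε (‖W u‖² + ‖W A u‖² + ‖W A^* A u‖²)`, for `τ ≥ τ₀(ε)`,

with `C` independent of `ε`. If `ε` is small, the first-order terms on the right are absorbed,
and so is any perturbation of `A^* A` by terms of first order (`carleman_estimate_perturbed`). After
`ε` has been fixed, `W` and `e^{φ/h}` are comparable on the compact set `M`, uniformly in `h`.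

*Scalar functions.* In the conformal metric `|dφ|² g` the differential of `φ` has unit length, and
the Poisson bracket condition says that the Hessian of `φ` vanishes in this metric
(`lieForm_eq_zero_of_bracket`; passing to a conformal metric multiplies the symbol by a function, and
hence the bracket by its square on the characteristic set). Conjugate `∂_j γ^{jk} ∂_k`, where `γ` is
the conformal cometric, by `W` and split the result into a symmetric and an antisymmetric part. Their
commutator is computed in `commutator_identity`: the Hessian of `φ` drops out, and the
convexification leaves a positive term of order zero and of size `τ² / ε`. This gives
`carleman_estimate_euclidean`, carried to the manifold in `carleman_estimate_chart`.

*Sections.* Near a point, take a local frame `e_a` and apply the scalar estimate to the functions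
`χ ⟨e_a, u⟩` with a cutoff function `χ`. As the principal part of `A^* A` is scalar, the conformal
operator applied to these functions is controlled pointwise by `u`, `A u` and `A^* A u`
(`dominatedOn_confLap`). The cutoff errors are of this kind too and need no separate treatment, so
that the local estimates add up over a finite cover.

*The operators.* The formal adjoint of a connection is given by a formula in coordinates and a local
frame. This shows that it exists (`exists_isRealAdjoint`) and that the Laplacian is `d^* d`
(`isRealAdjoint_laplacian`). A Hermitian bundle is treated as a real one, with the real part of the
Hermitian metric (`isFormalAdjointOf_iff`).
-/

set_option linter.unusedSectionVars false

noncomputable section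

namespace Carleman

/-! ### Divergence form operators in Euclidean space -/

section Euclid
variable {n : ℕ}
local notation "𝔼" => EuclideanSpace ℝ (Fin n)

theorem contDiff_pderiv {W : Type*} [NormedAddCommGroup W] [NormedSpace ℝ W] {f : 𝔼 → W}
    (hf : ContDiff ℝ ∞ f) (j : Fin n) : ContDiff ℝ ∞ (pderiv j f) := by
  unfold pderiv
  have h : ContDiff ℝ ∞ (fderiv ℝ f) := hf.fderiv_right (by simp)
  fun_prop

theorem pderiv_fun_add {f g : 𝔼 → ℝ} (hf : ContDiff ℝ ∞ f) (hg : ContDiff ℝ ∞ g) (j : Fin n)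
    (z : 𝔼) : pderiv j (fun y => f y + g y) z = pderiv j f z + pderiv j g z := by
  unfold pderiv
  rw [fderiv_fun_add (hf.differentiable (by simp) z) (hg.differentiable (by simp) z)]
  simp

theorem pderiv_fun_sub {f g : 𝔼 → ℝ} (hf : ContDiff ℝ ∞ f) (hg : ContDiff ℝ ∞ g) (j : Fin n)
    (z : 𝔼) : pderiv j (fun y => f y - g y) z = pderiv j f z - pderiv j g z := by
  unfold pderiv
  rw [fderiv_fun_sub (hf.differentiable (by simp) z) (hg.differentiable (by simp) z)]
  simp

theorem pderiv_fun_mul_of_differentiableAt {f g : 𝔼 → ℝ} {z : 𝔼} (hf : DifferentiableAt ℝ f z)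
    (hg : DifferentiableAt ℝ g z) (j : Fin n) :
    pderiv j (fun y => f y * g y) z = pderiv j f z * g z + f z * pderiv j g z := by
  unfold pderiv
  rw [fderiv_fun_mul hf hg]
  simp
  ring

theorem pderiv_fun_mul {f g : 𝔼 → ℝ} (hf : ContDiff ℝ ∞ f) (hg : ContDiff ℝ ∞ g) (j : Fin n)
    (z : 𝔼) : pderiv j (fun y => f y * g y) z = pderiv j f z * g z + f z * pderiv j g z :=
  pderiv_fun_mul_of_differentiableAt (hf.differentiable (by simp) z)
    (hg.differentiable (by simp) z) j

theorem pderiv_fun_sum {ι : Type*} {s : Finset ι} {f : ι → 𝔼 → ℝ}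
    (hf : ∀ i, ContDiff ℝ ∞ (f i)) (j : Fin n) (z : 𝔼) :
    pderiv j (fun y => ∑ i ∈ s, f i y) z = ∑ i ∈ s, pderiv j (f i) z := by
  unfold pderiv
  rw [fderiv_fun_sum fun i _ => (hf i).differentiable (by simp) z]
  simp

theorem pderiv_fun_const_mul (c : ℝ) {f : 𝔼 → ℝ} (hf : ContDiff ℝ ∞ f) (j : Fin n) (z : 𝔼) :
    pderiv j (fun y => c * f y) z = c * pderiv j f z := by
  unfold pderiv
  rw [fderiv_const_mul (hf.differentiable (by simp) z)]
  simp

theorem pderiv_fun_const (c : ℝ) (j : Fin n) (z : 𝔼) : pderiv j (fun _ => c) z = 0 := by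
  simp [pderiv]

theorem pderiv_comm {f : 𝔼 → ℝ} (hf : ContDiff ℝ ∞ f) (j k : Fin n) (z : 𝔼) :
    pderiv j (pderiv k f) z = pderiv k (pderiv j f) z := by
  have hs : IsSymmSndFDerivAt ℝ f z := hf.contDiffAt.isSymmSndFDerivAt (by
    simp
    exact WithTop.coe_le_coe.2 (le_top : (2 : ℕ∞) ≤ ⊤))
  have hd : DifferentiableAt ℝ (fderiv ℝ f) z :=
    (hf.fderiv_right (m := ∞) (by simp)).differentiable (by simp) z
  have key : ∀ i l : Fin n, pderiv i (pderiv l f) z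
      = fderiv ℝ (fderiv ℝ f) z (stdVec i) (stdVec l) := by
    intro i l
    unfold pderiv
    rw [fderiv_clm_apply hd (differentiableAt_const _)]
    simp
  rw [key, key, hs.eq]

theorem pderiv_eq_zero_of_notMem_tsupport {W : Type*} [NormedAddCommGroup W] [NormedSpace ℝ W]
    {f : 𝔼 → W} {z : 𝔼} (hz : z ∉ tsupport f) (j : Fin n) : pderiv j f z = 0 := by
  unfold pderiv
  rw [fderiv_of_notMem_tsupport ℝ hz]
  simp

theorem pderiv_congr {W : Type*} [NormedAddCommGroup W] [NormedSpace ℝ W]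
    {f g : 𝔼 → W} {z : 𝔼} (h : f =ᶠ[𝓝 z] g) (j : Fin n) : pderiv j f z = pderiv j g z := by
  unfold pderiv
  rw [h.fderiv_eq]

theorem hasCompactSupport_pderiv {f : 𝔼 → ℝ} (hf : HasCompactSupport f) (j : Fin n) :
    HasCompactSupport (pderiv j f) := by
  refine HasCompactSupport.intro hf fun z hz => pderiv_eq_zero_of_notMem_tsupport hz j

/-- Integration by parts for smooth functions one of which has compact support. -/
theorem integral_mul_pderiv {f g : 𝔼 → ℝ} (hf : ContDiff ℝ ∞ f) (hg : ContDiff ℝ ∞ g)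
    (hc : HasCompactSupport f) (j : Fin n) :
    ∫ z, f z * pderiv j g z = -∫ z, pderiv j f z * g z := by
  unfold pderiv
  refine integral_mul_fderiv_eq_neg_fderiv_mul_of_integrable ?_ ?_ ?_
    (fun x _ => hf.differentiable (by simp) x) (fun x _ => hg.differentiable (by simp) x)
  · exact (((contDiff_pderiv hf j).continuous).mul hg.continuous).integrable_of_hasCompactSupport
      ((hasCompactSupport_pderiv hc j).mul_right)
  · exact (hf.continuous.mul (contDiff_pderiv hg j).continuous).integrable_of_hasCompactSupport
      (hc.mul_right)
  · exact (hf.continuous.mul hg.continuous).integrable_of_hasCompactSupport hc.mul_right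

theorem integral_pderiv_eq_zero {f : 𝔼 → ℝ} (hf : ContDiff ℝ ∞ f) (hc : HasCompactSupport f)
    (j : Fin n) : ∫ z, pderiv j f z = 0 := by
  have h := integral_mul_pderiv hf (contDiff_const (c := (1 : ℝ))) hc j
  simpa [pderiv] using h

/-- The divergence form operator `∂_j (a^{jk} ∂_k f)`. -/
def divOp (a : Fin n → Fin n → 𝔼 → ℝ) (f : 𝔼 → ℝ) (z : 𝔼) : ℝ :=
  ∑ j, pderiv j (fun y => ∑ k, a j k y * pderiv k f y) z

/-- The quadratic form `a^{jk} ∂_j f ∂_k f`. -/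
def gradSq (a : Fin n → Fin n → 𝔼 → ℝ) (f : 𝔼 → ℝ) (z : 𝔼) : ℝ :=
  ∑ j, ∑ k, a j k z * pderiv j f z * pderiv k f z

/-- The divergence of a vector field. -/
def divField (Z : Fin n → 𝔼 → ℝ) (z : 𝔼) : ℝ := ∑ j, pderiv j (Z j) z

/-- The derivative of a function along a vector field. -/
def alongField (Z : Fin n → 𝔼 → ℝ) (f : 𝔼 → ℝ) (z : 𝔼) : ℝ := ∑ k, Z k z * pderiv k f z

/-- The quadratic form `a^{jl} ∂_l Z^k ξ_j ξ_k - ½ Z^l ∂_l a^{jk} ξ_j ξ_k`, minus one half of the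
Lie derivative along `Z` of the cometric `a`. For a gradient field it is the Hessian. -/
def lieForm (a : Fin n → Fin n → 𝔼 → ℝ) (Z : Fin n → 𝔼 → ℝ) (z : 𝔼) (ξ : Fin n → ℝ) : ℝ :=
  ∑ j, ∑ k, ∑ l, (a j l z * pderiv l (Z k) z - Z l z * pderiv l (a j k) z / 2) * ξ j * ξ k

theorem contDiff_divOp {a : Fin n → Fin n → 𝔼 → ℝ} (ha : ∀ j k, ContDiff ℝ ∞ (a j k))
    {f : 𝔼 → ℝ} (hf : ContDiff ℝ ∞ f) : ContDiff ℝ ∞ (divOp a f) := by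
  unfold divOp
  refine ContDiff.sum fun j _ => contDiff_pderiv ?_ j
  exact ContDiff.sum fun k _ => (ha j k).mul (contDiff_pderiv hf k)

theorem contDiff_gradSq {a : Fin n → Fin n → 𝔼 → ℝ} (ha : ∀ j k, ContDiff ℝ ∞ (a j k))
    {f : 𝔼 → ℝ} (hf : ContDiff ℝ ∞ f) : ContDiff ℝ ∞ (gradSq a f) := by
  unfold gradSq
  exact ContDiff.sum fun j _ => ContDiff.sum fun k _ =>
    ((ha j k).mul (contDiff_pderiv hf j)).mul (contDiff_pderiv hf k)

theorem contDiff_alongField {Z : Fin n → 𝔼 → ℝ} (hZ : ∀ k, ContDiff ℝ ∞ (Z k)) {f : 𝔼 → ℝ}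
    (hf : ContDiff ℝ ∞ f) : ContDiff ℝ ∞ (alongField Z f) := by
  unfold alongField
  exact ContDiff.sum fun k _ => (hZ k).mul (contDiff_pderiv hf k)

theorem contDiff_divField {Z : Fin n → 𝔼 → ℝ} (hZ : ∀ k, ContDiff ℝ ∞ (Z k)) :
    ContDiff ℝ ∞ (divField Z) := by
  unfold divField
  exact ContDiff.sum fun k _ => contDiff_pderiv (hZ k) k

/-- The pointwise form of the Rellich identity: up to a divergence, `(L v) Z v` is the quadratic
form `½ (div Z) |∇v|² - lieForm Z (∇v, ∇v)`. The second derivatives of `v` cancel. -/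
theorem rellich_pointwise {a : Fin n → Fin n → 𝔼 → ℝ} (ha : ∀ j k, ContDiff ℝ ∞ (a j k))
    (hsymm : ∀ j k, a j k = a k j) {Z : Fin n → 𝔼 → ℝ} (hZ : ∀ k, ContDiff ℝ ∞ (Z k)) {v : 𝔼 → ℝ}
    (hv : ContDiff ℝ ∞ v) (z : 𝔼) :
    divOp a v z * alongField Z v z + lieForm a Z z (fun j => pderiv j v z)
      - divField Z z * gradSq a v z / 2
      = ∑ j, pderiv j (fun y => (∑ k, a j k y * pderiv k v y) * alongField Z v y
          - Z j y * gradSq a v y / 2) z := by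
  have hv' := contDiff_pderiv hv
  have hv'' : ∀ j k, ContDiff ℝ ∞ (pderiv j (pderiv k v)) := fun j k => contDiff_pderiv (hv' k) j
  have hflux : ∀ j, ContDiff ℝ ∞ fun y => ∑ k, a j k y * pderiv k v y := fun j =>
    ContDiff.sum fun k _ => (ha j k).mul (hv' k)
  have hal := contDiff_alongField hZ hv
  have hgr := contDiff_gradSq ha hv
  have h1 : ∀ j, pderiv j (fun y => (∑ k, a j k y * pderiv k v y) * alongField Z v y
          - Z j y * gradSq a v y / 2) z
      = pderiv j (fun y => ∑ k, a j k y * pderiv k v y) z * alongField Z v z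
        + (∑ k, a j k z * pderiv k v z) * pderiv j (alongField Z v) z
        - pderiv j (Z j) z * gradSq a v z / 2 - Z j z * pderiv j (gradSq a v) z / 2 := by
    intro j
    have e : (fun y => (∑ k, a j k y * pderiv k v y) * alongField Z v y
          - Z j y * gradSq a v y / 2) = fun y => (∑ k, a j k y * pderiv k v y) * alongField Z v y
          - (1 / 2 : ℝ) * (Z j y * gradSq a v y) := by
      ext y; ring
    rw [e, pderiv_fun_sub ((hflux j).mul hal) (contDiff_const.mul ((hZ j).mul hgr)),
      pderiv_fun_mul (hflux j) hal, pderiv_fun_const_mul _ ((hZ j).mul hgr),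
      pderiv_fun_mul (hZ j) hgr]
    ring
  have h2 : ∀ j, pderiv j (alongField Z v) z
      = ∑ l, (pderiv j (Z l) z * pderiv l v z + Z l z * pderiv j (pderiv l v) z) := by
    intro j
    unfold alongField
    rw [pderiv_fun_sum fun l => (hZ l).mul (hv' l)]
    exact Finset.sum_congr rfl fun l _ => pderiv_fun_mul (hZ l) (hv' l) j z
  have h3 : ∀ j, pderiv j (gradSq a v) z = ∑ k, ∑ l, pderiv j (a k l) z * pderiv k v z * pderiv l v z
      + 2 * ∑ k, ∑ l, a k l z * pderiv k v z * pderiv j (pderiv l v) z := by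
    intro j
    unfold gradSq
    rw [pderiv_fun_sum fun k => ContDiff.sum fun l _ => ((ha k l).mul (hv' k)).mul (hv' l)]
    have e : ∀ k, pderiv j (fun y => ∑ l, a k l y * pderiv k v y * pderiv l v y) z
        = ∑ l, (pderiv j (a k l) z * pderiv k v z * pderiv l v z
          + a k l z * pderiv j (pderiv k v) z * pderiv l v z
          + a k l z * pderiv k v z * pderiv j (pderiv l v) z) := by
      intro k
      rw [pderiv_fun_sum fun l => ((ha k l).mul (hv' k)).mul (hv' l)]
      refine Finset.sum_congr rfl fun l _ => ?_
      rw [pderiv_fun_mul ((ha k l).mul (hv' k)) (hv' l), pderiv_fun_mul (ha k l) (hv' k)]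
      ring
    simp only [e, Finset.sum_add_distrib]
    have e2 : ∑ k, ∑ l, a k l z * pderiv j (pderiv k v) z * pderiv l v z
        = ∑ k, ∑ l, a k l z * pderiv k v z * pderiv j (pderiv l v) z := by
      rw [Finset.sum_comm]
      refine Finset.sum_congr rfl fun l _ => Finset.sum_congr rfl fun k _ => ?_
      rw [hsymm k l]; ring
    rw [e2]; ring
  simp only [h1, Finset.sum_sub_distrib, Finset.sum_add_distrib]
  have t1 : ∑ j, pderiv j (fun y => ∑ k, a j k y * pderiv k v y) z * alongField Z v z
      = divOp a v z * alongField Z v z := by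
    unfold divOp; rw [Finset.sum_mul]
  have t3 : ∑ j, pderiv j (Z j) z * gradSq a v z / 2 = divField Z z * gradSq a v z / 2 := by
    unfold divField; rw [Finset.sum_mul, Finset.sum_div]
  have t2 : ∑ j, (∑ k, a j k z * pderiv k v z) * pderiv j (alongField Z v) z
      - ∑ j, Z j z * pderiv j (gradSq a v) z / 2
      = lieForm a Z z (fun j => pderiv j v z) := by
    have s1 : ∑ j, (∑ k, a j k z * pderiv k v z) * pderiv j (alongField Z v) z
        = ∑ j, ∑ k, ∑ l, a j l z * pderiv l (Z k) z * pderiv j v z * pderiv k v z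
          + ∑ j, ∑ k, ∑ l, Z j z * (a k l z * pderiv k v z * pderiv j (pderiv l v) z) := by
      simp only [h2, Finset.sum_mul, Finset.mul_sum]
      have : ∀ j k l : Fin n, a j k z * pderiv k v z *
          (pderiv j (Z l) z * pderiv l v z + Z l z * pderiv j (pderiv l v) z)
          = a k j z * pderiv j (Z l) z * pderiv k v z * pderiv l v z
            + Z l z * (a k j z * pderiv k v z * pderiv l (pderiv j v) z) := by
        intro j k l
        rw [hsymm j k, pderiv_comm hv j l]; ring
      simp only [this, Finset.sum_add_distrib]
      congr 1
      · rw [Finset.sum_comm, Finset.sum_congr rfl fun k _ => Finset.sum_comm, Finset.sum_comm]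
      · rw [Finset.sum_comm, Finset.sum_congr rfl fun k _ => Finset.sum_comm]
    have s2 : ∑ j, Z j z * pderiv j (gradSq a v) z / 2
        = ∑ j, ∑ k, ∑ l, Z l z * pderiv l (a j k) z / 2 * pderiv j v z * pderiv k v z
          + ∑ j, ∑ k, ∑ l, Z j z * (a k l z * pderiv k v z * pderiv j (pderiv l v) z) := by
      have : ∀ j, Z j z * pderiv j (gradSq a v) z / 2
          = ∑ k, ∑ l, Z j z * pderiv j (a k l) z / 2 * pderiv k v z * pderiv l v z
          + ∑ k, ∑ l, Z j z * (a k l z * pderiv k v z * pderiv j (pderiv l v) z) := by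
        intro j
        rw [h3, mul_add, add_div, mul_left_comm, mul_div_cancel_left₀ _ (two_ne_zero' ℝ)]
        simp only [Finset.mul_sum, Finset.sum_div]
        congr 1
        refine Finset.sum_congr rfl fun k _ => Finset.sum_congr rfl fun l _ => by ring
      simp only [this, Finset.sum_add_distrib]
      congr 1
      rw [Finset.sum_comm]
      exact Finset.sum_congr rfl fun k _ => Finset.sum_comm
    rw [s1, s2]
    unfold lieForm
    simp only [sub_mul, Finset.sum_sub_distrib]
    ring
  rw [t1, t3, ← t2]
  ring

theorem alongField_eq_zero_of_notMem_tsupport (Z : Fin n → 𝔼 → ℝ) {f : 𝔼 → ℝ} {z : 𝔼}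
    (hz : z ∉ tsupport f) : alongField Z f z = 0 := by
  simp [alongField, pderiv_eq_zero_of_notMem_tsupport hz]

theorem gradSq_eq_zero_of_notMem_tsupport (a : Fin n → Fin n → 𝔼 → ℝ) {f : 𝔼 → ℝ} {z : 𝔼}
    (hz : z ∉ tsupport f) : gradSq a f z = 0 := by
  simp [gradSq, pderiv_eq_zero_of_notMem_tsupport hz]

theorem divOp_eq_zero_of_notMem_tsupport (a : Fin n → Fin n → 𝔼 → ℝ) {f : 𝔼 → ℝ} {z : 𝔼}
    (hz : z ∉ tsupport f) : divOp a f z = 0 := by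
  have h : ∀ᶠ y in 𝓝 z, y ∉ tsupport f := (isClosed_tsupport f).isOpen_compl.mem_nhds hz
  unfold divOp
  refine Finset.sum_eq_zero fun j _ => ?_
  have e : (fun y => ∑ k, a j k y * pderiv k f y) =ᶠ[𝓝 z] fun _ => 0 := by
    filter_upwards [h] with y hy
    simp [pderiv_eq_zero_of_notMem_tsupport hy]
  rw [pderiv_congr e, pderiv_fun_const]

theorem integrable_of_zero_off_compact {X : Type*} [TopologicalSpace X] [T2Space X]
    [MeasurableSpace X] [OpensMeasurableSpace X] {μ : Measure X} [IsFiniteMeasureOnCompacts μ]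
    {f : X → ℝ} {K : Set X} (hK : IsCompact K) (hf : Continuous f) (h0 : ∀ z, z ∉ K → f z = 0) :
    Integrable f μ :=
  hf.integrable_of_hasCompactSupport (HasCompactSupport.intro hK fun z hz => h0 z hz)

theorem integral_mul_divOp {a : Fin n → Fin n → 𝔼 → ℝ} (ha : ∀ j k, ContDiff ℝ ∞ (a j k))
    {f g : 𝔼 → ℝ} (hf : ContDiff ℝ ∞ f) (hg : ContDiff ℝ ∞ g) (hc : HasCompactSupport f) :
    ∫ z, f z * divOp a g z = -∫ z, ∑ j, ∑ k, a j k z * pderiv j f z * pderiv k g z := by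
  have hflux : ∀ j, ContDiff ℝ ∞ fun y => ∑ k, a j k y * pderiv k g y := fun j =>
    ContDiff.sum fun k _ => (ha j k).mul (contDiff_pderiv hg k)
  unfold divOp
  simp only [Finset.mul_sum]
  rw [integral_finsetSum, integral_finsetSum, ← Finset.sum_neg_distrib]
  · refine Finset.sum_congr rfl fun j _ => ?_
    rw [integral_mul_pderiv hf (hflux j) hc]
    congr 2
    ext z
    rw [Finset.mul_sum]
    exact Finset.sum_congr rfl fun k _ => by ring
  · intro j _
    refine integrable_of_zero_off_compact hc ?_ fun z hz => ?_
    · exact continuous_finsetSum _ fun k _ => ((ha j k).continuous.mul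
        (contDiff_pderiv hf j).continuous).mul (contDiff_pderiv hg k).continuous
    · simp [pderiv_eq_zero_of_notMem_tsupport hz]
  · intro j _
    refine integrable_of_zero_off_compact hc ?_ fun z hz => ?_
    · exact hf.continuous.mul (contDiff_pderiv (hflux j) j).continuous
    · simp [image_eq_zero_of_notMem_tsupport hz]

theorem rellich_integral {a : Fin n → Fin n → 𝔼 → ℝ} (ha : ∀ j k, ContDiff ℝ ∞ (a j k))
    (hsymm : ∀ j k, a j k = a k j) {Z : Fin n → 𝔼 → ℝ} (hZ : ∀ k, ContDiff ℝ ∞ (Z k)) {v : 𝔼 → ℝ}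
    (hv : ContDiff ℝ ∞ v) (hc : HasCompactSupport v) :
    ∫ z, (divOp a v z * alongField Z v z + lieForm a Z z (fun j => pderiv j v z)
      - divField Z z * gradSq a v z / 2) = 0 := by
  have hflux : ∀ j, ContDiff ℝ ∞ fun y => ((∑ k, a j k y * pderiv k v y) * alongField Z v y
          - Z j y * gradSq a v y / 2) := fun j =>
    ((ContDiff.sum fun k _ => (ha j k).mul (contDiff_pderiv hv k)).mul
      (contDiff_alongField hZ hv)).sub (((hZ j).mul (contDiff_gradSq ha hv)).div_const 2)
  have hfc : ∀ j, HasCompactSupport fun y => ((∑ k, a j k y * pderiv k v y) * alongField Z v y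
          - Z j y * gradSq a v y / 2) := fun j =>
    HasCompactSupport.intro hc fun z hz => by
      simp [alongField_eq_zero_of_notMem_tsupport Z hz, gradSq_eq_zero_of_notMem_tsupport a hz]
  simp only [rellich_pointwise ha hsymm hZ hv]
  rw [integral_finsetSum]
  · exact Finset.sum_eq_zero fun j _ => integral_pderiv_eq_zero (hflux j) (hfc j) j
  · intro j _
    exact (contDiff_pderiv (hflux j) j).continuous.integrable_of_hasCompactSupport
      (hasCompactSupport_pderiv (hfc j) j)

/-- Integration by parts in `∫ ρ v L v`. -/
theorem integral_mul_self_divOp {a : Fin n → Fin n → 𝔼 → ℝ} (ha : ∀ j k, ContDiff ℝ ∞ (a j k))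
    (hsymm : ∀ j k, a j k = a k j) {ρ v : 𝔼 → ℝ} (hρ : ContDiff ℝ ∞ ρ)
    (hv : ContDiff ℝ ∞ v) (hc : HasCompactSupport v) :
    ∫ z, (ρ z * v z * divOp a v z + ρ z * gradSq a v z - divOp a ρ z * v z ^ 2 / 2) = 0 := by
  have hρv : ContDiff ℝ ∞ fun z => ρ z * v z := hρ.mul hv
  have hv2 : ContDiff ℝ ∞ fun z => v z * v z := hv.mul hv
  have h1 := integral_mul_divOp ha hρv hv hc.mul_left
  have h2 := integral_mul_divOp ha hv2 hρ hc.mul_left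
  have c1 : Continuous (divOp a v) := (contDiff_divOp ha hv).continuous
  have c2 : Continuous (divOp a ρ) := (contDiff_divOp ha hρ).continuous
  have c3 : Continuous (gradSq a v) := (contDiff_gradSq ha hv).continuous
  have i1 : Integrable fun z => ρ z * v z * divOp a v z :=
    integrable_of_zero_off_compact hc ((hρ.continuous.mul hv.continuous).mul c1) fun z hz => by
      simp [image_eq_zero_of_notMem_tsupport hz]
  have i2 : Integrable fun z => v z * v z * divOp a ρ z :=
    integrable_of_zero_off_compact hc ((hv.continuous.mul hv.continuous).mul c2) fun z hz => by
      simp [image_eq_zero_of_notMem_tsupport hz]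
  have i3 : Integrable fun z => ρ z * gradSq a v z :=
    integrable_of_zero_off_compact hc (hρ.continuous.mul c3) fun z hz => by
      simp [gradSq_eq_zero_of_notMem_tsupport a hz]
  have cc : ∀ (f g : 𝔼 → ℝ), ContDiff ℝ ∞ f → ContDiff ℝ ∞ g →
      Continuous fun z => ∑ j, ∑ k, a j k z * pderiv j f z * pderiv k g z := fun f g hf hg =>
    continuous_finsetSum _ fun j _ => continuous_finsetSum _ fun k _ => ((ha j k).continuous.mul
        (contDiff_pderiv hf j).continuous).mul (contDiff_pderiv hg k).continuous
  have e1 : ∀ z, ∑ j, ∑ k, a j k z * pderiv j (fun z => ρ z * v z) z * pderiv k v z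
      = ρ z * gradSq a v z + (1/2) * ∑ j, ∑ k, a j k z * pderiv j (fun z => v z * v z) z
        * pderiv k ρ z := by
    intro z
    simp only [pderiv_fun_mul hρ hv, pderiv_fun_mul hv hv, gradSq, Finset.mul_sum]
    have e : ∀ j k, a j k z * (pderiv j ρ z * v z + ρ z * pderiv j v z) * pderiv k v z
        = a k j z * pderiv j ρ z * v z * pderiv k v z
          + ρ z * (a j k z * pderiv j v z * pderiv k v z) := by
      intro j k; rw [hsymm j k]; ring
    simp only [e, Finset.sum_add_distrib]
    rw [add_comm]
    congr 1
    rw [Finset.sum_comm]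
    exact Finset.sum_congr rfl fun j _ => Finset.sum_congr rfl fun k _ => by ring
  have i4 : Integrable fun z => (1/2) * ∑ j, ∑ k, a j k z * pderiv j (fun z => v z * v z) z
        * pderiv k ρ z :=
    integrable_of_zero_off_compact hc (continuous_const.mul (cc _ _ hv2 hρ)) fun z hz => by
      simp [pderiv_fun_mul hv hv, image_eq_zero_of_notMem_tsupport hz]
  simp only [e1] at h1
  rw [integral_add i3 i4, integral_const_mul] at h1
  have e3 : ∀ z, ρ z * v z * divOp a v z + ρ z * gradSq a v z - divOp a ρ z * v z ^ 2 / 2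
      = ρ z * v z * divOp a v z + ρ z * gradSq a v z - 1 / 2 * (v z * v z * divOp a ρ z) := by
    intro z; ring
  simp only [e3]
  rw [integral_sub (i1.fun_add i3) (i2.const_mul _), integral_add i1 i3, integral_const_mul, h1,
    h2]
  ring

/-- The divergence theorem for the vector field `f Z`. -/
theorem integral_alongField {Z : Fin n → 𝔼 → ℝ} (hZ : ∀ k, ContDiff ℝ ∞ (Z k)) {f : 𝔼 → ℝ}
    (hf : ContDiff ℝ ∞ f) (hc : HasCompactSupport f) :
    ∫ z, (alongField Z f z + divField Z z * f z) = 0 := by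
  have e : ∀ z, alongField Z f z + divField Z z * f z
      = ∑ k, pderiv k (fun y => Z k y * f y) z := by
    intro z
    unfold alongField divField
    rw [Finset.sum_mul, ← Finset.sum_add_distrib]
    exact Finset.sum_congr rfl fun k _ => by rw [pderiv_fun_mul (hZ k) hf]; ring
  simp only [e]
  rw [integral_finsetSum]
  · exact Finset.sum_eq_zero fun k _ => integral_pderiv_eq_zero ((hZ k).mul hf) hc.mul_left k
  · intro k _
    exact (contDiff_pderiv ((hZ k).mul hf) k).continuous.integrable_of_hasCompactSupport
      (hasCompactSupport_pderiv hc.mul_left k)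

theorem contDiff_lieForm {a : Fin n → Fin n → 𝔼 → ℝ} (ha : ∀ j k, ContDiff ℝ ∞ (a j k))
    {Z : Fin n → 𝔼 → ℝ} (hZ : ∀ k, ContDiff ℝ ∞ (Z k)) {v : 𝔼 → ℝ} (hv : ContDiff ℝ ∞ v) :
    ContDiff ℝ ∞ fun z => lieForm a Z z fun j => pderiv j v z := by
  unfold lieForm
  exact ContDiff.sum fun j _ => ContDiff.sum fun k _ => ContDiff.sum fun l _ =>
    ((((ha j l).mul (contDiff_pderiv (hZ k) l)).sub (((hZ l).mul
      (contDiff_pderiv (ha j k) l)).div_const 2)).mul (contDiff_pderiv hv j)).mul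
      (contDiff_pderiv hv k)

/-- The positive commutator identity: twice the product of the symmetric part
`L + τ² r²` and the antisymmetric part `-2τ Z - τ div Z` integrates to terms with the form
`lieForm Z` in the gradient of `v` and terms of order zero. It is the combination of the Rellich
identity, of `∫ (div Z) v L v` and of the divergence theorem for `r² v² Z` in which all other
terms cancel. -/
theorem commutator_identity {a : Fin n → Fin n → 𝔼 → ℝ} (ha : ∀ j k, ContDiff ℝ ∞ (a j k))
    (hsymm : ∀ j k, a j k = a k j) {Z : Fin n → 𝔼 → ℝ} (hZ : ∀ k, ContDiff ℝ ∞ (Z k))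
    {r : 𝔼 → ℝ} (hr : ContDiff ℝ ∞ r) {v : 𝔼 → ℝ}
    (hv : ContDiff ℝ ∞ v) (hc : HasCompactSupport v) (τ : ℝ) :
    ∫ z, 2 * ((divOp a v z + τ ^ 2 * r z ^ 2 * v z)
        * (-(2 * τ * alongField Z v z) - τ * divField Z z * v z))
      = ∫ z, (4 * τ * lieForm a Z z (fun j => pderiv j v z) - τ * divOp a (divField Z) z * v z ^ 2
          + 4 * τ ^ 3 * r z * alongField Z r z * v z ^ 2) := by
  have hρ := contDiff_divField hZ
  have hv2 : ContDiff ℝ ∞ fun z => v z * v z := hv.mul hv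
  have hr2Z : ∀ k, ContDiff ℝ ∞ fun z => r z ^ 2 * Z k z := fun k => (hr.pow 2).mul (hZ k)
  have h1 := rellich_integral ha hsymm hZ hv hc
  have h2 := integral_mul_self_divOp ha hsymm hρ hv hc
  have h3 := integral_alongField hr2Z hv2 hc.mul_left
  have cL := (contDiff_divOp ha hv).continuous
  have cLρ := (contDiff_divOp ha hρ).continuous
  have cG := (contDiff_gradSq ha hv).continuous
  have cA := (contDiff_alongField hZ hv).continuous
  have cAr := (contDiff_alongField hZ hr).continuous
  have clie := (contDiff_lieForm ha hZ hv).continuous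
  have e3 : ∀ z, alongField (fun k z => r z ^ 2 * Z k z) (fun z => v z * v z) z
      + divField (fun k z => r z ^ 2 * Z k z) z * (v z * v z)
      = 2 * r z ^ 2 * v z * alongField Z v z
        + (r z ^ 2 * divField Z z + 2 * r z * alongField Z r z) * v z ^ 2 := by
    intro z
    have hr2 : ContDiff ℝ ∞ fun z => r z * r z := hr.mul hr
    unfold alongField divField
    simp only [pow_two, pderiv_fun_mul hr2 (hZ _), pderiv_fun_mul hr hr, pderiv_fun_mul hv hv,
      Finset.mul_sum, ← Finset.sum_add_distrib, Finset.sum_mul]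
    exact Finset.sum_congr rfl fun k _ => by ring
  simp only [e3] at h3
  have lie0 : ∀ z, z ∉ tsupport v → lieForm a Z z (fun j => pderiv j v z) = 0 := fun z hz => by
    simp [lieForm, pderiv_eq_zero_of_notMem_tsupport hz]
  have i1 : Integrable fun z => divOp a v z * alongField Z v z
      + lieForm a Z z (fun j => pderiv j v z) - divField Z z * gradSq a v z / 2 :=
    integrable_of_zero_off_compact hc (((cL.mul cA).add clie).sub
      ((hρ.continuous.mul cG).div_const 2)) fun z hz => by
      simp [divOp_eq_zero_of_notMem_tsupport a hz, lie0 z hz,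
        gradSq_eq_zero_of_notMem_tsupport a hz]
  have i2 : Integrable fun z => divField Z z * v z * divOp a v z + divField Z z * gradSq a v z
      - divOp a (divField Z) z * v z ^ 2 / 2 :=
    integrable_of_zero_off_compact hc ((((hρ.continuous.mul hv.continuous).mul cL).add
      (hρ.continuous.mul cG)).sub ((cLρ.mul (hv.continuous.pow 2)).div_const 2)) fun z hz => by
      simp [divOp_eq_zero_of_notMem_tsupport a hz, image_eq_zero_of_notMem_tsupport hz,
        gradSq_eq_zero_of_notMem_tsupport a hz]
  have i3 : Integrable fun z => 2 * r z ^ 2 * v z * alongField Z v z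
        + (r z ^ 2 * divField Z z + 2 * r z * alongField Z r z) * v z ^ 2 :=
    integrable_of_zero_off_compact hc ((((continuous_const.mul (hr.continuous.pow 2)).mul
      hv.continuous).mul cA).add ((((hr.continuous.pow 2).mul hρ.continuous).add
      ((continuous_const.mul hr.continuous).mul cAr)).mul (hv.continuous.pow 2))) fun z hz => by
      simp [image_eq_zero_of_notMem_tsupport hz]
  have i4 : Integrable fun z => 2 * ((divOp a v z + τ ^ 2 * r z ^ 2 * v z)
        * (-(2 * τ * alongField Z v z) - τ * divField Z z * v z)) :=
    integrable_of_zero_off_compact hc (continuous_const.mul ((cL.add ((continuous_const.mul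
      (hr.continuous.pow 2)).mul hv.continuous)).mul ((continuous_const.mul cA).neg.sub
      ((continuous_const.mul hρ.continuous).mul hv.continuous)))) fun z hz => by
      simp [divOp_eq_zero_of_notMem_tsupport a hz, image_eq_zero_of_notMem_tsupport hz]
  have e : ∀ z, 4 * τ * lieForm a Z z (fun j => pderiv j v z)
        - τ * divOp a (divField Z) z * v z ^ 2
          + 4 * τ ^ 3 * r z * alongField Z r z * v z ^ 2
      = 2 * ((divOp a v z + τ ^ 2 * r z ^ 2 * v z)
        * (-(2 * τ * alongField Z v z) - τ * divField Z z * v z))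
        + (4 * τ * (divOp a v z * alongField Z v z
      + lieForm a Z z (fun j => pderiv j v z) - divField Z z * gradSq a v z / 2)
        + 2 * τ * (divField Z z * v z * divOp a v z + divField Z z * gradSq a v z
      - divOp a (divField Z) z * v z ^ 2 / 2)
        + 2 * τ ^ 3 * (2 * r z ^ 2 * v z * alongField Z v z
        + (r z ^ 2 * divField Z z + 2 * r z * alongField Z r z) * v z ^ 2)) := by
    intro z; ring
  simp only [e]
  rw [integral_add i4 (((i1.const_mul _).fun_add (i2.const_mul _)).fun_add (i3.const_mul _)),
    integral_add ((i1.const_mul _).fun_add (i2.const_mul _)) (i3.const_mul _),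
    integral_add (i1.const_mul _) (i2.const_mul _), integral_const_mul, integral_const_mul,
    integral_const_mul, integral_const_mul, h1, h2, h3]
  ring

end Euclid

/-! ### The Carleman estimate in Euclidean space -/

section EuclidCarleman
variable {n : ℕ}
local notation "𝔼" => EuclideanSpace ℝ (Fin n)

/-- The gradient field `X^k = a^{kj} ∂_j φ`. -/
def gradField (a : Fin n → Fin n → 𝔼 → ℝ) (φ : 𝔼 → ℝ) (k : Fin n) (z : 𝔼) : ℝ :=
  ∑ j, a k j z * pderiv j φ z

/-- The weight `exp (τφ + φ²/(2ε))`, the exponential `e^{τψ}` of the convexified phase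
`ψ = φ + φ²/(2ετ)`. -/
def carlemanWeight (ε τ : ℝ) (φ : ℝ) : ℝ := Real.exp (τ * φ + φ ^ 2 / (2 * ε))

theorem contDiff_gradField {a : Fin n → Fin n → 𝔼 → ℝ} (ha : ∀ j k, ContDiff ℝ ∞ (a j k))
    {φ : 𝔼 → ℝ} (hφ : ContDiff ℝ ∞ φ) (k : Fin n) : ContDiff ℝ ∞ (gradField a φ k) := by
  unfold gradField
  exact ContDiff.sum fun j _ => (ha k j).mul (contDiff_pderiv hφ j)

theorem contDiff_carlemanWeight {φ : 𝔼 → ℝ} (hφ : ContDiff ℝ ∞ φ) (ε τ : ℝ) :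
    ContDiff ℝ ∞ fun z => carlemanWeight ε τ (φ z) := by
  unfold carlemanWeight
  exact ((contDiff_const.mul hφ).add ((hφ.pow 2).div_const _)).exp

theorem pderiv_carlemanWeight {φ : 𝔼 → ℝ} (hφ : ContDiff ℝ ∞ φ) {ε τ s : ℝ} (hε : 0 < ε)
    (hs : s * (ε * τ) = 1) (j : Fin n) (z : 𝔼) :
    pderiv j (fun z => carlemanWeight ε τ (φ z)) z
      = carlemanWeight ε τ (φ z) * (τ * (1 + s * φ z) * pderiv j φ z) := by
  have hd : DifferentiableAt ℝ φ z := hφ.differentiable (by simp) z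
  have h1 : HasFDerivAt (fun y => carlemanWeight ε τ (φ y))
      ((carlemanWeight ε τ (φ z) * (τ + φ z / ε)) • fderiv ℝ φ z) z := by
    have h2 : HasDerivAt (carlemanWeight ε τ)
        (carlemanWeight ε τ (φ z) * (τ + φ z / ε)) (φ z) := by
      unfold carlemanWeight
      have h3 : HasDerivAt (fun t : ℝ => τ * t + t ^ 2 / (2 * ε)) (τ + φ z / ε) (φ z) := by
        have := ((hasDerivAt_id (φ z)).const_mul τ).add
          (((hasDerivAt_id (φ z)).pow 2).div_const (2 * ε))
        refine this.congr_deriv ?_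
        simp
        field_simp
      exact h3.exp
    exact h2.comp_hasFDerivAt z hd.hasFDerivAt
  unfold pderiv
  rw [h1.fderiv]
  have h4 : τ * (1 + s * φ z) = τ + φ z / ε := by
    field_simp
    linear_combination φ z * hs
  rw [h4]
  simp
  ring

/-- Conjugation of the operator `L = ∂_j a^{jk} ∂_k` by the weight `W`, when `φ` has unit gradient:
`W L W⁻¹` is the sum of the symmetric part `L + τ² r²` and the antisymmetric part
`-2τ Z - τ div Z`, where `r = 1 + s φ`, `Z = r ∇φ` and `s = 1 / (ε τ)`. -/
theorem divOp_conj {a : Fin n → Fin n → 𝔼 → ℝ} (ha : ∀ j k, ContDiff ℝ ∞ (a j k))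
    (hsymm : ∀ j k, a j k = a k j) {φ u : 𝔼 → ℝ} (hφ : ContDiff ℝ ∞ φ) (hu : ContDiff ℝ ∞ u)
    {ε τ s : ℝ} (hε : 0 < ε) (hs : s * (ε * τ) = 1) {z : 𝔼}
    (hb : ∑ k, gradField a φ k z * pderiv k φ z = 1) :
    let W := fun y => carlemanWeight ε τ (φ y)
    let v := fun y => W y * u y
    let Z := fun k y => (1 + s * φ y) * gradField a φ k y
    divOp a v z + τ ^ 2 * (1 + s * φ z) ^ 2 * v z + (-(2 * τ * alongField Z v z)
      - τ * divField Z z * v z) = W z * divOp a u z := by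
  intro W v Z
  have hW : ContDiff ℝ ∞ W := contDiff_carlemanWeight hφ ε τ
  have hr : ContDiff ℝ ∞ fun y => 1 + s * φ y := contDiff_const.add (contDiff_const.mul hφ)
  have hX := contDiff_gradField ha hφ
  have hZ : ∀ k, ContDiff ℝ ∞ (Z k) := fun k => hr.mul (hX k)
  have hv : ContDiff ℝ ∞ v := hW.mul hu
  have pW : ∀ j y, pderiv j W y = W y * (τ * (1 + s * φ y) * pderiv j φ y) := fun j y =>
    pderiv_carlemanWeight hφ hε hs j y
  have pv : ∀ j y, pderiv j v y = W y * (τ * (1 + s * φ y) * pderiv j φ y) * u y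
      + W y * pderiv j u y := fun j y => by
    rw [show pderiv j v y = _ from pderiv_fun_mul hW hu j y, pW]
  have hflux : ∀ j, ContDiff ℝ ∞ fun y => ∑ k, a j k y * pderiv k u y := fun j =>
    ContDiff.sum fun k _ => (ha j k).mul (contDiff_pderiv hu k)
  have flux : ∀ j, (fun y => ∑ k, a j k y * pderiv k v y)
      = fun y => W y * (∑ k, a j k y * pderiv k u y) + τ * (Z j y * (W y * u y)) := by
    intro j
    ext y
    simp only [pv, Z, gradField, Finset.mul_sum, Finset.sum_mul, ← Finset.sum_add_distrib]
    exact Finset.sum_congr rfl fun k _ => by ring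
  have hL : divOp a v z = ∑ j, (W z * (τ * (1 + s * φ z) * pderiv j φ z)
        * (∑ k, a j k z * pderiv k u z)
      + W z * pderiv j (fun y => ∑ k, a j k y * pderiv k u y) z
      + τ * (pderiv j (Z j) z * (W z * u z)
        + Z j z * (W z * (τ * (1 + s * φ z) * pderiv j φ z) * u z + W z * pderiv j u z))) := by
    unfold divOp
    refine Finset.sum_congr rfl fun j _ => ?_
    rw [flux, pderiv_fun_add (hW.mul (hflux j)) (contDiff_const.mul ((hZ j).mul (hW.mul hu))),
      pderiv_fun_mul hW (hflux j), pderiv_fun_const_mul _ ((hZ j).mul (hW.mul hu)),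
      pderiv_fun_mul (hZ j) (hW.mul hu), pderiv_fun_mul hW hu, pW]
  have hflux2 : ∑ j, W z * (τ * (1 + s * φ z) * pderiv j φ z) * (∑ k, a j k z * pderiv k u z)
      = τ * W z * alongField Z u z := by
    unfold alongField
    simp only [Finset.mul_sum, Z, gradField, Finset.sum_mul]
    rw [Finset.sum_comm]
    exact Finset.sum_congr rfl fun k _ => Finset.sum_congr rfl fun j _ => by
      rw [hsymm j k]; ring
  have hZb : ∑ j, Z j z * (W z * (τ * (1 + s * φ z) * pderiv j φ z) * u z + W z * pderiv j u z)
      = τ * (1 + s * φ z) ^ 2 * W z * u z + W z * alongField Z u z := by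
    have : ∀ j, Z j z * (W z * (τ * (1 + s * φ z) * pderiv j φ z) * u z + W z * pderiv j u z)
        = τ * (1 + s * φ z) ^ 2 * W z * u z * (gradField a φ j z * pderiv j φ z)
          + W z * (Z j z * pderiv j u z) := fun j => by simp only [Z]; ring
    simp only [this, Finset.sum_add_distrib, ← Finset.mul_sum, hb, alongField, mul_one]
  have hA : alongField Z v z = τ * (1 + s * φ z) ^ 2 * W z * u z + W z * alongField Z u z := by
    rw [← hZb]
    exact Finset.sum_congr rfl fun j _ => by rw [pv]
  rw [hL, hA]
  simp only [Finset.sum_add_distrib, ← Finset.mul_sum, hZb, hflux2]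
  rw [← Finset.sum_mul]
  change _ + W z * divOp a u z + τ * (divField Z z * (W z * u z) + _) + τ ^ 2 * _ * (W z * u z)
    + (_ - _ * (W z * u z)) = _
  ring

/-- Where the Hessian of `φ` vanishes, the one of the convexified phase is `s dφ ⊗ dφ`. -/
theorem lieForm_smul_grad {a : Fin n → Fin n → 𝔼 → ℝ} (ha : ∀ j k, ContDiff ℝ ∞ (a j k))
    {φ : 𝔼 → ℝ} (hφ : ContDiff ℝ ∞ φ) (s : ℝ) {z : 𝔼} {ξ : Fin n → ℝ}
    (hH : lieForm a (gradField a φ) z ξ = 0) :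
    lieForm a (fun k y => (1 + s * φ y) * gradField a φ k y) z ξ
      = s * (∑ k, gradField a φ k z * ξ k) ^ 2 := by
  have hr : ContDiff ℝ ∞ fun y => 1 + s * φ y := contDiff_const.add (contDiff_const.mul hφ)
  have hX := contDiff_gradField ha hφ
  have e : ∀ k l, pderiv l (fun y => (1 + s * φ y) * gradField a φ k y) z
      = s * pderiv l φ z * gradField a φ k z + (1 + s * φ z) * pderiv l (gradField a φ k) z := by
    intro k l
    rw [pderiv_fun_mul hr (hX k), pderiv_fun_add contDiff_const (contDiff_const.mul hφ),
      pderiv_fun_const_mul _ hφ, pderiv_fun_const]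
    ring
  have h : lieForm a (fun k y => (1 + s * φ y) * gradField a φ k y) z ξ
      = (1 + s * φ z) * lieForm a (gradField a φ) z ξ
        + s * ∑ j, ∑ k, (∑ l, a j l z * pderiv l φ z) * gradField a φ k z * ξ j * ξ k := by
    unfold lieForm
    simp only [e, Finset.mul_sum, Finset.sum_mul, ← Finset.sum_add_distrib]
    exact Finset.sum_congr rfl fun j _ => Finset.sum_congr rfl fun k _ =>
      Finset.sum_congr rfl fun l _ => by ring
  rw [h, hH, pow_two, Finset.sum_mul_sum]
  simp only [mul_zero, zero_add]
  congr 1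
  refine Finset.sum_congr rfl fun j _ => Finset.sum_congr rfl fun k _ => ?_
  simp only [gradField]
  ring

theorem exists_bound_of_hasCompactSupport {f : 𝔼 → ℝ} (hf : Continuous f)
    (hc : HasCompactSupport f) : ∃ B : ℝ, 0 ≤ B ∧ ∀ z, |f z| ≤ B := by
  obtain ⟨C, hC⟩ := hc.exists_bound_of_continuous hf
  exact ⟨max C 0, le_max_right _ _, fun z => (hC z).trans (le_max_left _ _)⟩

set_option maxHeartbeats 1000000 in
/-- The Carleman estimate in `ℝⁿ` for a cometric `a` in which the weight has unit gradient
and vanishing Hessian on the set `O`. The gain `ε` is what absorbs lower order terms: it comes from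
the convexification, whose strength `1 / ε` is fixed before the large parameter `τ`. -/
theorem carleman_estimate_euclidean {a : Fin n → Fin n → 𝔼 → ℝ}
    (ha : ∀ j k, ContDiff ℝ ∞ (a j k)) (hac : ∀ j k, HasCompactSupport (a j k))
    (hsymm : ∀ j k, a j k = a k j) {φ : 𝔼 → ℝ} (hφ : ContDiff ℝ ∞ φ) (hφc : HasCompactSupport φ)
    {O : Set 𝔼} (hb : ∀ z ∈ O, ∑ k, gradField a φ k z * pderiv k φ z = 1)
    (hH : ∀ z ∈ O, ∀ ξ, lieForm a (gradField a φ) z ξ = 0) {c : ℝ} (hc : 0 < c)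
    (hell : ∀ z ∈ O, ∀ ξ : Fin n → ℝ, c * ∑ j, ξ j ^ 2 ≤ ∑ j, ∑ k, a j k z * ξ j * ξ k) :
    ∃ C : ℝ, 0 < C ∧ ∀ ε : ℝ, 0 < ε → ε ≤ 1 → ∃ τ₀ : ℝ, 1 ≤ τ₀ ∧ ∀ τ, τ₀ ≤ τ →
      ∀ u : 𝔼 → ℝ, ContDiff ℝ ∞ u → HasCompactSupport u → tsupport u ⊆ O →
        ∫ z, carlemanWeight ε τ (φ z) ^ 2 * (τ ^ 2 * u z ^ 2 + ∑ j, pderiv j u z ^ 2)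
          ≤ C * ε * ∫ z, carlemanWeight ε τ (φ z) ^ 2 * divOp a u z ^ 2 := by
  have hX := contDiff_gradField ha hφ
  have hD0 : ContDiff ℝ ∞ (divField (gradField a φ)) := contDiff_divField hX
  have hφX : ∀ k, ContDiff ℝ ∞ fun y => φ y * gradField a φ k y := fun k => hφ.mul (hX k)
  have hD1 : ContDiff ℝ ∞ (divField fun k y => φ y * gradField a φ k y) := contDiff_divField hφX
  obtain ⟨B, hB0, hB⟩ := exists_bound_of_hasCompactSupport hφ.continuous hφc
  obtain ⟨B₁, hB₁0, hB₁⟩ : ∃ B : ℝ, 0 ≤ B ∧ ∀ z, |∑ j, pderiv j φ z ^ 2| ≤ B :=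
    exists_bound_of_hasCompactSupport
      (continuous_finsetSum _ fun j _ => (contDiff_pderiv hφ j).continuous.pow 2)
      (HasCompactSupport.intro hφc fun z hz => by simp [pderiv_eq_zero_of_notMem_tsupport hz])
  have hdiv : ∀ f : 𝔼 → ℝ, ContDiff ℝ ∞ f → ∃ B : ℝ, 0 ≤ B ∧ ∀ z, |divOp a f z| ≤ B := by
    intro f hf
    have hflux : ∀ j, HasCompactSupport fun y => ∑ k, a j k y * pderiv k f y := fun j => by
      have hK : IsCompact (⋃ k, tsupport (a j k)) := isCompact_iUnion fun k => hac j k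
      refine HasCompactSupport.intro hK fun z hz => Finset.sum_eq_zero fun k _ => ?_
      have : z ∉ tsupport (a j k) := fun h => hz (mem_iUnion.2 ⟨k, h⟩)
      simp [image_eq_zero_of_notMem_tsupport this]
    have hK : IsCompact (⋃ j, tsupport fun y => ∑ k, a j k y * pderiv k f y) :=
      isCompact_iUnion fun j => hflux j
    refine exists_bound_of_hasCompactSupport (contDiff_divOp ha hf).continuous
      (HasCompactSupport.intro hK fun z hz => Finset.sum_eq_zero fun j _ => ?_)
    exact pderiv_eq_zero_of_notMem_tsupport (fun h => hz (mem_iUnion.2 ⟨j, h⟩)) j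
  obtain ⟨B₂, hB₂0, hB₂⟩ := hdiv _ hD0
  obtain ⟨B₃, hB₃0, hB₃⟩ := hdiv _ hD1
  refine ⟨2 + 12 / c + 9 * B₁, by positivity, fun ε hε hε1 => ?_⟩
  -- `τ` has to be so large that `|s φ| ≤ 1/2` for `s = 1 / (ε τ)`, and that the term of order zero
  -- from `L div Z` is absorbed
  refine ⟨1 / ε + 2 * B / ε + 2 * (B₂ + B₃), ?_, fun τ hτ u hu huc huO => ?_⟩
  · have : 1 ≤ 1 / ε := by rw [le_div_iff₀ hε]; linarith
    have : 0 ≤ 2 * B / ε := by positivity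
    linarith
  have hτε : 1 / ε ≤ τ := by
    have : 0 ≤ 2 * B / ε := by positivity
    linarith
  have hτB : 2 * B / ε ≤ τ := by
    have : 0 ≤ 1 / ε := by positivity
    linarith
  have hτB2 : 2 * (B₂ + B₃) ≤ τ := by
    have h1 : 0 ≤ 1 / ε := by positivity
    have h2 : 0 ≤ 2 * B / ε := by positivity
    linarith
  have hετ : 1 ≤ ε * τ := by rw [div_le_iff₀ hε] at hτε; linarith
  have hτ1 : 1 ≤ τ := by nlinarith
  have hτ0 : 0 < τ := by linarith
  obtain ⟨s, hs⟩ : ∃ s : ℝ, s * (ε * τ) = 1 := ⟨(ε * τ)⁻¹, inv_mul_cancel₀ (by positivity)⟩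
  have hs0 : 0 < s := by
    by_contra h
    nlinarith
  have hs1 : s ≤ 1 := by nlinarith
  have hsB : s * B ≤ 1 / 2 := by
    rw [div_le_iff₀ hε] at hτB
    nlinarith
  set W := fun y => carlemanWeight ε τ (φ y) with hWdef
  set v := fun y => W y * u y with hvdef
  set r := fun y => 1 + s * φ y with hrdef
  set Z := fun k y => r y * gradField a φ k y with hZdef
  have hW : ContDiff ℝ ∞ W := contDiff_carlemanWeight hφ ε τ
  have hr : ContDiff ℝ ∞ r := contDiff_const.add (contDiff_const.mul hφ)
  have hZ : ∀ k, ContDiff ℝ ∞ (Z k) := fun k => hr.mul (hX k)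
  have hv : ContDiff ℝ ∞ v := hW.mul hu
  have hvc : HasCompactSupport v := huc.mul_left
  have hvu : ∀ z, z ∉ O → z ∉ tsupport v := fun z hz h =>
    hz (huO (tsupport_mul_subset_right h))
  have hrb : ∀ z, 1 / 2 ≤ r z ∧ r z ≤ 3 / 2 := by
    intro z
    have h1 := abs_le.1 (hB z)
    simp only [hrdef]
    constructor <;> nlinarith
  have hr2 : ∀ z, 1 ≤ 4 * r z ^ 2 ∧ r z ^ 2 ≤ 9 / 4 := by
    intro z
    have := hrb z
    constructor <;> nlinarith
  have hid := commutator_identity ha hsymm hZ hr hv hvc τ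
  -- the symmetric and the antisymmetric part of the conjugated operator
  set S := fun z => divOp a v z + τ ^ 2 * r z ^ 2 * v z with hSdef
  set T := fun z => -(2 * τ * alongField Z v z) - τ * divField Z z * v z with hTdef
  have hconj : ∀ z, S z + T z = W z * divOp a u z := by
    intro z
    by_cases hz : z ∈ O
    · exact divOp_conj ha hsymm hφ hu hε hs (hb z hz)
    · have h1 := hvu z hz
      have h2 : z ∉ tsupport u := fun h => hz (huO h)
      simp [S, T, divOp_eq_zero_of_notMem_tsupport a h1, divOp_eq_zero_of_notMem_tsupport a h2,
        alongField_eq_zero_of_notMem_tsupport Z h1, image_eq_zero_of_notMem_tsupport h1]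
  have cv := hv.continuous
  have cS : Continuous S := ((contDiff_divOp ha hv).add
    ((contDiff_const.mul (hr.pow 2)).mul hv)).continuous
  have cT : Continuous T := ((contDiff_const.mul (contDiff_alongField hZ hv)).neg.sub
    ((contDiff_const.mul (contDiff_divField hZ)).mul hv)).continuous
  have S0 : ∀ z, z ∉ tsupport v → S z = 0 := fun z hz => by
    simp [S, divOp_eq_zero_of_notMem_tsupport a hz, image_eq_zero_of_notMem_tsupport hz]
  have T0 : ∀ z, z ∉ tsupport v → T z = 0 := fun z hz => by
    simp [T, alongField_eq_zero_of_notMem_tsupport Z hz, image_eq_zero_of_notMem_tsupport hz]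
  have v0 : ∀ z, z ∉ tsupport v → v z = 0 := fun z hz => image_eq_zero_of_notMem_tsupport hz
  have iS : Integrable fun z => S z ^ 2 :=
    integrable_of_zero_off_compact hvc (cS.pow 2) fun z hz => by simp [S0 z hz]
  have iv : Integrable fun z => v z ^ 2 :=
    integrable_of_zero_off_compact hvc (cv.pow 2) fun z hz => by simp [v0 z hz]
  have iN : Integrable fun z => (S z + T z) ^ 2 :=
    integrable_of_zero_off_compact hvc ((cS.add cT).pow 2) fun z hz => by simp [S0 z hz, T0 z hz]
  have iST : Integrable fun z => 2 * (S z * T z) :=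
    integrable_of_zero_off_compact hvc (continuous_const.mul (cS.mul cT)) fun z hz => by
      simp [S0 z hz]
  set N := ∫ z, (S z + T z) ^ 2 with hN
  have hNu : ∫ z, W z ^ 2 * divOp a u z ^ 2 = N := by
    rw [hN]; congr 1; ext z; rw [hconj]; ring
  -- the commutator is bounded below by `τ² / (2ε)`
  have hdiv : divField Z = fun z => divField (gradField a φ) z
      + s * divField (fun k y => φ y * gradField a φ k y) z := by
    ext z
    unfold divField
    rw [Finset.mul_sum, ← Finset.sum_add_distrib]
    refine Finset.sum_congr rfl fun k _ => ?_
    have : Z k = fun y => gradField a φ k y + s * (φ y * gradField a φ k y) := by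
      ext y; simp only [Z, r]; ring
    rw [this, pderiv_fun_add (hX k) (contDiff_const.mul (hφX k)), pderiv_fun_const_mul _ (hφX k)]
  have hLdiv : ∀ z, divOp a (divField Z) z ≤ B₂ + B₃ := by
    intro z
    have e : divOp a (divField Z) z = divOp a (divField (gradField a φ)) z
        + s * divOp a (divField (fun k y => φ y * gradField a φ k y)) z := by
      have e1 : ∀ j, (fun y => ∑ k, a j k y * pderiv k (divField Z) y)
          = fun y => (∑ k, a j k y * pderiv k (divField (gradField a φ)) y)
            + s * ∑ k, a j k y * pderiv k (divField (fun k y => φ y * gradField a φ k y)) y := by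
        intro j
        ext y
        rw [Finset.mul_sum, ← Finset.sum_add_distrib, hdiv]
        refine Finset.sum_congr rfl fun k _ => ?_
        rw [pderiv_fun_add hD0 (contDiff_const.mul hD1), pderiv_fun_const_mul _ hD1]
        ring
      have hf : ∀ (f : 𝔼 → ℝ), ContDiff ℝ ∞ f → ∀ j,
          ContDiff ℝ ∞ fun y => ∑ k, a j k y * pderiv k f y := fun f hf j =>
        ContDiff.sum fun k _ => (ha j k).mul (contDiff_pderiv hf k)
      unfold divOp
      rw [Finset.mul_sum, ← Finset.sum_add_distrib]
      refine Finset.sum_congr rfl fun j _ => ?_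
      rw [e1, pderiv_fun_add (hf _ hD0 j) (contDiff_const.mul (hf _ hD1 j)),
        pderiv_fun_const_mul _ (hf _ hD1 j)]
    have h2 := abs_le.1 (hB₂ z)
    have h3 := abs_le.1 (hB₃ z)
    rw [e]
    nlinarith
  have hcomm : τ ^ 2 / (2 * ε) * ∫ z, v z ^ 2 ≤ ∫ z, 2 * (S z * T z) := by
    rw [hid, ← integral_const_mul]
    refine integral_mono (iv.const_mul _) ?_ fun z => ?_
    · refine integrable_of_zero_off_compact hvc ?_ fun z hz => ?_
      · exact (((contDiff_const.mul (contDiff_lieForm ha hZ hv)).sub ((contDiff_const.mul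
          (contDiff_divOp ha (contDiff_divField hZ))).mul (hv.pow 2))).add
          (((contDiff_const.mul hr).mul (contDiff_alongField hZ hr)).mul (hv.pow 2))).continuous
      · simp [v0 z hz, lieForm, pderiv_eq_zero_of_notMem_tsupport hz]
    · by_cases hz : z ∈ O
      · have e1 : lieForm a Z z (fun j => pderiv j v z)
            = s * (∑ k, gradField a φ k z * pderiv k v z) ^ 2 :=
          lieForm_smul_grad ha hφ s (hH z hz _)
        have e2 : alongField Z r z = r z * s := by
          have : ∀ k, pderiv k r z = s * pderiv k φ z := fun k => by
            rw [show pderiv k r z = _ from pderiv_fun_add contDiff_const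
              (contDiff_const.mul hφ) k z, pderiv_fun_const_mul _ hφ, pderiv_fun_const, zero_add]
          unfold alongField
          simp only [this]
          calc ∑ k, Z k z * (s * pderiv k φ z)
              = r z * s * ∑ k, gradField a φ k z * pderiv k φ z := by
                rw [Finset.mul_sum]
                exact Finset.sum_congr rfl fun k _ => by simp only [Z]; ring
            _ = _ := by rw [hb z hz, mul_one]
        have e3 : τ ^ 3 * s = τ ^ 2 / ε := by
          rw [eq_div_iff hε.ne']
          linear_combination τ ^ 2 * hs
        have h1 : 0 ≤ 4 * τ * (s * (∑ k, gradField a φ k z * pderiv k v z) ^ 2) := by positivity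
        have h2 : τ * divOp a (divField Z) z * v z ^ 2 ≤ τ ^ 2 / (2 * ε) * v z ^ 2 := by
          refine mul_le_mul_of_nonneg_right ?_ (sq_nonneg _)
          have h3 := hLdiv z
          have h4 : τ * (τ / 2) ≤ τ ^ 2 / (2 * ε) := by
            rw [le_div_iff₀ (by positivity)]
            nlinarith [sq_nonneg τ]
          nlinarith
        have h5 : τ ^ 2 / ε * v z ^ 2 ≤ 4 * τ ^ 3 * r z * (r z * s) * v z ^ 2 := by
          refine mul_le_mul_of_nonneg_right ?_ (sq_nonneg _)
          rw [show 4 * τ ^ 3 * r z * (r z * s) = (4 * r z ^ 2) * (τ ^ 3 * s) by ring, e3]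
          have : 0 ≤ τ ^ 2 / ε := by positivity
          nlinarith [(hr2 z).1]
        have h6 : τ ^ 2 / ε * v z ^ 2 = 2 * (τ ^ 2 / (2 * ε) * v z ^ 2) := by
          field_simp
        change τ ^ 2 / (2 * ε) * v z ^ 2 ≤ _
        rw [e1, e2]
        linarith
      · have hz' := hvu z hz
        simp [v0 z hz', lieForm, pderiv_eq_zero_of_notMem_tsupport hz']
  -- drop the square of the antisymmetric part from `‖S + T‖² = ‖S‖² + ‖T‖² + 2 (S, T)`
  have hmain : (∫ z, S z ^ 2) + τ ^ 2 / (2 * ε) * ∫ z, v z ^ 2 ≤ N := by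
    have h1 : (∫ z, S z ^ 2) + ∫ z, 2 * (S z * T z) ≤ N := by
      rw [← integral_add iS iST]
      exact integral_mono (iS.fun_add iST) iN fun z => by
        change _ ≤ (S z + T z) ^ 2
        nlinarith [sq_nonneg (T z)]
    linarith
  have hS0 : 0 ≤ ∫ z, S z ^ 2 := integral_nonneg fun z => sq_nonneg _
  have hV0 : 0 ≤ ∫ z, v z ^ 2 := integral_nonneg fun z => sq_nonneg _
  have hN0 : 0 ≤ N := integral_nonneg fun z => sq_nonneg _
  have hV : τ ^ 2 * ∫ z, v z ^ 2 ≤ 2 * ε * N := by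
    have h1 : τ ^ 2 / (2 * ε) * ∫ z, v z ^ 2 ≤ N := by linarith
    rw [div_mul_eq_mul_div, div_le_iff₀ (by positivity)] at h1
    linarith
  -- the gradient is controlled by `-∫ v L v`, where `L v = S - τ² r² v`
  have cg := (contDiff_gradSq ha hv).continuous
  have ig : Integrable (gradSq a v) :=
    integrable_of_zero_off_compact hvc cg fun z hz => gradSq_eq_zero_of_notMem_tsupport a hz
  have hgrad : ∫ z, gradSq a v z ≤ 6 * ε * N := by
    have h1 := integral_mul_divOp ha hv hv hvc
    have h2 : ∫ z, gradSq a v z = ∫ z, -(v z * divOp a v z) := by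
      rw [integral_neg, h1, neg_neg]; rfl
    rw [h2]
    have h3 : ∫ z, -(v z * divOp a v z)
        ≤ ∫ z, (ε / 2 * S z ^ 2 + (1 / (2 * ε) + 9 / 4 * τ ^ 2) * v z ^ 2) := by
      refine integral_mono ?_ ((iS.const_mul _).fun_add (iv.const_mul _)) fun z => ?_
      · exact integrable_of_zero_off_compact hvc (cv.mul (contDiff_divOp ha hv).continuous).neg
          fun z hz => by simp [v0 z hz]
      · change -(v z * divOp a v z) ≤ ε / 2 * S z ^ 2 + (1 / (2 * ε) + 9 / 4 * τ ^ 2) * v z ^ 2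
        have e : divOp a v z = S z - τ ^ 2 * r z ^ 2 * v z := by simp [S]
        have h4 : -(v z * S z) ≤ ε / 2 * S z ^ 2 + 1 / (2 * ε) * v z ^ 2 := by
          have : ε / 2 * S z ^ 2 + 1 / (2 * ε) * v z ^ 2 + v z * S z
              = (ε * S z + v z) ^ 2 / (2 * ε) := by field_simp; ring
          have h5 : 0 ≤ (ε * S z + v z) ^ 2 / (2 * ε) := by positivity
          linarith
        have h6 : τ ^ 2 * r z ^ 2 * v z ^ 2 ≤ 9 / 4 * τ ^ 2 * v z ^ 2 := by
          refine mul_le_mul_of_nonneg_right ?_ (sq_nonneg _)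
          nlinarith [(hr2 z).2, sq_nonneg τ]
        rw [e]
        nlinarith
    rw [integral_add (iS.const_mul _) (iv.const_mul _), integral_const_mul,
      integral_const_mul] at h3
    have h7 : 1 / (2 * ε) ≤ τ ^ 2 / 2 := by
      rw [div_le_div_iff₀ (by positivity) (by norm_num)]
      nlinarith
    have h8 : ∫ z, S z ^ 2 ≤ N := by
      have : 0 ≤ τ ^ 2 / (2 * ε) * ∫ z, v z ^ 2 := by positivity
      linarith
    nlinarith
  have iD : Integrable fun z => ∑ j, pderiv j v z ^ 2 :=
    integrable_of_zero_off_compact hvc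
      (continuous_finsetSum _ fun j _ => (contDiff_pderiv hv j).continuous.pow 2)
      fun z hz => by simp [pderiv_eq_zero_of_notMem_tsupport hz]
  have hD : c * ∫ z, ∑ j, pderiv j v z ^ 2 ≤ 6 * ε * N := by
    rw [← integral_const_mul]
    refine (integral_mono (iD.const_mul c) ig fun z => ?_).trans hgrad
    by_cases hz : z ∈ O
    · exact hell z hz _
    · simp [pderiv_eq_zero_of_notMem_tsupport (hvu z hz),
        gradSq_eq_zero_of_notMem_tsupport a (hvu z hz)]
  -- return from `v = W u` to `u`
  have hfin : ∫ z, W z ^ 2 * (τ ^ 2 * u z ^ 2 + ∑ j, pderiv j u z ^ 2)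
      ≤ ∫ z, ((1 + 9 / 2 * B₁) * (τ ^ 2 * v z ^ 2) + 2 * ∑ j, pderiv j v z ^ 2) := by
    refine integral_mono ?_ (((iv.const_mul _).const_mul _).fun_add (iD.const_mul 2)) fun z => ?_
    · refine integrable_of_zero_off_compact huc ?_ fun z hz => ?_
      · exact (hW.continuous.pow 2).mul ((continuous_const.mul (hu.continuous.pow 2)).add
          (continuous_finsetSum _ fun j _ => (contDiff_pderiv hu j).continuous.pow 2))
      · simp [image_eq_zero_of_notMem_tsupport hz, pderiv_eq_zero_of_notMem_tsupport hz]
    · change W z ^ 2 * (τ ^ 2 * u z ^ 2 + ∑ j, pderiv j u z ^ 2)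
        ≤ (1 + 9 / 2 * B₁) * (τ ^ 2 * v z ^ 2) + 2 * ∑ j, pderiv j v z ^ 2
      have h1 : ∀ j, W z ^ 2 * pderiv j u z ^ 2
          ≤ 2 * pderiv j v z ^ 2 + 9 / 2 * τ ^ 2 * v z ^ 2 * pderiv j φ z ^ 2 := by
        intro j
        have e : W z * pderiv j u z = pderiv j v z - τ * r z * pderiv j φ z * v z := by
          have := pderiv_fun_mul hW hu j z
          rw [pderiv_carlemanWeight hφ hε hs] at this
          change pderiv j v z = _ at this
          rw [this]; simp only [v, W, r]; ring
        have h2 : (W z * pderiv j u z) ^ 2 ≤ 2 * pderiv j v z ^ 2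
            + 2 * (r z ^ 2 * (τ ^ 2 * v z ^ 2 * pderiv j φ z ^ 2)) := by
          rw [e]
          nlinarith [sq_nonneg (pderiv j v z + τ * r z * pderiv j φ z * v z)]
        have h3 : r z ^ 2 * (τ ^ 2 * v z ^ 2 * pderiv j φ z ^ 2)
            ≤ 9 / 4 * (τ ^ 2 * v z ^ 2 * pderiv j φ z ^ 2) :=
          mul_le_mul_of_nonneg_right (hr2 z).2 (by positivity)
        nlinarith
      have h2 : W z ^ 2 * ∑ j, pderiv j u z ^ 2
          ≤ 2 * ∑ j, pderiv j v z ^ 2 + 9 / 2 * τ ^ 2 * v z ^ 2 * ∑ j, pderiv j φ z ^ 2 := by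
        rw [Finset.mul_sum, Finset.mul_sum, Finset.mul_sum, ← Finset.sum_add_distrib]
        exact Finset.sum_le_sum fun j _ => h1 j
      have h3 : 9 / 2 * τ ^ 2 * v z ^ 2 * ∑ j, pderiv j φ z ^ 2 ≤ 9 / 2 * τ ^ 2 * v z ^ 2 * B₁ :=
        mul_le_mul_of_nonneg_left ((le_abs_self _).trans (hB₁ z)) (by positivity)
      have h4 : W z ^ 2 * (τ ^ 2 * u z ^ 2) = τ ^ 2 * v z ^ 2 := by simp only [v]; ring
      rw [mul_add, h4]
      linarith
  rw [integral_add ((iv.const_mul _).const_mul _) (iD.const_mul 2), integral_const_mul,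
    integral_const_mul, integral_const_mul] at hfin
  rw [hNu]
  refine hfin.trans ?_
  have hD' : ∫ z, ∑ j, pderiv j v z ^ 2 ≤ 6 / c * ε * N := by
    rw [show 6 / c * ε * N = (6 * ε * N) / c by ring, le_div_iff₀ hc]
    linarith
  have h9 : (1 + 9 / 2 * B₁) * (τ ^ 2 * ∫ z, v z ^ 2) ≤ (1 + 9 / 2 * B₁) * (2 * ε * N) :=
    mul_le_mul_of_nonneg_left hV (by positivity)
  calc _ ≤ (1 + 9 / 2 * B₁) * (2 * ε * N) + 2 * (6 / c * ε * N) := by linarith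
    _ = _ := by ring

end EuclidCarleman

/-! ### The Poisson bracket condition and the Hessian of the weight -/

section Bracket
variable {n : ℕ}
local notation "𝔼" => EuclideanSpace ℝ (Fin n)

/-- In a cometric for which `φ` has constant gradient length, the Hessian of `φ` annihilates
`dφ`. The arguments stand for the values and first derivatives of the cometric, the first and
second derivatives of `φ`, and the gradient field with its derivatives. -/
theorem hessian_apply_grad {A : Fin n → Fin n → ℝ} {dA : Fin n → Fin n → Fin n → ℝ}
    {P X : Fin n → ℝ} {D dX : Fin n → Fin n → ℝ} (hA : ∀ j k, A j k = A k j)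
    (hdA : ∀ l j k, dA l j k = dA l k j)
    (hD : ∀ j k, D j k = D k j) (hX : ∀ k, X k = ∑ m, A k m * P m)
    (hdX : ∀ l k, dX l k = ∑ m, (dA l k m * P m + A k m * D l m))
    (hb : ∀ l, ∑ k, dX l k * P k = -∑ k, X k * D l k) (ζ : Fin n → ℝ) :
    ∑ j, ∑ k, (∑ l, (A j l * dX l k - X l * dA l j k / 2)) * (P j * ζ k + ζ j * P k) = 0 := by
  have e1 : ∑ j, ∑ k, (∑ l, A j l * dX l k) * (P j * ζ k) = ∑ l, ∑ k, X l * dX l k * ζ k := by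
    simp only [hX, Finset.sum_mul]
    rw [Finset.sum_comm, Finset.sum_congr rfl fun k _ => Finset.sum_comm, Finset.sum_comm]
    exact Finset.sum_congr rfl fun l _ => Finset.sum_congr rfl fun k _ =>
      Finset.sum_congr rfl fun j _ => by rw [hA j l]; ring
  have e2 : ∑ j, ∑ k, (∑ l, A j l * dX l k) * (ζ j * P k)
      = -∑ j, ∑ l, A j l * ζ j * ∑ k, X k * D l k := by
    rw [← Finset.sum_neg_distrib]
    refine Finset.sum_congr rfl fun j _ => ?_
    simp only [Finset.sum_mul]
    rw [Finset.sum_comm, ← Finset.sum_neg_distrib]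
    refine Finset.sum_congr rfl fun l _ => ?_
    rw [← mul_neg, ← hb, Finset.mul_sum]
    exact Finset.sum_congr rfl fun k _ => by ring
  have e3 : ∑ j, ∑ k, (∑ l, X l * dA l j k / 2) * (P j * ζ k + ζ j * P k)
      = ∑ l, ∑ k, X l * (∑ m, dA l k m * P m) * ζ k := by
    have : ∀ j k, (∑ l, X l * dA l j k / 2) * (P j * ζ k + ζ j * P k)
        = (∑ l, X l * dA l k j * P j * ζ k) / 2 + (∑ l, X l * dA l j k * P k * ζ j) / 2 := by
      intro j k
      rw [Finset.sum_mul, Finset.sum_div, Finset.sum_div, ← Finset.sum_add_distrib]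
      exact Finset.sum_congr rfl fun l _ => by rw [hdA l k j]; ring
    rw [Finset.sum_congr rfl fun j _ => Finset.sum_congr rfl fun k _ => this j k]
    simp only [Finset.sum_add_distrib, ← Finset.sum_div]
    have h1 : ∑ j, ∑ k, ∑ l, X l * dA l k j * P j * ζ k
        = ∑ j, ∑ k, ∑ l, X l * dA l j k * P k * ζ j := Finset.sum_comm
    rw [h1, add_halves, Finset.sum_congr rfl fun k _ => Finset.sum_comm, Finset.sum_comm]
    refine Finset.sum_congr rfl fun l _ => Finset.sum_congr rfl fun k _ => ?_
    rw [Finset.mul_sum, Finset.sum_mul]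
    exact Finset.sum_congr rfl fun m _ => by ring
  have e4 : ∑ l, ∑ k, X l * dX l k * ζ k - ∑ l, ∑ k, X l * (∑ m, dA l k m * P m) * ζ k
      = ∑ j, ∑ l, A j l * ζ j * ∑ k, X k * D l k := by
    have h : ∀ l k, X l * dX l k * ζ k - X l * (∑ m, dA l k m * P m) * ζ k
        = ∑ m, A k m * ζ k * (X l * D l m) := by
      intro l k
      rw [hdX, Finset.sum_add_distrib, mul_add, add_mul, add_sub_cancel_left, Finset.mul_sum,
        Finset.sum_mul]
      exact Finset.sum_congr rfl fun m _ => by ring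
    simp only [← Finset.sum_sub_distrib, h]
    rw [Finset.sum_comm, Finset.sum_congr rfl fun k _ => Finset.sum_comm]
    refine Finset.sum_congr rfl fun k _ => Finset.sum_congr rfl fun m _ => ?_
    rw [Finset.mul_sum]
    exact Finset.sum_congr rfl fun l _ => by rw [hD m l]
  have h : ∑ j, ∑ k, (∑ l, (A j l * dX l k - X l * dA l j k / 2)) * (P j * ζ k + ζ j * P k)
      = ∑ j, ∑ k, (∑ l, A j l * dX l k) * (P j * ζ k)
        + ∑ j, ∑ k, (∑ l, A j l * dX l k) * (ζ j * P k)
        - ∑ j, ∑ k, (∑ l, X l * dA l j k / 2) * (P j * ζ k + ζ j * P k) := by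
    simp only [Finset.sum_sub_distrib, ← Finset.sum_add_distrib]
    simp only [← Finset.sum_sub_distrib]
    refine Finset.sum_congr rfl fun j _ => Finset.sum_congr rfl fun k _ => ?_
    rw [Finset.sum_sub_distrib]
    ring
  rw [h, e1, e2, e3, ← e4]
  ring

/-- The Poisson bracket condition for the weight says that its Hessian vanishes in the conformal
metric for which its gradient has length one. Here `N` is the conformal factor, so that `N a` is
the original cometric and `p` the symbol formed with it. -/
theorem lieForm_eq_zero_of_bracket {a : Fin n → Fin n → 𝔼 → ℝ}
    (ha : ∀ j k, ContDiff ℝ ∞ (a j k)) (hsymm : ∀ j k, a j k = a k j) {φ : 𝔼 → ℝ}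
    (hφ : ContDiff ℝ ∞ φ) {O : Set 𝔼} (hO : IsOpen O)
    (hb : ∀ z ∈ O, ∑ k, gradField a φ k z * pderiv k φ z = 1)
    (hpos : ∀ z ∈ O, ∀ ξ : Fin n → ℝ, ξ ≠ 0 → 0 < ∑ j, ∑ k, a j k z * ξ j * ξ k)
    {N : 𝔼 → ℝ} (hN : ∀ z ∈ O, DifferentiableAt ℝ N z) (hN0 : ∀ z ∈ O, N z ≠ 0)
    {p : 𝔼 → 𝔼 → ℂ} (hp : ∀ y ∈ O, ∀ η : 𝔼, p y η = (N y : ℂ) * ∑ j, ∑ k, (a j k y : ℂ) *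
      ((η j : ℂ) + Complex.I * ((pderiv j φ y : ℝ) : ℂ)) * ((η k : ℂ) + Complex.I * ((pderiv k φ y : ℝ) : ℂ)))
    (hbr : ∀ z ∈ O, ∀ ξ : 𝔼, p z ξ = 0 →
      poissonBracket (fun y η => (p y η).re) (fun y η => (p y η).im) z ξ = 0)
    {z : 𝔼} (hz : z ∈ O) (ξ : Fin n → ℝ) : lieForm a (gradField a φ) z ξ = 0 := by
  have hX := contDiff_gradField ha hφ
  have hOz : ∀ᶠ y in 𝓝 z, y ∈ O := hO.mem_nhds hz
  -- the real and imaginary parts of the symbol of the conformal metric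
  set q₁ : 𝔼 → 𝔼 → ℝ := fun y η => (∑ j, ∑ k, a j k y * η j * η k) - 1 with hq₁
  set q₂ : 𝔼 → 𝔼 → ℝ := fun y η => 2 * ∑ k, gradField a φ k y * η k with hq₂
  have hre : ∀ y ∈ O, ∀ η, (p y η).re = N y * q₁ y η := by
    intro y hy η
    have h1 : ∑ j, ∑ k, a j k y * pderiv j φ y * pderiv k φ y = 1 := by
      rw [← hb y hy, Finset.sum_comm]
      refine Finset.sum_congr rfl fun k _ => ?_
      rw [gradField, Finset.sum_mul]
      exact Finset.sum_congr rfl fun j _ => by rw [hsymm j k]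
    rw [hp y hy, hq₁, ← h1, Complex.re_ofReal_mul]
    simp only [Complex.re_sum, ← Finset.sum_sub_distrib]
    congr 1
    refine Finset.sum_congr rfl fun j _ => Finset.sum_congr rfl fun k _ => ?_
    simp [mul_assoc, mul_sub]
  have him : ∀ y ∈ O, ∀ η, (p y η).im = N y * q₂ y η := by
    intro y hy η
    have h1 : ∑ j, ∑ k, a j k y * pderiv j φ y * η k = ∑ k, gradField a φ k y * η k := by
      rw [Finset.sum_comm]
      refine Finset.sum_congr rfl fun k _ => ?_
      rw [gradField, Finset.sum_mul]
      exact Finset.sum_congr rfl fun j _ => by rw [hsymm j k]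
    have h2 : ∑ j, ∑ k, a j k y * η j * pderiv k φ y = ∑ k, gradField a φ k y * η k := by
      refine Finset.sum_congr rfl fun j _ => ?_
      rw [gradField, Finset.sum_mul]
      exact Finset.sum_congr rfl fun j _ => by ring
    rw [hp y hy, hq₂]
    simp only [two_mul]
    nth_rw 1 [← h1]
    rw [← h2, Complex.im_ofReal_mul]
    simp only [Complex.im_sum, ← Finset.sum_add_distrib]
    congr 1
    refine Finset.sum_congr rfl fun j _ => Finset.sum_congr rfl fun k _ => ?_
    simp
    ring
  have hcoord : ∀ (η : 𝔼) (l j : Fin n), pderiv l (fun η : 𝔼 => η j) η = if l = j then 1 else 0 := by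
    intro η l j
    have : HasFDerivAt (fun η : 𝔼 => η j) (EuclideanSpace.proj j : 𝔼 →L[ℝ] ℝ) η :=
      (EuclideanSpace.proj j : 𝔼 →L[ℝ] ℝ).hasFDerivAt
    unfold pderiv
    rw [this.fderiv]
    simp [eq_comm]
  have ccoord : ∀ j : Fin n, ContDiff ℝ ∞ fun η : 𝔼 => η j := fun j =>
    (EuclideanSpace.proj j : 𝔼 →L[ℝ] ℝ).contDiff
  have cq : ∀ y, ContDiff ℝ ∞ (q₁ y) := fun y => (ContDiff.sum fun j _ => ContDiff.sum fun k _ =>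
    (contDiff_const.mul (ccoord j)).mul (ccoord k)).sub contDiff_const
  have cq' : ∀ η, ContDiff ℝ ∞ fun y => q₁ y η := fun η => (ContDiff.sum fun j _ =>
    ContDiff.sum fun k _ => ((ha j k).mul contDiff_const).mul contDiff_const).sub contDiff_const
  have cr : ∀ y, ContDiff ℝ ∞ (q₂ y) := fun y => contDiff_const.mul (ContDiff.sum fun k _ =>
    contDiff_const.mul (ccoord k))
  have cr' : ∀ η, ContDiff ℝ ∞ fun y => q₂ y η := fun η => contDiff_const.mul
    (ContDiff.sum fun k _ => (hX k).mul contDiff_const)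
  have dq : ∀ l (η : 𝔼), pderiv l (q₁ z) η = 2 * ∑ j, a l j z * η j := by
    intro l η
    have e : ∀ j k : Fin n, pderiv l (fun η : 𝔼 => a j k z * η j * η k) η
        = a j k z * ((if l = j then η k else 0) + if l = k then η j else 0) := by
      intro j k
      rw [pderiv_fun_mul (contDiff_const.mul (ccoord j)) (ccoord k),
        pderiv_fun_const_mul _ (ccoord j), hcoord, hcoord]
      split_ifs <;> ring
    rw [hq₁]
    simp only
    rw [pderiv_fun_sub (ContDiff.sum fun j _ => ContDiff.sum fun k _ =>
      (contDiff_const.mul (ccoord j)).mul (ccoord k)) contDiff_const, pderiv_fun_const,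
      pderiv_fun_sum fun j => ContDiff.sum fun k _ => (contDiff_const.mul (ccoord j)).mul (ccoord k)]
    simp only [pderiv_fun_sum fun k => (contDiff_const.mul (ccoord _)).mul (ccoord k), e, mul_add,
      Finset.sum_add_distrib, mul_ite, mul_zero]
    rw [Finset.sum_comm]
    simp only [Finset.sum_ite_eq, Finset.mem_univ, if_true]
    rw [sub_zero, two_mul]
    congr 1
    exact Finset.sum_congr rfl fun j _ => by rw [hsymm j l]
  have dr : ∀ l (η : 𝔼), pderiv l (q₂ z) η = 2 * gradField a φ l z := by
    intro l η
    rw [hq₂]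
    simp only
    rw [pderiv_fun_const_mul _ (ContDiff.sum fun k _ => contDiff_const.mul (ccoord k)),
      pderiv_fun_sum fun k => contDiff_const.mul (ccoord k)]
    simp [pderiv_fun_const_mul _ (ccoord _), hcoord]
  have dq' : ∀ l (η : 𝔼), pderiv l (fun y => q₁ y η) z
      = ∑ j, ∑ k, pderiv l (a j k) z * η j * η k := by
    intro l η
    have e : ∀ j k, pderiv l (fun y => a j k y * η j * η k) z = pderiv l (a j k) z * η j * η k := by
      intro j k
      rw [pderiv_fun_mul ((ha j k).mul contDiff_const) contDiff_const,
        pderiv_fun_mul (ha j k) contDiff_const, pderiv_fun_const, pderiv_fun_const]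
      ring
    rw [hq₁]
    simp only
    rw [pderiv_fun_sub (ContDiff.sum fun j _ => ContDiff.sum fun k _ =>
      ((ha j k).mul contDiff_const).mul contDiff_const) contDiff_const, pderiv_fun_const,
      pderiv_fun_sum fun j => ContDiff.sum fun k _ => ((ha j k).mul contDiff_const).mul
        contDiff_const]
    simp only [pderiv_fun_sum fun k => ((ha _ k).mul contDiff_const).mul contDiff_const, e,
      sub_zero]
  have dr' : ∀ l (η : 𝔼), pderiv l (fun y => q₂ y η) z
      = 2 * ∑ k, pderiv l (gradField a φ k) z * η k := by
    intro l η
    have e : ∀ k, pderiv l (fun y => gradField a φ k y * η k) z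
        = pderiv l (gradField a φ k) z * η k := by
      intro k
      rw [pderiv_fun_mul (hX k) contDiff_const, pderiv_fun_const]
      ring
    rw [hq₂]
    simp only
    rw [pderiv_fun_const_mul _ (ContDiff.sum fun k _ => (hX k).mul contDiff_const),
      pderiv_fun_sum fun k => (hX k).mul contDiff_const]
    simp only [e]
  -- the bracket is four times the Hessian, up to the square of the conformal factor
  have hchar : ∀ η : 𝔼, q₁ z η = 0 → q₂ z η = 0 → lieForm a (gradField a φ) z η = 0 := by
    intro η h1 h2
    have hp0 : p z η = 0 := Complex.ext (by rw [hre z hz, h1]; simp) (by rw [him z hz, h2]; simp)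
    have hB := hbr z hz η hp0
    unfold poissonBracket at hB
    have e1 : ∀ l, pderiv l (fun η => (p z η).re) η = N z * pderiv l (q₁ z) η := fun l => by
      rw [← pderiv_fun_const_mul _ (cq z)]
      exact pderiv_congr (Eventually.of_forall fun η => hre z hz η) l
    have e2 : ∀ l, pderiv l (fun η => (p z η).im) η = N z * pderiv l (q₂ z) η := fun l => by
      rw [← pderiv_fun_const_mul _ (cr z)]
      exact pderiv_congr (Eventually.of_forall fun η => him z hz η) l
    have e3 : ∀ l, pderiv l (fun y => (p y η).re) z = N z * pderiv l (fun y => q₁ y η) z := by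
      intro l
      have : (fun y => (p y η).re) =ᶠ[𝓝 z] fun y => N y * q₁ y η := hOz.mono fun y hy => hre y hy η
      rw [pderiv_congr this, pderiv_fun_mul_of_differentiableAt (hN z hz)
        ((cq' η).differentiable (by simp) z), h1, mul_zero, zero_add]
    have e4 : ∀ l, pderiv l (fun y => (p y η).im) z = N z * pderiv l (fun y => q₂ y η) z := by
      intro l
      have : (fun y => (p y η).im) =ᶠ[𝓝 z] fun y => N y * q₂ y η := hOz.mono fun y hy => him y hy η
      rw [pderiv_congr this, pderiv_fun_mul_of_differentiableAt (hN z hz)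
        ((cr' η).differentiable (by simp) z), h2, mul_zero, zero_add]
    simp only [e1, e2, e3, e4, dq, dr, dq', dr'] at hB
    have key : ∑ l, (N z * (2 * ∑ j, a l j z * η j) * (N z * (2 * ∑ k, pderiv l (gradField a φ k) z
        * η k)) - N z * (∑ j, ∑ k, pderiv l (a j k) z * η j * η k)
          * (N z * (2 * gradField a φ l z)))
        = N z ^ 2 * (4 * lieForm a (gradField a φ) z η) := by
      unfold lieForm
      rw [Finset.sum_congr rfl fun j _ => Finset.sum_comm, Finset.sum_comm, Finset.mul_sum,
        Finset.mul_sum]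
      refine Finset.sum_congr rfl fun l _ => ?_
      have h3 : ∑ j, ∑ k, (a j l z * pderiv l (gradField a φ k) z
          - gradField a φ l z * pderiv l (a j k) z / 2) * η j * η k
          = (∑ j, a l j z * η j) * (∑ k, pderiv l (gradField a φ k) z * η k)
            - gradField a φ l z * (∑ j, ∑ k, pderiv l (a j k) z * η j * η k) / 2 := by
        rw [Finset.sum_mul_sum, Finset.mul_sum, Finset.sum_div, ← Finset.sum_sub_distrib]
        refine Finset.sum_congr rfl fun j _ => ?_
        rw [Finset.mul_sum, Finset.sum_div, ← Finset.sum_sub_distrib]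
        exact Finset.sum_congr rfl fun k _ => by rw [hsymm j l]; ring
      rw [h3]
      ring
    rw [key] at hB
    have := hN0 z hz
    have h4 : N z ^ 2 * 4 ≠ 0 := by positivity
    rw [← mul_assoc] at hB
    exact (mul_eq_zero.1 hB).resolve_left h4
  -- polarization: split off the component along `dφ`
  set P : Fin n → ℝ := fun j => pderiv j φ z with hP
  set m : Fin n → Fin n → ℝ := fun j k => ∑ l, (a j l z * pderiv l (gradField a φ k) z
    - gradField a φ l z * pderiv l (a j k) z / 2) with hm
  have hlie : ∀ ζ : Fin n → ℝ, lieForm a (gradField a φ) z ζ = ∑ j, ∑ k, m j k * ζ j * ζ k := by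
    intro ζ
    unfold lieForm
    simp only [hm, Finset.sum_mul]
  have hcross : ∀ ζ : Fin n → ℝ, ∑ j, ∑ k, m j k * (P j * ζ k + ζ j * P k) = 0 := by
    refine hessian_apply_grad (A := fun j k => a j k z) (dA := fun l j k => pderiv l (a j k) z)
      (D := fun j k => pderiv j (pderiv k φ) z) (dX := fun l k => pderiv l (gradField a φ k) z)
      (fun j k => by simp only [hsymm j k]) (fun l j k => by simp only [hsymm j k])
      (fun j k => pderiv_comm hφ j k z) (fun k => rfl) (fun l k => ?_) (fun l => ?_)
    · have : gradField a φ k = fun y => ∑ j, a k j y * pderiv j φ y := rfl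
      simp only [this]
      rw [pderiv_fun_sum fun j => (ha k j).mul (contDiff_pderiv hφ j)]
      exact Finset.sum_congr rfl fun j _ => pderiv_fun_mul (ha k j) (contDiff_pderiv hφ j) l z
    · have h1 : pderiv l (fun y => ∑ k, gradField a φ k y * pderiv k φ y) z = 0 := by
        rw [pderiv_congr (g := fun _ => (1 : ℝ)) (hOz.mono fun y hy => hb y hy), pderiv_fun_const]
      rw [pderiv_fun_sum fun k => (hX k).mul (contDiff_pderiv hφ k)] at h1
      simp only [pderiv_fun_mul (hX _) (contDiff_pderiv hφ _), Finset.sum_add_distrib] at h1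
      linarith
  -- covectors orthogonal to `dφ` are characteristic after normalization
  have hperp : ∀ ζ : Fin n → ℝ, ∑ k, gradField a φ k z * ζ k = 0 →
      lieForm a (gradField a φ) z ζ = 0 := by
    intro ζ hζ
    by_cases h0 : ζ = 0
    · simp [h0, lieForm]
    have ht := hpos z hz ζ h0
    set t := ∑ j, ∑ k, a j k z * ζ j * ζ k with htdef
    have hs : √t * √t = t := Real.mul_self_sqrt ht.le
    have hs0 : √t ≠ 0 := (Real.sqrt_pos.2 ht).ne'
    have h1 := hchar (WithLp.toLp 2 fun j => ζ j / √t) ?_ ?_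
    · rw [hlie] at h1 ⊢
      have h2 : ∑ j, ∑ k, m j k * ζ j * ζ k
          = t * ∑ j, ∑ k, m j k * (ζ j / √t) * (ζ k / √t) := by
        simp only [Finset.mul_sum]
        refine Finset.sum_congr rfl fun j _ => Finset.sum_congr rfl fun k _ => ?_
        nth_rw 1 [← hs]
        field_simp
      rw [h2]
      exact mul_eq_zero_of_right _ h1
    · have h2 : ∑ j, ∑ k, a j k z * (ζ j / √t) * (ζ k / √t) = t / (√t * √t) := by
        rw [htdef, Finset.sum_div]
        refine Finset.sum_congr rfl fun j _ => ?_
        rw [Finset.sum_div]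
        refine Finset.sum_congr rfl fun k _ => ?_
        field_simp
      rw [hs, div_self ht.ne'] at h2
      simp only [hq₁]
      rw [h2, sub_self]
    · have h2 : ∑ k, gradField a φ k z * (ζ k / √t) = (∑ k, gradField a φ k z * ζ k) / √t := by
        rw [Finset.sum_div]
        exact Finset.sum_congr rfl fun k _ => by ring
      simp only [hq₂]
      rw [h2, hζ]
      simp
  set s := ∑ k, gradField a φ k z * ξ k with hs
  have h1 := hperp (fun j => ξ j - s * P j) (by
    simp only [mul_sub, Finset.sum_sub_distrib]
    rw [← hs]
    have : ∑ k, gradField a φ k z * (s * P k) = s * ∑ k, gradField a φ k z * P k := by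
      rw [Finset.mul_sum]
      exact Finset.sum_congr rfl fun k _ => by ring
    rw [this, hb z hz]
    ring)
  have h2 := hcross ξ
  have h3 := hcross P
  rw [hlie] at h1 ⊢
  have h4 : ∑ j, ∑ k, m j k * ξ j * ξ k
      = ∑ j, ∑ k, m j k * (ξ j - s * P j) * (ξ k - s * P k)
        + s * ∑ j, ∑ k, m j k * (P j * ξ k + ξ j * P k)
        - s ^ 2 / 2 * ∑ j, ∑ k, m j k * (P j * P k + P j * P k) := by
    simp only [Finset.mul_sum, ← Finset.sum_add_distrib, ← Finset.sum_sub_distrib]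
    exact Finset.sum_congr rfl fun j _ => Finset.sum_congr rfl fun k _ => by ring
  rw [h4, h1, h2, h3]
  ring

end Bracket

/-! ### Positive definite matrices and vector-valued covectors -/

section PosDef
variable {ι W : Type*} [Fintype ι] [DecidableEq ι] [NormedAddCommGroup W] [InnerProductSpace ℝ W]

open scoped MatrixOrder Matrix.Norms.L2Operator in
theorem posSemidef_sum_inner_nonneg {P : Matrix ι ι ℝ} (hP : P.PosSemidef) (α : ι → W) :
    0 ≤ ∑ j, ∑ k, P j k * inner ℝ (α j) (α k) := by
  obtain ⟨B, hB⟩ := CStarAlgebra.nonneg_iff_eq_star_mul_self.1 hP.nonneg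
  have h : ∑ j, ∑ k, P j k * inner ℝ (α j) (α k) = ∑ i, ‖∑ j, B i j • α j‖ ^ 2 := by
    have h1 : ∀ i, ‖∑ j, B i j • α j‖ ^ 2 = ∑ j, ∑ k, B i j * B i k * inner ℝ (α j) (α k) := by
      intro i
      rw [← real_inner_self_eq_norm_sq, sum_inner]
      refine Finset.sum_congr rfl fun j _ => ?_
      rw [inner_sum]
      refine Finset.sum_congr rfl fun k _ => ?_
      rw [real_inner_smul_left, real_inner_smul_right]
      ring
    simp only [h1]
    symm
    rw [Finset.sum_comm]
    refine Finset.sum_congr rfl fun j _ => ?_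
    rw [Finset.sum_comm]
    refine Finset.sum_congr rfl fun k _ => ?_
    rw [← Finset.sum_mul, hB, Matrix.mul_apply]
    simp [Matrix.star_apply]
  rw [h]
  exact Finset.sum_nonneg fun i _ => sq_nonneg _

/-- The Cauchy–Schwarz inequality `|α(X)|² ≤ g(X,X) |α|²` for a vector valued covector `α`. -/
theorem norm_sum_smul_sq_le {G : Matrix ι ι ℝ} (hG : G.PosDef) (α : ι → W) (X : ι → ℝ) :
    ‖∑ j, X j • α j‖ ^ 2 ≤ (∑ j, ∑ k, G j k * X j * X k)
      * ∑ j, ∑ k, G⁻¹ j k * inner ℝ (α j) (α k) := by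
  set q := ∑ j, ∑ k, G j k * X j * X k with hq
  set w := ∑ j, X j • α j with hw
  have hP := hG.inv.posSemidef
  have hq' : q = X ⬝ᵥ G.mulVec X := by
    simp only [hq, dotProduct, Matrix.mulVec, Finset.mul_sum]
    exact Finset.sum_congr rfl fun j _ => Finset.sum_congr rfl fun k _ => by ring
  by_cases hX : X = 0
  · simp [hq, hw, hX]
  have hq0 : 0 < q := by
    rw [hq']
    simpa using hG.dotProduct_mulVec_pos hX
  -- test positivity on `α - q⁻¹ β` with `β = G X ⊗ w`
  have h0 := posSemidef_sum_inner_nonneg hP fun j => α j - (q⁻¹ * G.mulVec X j) • w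
  have hGG : ∀ j, ∑ k, G⁻¹ j k * G.mulVec X k = X j := by
    intro j
    have : (G⁻¹).mulVec (G.mulVec X) = X := by
      rw [Matrix.mulVec_mulVec, Matrix.nonsing_inv_mul _ ((Matrix.isUnit_iff_isUnit_det _).1
        hG.isUnit), Matrix.one_mulVec]
    exact congrFun this j
  have hsym : ∀ j k, G⁻¹ j k = G⁻¹ k j := fun j k => by
    simpa using (hG.inv.isHermitian.apply j k).symm
  have e1 : ∑ j, ∑ k, G⁻¹ j k * (G.mulVec X k * inner ℝ (α j) w) = ‖w‖ ^ 2 := by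
    rw [← real_inner_self_eq_norm_sq]
    nth_rw 2 [hw]
    rw [sum_inner]
    refine Finset.sum_congr rfl fun j _ => ?_
    rw [real_inner_smul_left, ← hGG j, Finset.sum_mul]
    exact Finset.sum_congr rfl fun k _ => by ring
  have e2 : ∑ j, ∑ k, G⁻¹ j k * (G.mulVec X j * inner ℝ w (α k)) = ‖w‖ ^ 2 := by
    rw [← e1, Finset.sum_comm]
    refine Finset.sum_congr rfl fun j _ => Finset.sum_congr rfl fun k _ => ?_
    rw [hsym, real_inner_comm]
  have e3 : ∑ j, ∑ k, G⁻¹ j k * (G.mulVec X j * G.mulVec X k) = q := by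
    rw [hq', dotProduct, Finset.sum_comm]
    refine Finset.sum_congr rfl fun k _ => ?_
    rw [← hGG k, Finset.sum_mul]
    exact Finset.sum_congr rfl fun j _ => by rw [hsym]; ring
  have h1 : ∑ j, ∑ k, G⁻¹ j k * inner ℝ (α j - (q⁻¹ * G.mulVec X j) • w)
        (α k - (q⁻¹ * G.mulVec X k) • w)
      = (∑ j, ∑ k, G⁻¹ j k * inner ℝ (α j) (α k))
        - q⁻¹ * (∑ j, ∑ k, G⁻¹ j k * (G.mulVec X k * inner ℝ (α j) w))
        - q⁻¹ * (∑ j, ∑ k, G⁻¹ j k * (G.mulVec X j * inner ℝ w (α k)))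
        + q⁻¹ ^ 2 * ‖w‖ ^ 2 * ∑ j, ∑ k, G⁻¹ j k * (G.mulVec X j * G.mulVec X k) := by
    simp only [Finset.mul_sum, ← Finset.sum_add_distrib, ← Finset.sum_sub_distrib]
    refine Finset.sum_congr rfl fun j _ => Finset.sum_congr rfl fun k _ => ?_
    rw [inner_sub_left, inner_sub_right, inner_sub_right, real_inner_smul_left,
      real_inner_smul_left, real_inner_smul_right, real_inner_smul_right,
      real_inner_self_eq_norm_sq]
    ring
  rw [h1, e1, e2, e3] at h0
  have h2 : q⁻¹ ^ 2 * ‖w‖ ^ 2 * q = q⁻¹ * ‖w‖ ^ 2 := by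
    field_simp
  rw [h2] at h0
  have h3 : q⁻¹ * ‖w‖ ^ 2 ≤ ∑ j, ∑ k, G⁻¹ j k * inner ℝ (α j) (α k) := by linarith
  rwa [inv_mul_le_iff₀ hq0] at h3

end PosDef

/-! ### Smoothness of matrix functions -/

section MatrixFunctions
variable {n : ℕ} {U : Type*} [TopologicalSpace U] [ChartedSpace (EuclideanSpace ℝ (Fin n)) U]

theorem contMDiffOn_det {ι : Type*} [Fintype ι] [DecidableEq ι] {s : Set U}
    {f : U → Matrix ι ι ℝ} (hf : ∀ i j, ContMDiffOn (𝓡 n) 𝓘(ℝ, ℝ) ∞ (fun y => f y i j) s) :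
    ContMDiffOn (𝓡 n) 𝓘(ℝ, ℝ) ∞ (fun y => (f y).det) s := by
  simp only [Matrix.det_apply']
  exact contMDiffOn_finsetSum fun σ _ => contMDiffOn_const.mul
    (contMDiffOn_finsetProd fun i _ => hf (σ i) i)

theorem contMDiffOn_inv {s : Set U} {f : U → ℝ} (hf : ContMDiffOn (𝓡 n) 𝓘(ℝ, ℝ) ∞ f s)
    (h0 : ∀ y ∈ s, f y ≠ 0) : ContMDiffOn (𝓡 n) 𝓘(ℝ, ℝ) ∞ (fun y => (f y)⁻¹) s := by
  intro y hy
  exact ((contDiffAt_inv ℝ (h0 y hy)).contMDiffAt).comp_contMDiffWithinAt y (hf y hy)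

theorem contMDiffOn_matrixInv {ι : Type*} [Fintype ι] [DecidableEq ι] {s : Set U}
    {f : U → Matrix ι ι ℝ} (hf : ∀ i j, ContMDiffOn (𝓡 n) 𝓘(ℝ, ℝ) ∞ (fun y => f y i j) s)
    (h0 : ∀ y ∈ s, (f y).det ≠ 0) (i j : ι) :
    ContMDiffOn (𝓡 n) 𝓘(ℝ, ℝ) ∞ (fun y => (f y)⁻¹ i j) s := by
  simp only [Matrix.inv_def, Ring.inverse_eq_inv', Matrix.smul_apply, smul_eq_mul,
    Matrix.adjugate_apply]
  refine (contMDiffOn_inv (contMDiffOn_det hf) h0).mul (contMDiffOn_det fun k l => ?_)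
  by_cases h : k = j
  · subst h
    simp only [Matrix.updateRow_self]
    exact contMDiffOn_const
  · simp only [Matrix.updateRow_ne h]
    exact hf k l

end MatrixFunctions

/-! ### Coordinate vectors and the metric in charts -/

section Charts
variable {n : ℕ} {U : Type*} [TopologicalSpace U] [ChartedSpace (EuclideanSpace ℝ (Fin n)) U]
  [IsManifold (𝓡 n) ∞ U]
local notation "𝔼" => EuclideanSpace ℝ (Fin n)

/-- The coordinate vectors act on functions as the partial derivatives in the chart. -/
theorem mvfderiv_coordVec {W : Type*} [NormedAddCommGroup W] [NormedSpace ℝ W] {f : U → W}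
    {p y : U} (hy : y ∈ (chartAt 𝔼 p).source) (hf : MDifferentiableAt (𝓡 n) 𝓘(ℝ, W) f y)
    (j : Fin n) : mvfderiv (𝓡 n) f y (coordVec p y j)
      = pderiv j (f ∘ (chartAt 𝔼 p).symm) (chartAt 𝔼 p y) := by
  have hz : extChartAt (𝓡 n) p y ∈ (extChartAt (𝓡 n) p).target :=
    (extChartAt (𝓡 n) p).map_source (by simpa using hy)
  have hinv : (extChartAt (𝓡 n) p).symm (extChartAt (𝓡 n) p y) = y :=
    (extChartAt (𝓡 n) p).left_inv (by simpa using hy)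
  have h1 : MDifferentiableAt 𝓘(ℝ, 𝔼) (𝓡 n) (extChartAt (𝓡 n) p).symm (extChartAt (𝓡 n) p y) := by
    have := mdifferentiableWithinAt_extChartAt_symm (I := 𝓡 n) hz
    rwa [modelWithCornersSelf_coe, range_id, mdifferentiableWithinAt_univ] at this
  have h2 : MDifferentiableAt (𝓡 n) 𝓘(ℝ, W) f
      ((extChartAt (𝓡 n) p).symm (extChartAt (𝓡 n) p y)) := by rwa [hinv]
  have h3 := (h2.hasMFDerivAt.comp _ h1.hasMFDerivAt).hasFDerivAt
  have h5 : ∀ y', y' = y → ∀ v : 𝔼, (mfderiv (𝓡 n) 𝓘(ℝ, W) f y' : 𝔼 →L[ℝ] W) v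
      = (mfderiv (𝓡 n) 𝓘(ℝ, W) f y : 𝔼 →L[ℝ] W) v := by
    rintro _ rfl _
    rfl
  have h4 : fderiv ℝ (f ∘ (chartAt 𝔼 p).symm) (chartAt 𝔼 p y) (stdVec j)
      = (mfderiv (𝓡 n) 𝓘(ℝ, W) f y : 𝔼 →L[ℝ] W)
        ((mfderiv 𝓘(ℝ, 𝔼) (𝓡 n) (extChartAt (𝓡 n) p).symm (extChartAt (𝓡 n) p y) : 𝔼 →L[ℝ] 𝔼)
          (stdVec j)) := by
    refine Eq.trans ?_ (h5 _ hinv _)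
    exact DFunLike.congr_fun (F := 𝔼 →L[ℝ] W) (HasFDerivAt.fderiv (𝕜 := ℝ) (E := 𝔼) (F := W) h3) (stdVec j)
  unfold pderiv
  rw [h4]
  have h6 : coordVec p y j = (mfderiv 𝓘(ℝ, 𝔼) (𝓡 n) (extChartAt (𝓡 n) p).symm
      (extChartAt (𝓡 n) p y) : 𝔼 →L[ℝ] 𝔼) (stdVec j) := by
    have := congrArg (fun L : 𝔼 →L[ℝ] 𝔼 => L (stdVec j)) (TangentBundle.symmL_trivializationAt
      (𝕜 := ℝ) (I := 𝓡 n) hy)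
    rw [modelWithCornersSelf_coe, range_id, mfderivWithin_univ] at this
    exact this
  rw [h6]
  rfl

theorem contMDiffOn_coordVec (p : U) (i : Fin n) :
    ContMDiffOn (𝓡 n) (𝓡 n).tangent ∞ (fun y => (⟨y, coordVec p y i⟩ : TangentBundle (𝓡 n) U))
      (chartAt 𝔼 p).source := by
  have h := (trivializationAt 𝔼 (TangentSpace (𝓡 n) : U → Type _) p).contMDiffOn_section_baseSet_iff
    (IB := 𝓡 n) (n := ∞) (s := fun y => coordVec p y i)
  rw [TangentBundle.trivializationAt_baseSet] at h
  refine h.2 ((contMDiffOn_const (c := stdVec i)).congr fun y hy => ?_)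
  have hy' : y ∈ (trivializationAt 𝔼 (TangentSpace (𝓡 n) : U → Type _) p).baseSet := by
    rwa [TangentBundle.trivializationAt_baseSet]
  unfold coordVec
  rw [Trivialization.symmL_apply _ hy']
  exact congrArg Prod.snd (Trivialization.apply_mk_symm
    (trivializationAt 𝔼 (TangentSpace (𝓡 n) : U → Type _) p) hy' (stdVec i))

theorem linearIndependent_coordVec {p y : U} (hy : y ∈ (chartAt 𝔼 p).source) :
    LinearIndependent ℝ (coordVec (n := n) p y) := by
  have hy' : y ∈ (trivializationAt 𝔼 (TangentSpace (𝓡 n) : U → Type _) p).baseSet := by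
    rwa [TangentBundle.trivializationAt_baseSet]
  refine LinearIndependent.of_comp ((trivializationAt 𝔼 (TangentSpace (𝓡 n) : U → Type _)
    p).continuousLinearMapAt ℝ y).toLinearMap ?_
  have : (((trivializationAt 𝔼 (TangentSpace (𝓡 n) : U → Type _)
      p).continuousLinearMapAt ℝ y).toLinearMap ∘ coordVec p y)
      = (EuclideanSpace.basisFun (Fin n) ℝ).toBasis := by
    ext1 i
    simp only [Function.comp, coordVec]
    refine (Trivialization.continuousLinearMapAt_symmL _ hy' _).trans ?_
    simp [stdVec]
  rw [this]
  exact Module.Basis.linearIndependent _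

/-- The matrix of the change of coordinate vectors from the chart at `q` to the chart at `p`. -/
def transitionMatrix (q p y : U) : Matrix (Fin n) (Fin n) ℝ :=
  Matrix.of fun k i => pderiv i (chartAt 𝔼 q ∘ (chartAt 𝔼 p).symm) (chartAt 𝔼 p y) k

theorem coordVec_eq_sum {p q y : U} (hp : y ∈ (chartAt 𝔼 p).source)
    (hq : y ∈ (chartAt 𝔼 q).source) (i : Fin n) :
    coordVec p y i = ∑ k, transitionMatrix q p y k i • coordVec q y k := by
  have hy' : y ∈ (trivializationAt 𝔼 (TangentSpace (𝓡 n) : U → Type _) q).baseSet := by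
    rwa [TangentBundle.trivializationAt_baseSet]
  have h1 : MDifferentiableAt (𝓡 n) 𝓘(ℝ, 𝔼) (chartAt 𝔼 q) y := by
    have := mdifferentiableAt_extChartAt (I := 𝓡 n) hq
    simpa using this
  have h2 := mvfderiv_coordVec hp h1 i
  have h3 : (trivializationAt 𝔼 (TangentSpace (𝓡 n) : U → Type _) q).continuousLinearMapAt ℝ y
      (coordVec p y i) = pderiv i (chartAt 𝔼 q ∘ (chartAt 𝔼 p).symm) (chartAt 𝔼 p y) := by
    rw [← h2, TangentBundle.continuousLinearMapAt_trivializationAt hq]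
    have : (extChartAt (𝓡 n) q : U → 𝔼) = chartAt 𝔼 q := by ext1 x; simp
    rw [this]
    rfl
  have h4 := Trivialization.symmL_continuousLinearMapAt (R := ℝ)
    (trivializationAt 𝔼 (TangentSpace (𝓡 n) : U → Type _) q) hy' (coordVec p y i)
  rw [← h4, h3]
  have h5 : pderiv i (chartAt 𝔼 q ∘ (chartAt 𝔼 p).symm) (chartAt 𝔼 p y)
      = ∑ k, transitionMatrix q p y k i • stdVec k := by
    ext k
    simp [transitionMatrix, stdVec, Pi.single_apply]
  rw [h5, map_sum]
  simp only [map_smul]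
  rfl

section Metric
variable [RiemannianBundle (fun x : U => TangentSpace (𝓡 n) x)]

theorem posDef_gram {p y : U} (hy : y ∈ (chartAt 𝔼 p).source) : (gram n p y).PosDef :=
  Matrix.posDef_gram_of_linearIndependent (𝕜 := ℝ) (linearIndependent_coordVec hy)

theorem gram_change {p q y : U} (hp : y ∈ (chartAt 𝔼 p).source)
    (hq : y ∈ (chartAt 𝔼 q).source) :
    gram n p y = (transitionMatrix q p y).transpose * gram n q y * transitionMatrix q p y := by
  ext i j
  simp only [gram, Matrix.of_apply, Matrix.mul_apply, Matrix.transpose_apply]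
  rw [coordVec_eq_sum hp hq i, coordVec_eq_sum hp hq j, sum_inner]
  simp only [inner_sum, real_inner_smul_left, real_inner_smul_right, Finset.sum_mul]
  rw [Finset.sum_comm]
  exact Finset.sum_congr rfl fun k _ => Finset.sum_congr rfl fun l _ => by ring

theorem isUnit_det_transitionMatrix {p q y : U} (hp : y ∈ (chartAt 𝔼 p).source)
    (hq : y ∈ (chartAt 𝔼 q).source) : IsUnit (transitionMatrix (n := n) q p y).det := by
  have h := congrArg Matrix.det (gram_change (n := n) hp hq)
  rw [Matrix.det_mul, Matrix.det_mul, Matrix.det_transpose] at h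
  have h0 : (gram n p y).det ≠ 0 := (posDef_gram hp).det_pos.ne'
  refine isUnit_iff_ne_zero.2 fun h1 => h0 ?_
  rw [h, h1]
  ring

theorem sqrt_det_gram_change {p q y : U} (hp : y ∈ (chartAt 𝔼 p).source)
    (hq : y ∈ (chartAt 𝔼 q).source) :
    √(gram n p y).det = |(transitionMatrix (n := n) q p y).det| * √(gram n q y).det := by
  rw [gram_change hp hq, Matrix.det_mul, Matrix.det_mul, Matrix.det_transpose,
    show (transitionMatrix (n := n) q p y).det * (gram n q y).det * (transitionMatrix q p y).det
      = (transitionMatrix (n := n) q p y).det ^ 2 * (gram n q y).det by ring,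
    Real.sqrt_mul (sq_nonneg _), Real.sqrt_sq_eq_abs]

theorem inv_gram_change {p q y : U} (hp : y ∈ (chartAt 𝔼 p).source)
    (hq : y ∈ (chartAt 𝔼 q).source) :
    (gram n q y)⁻¹ = transitionMatrix q p y * (gram n p y)⁻¹ * (transitionMatrix q p y).transpose := by
  set T := transitionMatrix (n := n) q p y with hT
  have hTu : IsUnit T.det := isUnit_det_transitionMatrix hp hq
  have hGu : IsUnit (gram n q y).det := isUnit_iff_ne_zero.2 (posDef_gram hq).det_pos.ne'
  rw [gram_change hp hq, ← hT, Matrix.mul_inv_rev, Matrix.mul_inv_rev, ← Matrix.mul_assoc,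
    ← Matrix.mul_assoc, Matrix.mul_nonsing_inv _ hTu, Matrix.one_mul, Matrix.mul_assoc,
    Matrix.nonsing_inv_mul _ (by rwa [Matrix.det_transpose]), Matrix.mul_one]

/-- The inner product of covectors with values in a real inner product space, computed in the
coordinates of the chart at `p`. -/
def covInner {W : Type*} [NormedAddCommGroup W] [InnerProductSpace ℝ W] (p x : U)
    (α β : TangentSpace (𝓡 n) x →L[ℝ] W) : ℝ :=
  ∑ i : Fin n, ∑ j : Fin n,
    (gram n p x)⁻¹ i j * inner ℝ (α (coordVec p x i)) (β (coordVec p x j))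

/-- The inner product of covectors does not depend on the chart. -/
theorem covInner_change {W : Type*} [NormedAddCommGroup W] [InnerProductSpace ℝ W] {p q x : U}
    (hp : x ∈ (chartAt 𝔼 p).source) (hq : x ∈ (chartAt 𝔼 q).source)
    (α β : TangentSpace (𝓡 n) x →L[ℝ] W) : covInner p x α β = covInner q x α β := by
  unfold covInner
  rw [inv_gram_change hp hq]
  have e1 : ∀ i j, (gram n p x)⁻¹ i j * inner ℝ (α (coordVec p x i)) (β (coordVec p x j))
      = ∑ k, ∑ l, transitionMatrix q p x k i * (gram n p x)⁻¹ i j * transitionMatrix q p x l j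
        * inner ℝ (α (coordVec q x k)) (β (coordVec q x l)) := by
    intro i j
    rw [coordVec_eq_sum hp hq i, coordVec_eq_sum hp hq j, map_sum, map_sum, sum_inner,
      Finset.mul_sum]
    refine Finset.sum_congr rfl fun k _ => ?_
    rw [inner_sum, Finset.mul_sum]
    refine Finset.sum_congr rfl fun l _ => ?_
    rw [map_smul, map_smul, real_inner_smul_left, real_inner_smul_right]
    ring
  have e2 : ∀ k l, (transitionMatrix q p x * (gram n p x)⁻¹ * (transitionMatrix q p x).transpose :
        Matrix (Fin n) (Fin n) ℝ) k l * inner ℝ (α (coordVec q x k)) (β (coordVec q x l))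
      = ∑ j, ∑ i, transitionMatrix q p x k i * (gram n p x)⁻¹ i j * transitionMatrix q p x l j
        * inner ℝ (α (coordVec q x k)) (β (coordVec q x l)) := by
    intro k l
    simp only [Matrix.mul_apply, Matrix.transpose_apply, Finset.sum_mul]
  simp only [e1, e2]
  rw [Finset.sum_congr rfl fun i _ => Finset.sum_comm, Finset.sum_comm]
  refine Finset.sum_congr rfl fun k _ => ?_
  rw [Finset.sum_congr rfl fun i _ => Finset.sum_comm, Finset.sum_comm]
  exact Finset.sum_congr rfl fun l _ => Finset.sum_comm

theorem covInner_self_nonneg {W : Type*} [NormedAddCommGroup W] [InnerProductSpace ℝ W] {p x : U}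
    (hp : x ∈ (chartAt 𝔼 p).source) (α : TangentSpace (𝓡 n) x →L[ℝ] W) : 0 ≤ covInner p x α α :=
  posSemidef_sum_inner_nonneg (posDef_gram hp).inv.posSemidef _

/-- The Cauchy–Schwarz inequality `|α(X)|² ≤ |X|² |α|²`. -/
theorem norm_apply_sq_le {W : Type*} [NormedAddCommGroup W] [InnerProductSpace ℝ W] {p x : U}
    (hp : x ∈ (chartAt 𝔼 p).source) (α : TangentSpace (𝓡 n) x →L[ℝ] W) (X : TangentSpace (𝓡 n) x) :
    ‖α X‖ ^ 2 ≤ inner ℝ X X * covInner p x α α := by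
  have hp' : x ∈ (trivializationAt 𝔼 (TangentSpace (𝓡 n) : U → Type _) p).baseSet := by
    rwa [TangentBundle.trivializationAt_baseSet]
  obtain ⟨c, hc⟩ : ∃ c : Fin n → ℝ, X = ∑ j, c j • coordVec p x j := by
    refine ⟨((trivializationAt 𝔼 (TangentSpace (𝓡 n) : U → Type _) p).continuousLinearMapAt ℝ x X
      : 𝔼), ?_⟩
    set v : 𝔼 := (trivializationAt 𝔼 (TangentSpace (𝓡 n) : U → Type _) p).continuousLinearMapAt ℝ x X
      with hv
    have h4 := Trivialization.symmL_continuousLinearMapAt (R := ℝ)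
      (trivializationAt 𝔼 (TangentSpace (𝓡 n) : U → Type _) p) hp' X
    have h5 : v = ∑ k, v k • stdVec k := by
      ext k
      simp [stdVec, Pi.single_apply]
    rw [← hv, h5, map_sum] at h4
    rw [← h4]
    simp only [map_smul]
    rfl
  have h := norm_sum_smul_sq_le (posDef_gram hp) (fun j => α (coordVec p x j)) c
  have e : inner ℝ X X = ∑ j, ∑ k, gram n p x j k * c j * c k := by
    rw [hc, sum_inner]
    refine Finset.sum_congr rfl fun j _ => ?_
    rw [inner_sum]
    refine Finset.sum_congr rfl fun k _ => ?_
    rw [real_inner_smul_left, real_inner_smul_right, gram, Matrix.of_apply]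
    ring
  rw [e]
  have e' : ‖α X‖ = ‖∑ j, c j • α (coordVec p x j)‖ := by
    rw [hc, map_sum]
    simp only [map_smul]
  rw [e']
  exact h

variable (n) in
/-- The density `|g|^{1/2}` of the Riemannian volume in the chart at `p`. -/
def volDensity (p y : U) : ℝ := √(gram n p y).det

theorem volDensity_pos {p y : U} (hy : y ∈ (chartAt 𝔼 p).source) :
    0 < volDensity n p y := Real.sqrt_pos.2 (posDef_gram hy).det_pos

end Metric

section SmoothMetric
variable [RiemannianBundle (fun x : U => TangentSpace (𝓡 n) x)]
  [IsContMDiffRiemannianBundle (𝓡 n) ∞ (EuclideanSpace ℝ (Fin n)) (fun x : U => TangentSpace (𝓡 n) x)]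

theorem contMDiffOn_gram (p : U) (i j : Fin n) :
    ContMDiffOn (𝓡 n) 𝓘(ℝ, ℝ) ∞ (fun y => gram n p y i j) (chartAt 𝔼 p).source :=
  (contMDiffOn_coordVec p i).inner_bundle (contMDiffOn_coordVec p j)

theorem contMDiffOn_volDensity (p : U) :
    ContMDiffOn (𝓡 n) 𝓘(ℝ, ℝ) ∞ (volDensity n p) (chartAt 𝔼 p).source := by
  intro y hy
  exact ((Real.contDiffAt_sqrt (posDef_gram hy).det_pos.ne').contMDiffAt).comp_contMDiffWithinAt y
    (contMDiffOn_det (fun i j => contMDiffOn_gram p i j) y hy)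

theorem contMDiffOn_inv_gram (p : U) (i j : Fin n) :
    ContMDiffOn (𝓡 n) 𝓘(ℝ, ℝ) ∞ (fun y => (gram n p y)⁻¹ i j) (chartAt 𝔼 p).source :=
  contMDiffOn_matrixInv (fun i j => contMDiffOn_gram p i j)
    (fun _ hy => (posDef_gram hy).det_pos.ne') i j

end SmoothMetric
end Charts

/-! ### Cutoff functions and functions read in a chart -/

section Cutoff
variable {n : ℕ} {U : Type*} [TopologicalSpace U] [ChartedSpace (EuclideanSpace ℝ (Fin n)) U]
  [IsManifold (𝓡 n) ∞ U]
local notation "𝔼" => EuclideanSpace ℝ (Fin n)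

variable (n) in
theorem exists_smooth_cutoff [T2Space U] [SigmaCompactSpace U] {K O : Set U} (hK : IsCompact K)
    (hO : IsOpen O) (hKO : K ⊆ O) :
    ∃ θ : U → ℝ, ContMDiff (𝓡 n) 𝓘(ℝ, ℝ) ∞ θ ∧ HasCompactSupport θ ∧ tsupport θ ⊆ O ∧
      (∀ᶠ x in 𝓝ˢ K, θ x = 1) ∧ ∀ x, 0 ≤ θ x ∧ θ x ≤ 1 := by
  have : LocallyCompactSpace U := ChartedSpace.locallyCompactSpace 𝔼 U
  obtain ⟨L, hL, hKL, hLO⟩ := exists_compact_between hK hO hKO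
  obtain ⟨f, h1, h0, h01⟩ := exists_contMDiffMap_one_nhds_of_subset_interior (𝓡 n) (n := ⊤)
    hK.isClosed hKL
  have hs : tsupport f ⊆ L := by
    refine closure_minimal (fun x hx => ?_) hL.isClosed
    by_contra h
    exact hx (h0 x h)
  exact ⟨f, f.contMDiff, hL.of_isClosed_subset (isClosed_tsupport _) hs, hs.trans hLO, h1,
    fun x => h01 x⟩

variable (n) in
/-- A function on the manifold read in the chart at `p`, extended by zero. -/
def pull {W : Type*} [Zero W] (p : U) (f : U → W) : 𝔼 → W :=
  (chartAt 𝔼 p).target.indicator (f ∘ (chartAt 𝔼 p).symm)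

theorem pull_apply {W : Type*} [Zero W] {p : U} (f : U → W) {z : 𝔼}
    (hz : z ∈ (chartAt 𝔼 p).target) : pull n p f z = f ((chartAt 𝔼 p).symm z) :=
  indicator_of_mem hz _

theorem pull_eventuallyEq {W : Type*} [Zero W] {p : U} (f : U → W) {z : 𝔼}
    (hz : z ∈ (chartAt 𝔼 p).target) : pull n p f =ᶠ[𝓝 z] f ∘ (chartAt 𝔼 p).symm :=
  eventually_of_mem ((chartAt 𝔼 p).open_target.mem_nhds hz) fun _ hy => pull_apply f hy

theorem tsupport_pull_subset [T2Space U] {W : Type*} [Zero W] {p : U} {f : U → W}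
    (hc : HasCompactSupport f) (hs : tsupport f ⊆ (chartAt 𝔼 p).source) :
    tsupport (pull n p f) ⊆ chartAt 𝔼 p '' tsupport f := by
  have hK : IsCompact (chartAt 𝔼 p '' tsupport f) :=
    IsCompact.image_of_continuousOn hc ((chartAt 𝔼 p).continuousOn.mono hs)
  refine closure_minimal (fun z hz => ?_) hK.isClosed
  have hz' : z ∈ (chartAt 𝔼 p).target := by
    by_contra h
    exact hz (indicator_of_notMem h _)
  refine ⟨(chartAt 𝔼 p).symm z, subset_tsupport _ ?_, (chartAt 𝔼 p).right_inv hz'⟩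
  rw [Function.mem_support, pull_apply f hz'] at hz
  exact hz

theorem hasCompactSupport_pull [T2Space U] {W : Type*} [Zero W] {p : U} {f : U → W}
    (hc : HasCompactSupport f) (hs : tsupport f ⊆ (chartAt 𝔼 p).source) :
    HasCompactSupport (pull n p f) :=
  (IsCompact.image_of_continuousOn hc ((chartAt 𝔼 p).continuousOn.mono hs)).of_isClosed_subset
    (isClosed_tsupport _) (tsupport_pull_subset (n := n) hc hs)

theorem contDiffOn_comp_chart_symm {W : Type*} [NormedAddCommGroup W] [NormedSpace ℝ W] {p : U}
    {f : U → W} (hf : ContMDiffOn (𝓡 n) 𝓘(ℝ, W) ∞ f (chartAt 𝔼 p).source) :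
    ContDiffOn ℝ ∞ (f ∘ (chartAt 𝔼 p).symm) (chartAt 𝔼 p).target := by
  rw [← contMDiffOn_iff_contDiffOn]
  refine hf.comp (contMDiffOn_chart_symm (I := 𝓡 n)) fun z hz => (chartAt 𝔼 p).map_target hz

theorem contDiff_pull [T2Space U] {W : Type*} [NormedAddCommGroup W] [NormedSpace ℝ W] {p : U}
    {f : U → W} (hf : ContMDiffOn (𝓡 n) 𝓘(ℝ, W) ∞ f (chartAt 𝔼 p).source)
    (hc : HasCompactSupport f) (hs : tsupport f ⊆ (chartAt 𝔼 p).source) :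
    ContDiff ℝ ∞ (pull n p f) := by
  rw [contDiff_iff_contDiffAt]
  intro z
  by_cases hz : z ∈ (chartAt 𝔼 p).target
  · exact ((contDiffOn_comp_chart_symm hf).contDiffAt
      ((chartAt 𝔼 p).open_target.mem_nhds hz)).congr_of_eventuallyEq (pull_eventuallyEq f hz)
  · have hz' : z ∉ tsupport (pull n p f) := fun h => by
      obtain ⟨y, hy, rfl⟩ := tsupport_pull_subset (n := n) hc hs h
      exact hz ((chartAt 𝔼 p).map_source (hs hy))
    exact contDiffAt_const.congr_of_eventuallyEq (notMem_tsupport_iff_eventuallyEq.1 hz')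

theorem pderiv_pull {W : Type*} [NormedAddCommGroup W] [NormedSpace ℝ W] {p : U} {f : U → W} {z : 𝔼}
    (hz : z ∈ (chartAt 𝔼 p).target)
    (hf : MDifferentiableAt (𝓡 n) 𝓘(ℝ, W) f ((chartAt 𝔼 p).symm z)) (j : Fin n) :
    pderiv j (pull n p f) z = mvfderiv (𝓡 n) f ((chartAt 𝔼 p).symm z)
      (coordVec p ((chartAt 𝔼 p).symm z) j) := by
  rw [mvfderiv_coordVec ((chartAt 𝔼 p).map_target hz) hf, (chartAt 𝔼 p).right_inv hz]
  unfold pderiv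
  rw [(pull_eventuallyEq f hz).fderiv_eq]

theorem contMDiffOn_mvfderiv_coordVec {W : Type*} [NormedAddCommGroup W] [NormedSpace ℝ W] {p : U}
    {N : Set U} (hN : IsOpen N) (hNp : N ⊆ (chartAt 𝔼 p).source)
    {f : U → W} (hf : ContMDiffOn (𝓡 n) 𝓘(ℝ, W) ∞ f N) (j : Fin n) :
    ContMDiffOn (𝓡 n) 𝓘(ℝ, W) ∞ (fun x => mvfderiv (𝓡 n) f x (coordVec p x j)) N := by
  have hO : IsOpen ((chartAt 𝔼 p).target ∩ (chartAt 𝔼 p).symm ⁻¹' N) :=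
    (chartAt 𝔼 p).isOpen_inter_preimage_symm hN
  have h0 : ContDiffOn ℝ ∞ (f ∘ (chartAt 𝔼 p).symm)
      ((chartAt 𝔼 p).target ∩ (chartAt 𝔼 p).symm ⁻¹' N) := by
    rw [← contMDiffOn_iff_contDiffOn]
    exact hf.comp ((contMDiffOn_chart_symm (I := 𝓡 n)).mono inter_subset_left) fun z hz => hz.2
  have h1 : ContDiffOn ℝ ∞ (pderiv j (f ∘ (chartAt 𝔼 p).symm))
      ((chartAt 𝔼 p).target ∩ (chartAt 𝔼 p).symm ⁻¹' N) := by
    have := h0.fderiv_of_isOpen (m := ∞) hO (by simp)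
    exact this.clm_apply contDiffOn_const
  have h2 : ContMDiffOn (𝓡 n) 𝓘(ℝ, W) ∞
      (pderiv j (f ∘ (chartAt 𝔼 p).symm) ∘ chartAt 𝔼 p) N :=
    h1.contMDiffOn.comp ((contMDiffOn_chart (I := 𝓡 n)).mono hNp) fun x hx =>
      ⟨(chartAt 𝔼 p).map_source (hNp hx), by simpa [(chartAt 𝔼 p).left_inv (hNp hx)] using hx⟩
  refine h2.congr fun x hx => ?_
  exact mvfderiv_coordVec (hNp hx)
    ((hf.contMDiffAt (hN.mem_nhds hx)).mdifferentiableAt (by simp)) j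

theorem mvfderiv_congr {W : Type*} [NormedAddCommGroup W] [NormedSpace ℝ W] {f g : U → W} {x : U}
    (h : f =ᶠ[𝓝 x] g) : mvfderiv (𝓡 n) f x = mvfderiv (𝓡 n) g x := by
  ext v
  have h1 : mfderiv (𝓡 n) 𝓘(ℝ, W) f x = (mfderiv (𝓡 n) 𝓘(ℝ, W) g x : 𝔼 →L[ℝ] W) := h.mfderiv_eq
  exact DFunLike.congr_fun (F := 𝔼 →L[ℝ] W) h1 v

theorem mvfderiv_eq_zero_of_notMem_tsupport {W : Type*} [NormedAddCommGroup W] [NormedSpace ℝ W]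
    {f : U → W} {x : U} (hx : x ∉ tsupport f) : mvfderiv (𝓡 n) f x = 0 := by
  rw [mvfderiv_congr (g := fun _ => 0) (notMem_tsupport_iff_eventuallyEq.1 hx)]
  ext v
  simp [mvfderiv]

/-- A function that is continuous on an open set and vanishes off a compact subset of it is
continuous. -/
theorem continuous_of_continuousOn_of_zero [T2Space U] {W : Type*} [TopologicalSpace W] [Zero W]
    {O K : Set U} (hO : IsOpen O) (hK : IsCompact K) (hKO : K ⊆ O) {f : U → W}
    (hf : ContinuousOn f O) (h0 : ∀ x ∉ K, f x = 0) : Continuous f := by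
  rw [continuous_iff_continuousAt]
  intro x
  by_cases hx : x ∈ K
  · exact hf.continuousAt (hO.mem_nhds (hKO hx))
  · have : f =ᶠ[𝓝 x] fun _ => 0 :=
      eventually_of_mem (hK.isClosed.isOpen_compl.mem_nhds hx) fun y hy => h0 y hy
    exact continuousAt_const.congr this.symm

theorem contMDiff_of_contMDiffOn_of_zero [T2Space U] {W : Type*} [NormedAddCommGroup W]
    [NormedSpace ℝ W]
    {O K : Set U} (hO : IsOpen O) (hK : IsCompact K) (hKO : K ⊆ O) {f : U → W}
    (hf : ContMDiffOn (𝓡 n) 𝓘(ℝ, W) ∞ f O) (h0 : ∀ x ∉ K, f x = 0) :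
    ContMDiff (𝓡 n) 𝓘(ℝ, W) ∞ f := by
  intro x
  by_cases hx : x ∈ K
  · exact hf.contMDiffAt (hO.mem_nhds (hKO hx))
  · have : f =ᶠ[𝓝 x] fun _ => 0 :=
      eventually_of_mem (hK.isClosed.isOpen_compl.mem_nhds hx) fun y hy => h0 y hy
    exact contMDiffAt_const.congr_of_eventuallyEq this

end Cutoff

/-! ### The Riemannian volume in charts -/

section Volume
variable {n : ℕ} {U : Type*} [TopologicalSpace U] [ChartedSpace (EuclideanSpace ℝ (Fin n)) U]
  [IsManifold (𝓡 n) ∞ U]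
  [RiemannianBundle (fun x : U => TangentSpace (𝓡 n) x)]
  [IsContMDiffRiemannianBundle (𝓡 n) ∞ (EuclideanSpace ℝ (Fin n))
    (fun x : U => TangentSpace (𝓡 n) x)] [MeasurableSpace U] [BorelSpace U]
local notation "𝔼" => EuclideanSpace ℝ (Fin n)

theorem continuousOn_volDensity_symm (p : U) :
    ContinuousOn (fun z => volDensity n p ((chartAt 𝔼 p).symm z)) (chartAt 𝔼 p).target :=
  (contMDiffOn_volDensity p).continuousOn.comp (chartAt 𝔼 p).continuousOn_symm
    fun _ hz => (chartAt 𝔼 p).map_target hz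

theorem aemeasurable_volDensity_symm (p : U) :
    AEMeasurable (fun z => ENNReal.ofReal (volDensity n p ((chartAt 𝔼 p).symm z)))
      (volume.restrict (chartAt 𝔼 p).target) :=
  ((continuousOn_volDensity_symm p).aemeasurable
    (chartAt 𝔼 p).open_target.measurableSet).ennreal_ofReal

theorem aemeasurable_chart_symm (p : U) : AEMeasurable (chartAt 𝔼 p).symm
    ((volume.restrict (chartAt 𝔼 p).target).withDensity
      (fun z => ENNReal.ofReal (volDensity n p ((chartAt 𝔼 p).symm z)))) :=
  ((chartAt 𝔼 p).continuousOn_symm.aemeasurable (chartAt 𝔼 p).open_target.measurableSet).mono_ac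
    (withDensity_absolutelyContinuous _ _)

theorem chartVolume_def (p : U) : chartVolume n p =
    ((volume.restrict (chartAt 𝔼 p).target).withDensity
      (fun z => ENNReal.ofReal (volDensity n p ((chartAt 𝔼 p).symm z)))).map (chartAt 𝔼 p).symm :=
  rfl

theorem measurableSet_chart_symm_preimage (p : U) {s : Set U} (hs : MeasurableSet s) :
    MeasurableSet ((chartAt 𝔼 p).target ∩ (chartAt 𝔼 p).symm ⁻¹' s) := by
  have h : MeasurableSet (((chartAt 𝔼 p).target.domRestrict (chartAt 𝔼 p).symm) ⁻¹' s) :=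
    ((chartAt 𝔼 p).continuousOn_symm.domRestrict.measurable) hs
  have h2 := (chartAt 𝔼 p).open_target.measurableSet.subtype_image h
  convert h2 using 1
  ext z
  simp [Set.domRestrict, and_comm]

/-- Change of variables for the chart volume. -/
theorem lintegral_chartVolume (p : U) {f : U → ENNReal} (hf : AEMeasurable f (chartVolume n p)) :
    ∫⁻ x, f x ∂(chartVolume n p) = ∫⁻ z in (chartAt 𝔼 p).target,
      ENNReal.ofReal (volDensity n p ((chartAt 𝔼 p).symm z)) * f ((chartAt 𝔼 p).symm z) := by
  rw [chartVolume_def] at hf ⊢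
  rw [lintegral_map' hf (aemeasurable_chart_symm p),
    lintegral_withDensity_eq_lintegral_mul_non_measurable₀ _ (aemeasurable_volDensity_symm p)
      (ae_of_all _ fun _ => ENNReal.ofReal_lt_top)]
  rfl

theorem chartVolume_apply (p : U) {s : Set U} (hs : MeasurableSet s) :
    chartVolume n p s = ∫⁻ z in (chartAt 𝔼 p).target ∩ (chartAt 𝔼 p).symm ⁻¹' s,
      ENNReal.ofReal (volDensity n p ((chartAt 𝔼 p).symm z)) := by
  have hA := measurableSet_chart_symm_preimage (n := n) p hs
  rw [← lintegral_indicator_one hs,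
    lintegral_chartVolume (n := n) p ((measurable_one.indicator hs).aemeasurable)]
  rw [setLIntegral_congr_fun (g := ((chartAt 𝔼 p).target ∩ (chartAt 𝔼 p).symm ⁻¹' s).indicator
    (fun z => ENNReal.ofReal (volDensity n p ((chartAt 𝔼 p).symm z))))
    (chartAt 𝔼 p).open_target.measurableSet]
  · rw [lintegral_indicator hA, Measure.restrict_restrict hA, inter_right_comm, inter_self]
  · intro z hz
    by_cases h : (chartAt 𝔼 p).symm z ∈ s
    · simp [h, hz]
    · simp [h]

theorem chartVolume_compl_source (p : U) : chartVolume n p (chartAt 𝔼 p).sourceᶜ = 0 := by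
  rw [chartVolume_apply p (chartAt 𝔼 p).open_source.measurableSet.compl]
  have : (chartAt 𝔼 p).target ∩ (chartAt 𝔼 p).symm ⁻¹' (chartAt 𝔼 p).sourceᶜ = ∅ := by
    ext z
    simp only [mem_inter_iff, mem_preimage, mem_compl_iff, mem_empty_iff_false, iff_false, not_and,
      not_not]
    exact fun hz => (chartAt 𝔼 p).map_target hz
  rw [this, Measure.restrict_empty, lintegral_zero_measure]

/-- The two chart volumes agree where both charts are defined. -/
theorem chartVolume_eq_of_subset {p q : U} {s : Set U} (hs : MeasurableSet s)
    (hp : s ⊆ (chartAt 𝔼 p).source) (hq : s ⊆ (chartAt 𝔼 q).source) :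
    chartVolume n p s = chartVolume n q s := by
  rw [chartVolume_apply p hs, chartVolume_apply q hs]
  set A := (chartAt 𝔼 p).target ∩ (chartAt 𝔼 p).symm ⁻¹' s with hA
  set T : 𝔼 → 𝔼 := chartAt 𝔼 q ∘ (chartAt 𝔼 p).symm with hT
  have himg : (chartAt 𝔼 q).target ∩ (chartAt 𝔼 q).symm ⁻¹' s = T '' A := by
    ext z
    constructor
    · rintro ⟨hz, hzs⟩
      refine ⟨chartAt 𝔼 p ((chartAt 𝔼 q).symm z), ⟨(chartAt 𝔼 p).map_source (hp hzs), ?_⟩, ?_⟩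
      · simpa [(chartAt 𝔼 p).left_inv (hp hzs)] using hzs
      · simp [hT, (chartAt 𝔼 p).left_inv (hp hzs), (chartAt 𝔼 q).right_inv hz]
    · rintro ⟨z, ⟨hz, hzs⟩, rfl⟩
      refine ⟨(chartAt 𝔼 q).map_source (hq hzs), ?_⟩
      simpa [hT, (chartAt 𝔼 q).left_inv (hq hzs)] using hzs
  have hinj : InjOn T A := by
    rintro z ⟨hz, hzs⟩ z' ⟨hz', hzs'⟩ h
    have h1 := (chartAt 𝔼 q).injOn (hq hzs) (hq hzs') h
    exact (chartAt 𝔼 p).symm.injOn hz hz' h1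
  have hd : ∀ z ∈ A, HasFDerivAt T (fderiv ℝ T z) z := by
    rintro z ⟨hz, hzs⟩
    have h1 : ContMDiffAt (𝓡 n) 𝓘(ℝ, 𝔼) ∞ (chartAt 𝔼 q) ((chartAt 𝔼 p).symm z) :=
      contMDiffAt_of_mem_maximalAtlas (IsManifold.chart_mem_maximalAtlas q) (hq hzs)
    have h2 : ContMDiffAt 𝓘(ℝ, 𝔼) (𝓡 n) ∞ (chartAt 𝔼 p).symm z :=
      contMDiffAt_symm_of_mem_maximalAtlas (IsManifold.chart_mem_maximalAtlas p) hz
    have h3 : ContDiffAt ℝ ∞ T z := (h1.comp z h2).contDiffAt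
    exact (h3.differentiableAt (by simp)).hasFDerivAt
  -- the Jacobian of the transition map is what changes the densities `|g|^{1/2}`
  rw [himg, lintegral_image_eq_lintegral_abs_det_fderiv_mul volume
    (measurableSet_chart_symm_preimage p hs) (fun z hz => (hd z hz).hasFDerivWithinAt) hinj]
  refine setLIntegral_congr_fun (measurableSet_chart_symm_preimage p hs) fun z hz => ?_
  obtain ⟨hz, hzs⟩ := hz
  have hd : (fderiv ℝ T z).det = (transitionMatrix (n := n) q p ((chartAt 𝔼 p).symm z)).det := by
    rw [ContinuousLinearMap.det, ← LinearMap.det_toMatrix (EuclideanSpace.basisFun (Fin n) ℝ).toBasis]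
    congr 1
    ext k i
    rw [LinearMap.toMatrix_apply]
    simp [transitionMatrix, (chartAt 𝔼 p).right_inv hz, pderiv, hT]
  simp only [hT, Function.comp, (chartAt 𝔼 q).left_inv (hq hzs)]
  rw [← ENNReal.ofReal_mul (abs_nonneg _)]
  congr 1
  unfold volDensity
  rw [sqrt_det_gram_change (hp hzs) (hq hzs), ← hd]

variable [T2Space U] [SigmaCompactSpace U]

/-- On the domain of a chart the Riemannian volume is the chart volume: the chart volumes agree on
overlaps, and the partition of unity sums to one. -/
theorem riemannianVolume_apply_of_subset (p : U) {s : Set U} (hs : MeasurableSet s)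
    (hp : s ⊆ (chartAt 𝔼 p).source) : riemannianVolume n U s = chartVolume n p s := by
  unfold riemannianVolume
  have hsub := (SmoothPartitionOfUnity.exists_isSubordinate_chartAt_source (𝓡 n) U).choose_spec
  set ρ := (SmoothPartitionOfUnity.exists_isSubordinate_chartAt_source (𝓡 n) U).choose with hρ
  rw [Measure.sum_apply _ hs]
  have hm : ∀ i : U, Measurable fun x => ENNReal.ofReal (ρ i x) := fun i =>
    (ρ i).contMDiff.continuous.measurable.ennreal_ofReal
  have h1 : ∀ i : U, ((chartVolume n i).withDensity fun x => ENNReal.ofReal (ρ i x)) s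
      = ∫⁻ x in s, ENNReal.ofReal (ρ i x) ∂(chartVolume n p) := by
    intro i
    have hsi : MeasurableSet (s ∩ (chartAt 𝔼 i).source) :=
      hs.inter (chartAt 𝔼 i).open_source.measurableSet
    have h2 : ∀ μ : Measure U, ∫⁻ x in s, ENNReal.ofReal (ρ i x) ∂μ
        = ∫⁻ x in s ∩ (chartAt 𝔼 i).source, ENNReal.ofReal (ρ i x) ∂μ := by
      intro μ
      rw [inter_comm, ← setLIntegral_indicator (chartAt 𝔼 i).open_source.measurableSet]
      refine lintegral_congr fun x => ?_
      by_cases hx : x ∈ (chartAt 𝔼 i).source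
      · simp [hx]
      · have : ρ i x = 0 := by
          by_contra h
          exact hx (hsub i (subset_tsupport _ h))
        simp [this, hx]
    rw [withDensity_apply _ hs, h2, h2]
    congr 1
    ext t ht
    rw [Measure.restrict_apply ht, Measure.restrict_apply ht]
    exact chartVolume_eq_of_subset (ht.inter hsi) (fun x hx => hx.2.2) (fun x hx => hp hx.2.1)
  simp only [h1]
  -- only countably many members of the partition are nonzero, so that sum and integral commute
  set S : Set U := {i | (Function.support (ρ i)).Nonempty} with hS
  have hScount : S.Countable := by
    have hlf : LocallyFinite fun i : S => Function.support (ρ i) :=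
      ρ.locallyFinite.comp_injective Subtype.val_injective
    have := hlf.countable_univ fun i => i.2
    exact countable_coe_iff.1 (countable_univ_iff.1 this)
  have : Countable S := hScount.to_subtype
  have h3 : ∀ f : U → ENNReal, (∀ i ∉ S, f i = 0) → ∑' i, f i = ∑' i : S, f i := fun f hf =>
    (tsum_subtype_eq_of_support_subset fun i hi => by
      by_contra h
      exact hi (hf i h)).symm
  have h0 : ∀ i ∉ S, ∀ x, ρ i x = 0 := by
    intro i hi x
    by_contra h
    exact hi ⟨x, h⟩
  rw [h3 _ fun i hi => by simp [h0 i hi], ← lintegral_tsum fun i : S => (hm i).aemeasurable,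
    ← setLIntegral_one]
  refine lintegral_congr fun x => ?_
  rw [← h3 (fun i => ENNReal.ofReal (ρ i x)) fun i hi => by simp [h0 i hi]]
  have hfin : (Function.support fun i => ρ i x).Finite := ρ.locallyFinite.point_finite x
  rw [tsum_eq_sum (s := hfin.toFinset) fun i hi => by
    have : ρ i x = 0 := by simpa using hi
    simp [this]]
  rw [← ENNReal.ofReal_sum_of_nonneg fun i _ => ρ.nonneg i x, ← ENNReal.ofReal_one]
  congr 1
  rw [← ρ.sum_eq_one (mem_univ x), finsum_eq_sum_of_support_subset]
  simp

theorem riemannianVolume_restrict_source (p : U) :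
    (riemannianVolume n U).restrict (chartAt 𝔼 p).source = chartVolume n p := by
  have ho := (chartAt 𝔼 p).open_source.measurableSet
  ext s hs
  rw [Measure.restrict_apply hs,
    riemannianVolume_apply_of_subset p (hs.inter ho) inter_subset_right, inter_comm]
  exact Measure.measure_inter_eq_of_ae (mem_ae_iff.2 (chartVolume_compl_source (n := n) p))

/-- The integral of a function supported in the domain of a chart, in coordinates. -/
theorem integral_eq_integral_chart (p : U) {f : U → ℝ}
    (hf : ContinuousOn f (chartAt 𝔼 p).source) (h0 : ∀ x ∉ (chartAt 𝔼 p).source, f x = 0) :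
    ∫ x, f x ∂(riemannianVolume n U) = ∫ z in (chartAt 𝔼 p).target,
      volDensity n p ((chartAt 𝔼 p).symm z) * f ((chartAt 𝔼 p).symm z) := by
  have hae : AEStronglyMeasurable f (chartVolume n p) := by
    rw [← riemannianVolume_restrict_source p]
    exact hf.aestronglyMeasurable (chartAt 𝔼 p).open_source.measurableSet
  rw [← setIntegral_eq_integral_of_forall_compl_eq_zero h0, riemannianVolume_restrict_source]
  rw [chartVolume_def] at hae ⊢
  rw [integral_map (aemeasurable_chart_symm p) hae,
    integral_withDensity_eq_integral_toReal_smul₀ (aemeasurable_volDensity_symm p)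
      (ae_of_all _ fun _ => ENNReal.ofReal_lt_top)]
  refine setIntegral_congr_fun (chartAt 𝔼 p).open_target.measurableSet fun z hz => ?_
  simp only [smul_eq_mul]
  rw [ENNReal.toReal_ofReal (volDensity_pos ((chartAt 𝔼 p).map_target hz)).le]

instance isLocallyFiniteMeasure_riemannianVolume :
    IsLocallyFiniteMeasure (riemannianVolume n U) := by
  refine ⟨fun p => ?_⟩
  have hp := mem_chart_source 𝔼 p
  have hz := (chartAt 𝔼 p).map_source hp
  have hc := ((continuousOn_volDensity_symm p).continuousAt
    ((chartAt 𝔼 p).open_target.mem_nhds hz))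
  set C := volDensity n p ((chartAt 𝔼 p).symm (chartAt 𝔼 p p)) + 1 with hC
  have h1 : ∀ᶠ z in 𝓝 (chartAt 𝔼 p p), volDensity n p ((chartAt 𝔼 p).symm z) < C :=
    hc.eventually (gt_mem_nhds (by rw [hC]; exact lt_add_one _))
  obtain ⟨r, hr, hball⟩ := Metric.eventually_nhds_iff_ball.1 h1
  refine ⟨(chartAt 𝔼 p).source ∩ chartAt 𝔼 p ⁻¹' Metric.ball (chartAt 𝔼 p p) r, ?_, ?_⟩
  · exact ((chartAt 𝔼 p).isOpen_inter_preimage Metric.isOpen_ball).mem_nhds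
      ⟨hp, Metric.mem_ball_self hr⟩
  · have hs : MeasurableSet ((chartAt 𝔼 p).source ∩
        chartAt 𝔼 p ⁻¹' Metric.ball (chartAt 𝔼 p p) r) :=
      ((chartAt 𝔼 p).isOpen_inter_preimage Metric.isOpen_ball).measurableSet
    rw [riemannianVolume_apply_of_subset p hs inter_subset_left, chartVolume_apply p hs]
    have hsub : (chartAt 𝔼 p).target ∩ (chartAt 𝔼 p).symm ⁻¹' ((chartAt 𝔼 p).source ∩
        chartAt 𝔼 p ⁻¹' Metric.ball (chartAt 𝔼 p p) r) ⊆ Metric.ball (chartAt 𝔼 p p) r := by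
      rintro z ⟨hz, -, hz2⟩
      rwa [mem_preimage, (chartAt 𝔼 p).right_inv hz] at hz2
    calc _ ≤ ∫⁻ z in Metric.ball (chartAt 𝔼 p p) r,
          ENNReal.ofReal (volDensity n p ((chartAt 𝔼 p).symm z)) := lintegral_mono_set hsub
      _ ≤ ∫⁻ z in Metric.ball (chartAt 𝔼 p p) r, ENNReal.ofReal C :=
          setLIntegral_mono measurable_const fun z hz => ENNReal.ofReal_le_ofReal (hball z hz).le
      _ < ⊤ := by
          rw [setLIntegral_const]
          exact ENNReal.mul_lt_top ENNReal.ofReal_lt_top measure_ball_lt_top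

instance isOpenPosMeasure_riemannianVolume :
    Measure.IsOpenPosMeasure (riemannianVolume n U) := by
  refine ⟨fun O hO hne h0 => ?_⟩
  obtain ⟨p, hpO⟩ := hne
  have hs : IsOpen (O ∩ (chartAt 𝔼 p).source) := hO.inter (chartAt 𝔼 p).open_source
  have h1 : riemannianVolume n U (O ∩ (chartAt 𝔼 p).source) = 0 :=
    measure_mono_null inter_subset_left h0
  rw [riemannianVolume_apply_of_subset p hs.measurableSet inter_subset_right,
    chartVolume_apply p hs.measurableSet] at h1
  have hA : IsOpen ((chartAt 𝔼 p).target ∩ (chartAt 𝔼 p).symm ⁻¹' (O ∩ (chartAt 𝔼 p).source)) :=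
    (chartAt 𝔼 p).isOpen_inter_preimage_symm hs
  have hpos : ∀ z ∈ (chartAt 𝔼 p).target ∩ (chartAt 𝔼 p).symm ⁻¹' (O ∩ (chartAt 𝔼 p).source),
      ENNReal.ofReal (volDensity n p ((chartAt 𝔼 p).symm z)) ≠ 0 := fun z hz => by
    simpa using volDensity_pos hz.2.2
  have h2 : volume ((chartAt 𝔼 p).target ∩
      (chartAt 𝔼 p).symm ⁻¹' (O ∩ (chartAt 𝔼 p).source)) = 0 := by
    have := (lintegral_eq_zero_iff' ((aemeasurable_volDensity_symm p).mono_set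
      inter_subset_left)).1 h1
    rw [← Measure.restrict_eq_zero, ← ae_eq_bot]
    by_contra hne
    have hne' : NeBot (ae (volume.restrict ((chartAt 𝔼 p).target ∩
      (chartAt 𝔼 p).symm ⁻¹' (O ∩ (chartAt 𝔼 p).source)))) := ⟨hne⟩
    obtain ⟨z, hz1, hz2⟩ := (this.and (ae_restrict_mem hA.measurableSet)).exists
    exact hpos z hz2 hz1
  rw [hA.measure_eq_zero_iff (μ := volume)] at h2
  have : chartAt 𝔼 p p ∈ (chartAt 𝔼 p).target ∩
      (chartAt 𝔼 p).symm ⁻¹' (O ∩ (chartAt 𝔼 p).source) :=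
    ⟨(chartAt 𝔼 p).map_source (mem_chart_source 𝔼 p), by
      simp [(chartAt 𝔼 p).left_inv (mem_chart_source 𝔼 p), hpO]⟩
  rw [h2] at this
  exact this

/-- Integration by parts with respect to a coordinate vector field. The density is divided out,
so that no divergence appears. -/
theorem integral_mul_mvfderiv_coordVec {p : U} {f h : U → ℝ} (hf : ContMDiff (𝓡 n) 𝓘(ℝ, ℝ) ∞ f)
    (hh : ContMDiff (𝓡 n) 𝓘(ℝ, ℝ) ∞ h) (hc : HasCompactSupport f)
    (hs : tsupport f ⊆ (chartAt 𝔼 p).source) (j : Fin n) :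
    ∫ x, (volDensity n p x)⁻¹ * (f x * mvfderiv (𝓡 n) h x (coordVec p x j))
        ∂(riemannianVolume n U)
      = -∫ x, (volDensity n p x)⁻¹ * (mvfderiv (𝓡 n) f x (coordVec p x j) * h x)
        ∂(riemannianVolume n U) := by
  -- `h` is cut off near the support of `f`, so that both functions may be read in the chart
  obtain ⟨θ, hθ, hθc, hθs, hθ1, -⟩ := exists_smooth_cutoff n hc (chartAt 𝔼 p).open_source hs
  have hθh : ContMDiff (𝓡 n) 𝓘(ℝ, ℝ) ∞ (fun x => θ x * h x) := hθ.mul hh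
  have hθhs : tsupport (fun x => θ x * h x) ⊆ tsupport θ := tsupport_mul_subset_left
  have hθhc : HasCompactSupport (fun x => θ x * h x) := hθc.mul_right
  have hcd := (contMDiffOn_volDensity (n := n) p).continuousOn
  have hd0 : ∀ x ∈ (chartAt 𝔼 p).source, volDensity n p x ≠ 0 := fun x hx => (volDensity_pos hx).ne'
  have key : ∀ F : U → ℝ, ContinuousOn F (chartAt 𝔼 p).source → (∀ x ∉ tsupport f, F x = 0) →
      ∀ G : 𝔼 → ℝ, (∀ z ∈ (chartAt 𝔼 p).target, G z = F ((chartAt 𝔼 p).symm z)) →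
      (∀ z ∉ (chartAt 𝔼 p).target, G z = 0) →
      ∫ x, (volDensity n p x)⁻¹ * F x ∂(riemannianVolume n U) = ∫ z, G z := by
    intro F hF hF0 G hG hG0
    rw [integral_eq_integral_chart p (f := fun x => (volDensity n p x)⁻¹ * F x)
      ((hcd.inv₀ hd0).mul hF) fun x hx => by rw [hF0 x fun h => hx (hs h), mul_zero],
      ← setIntegral_eq_integral_of_forall_compl_eq_zero hG0]
    refine setIntegral_congr_fun (chartAt 𝔼 p).open_target.measurableSet fun z hz => ?_
    rw [hG z hz, ← mul_assoc, mul_inv_cancel₀ (hd0 _ ((chartAt 𝔼 p).map_target hz)), one_mul]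
  have hout : ∀ z ∉ (chartAt 𝔼 p).target, z ∉ tsupport (pull n p f) := fun z hz h => by
    obtain ⟨y, hy, rfl⟩ := tsupport_pull_subset (n := n) hc hs h
    exact hz ((chartAt 𝔼 p).map_source (hs hy))
  have hpf := contDiff_pull hf.contMDiffOn hc hs
  have hph := contDiff_pull hθh.contMDiffOn hθhc (hθhs.trans hθs)
  have hθ1' : ∀ x ∈ tsupport f, (fun y => θ y * h y) =ᶠ[𝓝 x] h := fun x hx =>
    (hθ1.filter_mono (nhds_le_nhdsSet hx)).mono fun y hy => by simp [hy]
  rw [key (fun x => f x * mvfderiv (𝓡 n) h x (coordVec p x j)) (hf.continuous.continuousOn.mul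
      (contMDiffOn_mvfderiv_coordVec (chartAt 𝔼 p).open_source subset_rfl hh.contMDiffOn j).continuousOn)
      (fun x hx => by rw [image_eq_zero_of_notMem_tsupport hx, zero_mul])
      (fun z => pull n p f z * pderiv j (pull n p fun x => θ x * h x) z) ?_ ?_,
    key (fun x => mvfderiv (𝓡 n) f x (coordVec p x j) * h x)
      ((contMDiffOn_mvfderiv_coordVec (chartAt 𝔼 p).open_source subset_rfl
        hf.contMDiffOn j).continuousOn.mul hh.continuous.continuousOn)
      (fun x hx => by rw [mvfderiv_eq_zero_of_notMem_tsupport hx]; simp)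
      (fun z => pderiv j (pull n p f) z * (pull n p fun x => θ x * h x) z) ?_ ?_]
  · exact integral_mul_pderiv hpf hph (hasCompactSupport_pull hc hs) j
  · intro z hz
    rw [pderiv_pull hz (hf.mdifferentiable (by simp) _), pull_apply _ hz]
    by_cases hx : (chartAt 𝔼 p).symm z ∈ tsupport f
    · rw [(hθ1' _ hx).eq_of_nhds]
    · rw [mvfderiv_eq_zero_of_notMem_tsupport hx]
      simp
  · intro z hz
    rw [pderiv_eq_zero_of_notMem_tsupport (hout z hz), zero_mul]
  · intro z hz
    rw [pderiv_pull hz (hθh.mdifferentiable (by simp) _), pull_apply _ hz]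
    by_cases hx : (chartAt 𝔼 p).symm z ∈ tsupport f
    · rw [mvfderiv_congr (hθ1' _ hx)]
    · rw [image_eq_zero_of_notMem_tsupport hx]
      simp
  · intro z hz
    rw [image_eq_zero_of_notMem_tsupport (hout z hz), zero_mul]

/-- A smooth function on an open set that is orthogonal to all test functions vanishes. -/
theorem eq_zero_of_forall_integral_mul_eq_zero {N : Set U} (hN : IsOpen N) {f : U → ℝ}
    (hf : ContMDiffOn (𝓡 n) 𝓘(ℝ, ℝ) ∞ f N)
    (h : ∀ ψ : U → ℝ, ContMDiff (𝓡 n) 𝓘(ℝ, ℝ) ∞ ψ → HasCompactSupport ψ → tsupport ψ ⊆ N →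
      ∫ x, ψ x * f x ∂(riemannianVolume n U) = 0) : ∀ x ∈ N, f x = 0 := by
  intro x hx
  obtain ⟨θ, hθ, hθc, hθs, hθ1, hθ01⟩ := exists_smooth_cutoff n isCompact_singleton hN
    (singleton_subset_iff.2 hx)
  have hsm : ContMDiff (𝓡 n) 𝓘(ℝ, ℝ) ∞ (fun y => θ y * f y) :=
    contMDiff_of_contMDiffOn_of_zero hN hθc hθs (hθ.contMDiffOn.mul hf) fun y hy => by
      rw [image_eq_zero_of_notMem_tsupport hy, zero_mul]
  have hsm2 : Continuous (fun y => θ y * f y * f y) :=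
    continuous_of_continuousOn_of_zero hN hθc hθs
      (hsm.continuous.continuousOn.mul hf.continuousOn) fun y hy => by
      rw [image_eq_zero_of_notMem_tsupport hy, zero_mul, zero_mul]
  have hc : HasCompactSupport (fun y => θ y * f y * f y) := (hθc.mul_right).mul_right
  -- the test function `θ f` makes the integrand nonnegative
  by_contra hne
  have hpos := hsm2.integral_pos_of_hasCompactSupport_nonneg_nonzero (μ := riemannianVolume n U) hc
    (fun y => by
      have := mul_nonneg (hθ01 y).1 (mul_self_nonneg (f y))
      simpa [mul_assoc] using this) (x := x) (by
        have h1 : θ x = 1 := hθ1.self_of_nhdsSet x rfl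
        simp [h1, hne])
  exact hpos.ne' (h _ hsm hθc.mul_right ((tsupport_mul_subset_left).trans hθs))

end Volume

/-! ### Coordinate derivatives -/

section CoordDeriv
variable {n : ℕ} {U : Type*} [TopologicalSpace U] [ChartedSpace (EuclideanSpace ℝ (Fin n)) U]
  [IsManifold (𝓡 n) ∞ U] {W : Type*} [NormedAddCommGroup W] [NormedSpace ℝ W]
local notation "𝔼" => EuclideanSpace ℝ (Fin n)

/-- The derivative `∂f/∂xʲ` at a point of the manifold, for the coordinates of the chart at `p`. -/
def coordDeriv (p : U) (j : Fin n) (f : U → W) (x : U) : W := mvfderiv (𝓡 n) f x (coordVec p x j)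

theorem coordDeriv_congr {p : U} {j : Fin n} {f g : U → W} {x : U} (h : f =ᶠ[𝓝 x] g) :
    coordDeriv p j f x = coordDeriv p j g x := by
  unfold coordDeriv
  rw [mvfderiv_congr h]

theorem coordDeriv_eq_zero_of_notMem_tsupport {p : U} {j : Fin n} {f : U → W} {x : U}
    (h : x ∉ tsupport f) : coordDeriv p j f x = 0 := by
  unfold coordDeriv
  rw [mvfderiv_eq_zero_of_notMem_tsupport h]
  rfl

theorem ContMDiffOn.mdifferentiableAt_of_isOpen {N : Set U} {f : U → W} {x : U}
    (hf : ContMDiffOn (𝓡 n) 𝓘(ℝ, W) ∞ f N) (hN : IsOpen N) (hx : x ∈ N) :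
    MDifferentiableAt (𝓡 n) 𝓘(ℝ, W) f x :=
  (hf.contMDiffAt (hN.mem_nhds hx)).mdifferentiableAt (by simp)

theorem coordDeriv_add {p : U} {j : Fin n} {f g : U → W} {x : U}
    (hf : MDifferentiableAt (𝓡 n) 𝓘(ℝ, W) f x) (hg : MDifferentiableAt (𝓡 n) 𝓘(ℝ, W) g x) :
    coordDeriv p j (fun y => f y + g y) x = coordDeriv p j f x + coordDeriv p j g x := by
  unfold coordDeriv
  exact DFunLike.congr_fun (mvfderiv_add hf hg) _

theorem coordDeriv_const {p : U} {j : Fin n} (c : W) {x : U} :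
    coordDeriv p j (fun _ => c) x = 0 := by
  unfold coordDeriv
  rw [mvfderiv_const]
  rfl

theorem coordDeriv_smul {p : U} {j : Fin n} {f : U → ℝ} {g : U → W} {x : U}
    (hf : MDifferentiableAt (𝓡 n) 𝓘(ℝ, ℝ) f x) (hg : MDifferentiableAt (𝓡 n) 𝓘(ℝ, W) g x) :
    coordDeriv p j (fun y => f y • g y) x
      = f x • coordDeriv p j g x + coordDeriv p j f x • g x := by
  unfold coordDeriv
  exact DFunLike.congr_fun (mvfderiv_smul hf hg) _

theorem coordDeriv_mul {p : U} {j : Fin n} {f g : U → ℝ} {x : U}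
    (hf : MDifferentiableAt (𝓡 n) 𝓘(ℝ, ℝ) f x) (hg : MDifferentiableAt (𝓡 n) 𝓘(ℝ, ℝ) g x) :
    coordDeriv p j (fun y => f y * g y) x
      = f x * coordDeriv p j g x + coordDeriv p j f x * g x :=
  coordDeriv_smul hf hg

theorem mdifferentiableAt_sum {ι : Type*} {t : Finset ι} {f : ι → U → W} {x : U}
    (hf : ∀ i ∈ t, MDifferentiableAt (𝓡 n) 𝓘(ℝ, W) (f i) x) :
    MDifferentiableAt (𝓡 n) 𝓘(ℝ, W) (fun y => ∑ i ∈ t, f i y) x := by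
  classical
  induction t using Finset.induction_on with
  | empty => simpa using mdifferentiableAt_const
  | insert a t ha ih =>
    simp only [Finset.sum_insert ha]
    exact (hf a (Finset.mem_insert_self _ _)).add
      (ih fun i hi => hf i (Finset.mem_insert_of_mem hi))

theorem coordDeriv_sum {ι : Type*} {t : Finset ι} {p : U} {j : Fin n} {f : ι → U → W} {x : U}
    (hf : ∀ i ∈ t, MDifferentiableAt (𝓡 n) 𝓘(ℝ, W) (f i) x) :
    coordDeriv p j (fun y => ∑ i ∈ t, f i y) x = ∑ i ∈ t, coordDeriv p j (f i) x := by
  classical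
  induction t using Finset.induction_on with
  | empty => simpa using coordDeriv_const (0 : W)
  | insert a t ha ih =>
    simp only [Finset.sum_insert ha]
    rw [coordDeriv_add (hf a (Finset.mem_insert_self _ _))
      (mdifferentiableAt_sum fun i hi => hf i (Finset.mem_insert_of_mem hi)),
      ih fun i hi => hf i (Finset.mem_insert_of_mem hi)]

theorem contMDiffOn_coordDeriv {N : Set U} {p : U} (hN : IsOpen N) (hNp : N ⊆ (chartAt 𝔼 p).source)
    {f : U → W} (hf : ContMDiffOn (𝓡 n) 𝓘(ℝ, W) ∞ f N) (j : Fin n) :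
    ContMDiffOn (𝓡 n) 𝓘(ℝ, W) ∞ (coordDeriv p j f) N :=
  contMDiffOn_mvfderiv_coordVec hN hNp hf j

end CoordDeriv

/-! ### Sections and covariant derivatives -/

section Sections
variable {n : ℕ} {U : Type*} [TopologicalSpace U] [ChartedSpace (EuclideanSpace ℝ (Fin n)) U]
  [IsManifold (𝓡 n) ∞ U]
  {F : Type*} [NormedAddCommGroup F] [NormedSpace ℝ F]
  {V : U → Type*} [TopologicalSpace (TotalSpace F V)]
  [∀ x, NormedAddCommGroup (V x)] [∀ x, InnerProductSpace ℝ (V x)] [FiberBundle F V]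
  [VectorBundle ℝ F V]
local notation "𝔼" => EuclideanSpace ℝ (Fin n)

variable (n F) in
/-- The section `s` of `V` is smooth on the set `N`. -/
abbrev SmoothSectionOn (s : Π x, V x) (N : Set U) : Prop :=
  ContMDiffOn (𝓡 n) ((𝓡 n).prod 𝓘(ℝ, F)) ∞ (fun x => TotalSpace.mk' F x (s x)) N

variable (n F V) in
/-- The fibre metric of `V` is smooth: inner products of global smooth sections are smooth. -/
def IsSmoothMetric : Prop :=
  ∀ s t : Π x, V x, SmoothSectionOn n F s univ → SmoothSectionOn n F t univ →
    ContMDiff (𝓡 n) 𝓘(ℝ, ℝ) ∞ fun x => (inner ℝ (s x) (t x) : ℝ)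

theorem smoothSectionOn_smul_of_tsupport {N : Set U} (hN : IsOpen N) {s : Π x, V x}
    (hs : SmoothSectionOn n F s N) {θ : U → ℝ} (hθ : ContMDiff (𝓡 n) 𝓘(ℝ, ℝ) ∞ θ)
    (hθN : tsupport θ ⊆ N) : SmoothSectionOn n F (fun x => θ x • s x) univ := by
  rw [SmoothSectionOn, contMDiffOn_univ]
  intro x
  by_cases hx : x ∈ tsupport θ
  · exact (hθ x).smul_section (hs.contMDiffAt (hN.mem_nhds (hθN hx)))
  · have h0 : ∀ᶠ y in 𝓝 x, θ y • s y = 0 :=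
      (notMem_tsupport_iff_eventuallyEq.1 hx).mono fun y hy => by
        rw [hy, Pi.zero_apply, zero_smul]
    refine (contMDiff_zeroSection ℝ V x).congr_of_eventuallyEq ?_
    exact h0.mono fun y hy => by simp only [hy]; rfl

/-- Smoothness of the metric is local: sections over an open set are extended by cutting off. -/
theorem IsSmoothMetric.contMDiffOn_inner [T2Space U] [SigmaCompactSpace U]
    (hV : IsSmoothMetric n F V) {N : Set U} (hN : IsOpen N)
    {s t : Π x, V x} (hs : SmoothSectionOn n F s N) (ht : SmoothSectionOn n F t N) :
    ContMDiffOn (𝓡 n) 𝓘(ℝ, ℝ) ∞ (fun x => (inner ℝ (s x) (t x) : ℝ)) N := by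
  intro x hx
  obtain ⟨θ, hθ, hθc, hθs, hθ1, -⟩ := exists_smooth_cutoff n isCompact_singleton hN
    (singleton_subset_iff.2 hx)
  have h := hV _ _ (smoothSectionOn_smul_of_tsupport hN hs hθ hθs)
    (smoothSectionOn_smul_of_tsupport hN ht hθ hθs)
  refine ((h x).congr_of_eventuallyEq ?_).contMDiffWithinAt
  rw [nhdsSet_singleton] at hθ1
  exact hθ1.mono fun y hy => by simp [hy]

variable (A : CovariantDerivative (𝓡 n) F V)

theorem covDeriv_congr {s t : Π x, V x} {N : Set U} {x : U} (hN : IsOpen N) (hx : x ∈ N)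
    (hs : SmoothSectionOn n F s N) (h : ∀ y ∈ N, s y = t y) : A s x = A t x := by
  have ht : SmoothSectionOn n F t N := hs.congr fun y hy => by rw [h y hy]
  exact A.isCovariantDerivativeOnUniv.congr_of_eventuallyEq
    ((hs.contMDiffAt (hN.mem_nhds hx)).mdifferentiableAt (by simp))
    ((ht.contMDiffAt (hN.mem_nhds hx)).mdifferentiableAt (by simp)) univ_mem
    (eventually_of_mem (hN.mem_nhds hx) h)

theorem covDeriv_smul {s : Π x, V x} {f : U → ℝ} {N : Set U} {x : U} (hN : IsOpen N) (hx : x ∈ N)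
    (hs : SmoothSectionOn n F s N) (hf : ContMDiffOn (𝓡 n) 𝓘(ℝ, ℝ) ∞ f N)
    (X : TangentSpace (𝓡 n) x) :
    A (fun y => f y • s y) x X = f x • A s x X + mvfderiv (𝓡 n) f x X • s x :=
  DFunLike.congr_fun (A.isCovariantDerivativeOnUniv.leibniz
    ((hs.contMDiffAt (hN.mem_nhds hx)).mdifferentiableAt (by simp))
    (ContMDiffOn.mdifferentiableAt_of_isOpen hf hN hx)) X

theorem covDeriv_sum {ι : Type*} {t : Finset ι} {s : ι → Π x, V x} {N : Set U} {x : U}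
    (hN : IsOpen N) (hx : x ∈ N) (hs : ∀ i ∈ t, SmoothSectionOn n F (s i) N) :
    A (fun y => ∑ i ∈ t, s i y) x = ∑ i ∈ t, A (s i) x := by
  classical
  induction t using Finset.induction_on with
  | empty =>
    simp only [Finset.sum_empty]
    change A 0 x = 0
    rw [A.zero]
    rfl
  | insert a t ha ih =>
    simp only [Finset.sum_insert ha]
    have h1 : SmoothSectionOn n F (s a) N := hs a (Finset.mem_insert_self _ _)
    have h2 : ∀ i ∈ t, SmoothSectionOn n F (s i) N := fun i hi =>
      hs i (Finset.mem_insert_of_mem hi)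
    have h3 : SmoothSectionOn n F (fun y => ∑ i ∈ t, s i y) N := ContMDiffOn.sum_section h2
    rw [← ih h2]
    exact A.isCovariantDerivativeOnUniv.add
      ((h1.contMDiffAt (hN.mem_nhds hx)).mdifferentiableAt (by simp))
      ((h3.contMDiffAt (hN.mem_nhds hx)).mdifferentiableAt (by simp))

theorem covDeriv_eq_zero_of_notMem {s : Π x, V x} {x : U}
    (hs : SmoothSectionOn n F s univ) (hx : x ∉ secSupport s) : A s x = 0 := by
  have hO : IsOpen (secSupport s)ᶜ := isClosed_closure.isOpen_compl
  rw [covDeriv_congr A hO hx (hs.mono (subset_univ _)) (t := 0) fun y hy => by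
    by_contra h
    exact hy (subset_closure h)]
  rw [A.zero]
  rfl

theorem smoothSectionOn_covDeriv [T2Space U] [SigmaCompactSpace U]
    [CovariantDerivative.ContMDiffCovariantDerivative A ∞] {N : Set U} (hN : IsOpen N)
    {s : Π x, V x} (hs : SmoothSectionOn n F s N) {X : Π x, TangentSpace (𝓡 n) x}
    (hX : ContMDiffOn (𝓡 n) (𝓡 n).tangent ∞ (fun y => (⟨y, X y⟩ : TangentBundle (𝓡 n) U)) N) :
    SmoothSectionOn n F (fun x => A s x (X x)) N := by
  intro x hx
  obtain ⟨θ, hθ, hθc, hθs, hθ1, -⟩ := exists_smooth_cutoff n isCompact_singleton hN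
    (singleton_subset_iff.2 hx)
  have h1 := (CovariantDerivative.ContMDiffCovariantDerivative.contMDiff (cov := A) (k := ∞)).contMDiff
    (σ := fun x => θ x • s x) (smoothSectionOn_smul_of_tsupport hN hs hθ hθs)
  have h2 := ContMDiffAt.clm_bundle_apply (h1.contMDiffAt univ_mem) (hX.contMDiffAt (hN.mem_nhds hx))
  refine (h2.congr_of_eventuallyEq ?_).contMDiffWithinAt
  rw [nhdsSet_singleton] at hθ1
  obtain ⟨O, hO1, hO, hxO⟩ := eventually_nhds_iff.1 hθ1
  refine eventually_of_mem ((hO.inter hN).mem_nhds ⟨hxO, hx⟩) fun y hy => ?_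
  have := covDeriv_congr A (hO.inter hN) hy (hs.mono inter_subset_right)
    (t := fun x => θ x • s x) fun z hz => by rw [hO1 z hz.1, one_smul]
  simp only [this]

end Sections

/-! ### Local frames -/

section Frames
variable {n : ℕ} {U : Type*} [TopologicalSpace U] [ChartedSpace (EuclideanSpace ℝ (Fin n)) U]
  [IsManifold (𝓡 n) ∞ U]
  {F : Type*} [NormedAddCommGroup F] [NormedSpace ℝ F] [FiniteDimensional ℝ F]
  {V : U → Type*} [TopologicalSpace (TotalSpace F V)]
  [∀ x, NormedAddCommGroup (V x)] [∀ x, InnerProductSpace ℝ (V x)] [FiberBundle F V]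
  [VectorBundle ℝ F V] [ContMDiffVectorBundle ∞ F V (𝓡 n)]
local notation "𝔼" => EuclideanSpace ℝ (Fin n)

variable (n F V) in
/-- A neighbourhood of `p` on which both the preferred chart and the preferred trivialization at
`p` are defined. -/
def frameDomain (p : U) : Set U := (chartAt 𝔼 p).source ∩ (trivializationAt F V p).baseSet

variable (F V) in
/-- The local frame of `V` given by the preferred trivialization at `p` and a fixed basis of the
model fibre. -/
def frame (p : U) (a : Fin (Module.finrank ℝ F)) : Π x, V x :=
  (trivializationAt F V p).localFrame (Module.finBasis ℝ F) a

variable (n F V) in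
/-- The coefficients of a vector in the local frame at `p`. -/
def frameCoeff (p : U) (a : Fin (Module.finrank ℝ F)) : Π x, V x →ₗ[ℝ] ℝ :=
  (trivializationAt F V p).localFrameCoeff (𝓡 n) (Module.finBasis ℝ F) a

theorem isOpen_frameDomain (p : U) : IsOpen (frameDomain n F V p) :=
  (chartAt 𝔼 p).open_source.inter (trivializationAt F V p).open_baseSet

theorem mem_frameDomain (p : U) : p ∈ frameDomain n F V p :=
  ⟨mem_chart_source 𝔼 p, FiberBundle.mem_baseSet_trivializationAt' p⟩

theorem smoothSectionOn_frame (p : U) (a : Fin (Module.finrank ℝ F)) :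
    SmoothSectionOn n F (frame F V p a) (frameDomain n F V p) :=
  ((trivializationAt F V p).contMDiffOn_localFrame_baseSet ∞ _ a).mono inter_subset_right

theorem contMDiffOn_frameCoeff {p : U} (a : Fin (Module.finrank ℝ F)) {N : Set U} (hN : IsOpen N)
    (hNp : N ⊆ frameDomain n F V p) {s : Π x, V x} (hs : SmoothSectionOn n F s N) :
    ContMDiffOn (𝓡 n) 𝓘(ℝ, ℝ) ∞ (fun x => frameCoeff n F V p a x (s x)) N :=
  contMDiffOn_localFrameCoeff (Module.finBasis ℝ F) hN (hNp.trans inter_subset_right) hs a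

theorem eq_sum_frameCoeff {p x : U} (hx : x ∈ frameDomain n F V p) (v : V x) :
    v = ∑ a, frameCoeff n F V p a x v • frame F V p a x := by
  classical
  have h := (trivializationAt F V p).eq_sum_localFrameCoeff_smul (I := 𝓡 n)
    (b := Module.finBasis ℝ F) (s := Function.update 0 x v) hx.2
  rwa [Function.update_self] at h

theorem linearIndependent_frame {p x : U} (hx : x ∈ frameDomain n F V p) :
    LinearIndependent ℝ fun a => frame F V p a x :=
  ((trivializationAt F V p).isLocalFrameOn_localFrame_baseSet (𝓡 n) 1
    (Module.finBasis ℝ F)).linearIndependent hx.2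

end Frames

/-! ### The Gram matrix of a local frame -/

section FrameGram
variable {n : ℕ} {U : Type*} [TopologicalSpace U] [ChartedSpace (EuclideanSpace ℝ (Fin n)) U]
  [IsManifold (𝓡 n) ∞ U]
  {F : Type*} [NormedAddCommGroup F] [NormedSpace ℝ F] [FiniteDimensional ℝ F]
  {V : U → Type*} [TopologicalSpace (TotalSpace F V)]
  [∀ x, NormedAddCommGroup (V x)] [∀ x, InnerProductSpace ℝ (V x)] [FiberBundle F V]
  [VectorBundle ℝ F V] [ContMDiffVectorBundle ∞ F V (𝓡 n)]

variable (F V) in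
/-- The Gram matrix of the local frame at `p`. -/
def frameGram (p x : U) : Matrix (Fin (Module.finrank ℝ F)) (Fin (Module.finrank ℝ F)) ℝ :=
  Matrix.of fun a b => inner ℝ (frame F V p a x) (frame F V p b x)

theorem posDef_frameGram {p x : U} (hx : x ∈ frameDomain n F V p) : (frameGram F V p x).PosDef :=
  Matrix.posDef_gram_of_linearIndependent (𝕜 := ℝ) (linearIndependent_frame hx)

theorem isUnit_det_frameGram {p x : U} (hx : x ∈ frameDomain n F V p) :
    IsUnit (frameGram F V p x).det :=
  isUnit_iff_ne_zero.2 (posDef_frameGram hx).det_pos.ne'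

theorem contMDiffOn_inv_frameGram [T2Space U] [SigmaCompactSpace U] (hV : IsSmoothMetric n F V)
    (p : U) (a b : Fin (Module.finrank ℝ F)) :
    ContMDiffOn (𝓡 n) 𝓘(ℝ, ℝ) ∞ (fun x => (frameGram F V p x)⁻¹ a b) (frameDomain n F V p) :=
  contMDiffOn_matrixInv (fun a b => hV.contMDiffOn_inner (isOpen_frameDomain p)
    (smoothSectionOn_frame p a) (smoothSectionOn_frame p b))
    (fun _ hx => (posDef_frameGram hx).det_pos.ne') a b

variable (V) in
/-- The vector whose inner products with the local frame at `p` are the numbers `β a`. -/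
def dualCombination (p x : U) (β : Fin (Module.finrank ℝ F) → ℝ) : V x :=
  ∑ a, (∑ b, (frameGram F V p x)⁻¹ a b * β b) • frame F V p a x

theorem inner_frame_dualCombination {p x : U} (hx : x ∈ frameDomain n F V p)
    (β : Fin (Module.finrank ℝ F) → ℝ) (c : Fin (Module.finrank ℝ F)) :
    inner ℝ (frame F V p c x) (dualCombination V p x β) = β c := by
  have h : (frameGram F V p x).mulVec ((frameGram F V p x)⁻¹.mulVec β) c = β c := by
    rw [Matrix.mulVec_mulVec, Matrix.mul_nonsing_inv _ (isUnit_det_frameGram hx), Matrix.one_mulVec]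
  rw [← h, dualCombination, inner_sum]
  simp only [real_inner_smul_right, Matrix.mulVec, dotProduct]
  exact Finset.sum_congr rfl fun a _ => mul_comm _ _

theorem eq_of_inner_frame_eq {p x : U} (hx : x ∈ frameDomain n F V p) {v w : V x}
    (h : ∀ a, (inner ℝ (frame F V p a x) v : ℝ) = inner ℝ (frame F V p a x) w) : v = w := by
  rw [← sub_eq_zero, ← inner_self_eq_zero (𝕜 := ℝ)]
  nth_rw 1 [eq_sum_frameCoeff hx (v - w)]
  rw [sum_inner]
  refine Finset.sum_eq_zero fun a _ => ?_
  rw [real_inner_smul_left, inner_sub_right, h a, sub_self, mul_zero]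

theorem eq_dualCombination {p x : U} (hx : x ∈ frameDomain n F V p) (v : V x) :
    v = dualCombination V p x fun a => inner ℝ (frame F V p a x) v :=
  eq_of_inner_frame_eq hx fun a =>
    (inner_frame_dualCombination hx (fun a => inner ℝ (frame F V p a x) v) a).symm

theorem secSupport_smul_subset {f : U → ℝ} (s : Π x, V x) :
    secSupport (fun x => f x • s x) ⊆ tsupport f := by
  refine closure_mono fun x hx h => hx ?_
  change f x • s x = 0
  rw [h, zero_smul]

theorem eq_zero_of_notMem_secSupport {s : Π x, V x} {x : U} (hx : x ∉ secSupport s) : s x = 0 := by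
  by_contra h
  exact hx (subset_closure h)

end FrameGram

/-! ### The formal adjoint of a connection -/

section Adjoint
variable {n : ℕ} {U : Type*} [TopologicalSpace U] [ChartedSpace (EuclideanSpace ℝ (Fin n)) U]
  [IsManifold (𝓡 n) ∞ U]
  [RiemannianBundle (fun x : U => TangentSpace (𝓡 n) x)]
  [IsContMDiffRiemannianBundle (𝓡 n) ∞ (EuclideanSpace ℝ (Fin n))
    (fun x : U => TangentSpace (𝓡 n) x)] [MeasurableSpace U] [BorelSpace U]
  [T2Space U] [SigmaCompactSpace U]
  {F : Type*} [NormedAddCommGroup F] [NormedSpace ℝ F] [FiniteDimensional ℝ F]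
  {V : U → Type*} [TopologicalSpace (TotalSpace F V)]
  [∀ x, NormedAddCommGroup (V x)] [∀ x, InnerProductSpace ℝ (V x)] [FiberBundle F V]
  [VectorBundle ℝ F V] [ContMDiffVectorBundle ∞ F V (𝓡 n)]
local notation "𝔼" => EuclideanSpace ℝ (Fin n)

theorem integrable_of_continuousOn_of_zero {N K : Set U} (hN : IsOpen N) (hK : IsCompact K)
    (hKN : K ⊆ N) {f : U → ℝ} (hf : ContinuousOn f N) (h0 : ∀ x ∉ K, f x = 0) :
    Integrable f (riemannianVolume n U) :=
  (continuous_of_continuousOn_of_zero hN hK hKN hf h0).integrable_of_hasCompactSupport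
    (HasCompactSupport.intro hK h0)

/-- Integration by parts as in `integral_mul_mvfderiv_coordVec`, where the second function need only
be smooth near the support of the first. -/
theorem integral_coordDeriv_mul {p : U} {N : Set U} (hN : IsOpen N)
    (hNp : N ⊆ (chartAt 𝔼 p).source) {f h : U → ℝ} (hf : ContMDiff (𝓡 n) 𝓘(ℝ, ℝ) ∞ f)
    (hc : HasCompactSupport f) (hs : tsupport f ⊆ N) (hh : ContMDiffOn (𝓡 n) 𝓘(ℝ, ℝ) ∞ h N)
    (j : Fin n) :
    ∫ x, (volDensity n p x)⁻¹ * (coordDeriv p j f x * h x) ∂(riemannianVolume n U)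
      = -∫ x, (volDensity n p x)⁻¹ * (f x * coordDeriv p j h x) ∂(riemannianVolume n U) := by
  obtain ⟨θ, hθ, hθc, hθs, hθ1, -⟩ := exists_smooth_cutoff n hc hN hs
  have hθh : ContMDiff (𝓡 n) 𝓘(ℝ, ℝ) ∞ (fun x => θ x * h x) :=
    contMDiff_of_contMDiffOn_of_zero hN hθc hθs (hθ.contMDiffOn.mul hh) fun x hx => by
      rw [image_eq_zero_of_notMem_tsupport hx, zero_mul]
  have key := integral_mul_mvfderiv_coordVec hf hθh hc (hs.trans hNp) j
  have hθ1' : ∀ x ∈ tsupport f, (fun y => θ y * h y) =ᶠ[𝓝 x] h := fun x hx =>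
    (hθ1.filter_mono (nhds_le_nhdsSet hx)).mono fun y hy => by simp [hy]
  have e1 : ∀ x, (volDensity n p x)⁻¹ * (coordDeriv p j f x * h x)
      = (volDensity n p x)⁻¹ * (mvfderiv (𝓡 n) f x (coordVec p x j) * (θ x * h x)) := by
    intro x
    by_cases hx : x ∈ tsupport f
    · have : θ x * h x = h x := (hθ1' x hx).eq_of_nhds
      rw [this, coordDeriv]
    · simp only [coordDeriv, mvfderiv_eq_zero_of_notMem_tsupport hx]
      simp
  have e2 : ∀ x, (volDensity n p x)⁻¹ * (f x * coordDeriv p j h x)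
      = (volDensity n p x)⁻¹ *
        (f x * mvfderiv (𝓡 n) (fun y => θ y * h y) x (coordVec p x j)) := by
    intro x
    by_cases hx : x ∈ tsupport f
    · simp only [coordDeriv, mvfderiv_congr (hθ1' x hx)]
    · simp only [image_eq_zero_of_notMem_tsupport hx, zero_mul]
  simp only [e1, e2]
  rw [key, neg_neg]

variable (F) in
/-- A `V`-valued one-form is smooth: so are its values on the coordinate vector fields. -/
def IsSmoothForm (α : Π x, TangentSpace (𝓡 n) x →L[ℝ] V x) : Prop :=
  ∀ (p : U) (j : Fin n),
    SmoothSectionOn n F (fun x => α x (coordVec p x j)) (chartAt 𝔼 p).source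

theorem isSmoothForm_covDeriv (A : CovariantDerivative (𝓡 n) F V)
    [CovariantDerivative.ContMDiffCovariantDerivative A ∞] {s : Π x, V x}
    (hs : SmoothSectionOn n F s univ) : IsSmoothForm F (A s) := fun p j =>
  smoothSectionOn_covDeriv A (chartAt 𝔼 p).open_source (hs.mono (subset_univ _))
    (contMDiffOn_coordVec p j)

theorem contMDiff_covInner (hV : IsSmoothMetric n F V)
    {α β : Π x, TangentSpace (𝓡 n) x →L[ℝ] V x} (hα : IsSmoothForm F α) (hβ : IsSmoothForm F β) :
    ContMDiff (𝓡 n) 𝓘(ℝ, ℝ) ∞ fun x => covInner x x (α x) (β x) := by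
  intro p
  have h : ContMDiffOn (𝓡 n) 𝓘(ℝ, ℝ) ∞ (fun x => covInner p x (α x) (β x))
      (chartAt 𝔼 p).source :=
    contMDiffOn_finsetSum fun i _ => contMDiffOn_finsetSum fun j _ =>
      (contMDiffOn_inv_gram p i j).mul
        (hV.contMDiffOn_inner (chartAt 𝔼 p).open_source (hα p i) (hβ p j))
  have hp := (chartAt 𝔼 p).open_source.mem_nhds (mem_chart_source 𝔼 p)
  exact (h.contMDiffAt hp).congr_of_eventuallyEq (eventually_of_mem hp fun x hx =>
    covInner_change (mem_chart_source 𝔼 x) hx _ _)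

theorem covInner_zero_left {p x : U} (β : TangentSpace (𝓡 n) x →L[ℝ] V x) :
    covInner p x 0 β = 0 := by
  simp [covInner]

theorem covInner_sum_left {ι : Type*} (t : Finset ι) {p x : U}
    (α : ι → TangentSpace (𝓡 n) x →L[ℝ] V x) (β : TangentSpace (𝓡 n) x →L[ℝ] V x) :
    covInner p x (∑ i ∈ t, α i) β = ∑ i ∈ t, covInner p x (α i) β := by
  simp only [covInner, sum_apply, sum_inner, Finset.mul_sum]
  rw [Finset.sum_congr rfl fun i _ => Finset.sum_comm, Finset.sum_comm]

variable (A : CovariantDerivative (𝓡 n) F V)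
  [CovariantDerivative.ContMDiffCovariantDerivative A ∞]
  (α : Π x, TangentSpace (𝓡 n) x →L[ℝ] V x)

theorem integrable_covInner (hV : IsSmoothMetric n F V) {α} (hα : IsSmoothForm F α) {v : Π x, V x}
    (hv : SmoothSectionOn n F v univ) (hc : IsCompact (secSupport v)) :
    Integrable (fun x => covInner x x (A v x) (α x)) (riemannianVolume n U) :=
  integrable_of_continuousOn_of_zero isOpen_univ hc (subset_univ _)
    (contMDiff_covInner hV (isSmoothForm_covDeriv A hv) hα).continuous.continuousOn fun x hx => by
      rw [covDeriv_eq_zero_of_notMem A hv hx, covInner_zero_left]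

theorem integrable_inner_section (hV : IsSmoothMetric n F V) {v w : Π x, V x} {N : Set U}
    (hN : IsOpen N) (hv : SmoothSectionOn n F v N) (hw : SmoothSectionOn n F w N)
    (hc : IsCompact (secSupport v)) (hvN : secSupport v ⊆ N) :
    Integrable (fun x => (inner ℝ (v x) (w x) : ℝ)) (riemannianVolume n U) :=
  integrable_of_continuousOn_of_zero hN hc hvN (hV.contMDiffOn_inner hN hv hw).continuousOn
    fun x hx => by rw [eq_zero_of_notMem_secSupport hx, inner_zero_left]

/-- The components `|g|^{1/2} g^{jk} ⟨e_a, α_k⟩` of the flux of the one-form `α` tested with the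
frame section `e_a`. -/
def flux (p : U) (a : Fin (Module.finrank ℝ F)) (j : Fin n) (x : U) : ℝ :=
  ∑ k, volDensity n p x * (gram n p x)⁻¹ j k *
    inner ℝ (frame F V p a x) (α x (coordVec p x k))

/-- The value of `⟨e_a, d_A^* α⟩` in local coordinates, for `e_a` the local frame at `p`. -/
def adjointPairing (p : U) (a : Fin (Module.finrank ℝ F)) (x : U) : ℝ :=
  (∑ j, ∑ k, (gram n p x)⁻¹ j k *
    inner ℝ (A (frame F V p a) x (coordVec p x j)) (α x (coordVec p x k)))
    - (volDensity n p x)⁻¹ * ∑ j, coordDeriv p j (flux α p a j) x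

variable {α}

theorem contMDiffOn_inner_frame_form (hV : IsSmoothMetric n F V) (hα : IsSmoothForm F α) (p : U)
    (a : Fin (Module.finrank ℝ F)) (k : Fin n) : ContMDiffOn (𝓡 n) 𝓘(ℝ, ℝ) ∞
      (fun x => (inner ℝ (frame F V p a x) (α x (coordVec p x k)) : ℝ)) (frameDomain n F V p) :=
  hV.contMDiffOn_inner (isOpen_frameDomain p) (smoothSectionOn_frame p a)
    ((hα p k).mono inter_subset_left)

theorem contMDiffOn_flux (hV : IsSmoothMetric n F V) (hα : IsSmoothForm F α) (p : U)
    (a : Fin (Module.finrank ℝ F)) (j : Fin n) :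
    ContMDiffOn (𝓡 n) 𝓘(ℝ, ℝ) ∞ (flux α p a j) (frameDomain n F V p) :=
  contMDiffOn_finsetSum fun k _ => (((contMDiffOn_volDensity p).mono inter_subset_left).mul
    ((contMDiffOn_inv_gram p j k).mono inter_subset_left)).mul
      (contMDiffOn_inner_frame_form hV hα p a k)

theorem contMDiffOn_sum_inner_covDeriv_frame (hV : IsSmoothMetric n F V) (hα : IsSmoothForm F α)
    (p : U) (a : Fin (Module.finrank ℝ F)) :
    ContMDiffOn (𝓡 n) 𝓘(ℝ, ℝ) ∞ (fun x => ∑ j, ∑ k, (gram n p x)⁻¹ j k *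
      inner ℝ (A (frame F V p a) x (coordVec p x j)) (α x (coordVec p x k)))
      (frameDomain n F V p) :=
  contMDiffOn_finsetSum fun j _ => contMDiffOn_finsetSum fun k _ =>
    ((contMDiffOn_inv_gram p j k).mono inter_subset_left).mul
      (hV.contMDiffOn_inner (isOpen_frameDomain p)
        (smoothSectionOn_covDeriv A (isOpen_frameDomain p) (smoothSectionOn_frame p a)
          ((contMDiffOn_coordVec p j).mono inter_subset_left))
        ((hα p k).mono inter_subset_left))

theorem contMDiffOn_inv_volDensity (p : U) : ContMDiffOn (𝓡 n) 𝓘(ℝ, ℝ) ∞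
    (fun x => (volDensity n p x)⁻¹) (chartAt 𝔼 p).source :=
  contMDiffOn_inv (contMDiffOn_volDensity p) fun _ hx => (volDensity_pos hx).ne'

theorem contMDiffOn_adjointPairing (hV : IsSmoothMetric n F V) (hα : IsSmoothForm F α) (p : U)
    (a : Fin (Module.finrank ℝ F)) :
    ContMDiffOn (𝓡 n) 𝓘(ℝ, ℝ) ∞ (adjointPairing A α p a) (frameDomain n F V p) :=
  (contMDiffOn_sum_inner_covDeriv_frame A hV hα p a).sub
    (((contMDiffOn_inv_volDensity p).mono inter_subset_left).mul
      (contMDiffOn_finsetSum fun j _ => contMDiffOn_coordDeriv (isOpen_frameDomain p)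
        inter_subset_left (contMDiffOn_flux hV hα p a j) j))

/-- Integration by parts for sections that are multiples of one section of a local frame. -/
theorem integral_covInner_smul_frame (hV : IsSmoothMetric n F V) (hα : IsSmoothForm F α) {p : U}
    (a : Fin (Module.finrank ℝ F)) {ψ : U → ℝ} (hψ : ContMDiff (𝓡 n) 𝓘(ℝ, ℝ) ∞ ψ)
    (hc : HasCompactSupport ψ) (hs : tsupport ψ ⊆ frameDomain n F V p) :
    ∫ x, covInner x x (A (fun y => ψ y • frame F V p a y) x) (α x) ∂(riemannianVolume n U)
      = ∫ x, ψ x * adjointPairing A α p a x ∂(riemannianVolume n U) := by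
  have hO := isOpen_frameDomain (n := n) (F := F) (V := V) p
  set T : U → ℝ := fun x => ∑ j, ∑ k, (gram n p x)⁻¹ j k *
    inner ℝ (A (frame F V p a) x (coordVec p x j)) (α x (coordVec p x k)) with hT
  -- the Leibniz rule splits off the term in which `ψ` is differentiated, to be integrated by parts
  have h1 : ∀ x, covInner x x (A (fun y => ψ y • frame F V p a y) x) (α x)
      = ψ x * T x + ∑ j, (volDensity n p x)⁻¹ * (coordDeriv p j ψ x * flux α p a j x) := by
    intro x
    by_cases hx : x ∈ tsupport ψ
    · have hxp := hs hx
      rw [covInner_change (mem_chart_source 𝔼 x) hxp.1]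
      simp only [covInner, hT, flux, Finset.mul_sum, ← Finset.sum_add_distrib]
      refine Finset.sum_congr rfl fun j _ => Finset.sum_congr rfl fun k _ => ?_
      rw [covDeriv_smul A hO hxp (smoothSectionOn_frame p a) hψ.contMDiffOn, inner_add_left,
        real_inner_smul_left, real_inner_smul_left]
      have := (volDensity_pos (n := n) hxp.1).ne'
      unfold coordDeriv
      field_simp
    · rw [covDeriv_eq_zero_of_notMem A
        (smoothSectionOn_smul_of_tsupport hO (smoothSectionOn_frame p a) hψ hs)
        (fun h => hx (secSupport_smul_subset _ h)), covInner_zero_left,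
        image_eq_zero_of_notMem_tsupport hx]
      simp [coordDeriv_eq_zero_of_notMem_tsupport hx]
  have hTs : ContMDiffOn (𝓡 n) 𝓘(ℝ, ℝ) ∞ T (frameDomain n F V p) :=
    contMDiffOn_sum_inner_covDeriv_frame A hV hα p a
  have hd : ContMDiffOn (𝓡 n) 𝓘(ℝ, ℝ) ∞ (fun x => (volDensity n p x)⁻¹) (frameDomain n F V p) :=
    (contMDiffOn_inv_volDensity p).mono inter_subset_left
  have i1 : Integrable (fun x => ψ x * T x) (riemannianVolume n U) :=
    integrable_of_continuousOn_of_zero hO hc hs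
      (hψ.continuous.continuousOn.mul hTs.continuousOn) fun x hx => by
        rw [image_eq_zero_of_notMem_tsupport hx, zero_mul]
  have i2 : ∀ j, Integrable (fun x => (volDensity n p x)⁻¹ * (coordDeriv p j ψ x * flux α p a j x))
      (riemannianVolume n U) := fun j =>
    integrable_of_continuousOn_of_zero hO hc hs
      (hd.continuousOn.mul (((contMDiffOn_coordDeriv hO inter_subset_left hψ.contMDiffOn
        j).continuousOn).mul (contMDiffOn_flux hV hα p a j).continuousOn)) fun x hx => by
        rw [coordDeriv_eq_zero_of_notMem_tsupport hx, zero_mul, mul_zero]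
  have i3 : ∀ j, Integrable (fun x => (volDensity n p x)⁻¹ * (ψ x * coordDeriv p j (flux α p a j) x))
      (riemannianVolume n U) := fun j =>
    integrable_of_continuousOn_of_zero hO hc hs
      (hd.continuousOn.mul (hψ.continuous.continuousOn.mul
        (contMDiffOn_coordDeriv hO inter_subset_left (contMDiffOn_flux hV hα p a j)
        j).continuousOn)) fun x hx => by
        rw [image_eq_zero_of_notMem_tsupport hx, zero_mul, mul_zero]
  simp only [h1]
  rw [integral_add i1 (integrable_finsetSum _ fun j _ => i2 j), integral_finsetSum _ fun j _ => i2 j]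
  simp only [integral_coordDeriv_mul hO inter_subset_left hψ hc hs (contMDiffOn_flux hV hα p a _)]
  rw [Finset.sum_neg_distrib, ← integral_finsetSum _ fun j _ => i3 j, ← sub_eq_add_neg,
    ← integral_sub i1 (integrable_finsetSum _ fun j _ => i3 j)]
  refine integral_congr_ae (ae_of_all _ fun x => ?_)
  simp only [adjointPairing, hT]
  rw [mul_sub, Finset.mul_sum _ _ (volDensity n p x)⁻¹, Finset.mul_sum _ _ (ψ x)]
  congr 1
  rw [Finset.mul_sum]
  exact Finset.sum_congr rfl fun j _ => by ring

/-- The section `w` is `d_A^* α` in the weak sense, for the real inner products. -/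
def IsRealAdjoint (α : Π x, TangentSpace (𝓡 n) x →L[ℝ] V x) (w : Π x, V x) : Prop :=
  SmoothSectionOn n F w univ ∧ ∀ v : Π x, V x, SmoothSectionOn n F v univ →
    IsCompact (secSupport v) → ∫ x, (inner ℝ (v x) (w x) : ℝ) ∂(riemannianVolume n U)
      = ∫ x, covInner x x (A v x) (α x) ∂(riemannianVolume n U)

/-- On an open set, inner products with a frame section are determined by testing. -/
theorem inner_frame_eq_adjointPairing_of_test (hV : IsSmoothMetric n F V) (hα : IsSmoothForm F α)
    {w : Π x, V x} {p : U} {N : Set U} (hN : IsOpen N) (hNp : N ⊆ frameDomain n F V p)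
    (hw : SmoothSectionOn n F w N) (a : Fin (Module.finrank ℝ F))
    (h : ∀ ψ : U → ℝ, ContMDiff (𝓡 n) 𝓘(ℝ, ℝ) ∞ ψ → HasCompactSupport ψ → tsupport ψ ⊆ N →
      ∫ x, (inner ℝ (ψ x • frame F V p a x) (w x) : ℝ) ∂(riemannianVolume n U)
      = ∫ x, covInner x x (A (fun y => ψ y • frame F V p a y) x) (α x) ∂(riemannianVolume n U)) :
    ∀ x ∈ N, inner ℝ (frame F V p a x) (w x) = adjointPairing A α p a x := by
  have hs1 : ContMDiffOn (𝓡 n) 𝓘(ℝ, ℝ) ∞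
      (fun x => (inner ℝ (frame F V p a x) (w x) : ℝ)) N :=
    hV.contMDiffOn_inner hN ((smoothSectionOn_frame p a).mono hNp) hw
  have hs2 := (contMDiffOn_adjointPairing A hV hα p a).mono hNp
  have := eq_zero_of_forall_integral_mul_eq_zero hN (hs1.sub hs2) fun ψ hψ hc hs => ?_
  · intro x hx
    exact sub_eq_zero.1 (this x hx)
  · have h1 := h ψ hψ hc hs
    rw [integral_covInner_smul_frame A hV hα a hψ hc (hs.trans hNp)] at h1
    simp only [real_inner_smul_left] at h1
    have i1 : Integrable (fun x => ψ x * inner ℝ (frame F V p a x) (w x))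
        (riemannianVolume n U) :=
      integrable_of_continuousOn_of_zero hN hc hs
        (hψ.continuous.continuousOn.mul hs1.continuousOn) fun x hx => by
          rw [image_eq_zero_of_notMem_tsupport hx, zero_mul]
    have i2 : Integrable (fun x => ψ x * adjointPairing A α p a x) (riemannianVolume n U) :=
      integrable_of_continuousOn_of_zero hN hc hs
        (hψ.continuous.continuousOn.mul hs2.continuousOn) fun x hx => by
          rw [image_eq_zero_of_notMem_tsupport hx, zero_mul]
    rw [← sub_eq_zero, ← integral_sub i1 i2] at h1
    rw [← h1]
    exact integral_congr_ae (ae_of_all _ fun x => by simp [mul_sub])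

/-- A weak adjoint is given by the coordinate formula. -/
theorem IsRealAdjoint.inner_frame_eq (hV : IsSmoothMetric n F V) (hα : IsSmoothForm F α)
    {w : Π x, V x} (hw : IsRealAdjoint A α w) {p x : U} (hx : x ∈ frameDomain n F V p)
    (a : Fin (Module.finrank ℝ F)) :
    inner ℝ (frame F V p a x) (w x) = adjointPairing A α p a x :=
  inner_frame_eq_adjointPairing_of_test A hV hα (isOpen_frameDomain p) subset_rfl
    (hw.1.mono (subset_univ _)) a (fun _ hψ hc hs => hw.2 _
      (smoothSectionOn_smul_of_tsupport (isOpen_frameDomain p) (smoothSectionOn_frame p a) hψ hs)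
      (hc.of_isClosed_subset isClosed_closure (secSupport_smul_subset _))) x hx

variable (α) in
/-- The section `d_A^* α` computed in the coordinates and the frame at `p`. -/
def localAdjoint (p x : U) : V x := dualCombination V p x fun a => adjointPairing A α p a x

theorem smoothSectionOn_localAdjoint (hV : IsSmoothMetric n F V) (hα : IsSmoothForm F α) (p : U) :
    SmoothSectionOn n F (localAdjoint A α p) (frameDomain n F V p) :=
  ContMDiffOn.sum_section (s := Finset.univ) (t := fun a x =>
    (∑ b, (frameGram F V p x)⁻¹ a b * adjointPairing A α p b x) • frame F V p a x)
    fun a _ => ContMDiffOn.smul_section (contMDiffOn_finsetSum fun b _ =>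
      (contMDiffOn_inv_frameGram hV p a b).mul (contMDiffOn_adjointPairing A hV hα p b))
      (smoothSectionOn_frame p a)

/-- The local formula has the defining property of the adjoint for sections supported in the domain
of the frame. -/
theorem integral_inner_localAdjoint (hV : IsSmoothMetric n F V) (hα : IsSmoothForm F α) {p : U}
    {v : Π x, V x} (hv : SmoothSectionOn n F v univ) (hc : IsCompact (secSupport v))
    (hs : secSupport v ⊆ frameDomain n F V p) :
    ∫ x, (inner ℝ (v x) (localAdjoint A α p x) : ℝ) ∂(riemannianVolume n U)
      = ∫ x, covInner x x (A v x) (α x) ∂(riemannianVolume n U) := by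
  have hO := isOpen_frameDomain (n := n) (F := F) (V := V) p
  set ψ : Fin (Module.finrank ℝ F) → U → ℝ := fun b x => frameCoeff n F V p b x (v x) with hψ
  have hψ0 : ∀ b, ∀ x ∉ secSupport v, ψ b x = 0 := fun b x hx => by
    simp [hψ, eq_zero_of_notMem_secSupport hx]
  have hψs : ∀ b, ContMDiff (𝓡 n) 𝓘(ℝ, ℝ) ∞ (ψ b) := fun b =>
    contMDiff_of_contMDiffOn_of_zero hO hc hs
      (contMDiffOn_frameCoeff b hO subset_rfl (hv.mono (subset_univ _))) (hψ0 b)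
  have hψt : ∀ b, tsupport (ψ b) ⊆ secSupport v := fun b =>
    closure_minimal (fun x hx => by
      by_contra h
      exact hx (hψ0 b x h)) isClosed_closure
  have hψc : ∀ b, HasCompactSupport (ψ b) := fun b =>
    hc.of_isClosed_subset (isClosed_tsupport _) (hψt b)
  have hsum : v = fun x => ∑ b, ψ b x • frame F V p b x := by
    funext x
    by_cases hx : x ∈ secSupport v
    · exact eq_sum_frameCoeff (hs hx) (v x)
    · simp [hψ0 _ x hx, eq_zero_of_notMem_secSupport hx]
  have hsm : ∀ b, SmoothSectionOn n F (fun x => ψ b x • frame F V p b x) univ := fun b =>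
    smoothSectionOn_smul_of_tsupport hO (smoothSectionOn_frame p b) (hψs b) ((hψt b).trans hs)
  have hcb : ∀ b, IsCompact (secSupport fun x => ψ b x • frame F V p b x) := fun b =>
    (hψc b).of_isClosed_subset isClosed_closure (secSupport_smul_subset _)
  have hA : ∀ x, covInner x x (A v x) (α x)
      = ∑ b, covInner x x (A (fun y => ψ b y • frame F V p b y) x) (α x) := by
    intro x
    rw [← covInner_sum_left, ← covDeriv_sum A isOpen_univ (mem_univ x) fun b _ => hsm b, ← hsum]
  have hI : ∀ x, (inner ℝ (v x) (localAdjoint A α p x) : ℝ)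
      = ∑ b, ψ b x * adjointPairing A α p b x := by
    intro x
    by_cases hx : x ∈ secSupport v
    · have : v x = ∑ b, ψ b x • frame F V p b x := congrFun hsum x
      rw [this, sum_inner]
      refine Finset.sum_congr rfl fun b _ => ?_
      rw [real_inner_smul_left, localAdjoint, inner_frame_dualCombination (hs hx)]
    · simp [hψ0 _ x hx, eq_zero_of_notMem_secSupport hx]
  simp only [hA, hI]
  rw [integral_finsetSum _ fun b _ => integrable_covInner A hV hα (hsm b) (hcb b),
    integral_finsetSum (f := fun b x => ψ b x * adjointPairing A α p b x) _ fun b _ =>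
      integrable_of_continuousOn_of_zero hO hc hs
      ((hψs b).continuous.continuousOn.mul (contMDiffOn_adjointPairing A hV hα p b).continuousOn)
      fun x hx => by rw [hψ0 b x hx, zero_mul]]
  exact Finset.sum_congr rfl fun b _ =>
    (integral_covInner_smul_frame A hV hα b (hψs b) (hψc b) ((hψt b).trans hs)).symm

/-- The local formulas for `d_A^* α` agree on overlaps, because both are determined by testing. -/
theorem localAdjoint_eq (hV : IsSmoothMetric n F V) (hα : IsSmoothForm F α) {p q x : U}
    (hp : x ∈ frameDomain n F V p) (hq : x ∈ frameDomain n F V q) :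
    localAdjoint A α p x = localAdjoint A α q x := by
  refine eq_of_inner_frame_eq hp fun a => ?_
  rw [localAdjoint, inner_frame_dualCombination hp]
  have hN := (isOpen_frameDomain (n := n) (F := F) (V := V) p).inter (isOpen_frameDomain (n := n) (F := F) (V := V) q)
  refine (inner_frame_eq_adjointPairing_of_test A hV hα hN inter_subset_left
    ((smoothSectionOn_localAdjoint A hV hα q).mono inter_subset_right) a
    (fun ψ hψ hc hs => ?_) x ⟨hp, hq⟩).symm
  exact integral_inner_localAdjoint A hV hα
    (smoothSectionOn_smul_of_tsupport (isOpen_frameDomain (n := n) (F := F) (V := V) p)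
      (smoothSectionOn_frame p a) hψ (hs.trans inter_subset_left))
    (hc.of_isClosed_subset isClosed_closure (secSupport_smul_subset _))
    ((secSupport_smul_subset _).trans (hs.trans inter_subset_right))

/-- The formal adjoint of a connection exists on smooth one-forms: the local formulas glue, and test
sections are decomposed by a partition of unity. -/
theorem exists_isRealAdjoint (hV : IsSmoothMetric n F V) (hα : IsSmoothForm F α) :
    ∃ w, IsRealAdjoint A α w := by
  have hw : ∀ p : U, ∀ x ∈ frameDomain n F V p, localAdjoint A α x x = localAdjoint A α p x :=
    fun p x hx => localAdjoint_eq A hV hα (mem_frameDomain x) hx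
  have hws : SmoothSectionOn n F (fun x => localAdjoint A α x x) univ := by
    rw [SmoothSectionOn, contMDiffOn_univ]
    intro p
    have hp := (isOpen_frameDomain (n := n) (F := F) (V := V) p).mem_nhds (mem_frameDomain p)
    refine ((smoothSectionOn_localAdjoint A hV hα p).contMDiffAt hp).congr_of_eventuallyEq ?_
    exact eventually_of_mem hp fun x hx => by simp only [hw p x hx]
  refine ⟨fun x => localAdjoint A α x x, hws, fun v hv hc => ?_⟩
  obtain ⟨ρ, hρ⟩ := SmoothPartitionOfUnity.exists_isSubordinate (𝓡 n) isClosed_univ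
    (fun p : U => frameDomain n F V p) (fun p => isOpen_frameDomain p)
    (fun x _ => mem_iUnion.2 ⟨x, mem_frameDomain x⟩)
  have hfin := ρ.locallyFinite.finite_nonempty_inter_compact hc
  set S := hfin.toFinset with hS
  have hρ0 : ∀ i ∉ S, ∀ x ∈ secSupport v, ρ i x = 0 := by
    intro i hi x hx
    by_contra h
    exact hi (hfin.mem_toFinset.2 ⟨x, h, hx⟩)
  have hsum : v = fun x => ∑ i ∈ S, ρ i x • v x := by
    funext x
    by_cases hx : x ∈ secSupport v
    · rw [← Finset.sum_smul]
      have h1 := ρ.sum_eq_one (mem_univ x)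
      rw [finsum_eq_sum_of_support_subset (s := S) _ fun i hi => by
        by_contra h
        exact hi (hρ0 i h x hx)] at h1
      rw [h1, one_smul]
    · simp [eq_zero_of_notMem_secSupport hx]
  have hsm : ∀ i, SmoothSectionOn n F (fun x => ρ i x • v x) univ := fun i =>
    smoothSectionOn_smul_of_tsupport isOpen_univ hv (ρ i).contMDiff (subset_univ _)
  have hsub : ∀ i, secSupport (fun x => ρ i x • v x) ⊆ secSupport v := fun i =>
    closure_mono fun x hx h => hx (by
      change ρ i x • v x = 0
      rw [h, smul_zero])
  have hci : ∀ i, IsCompact (secSupport fun x => ρ i x • v x) := fun i =>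
    hc.of_isClosed_subset isClosed_closure (hsub i)
  have hsi : ∀ i, secSupport (fun x => ρ i x • v x) ⊆ frameDomain n F V i := fun i =>
    (secSupport_smul_subset _).trans (hρ i)
  have hA : ∀ x, covInner x x (A v x) (α x)
      = ∑ i ∈ S, covInner x x (A (fun y => ρ i y • v y) x) (α x) := by
    intro x
    rw [← covInner_sum_left, ← covDeriv_sum A isOpen_univ (mem_univ x) fun b _ => hsm b, ← hsum]
  have hI : ∀ x, (inner ℝ (v x) (localAdjoint A α x x) : ℝ)
      = ∑ i ∈ S, inner ℝ (ρ i x • v x) (localAdjoint A α x x) := by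
    intro x
    rw [← sum_inner, ← congrFun hsum x]
  simp only [hA, hI]
  rw [integral_finsetSum _ fun b _ => integrable_covInner A hV hα (hsm b) (hci b),
    integral_finsetSum _ fun b _ => integrable_inner_section hV isOpen_univ (hsm b) hws (hci b)
      (subset_univ _)]
  refine Finset.sum_congr rfl fun i _ => ?_
  rw [← integral_inner_localAdjoint A hV hα (hsm i) (hci i) (hsi i)]
  refine integral_congr_ae (ae_of_all _ fun x => ?_)
  by_cases hx : x ∈ secSupport fun x => ρ i x • v x
  · simp only [hw i x (hsi i hx)]
  · have := eq_zero_of_notMem_secSupport hx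
    simp only [this, inner_zero_left]

end Adjoint

/-! ### The Carleman estimate in a chart -/

section ConformalLaplacian
variable {n : ℕ} {U : Type*} [TopologicalSpace U] [ChartedSpace (EuclideanSpace ℝ (Fin n)) U]
  [IsManifold (𝓡 n) ∞ U]
  [RiemannianBundle (fun x : U => TangentSpace (𝓡 n) x)]
local notation "𝔼" => EuclideanSpace ℝ (Fin n)

variable (n) in
/-- The squared norm `|dφ|²` of the differential, in the coordinates of the chart at `p`. -/
def gradNormSq (p : U) (φ : U → ℝ) (x : U) : ℝ :=
  ∑ j : Fin n, ∑ k : Fin n, (gram n p x)⁻¹ j k * coordDeriv p j φ x * coordDeriv p k φ x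

/-- The inverse of the conformal metric `|dφ|² g`, for which `dφ` has length one. -/
def confMetric (p : U) (φ : U → ℝ) (j k : Fin n) (x : U) : ℝ :=
  (gradNormSq n p φ x)⁻¹ * (gram n p x)⁻¹ j k

variable (n) in
/-- The operator `∂_j (γ^{jk} ∂_k f)`, where `γ` is the inverse of the conformal metric. Without the
factors of the volume density, it has the principal part of the Laplacian of the conformal metric,
up to sign, and depends on the chart in the first-order terms. -/
def confLap (p : U) (φ f : U → ℝ) (x : U) : ℝ :=
  ∑ j : Fin n, coordDeriv p j (fun y => ∑ k, confMetric p φ j k y * coordDeriv p k f y) x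

/-- The inverse metric is bounded below by the reciprocal of the trace of the metric. -/
theorem sum_inv_gram_mul_le {p x : U} (hx : x ∈ (chartAt 𝔼 p).source) (ξ : Fin n → ℝ) :
    ∑ j, ξ j ^ 2 ≤ (∑ j, gram n p x j j) *
      ∑ j, ∑ k, (gram n p x)⁻¹ j k * ξ j * ξ k := by
  rw [Finset.sum_mul]
  refine Finset.sum_le_sum fun i _ => ?_
  have h := norm_sum_smul_sq_le (posDef_gram hx) ξ (Pi.single i 1)
  have e1 : ∑ j, (Pi.single i 1 : Fin n → ℝ) j • ξ j = ξ i := by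
    simp [Pi.single_apply]
  have e2 : ∑ j, ∑ k, gram n p x j k * (Pi.single i 1 : Fin n → ℝ) j *
      (Pi.single i 1 : Fin n → ℝ) k = gram n p x i i := by
    simp [Pi.single_apply]
  have e3 : ∀ j k, (gram n p x)⁻¹ j k * inner ℝ (ξ j) (ξ k) = (gram n p x)⁻¹ j k * ξ j * ξ k := by
    intro j k
    simp only [RCLike.inner_apply, conj_trivial]
    ring
  simp only [e3] at h
  rwa [e1, e2, Real.norm_eq_abs, sq_abs] at h

theorem gradNormSq_pos {φ : U → ℝ} (hφ : ∀ x, mfderiv (𝓡 n) 𝓘(ℝ, ℝ) φ x ≠ 0) {p x : U}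
    (hx : x ∈ (chartAt 𝔼 p).source) : 0 < gradNormSq n p φ x := by
  have e : gradNormSq n p φ x = covInner p x (mvfderiv (𝓡 n) φ x) (mvfderiv (𝓡 n) φ x) := by
    unfold gradNormSq covInner coordDeriv
    refine Finset.sum_congr rfl fun j _ => Finset.sum_congr rfl fun k _ => ?_
    simp only [RCLike.inner_apply, conj_trivial]
    ring
  rw [e]
  refine lt_of_le_of_ne (covInner_self_nonneg hx _) fun h => hφ x ?_
  have h1 : mvfderiv (𝓡 n) φ x = 0 := by
    ext v
    have := norm_apply_sq_le hx (mvfderiv (𝓡 n) φ x) v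
    rw [← h, mul_zero] at this
    simpa using this
  exact h1

theorem inv_gram_symm {p x : U} (hx : x ∈ (chartAt 𝔼 p).source) (j k : Fin n) :
    (gram n p x)⁻¹ j k = (gram n p x)⁻¹ k j := by
  have := (posDef_gram (n := n) hx).inv.isHermitian.apply j k
  simpa using this.symm

end ConformalLaplacian

section LocalCarleman
variable {n : ℕ} {U : Type*} [TopologicalSpace U] [ChartedSpace (EuclideanSpace ℝ (Fin n)) U]
  [IsManifold (𝓡 n) ∞ U]
  [RiemannianBundle (fun x : U => TangentSpace (𝓡 n) x)]
  [IsContMDiffRiemannianBundle (𝓡 n) ∞ (EuclideanSpace ℝ (Fin n))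
    (fun x : U => TangentSpace (𝓡 n) x)] [MeasurableSpace U] [BorelSpace U]
  [T2Space U] [SigmaCompactSpace U]
local notation "𝔼" => EuclideanSpace ℝ (Fin n)

theorem contMDiffOn_gradNormSq {φ : U → ℝ} (hφ : ContMDiff (𝓡 n) 𝓘(ℝ, ℝ) ∞ φ) (p : U) :
    ContMDiffOn (𝓡 n) 𝓘(ℝ, ℝ) ∞ (gradNormSq n p φ) (chartAt 𝔼 p).source :=
  contMDiffOn_finsetSum fun j _ => contMDiffOn_finsetSum fun k _ =>
    ((contMDiffOn_inv_gram p j k).mul (contMDiffOn_coordDeriv (chartAt 𝔼 p).open_source subset_rfl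
      hφ.contMDiffOn j)).mul (contMDiffOn_coordDeriv (chartAt 𝔼 p).open_source subset_rfl
      hφ.contMDiffOn k)

theorem contMDiffOn_confMetric {φ : U → ℝ} (hφ : IsLCW n φ) (p : U) (j k : Fin n) :
    ContMDiffOn (𝓡 n) 𝓘(ℝ, ℝ) ∞ (confMetric p φ j k) (chartAt 𝔼 p).source :=
  (contMDiffOn_inv (contMDiffOn_gradNormSq hφ.contMDiff p) fun _ hx =>
    (gradNormSq_pos hφ.mfderiv_ne_zero hx).ne').mul (contMDiffOn_inv_gram p j k)

theorem contMDiffOn_confLap {φ : U → ℝ} (hφ : IsLCW n φ) (p : U) {f : U → ℝ}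
    (hf : ContMDiff (𝓡 n) 𝓘(ℝ, ℝ) ∞ f) :
    ContMDiffOn (𝓡 n) 𝓘(ℝ, ℝ) ∞ (confLap n p φ f) (chartAt 𝔼 p).source :=
  contMDiffOn_finsetSum fun j _ => contMDiffOn_coordDeriv (chartAt 𝔼 p).open_source subset_rfl
    (contMDiffOn_finsetSum fun k _ => (contMDiffOn_confMetric hφ p j k).mul
      (contMDiffOn_coordDeriv (chartAt 𝔼 p).open_source subset_rfl hf.contMDiffOn k)) j

theorem confLap_eq_zero_of_notMem_tsupport {p : U} {φ f : U → ℝ} {x : U} (hx : x ∉ tsupport f) :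
    confLap n p φ f x = 0 := by
  have h : ∀ᶠ y in 𝓝 x, y ∉ tsupport f := (isClosed_tsupport f).isOpen_compl.mem_nhds hx
  refine Finset.sum_eq_zero fun j _ => ?_
  rw [coordDeriv_congr (g := fun _ => (0 : ℝ)) (h.mono fun y hy => Finset.sum_eq_zero fun k _ => by
    rw [coordDeriv_eq_zero_of_notMem_tsupport hy, mul_zero]), coordDeriv_const]

/-- Lebesgue integrals in a chart as integrals for the Riemannian volume. -/
theorem integral_inv_volDensity_mul (p : U) {F : U → ℝ}
    (hF : ContinuousOn F (chartAt 𝔼 p).source) {G : 𝔼 → ℝ} (hF0 : ∀ x ∉ (chartAt 𝔼 p).source, F x = 0)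
    (hG : ∀ z ∈ (chartAt 𝔼 p).target, G z = F ((chartAt 𝔼 p).symm z))
    (hG0 : ∀ z ∉ (chartAt 𝔼 p).target, G z = 0) :
    ∫ x, (volDensity n p x)⁻¹ * F x ∂(riemannianVolume n U) = ∫ z, G z := by
  rw [integral_eq_integral_chart p (f := fun x => (volDensity n p x)⁻¹ * F x)
    ((contMDiffOn_inv_volDensity p).continuousOn.mul hF) fun x hx => by rw [hF0 x hx, mul_zero],
    ← setIntegral_eq_integral_of_forall_compl_eq_zero hG0]
  refine setIntegral_congr_fun (chartAt 𝔼 p).open_target.measurableSet fun z hz => ?_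
  rw [hG z hz, ← mul_assoc, mul_inv_cancel₀ (volDensity_pos ((chartAt 𝔼 p).map_target hz)).ne',
    one_mul]

theorem exists_pos_bounds_of_continuousOn {K N : Set U} (hK : IsCompact K) (hKN : K ⊆ N) {f : U → ℝ}
    (hf : ContinuousOn f N) (hpos : ∀ x ∈ N, 0 < f x) :
    ∃ c₁ c₂ : ℝ, 0 < c₁ ∧ 0 < c₂ ∧ ∀ x ∈ K, c₁ ≤ f x ∧ f x ≤ c₂ := by
  rcases K.eq_empty_or_nonempty with rfl | hne
  · exact ⟨1, 1, one_pos, one_pos, by simp⟩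
  obtain ⟨y, hy, hy'⟩ := hK.exists_isMinOn hne (hf.mono hKN)
  obtain ⟨z, hz, hz'⟩ := hK.exists_isMaxOn hne (hf.mono hKN)
  exact ⟨f y, f z, hpos y (hKN hy), hpos z (hKN hz), fun x hx => ⟨hy' hx, hz' hx⟩⟩

/-- The Carleman estimate for scalar functions supported in a fixed compact subset of a chart. It is
the Euclidean estimate for the conformal cometric, which is admissible by the bracket condition. The
coefficients are cut off to be defined on all of `ℝⁿ`. -/
theorem carleman_estimate_chart {φ : U → ℝ} (hφ : IsLCW n φ) (p : U) {K : Set U} (hK : IsCompact K)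
    (hKp : K ⊆ (chartAt 𝔼 p).source) :
    ∃ C : ℝ, 0 < C ∧ ∀ ε : ℝ, 0 < ε → ε ≤ 1 → ∃ τ₀ : ℝ, 1 ≤ τ₀ ∧ ∀ τ, τ₀ ≤ τ →
      ∀ f : U → ℝ, ContMDiff (𝓡 n) 𝓘(ℝ, ℝ) ∞ f → tsupport f ⊆ K →
        ∫ x, carlemanWeight ε τ (φ x) ^ 2 * (τ ^ 2 * f x ^ 2 + ∑ j : Fin n, coordDeriv p j f x ^ 2)
          ∂(riemannianVolume n U)
        ≤ C * ε * ∫ x, carlemanWeight ε τ (φ x) ^ 2 * confLap n p φ f x ^ 2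
          ∂(riemannianVolume n U) := by
  obtain ⟨θ, hθ, hθc, hθs, hθ1, -⟩ := exists_smooth_cutoff n hK (chartAt 𝔼 p).open_source hKp
  obtain ⟨O₁, hO₁, hKO₁, hθO₁⟩ := eventually_nhdsSet_iff_exists.1 hθ1
  have hO₁θ : O₁ ⊆ tsupport θ := fun x hx => subset_tsupport _ (by
    rw [Function.mem_support, hθO₁ x hx]
    exact one_ne_zero)
  have hO₁s : O₁ ⊆ (chartAt 𝔼 p).source := hO₁θ.trans hθs
  set O : Set 𝔼 := (chartAt 𝔼 p).target ∩ (chartAt 𝔼 p).symm ⁻¹' O₁ with hOdef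
  have hO : IsOpen O := (chartAt 𝔼 p).isOpen_inter_preimage_symm hO₁
  have hpos := fun x (hx : x ∈ (chartAt 𝔼 p).source) => gradNormSq_pos hφ.mfderiv_ne_zero hx
  -- the coefficients and the phase, cut off in the chart
  have hcut : ∀ {g : U → ℝ}, ContMDiffOn (𝓡 n) 𝓘(ℝ, ℝ) ∞ g (chartAt 𝔼 p).source →
      ContDiff ℝ ∞ (pull n p fun x => θ x * g x) ∧
      HasCompactSupport (pull n p fun x => θ x * g x) := fun {g} hg =>
    have hs : tsupport (fun x => θ x * g x) ⊆ (chartAt 𝔼 p).source :=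
      (tsupport_mul_subset_left).trans hθs
    ⟨contDiff_pull (f := fun x => θ x * g x) (hθ.contMDiffOn.mul hg) hθc.mul_right hs,
      hasCompactSupport_pull (f := fun x => θ x * g x) hθc.mul_right hs⟩
  have hcutO : ∀ (g : U → ℝ), ∀ z ∈ O,
      (pull n p fun x => θ x * g x) z = g ((chartAt 𝔼 p).symm z) := fun g z hz => by
    rw [pull_apply _ hz.1, hθO₁ _ hz.2, one_mul]
  have hcutd : ∀ {g : U → ℝ}, ContMDiffOn (𝓡 n) 𝓘(ℝ, ℝ) ∞ g O₁ → ∀ z ∈ O, ∀ j,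
      ∀ G : 𝔼 → ℝ, (∀ y ∈ O, G y = g ((chartAt 𝔼 p).symm y)) →
      pderiv j G z = coordDeriv p j g ((chartAt 𝔼 p).symm z) := by
    intro g hg z hz j G hG
    rw [coordDeriv, ← pderiv_pull hz.1 (ContMDiffOn.mdifferentiableAt_of_isOpen hg hO₁ hz.2)]
    refine pderiv_congr (eventually_of_mem (hO.mem_nhds hz) fun y hy => ?_) j
    rw [hG y hy, pull_apply _ hy.1]
  set a : Fin n → Fin n → 𝔼 → ℝ := fun j k => pull n p fun x => θ x * confMetric p φ j k x with ha
  set φ' : 𝔼 → ℝ := pull n p fun x => θ x * φ x with hφ'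
  have haO : ∀ j k, ∀ z ∈ O, a j k z = confMetric p φ j k ((chartAt 𝔼 p).symm z) :=
    fun j k z hz => hcutO _ z hz
  have hφO : ∀ z ∈ O, φ' z = φ ((chartAt 𝔼 p).symm z) := fun z hz => hcutO _ z hz
  have hdφO : ∀ z ∈ O, ∀ j, pderiv j φ' z = coordDeriv p j φ ((chartAt 𝔼 p).symm z) :=
    fun z hz j => hcutd hφ.contMDiff.contMDiffOn z hz j φ' hφO
  have hsymm : ∀ j k, a j k = a k j := by
    intro j k
    funext z
    by_cases hz : z ∈ (chartAt 𝔼 p).target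
    · simp only [ha]
      rw [pull_apply _ hz, pull_apply _ hz, confMetric, confMetric,
        inv_gram_symm ((chartAt 𝔼 p).map_target hz)]
    · simp only [ha, pull]
      rw [indicator_of_notMem hz, indicator_of_notMem hz]
  have haC : ∀ j k, ContDiff ℝ ∞ (a j k) := fun j k => (hcut (contMDiffOn_confMetric hφ p j k)).1
  have haS : ∀ j k, HasCompactSupport (a j k) :=
    fun j k => (hcut (contMDiffOn_confMetric hφ p j k)).2
  have hφC : ContDiff ℝ ∞ φ' := (hcut hφ.contMDiff.contMDiffOn).1
  have hφS : HasCompactSupport φ' := (hcut hφ.contMDiff.contMDiffOn).2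
  clear_value a φ'
  -- in the conformal metric the gradient of the weight has unit length
  have hb : ∀ z ∈ O, ∑ k, gradField a φ' k z * pderiv k φ' z = 1 := by
    intro z hz
    have hx := hO₁s hz.2
    rw [← inv_mul_cancel₀ (hpos _ hx).ne', gradNormSq, Finset.mul_sum]
    refine Finset.sum_congr rfl fun k _ => ?_
    rw [gradField, Finset.sum_mul, Finset.mul_sum]
    refine Finset.sum_congr rfl fun j _ => ?_
    rw [haO k j z hz, hdφO z hz, hdφO z hz, confMetric, gradNormSq]
    ring
  -- uniform ellipticity on the support of the cutoff function
  obtain ⟨B, hB⟩ := hθc.exists_bound_of_continuousOn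
    (f := fun x => (∑ j, gram n p x j j) * gradNormSq n p φ x)
    ((continuousOn_finsetSum _ fun j _ => (contMDiffOn_gram p j j).continuousOn.mono hθs).mul
      ((contMDiffOn_gradNormSq hφ.contMDiff p).continuousOn.mono hθs))
  have hell : ∀ z ∈ O, ∀ ξ : Fin n → ℝ,
      (|B| + 1)⁻¹ * ∑ j, ξ j ^ 2 ≤ ∑ j, ∑ k, a j k z * ξ j * ξ k := by
    intro z hz ξ
    have hx := hO₁s hz.2
    have h1 := sum_inv_gram_mul_le hx ξ
    have h2 : ∑ j, ∑ k, (gram n p ((chartAt 𝔼 p).symm z))⁻¹ j k * ξ j * ξ k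
        = gradNormSq n p φ ((chartAt 𝔼 p).symm z) * ∑ j, ∑ k, a j k z * ξ j * ξ k := by
      simp only [Finset.mul_sum]
      refine Finset.sum_congr rfl fun j _ => Finset.sum_congr rfl fun k _ => ?_
      rw [haO j k z hz, confMetric]
      have := (hpos _ hx).ne'
      field_simp
    rw [h2, ← mul_assoc] at h1
    have h3 : 0 ≤ ∑ j, ∑ k, a j k z * ξ j * ξ k := by
      have h4 := posSemidef_sum_inner_nonneg (posDef_gram hx).inv.posSemidef ξ
      have h5 : 0 ≤ ∑ j, ∑ k, (gram n p ((chartAt 𝔼 p).symm z))⁻¹ j k * ξ j * ξ k := by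
        refine h4.trans_eq (Finset.sum_congr rfl fun j _ => Finset.sum_congr rfl fun k _ => ?_)
        simp only [RCLike.inner_apply, conj_trivial]
        ring
      rw [h2] at h5
      exact nonneg_of_mul_nonneg_right h5 (hpos _ hx)
    have h6 := hB _ (hO₁θ hz.2)
    have h7 : (∑ j, gram n p ((chartAt 𝔼 p).symm z) j j) *
        gradNormSq n p φ ((chartAt 𝔼 p).symm z) ≤ |B| + 1 :=
      (le_abs_self _).trans (h6.trans ((le_abs_self B).trans (by linarith)))
    rw [inv_mul_le_iff₀ (by positivity)]
    exact h1.trans (mul_le_mul_of_nonneg_right h7 h3)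
  -- the Hessian of the weight vanishes; the conformal factor is `|dφ|²`
  have hH : ∀ z ∈ O, ∀ ξ, lieForm a (gradField a φ') z ξ = 0 := by
    intro z hz ξ
    refine lieForm_eq_zero_of_bracket (N := fun z => gradNormSq n p φ ((chartAt 𝔼 p).symm z))
      (p := conjSymbol φ p)
      haC hsymm hφC hO hb (fun z hz ξ hξ => ?_) (fun z hz => ?_)
      (fun z hz => (hpos _ (hO₁s hz.2)).ne') (fun y hy η => ?_) (fun z hz ξ h0 => ?_) hz ξ
    · refine lt_of_lt_of_le ?_ (hell z hz ξ)
      obtain ⟨i, hi⟩ := Function.ne_iff.1 hξ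
      have : 0 < ∑ j, ξ j ^ 2 := Finset.sum_pos' (fun j _ => sq_nonneg _)
        ⟨i, Finset.mem_univ i, by
          have : ξ i ≠ 0 := hi
          positivity⟩
      positivity
    · exact ((contDiffOn_comp_chart_symm (contMDiffOn_gradNormSq hφ.contMDiff p)).contDiffAt
        ((chartAt 𝔼 p).open_target.mem_nhds hz.1)).differentiableAt (by simp)
    · have hx := hO₁s hy.2
      unfold conjSymbol
      simp only [Finset.mul_sum]
      refine Finset.sum_congr rfl fun j _ => Finset.sum_congr rfl fun k _ => ?_
      have hd : ∀ j, pderiv j (fun z' => φ ((chartAt 𝔼 p).symm z')) y = pderiv j φ' y := by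
        intro j
        exact pderiv_congr (eventually_of_mem (hO.mem_nhds hy) fun y' hy' => (hφO y' hy').symm) j
      change (((gram n p ((chartAt 𝔼 p).symm y))⁻¹ j k : ℝ) : ℂ) * _ * _ = _
      rw [hd, hd, haO j k y hy, confMetric]
      have h1 : ((gradNormSq n p φ ((chartAt 𝔼 p).symm y) : ℝ) : ℂ) ≠ 0 := by
        exact_mod_cast (hpos _ hx).ne'
      push_cast
      field_simp
    · exact hφ.bracket p z hz.1 ξ h0
  obtain ⟨C, hC, hcarl⟩ := carleman_estimate_euclidean haC haS hsymm hφC hφS hb hH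
    (c := (|B| + 1)⁻¹) (by positivity) hell
  -- on `K` the Lebesgue measure of the chart is comparable to the Riemannian volume
  obtain ⟨c₁, c₂, hc₁, hc₂, hc⟩ := exists_pos_bounds_of_continuousOn hK hKp
    (contMDiffOn_volDensity (n := n) p).continuousOn fun x hx => volDensity_pos hx
  refine ⟨c₂ * C * c₁⁻¹, by positivity, fun ε hε hε1 => ?_⟩
  obtain ⟨τ₀, hτ₀, hτ⟩ := hcarl ε hε hε1
  refine ⟨τ₀, hτ₀, fun τ hττ f hf hfK => ?_⟩
  have hfc : HasCompactSupport f := hK.of_isClosed_subset (isClosed_tsupport f) hfK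
  have hfs := hfK.trans hKp
  have hsup : tsupport (pull n p f) ⊆ chartAt 𝔼 p '' tsupport f := tsupport_pull_subset hfc hfs
  have hsupO : tsupport (pull n p f) ⊆ O := fun z hz => by
    obtain ⟨y, hy, rfl⟩ := hsup hz
    refine ⟨(chartAt 𝔼 p).map_source (hfs hy), ?_⟩
    rw [mem_preimage, (chartAt 𝔼 p).left_inv (hfs hy)]
    exact hKO₁ (hfK hy)
  have hnot : ∀ z ∈ (chartAt 𝔼 p).target, (chartAt 𝔼 p).symm z ∉ tsupport f →
      z ∉ tsupport (pull n p f) := fun z hz h h' => by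
    obtain ⟨y, hy, rfl⟩ := hsup h'
    rw [(chartAt 𝔼 p).left_inv (hfs hy)] at h
    exact h hy
  have main := hτ τ hττ _ (contDiff_pull hf.contMDiffOn hfc hfs) (hasCompactSupport_pull hfc hfs)
    hsupO
  have hWc : Continuous fun x => carlemanWeight ε τ (φ x) ^ 2 :=
    have := hφ.contMDiff.continuous
    (Real.continuous_exp.comp
      ((continuous_const.mul this).add ((this.pow 2).div_const (2 * ε)))).pow 2
  have hFc : ContinuousOn (fun x => carlemanWeight ε τ (φ x) ^ 2 *
      (τ ^ 2 * f x ^ 2 + ∑ j : Fin n, coordDeriv p j f x ^ 2)) (chartAt 𝔼 p).source :=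
    hWc.continuousOn.mul ((continuousOn_const.mul (hf.continuous.continuousOn.pow 2)).add
      (continuousOn_finsetSum _ fun j _ => (contMDiffOn_coordDeriv (chartAt 𝔼 p).open_source
        subset_rfl hf.contMDiffOn j).continuousOn.pow 2))
  have hF0 : ∀ x ∉ tsupport f, carlemanWeight ε τ (φ x) ^ 2 *
      (τ ^ 2 * f x ^ 2 + ∑ j : Fin n, coordDeriv p j f x ^ 2) = 0 := fun x hx => by
    simp [image_eq_zero_of_notMem_tsupport hx, coordDeriv_eq_zero_of_notMem_tsupport hx]
  have hHc : ContinuousOn (fun x => carlemanWeight ε τ (φ x) ^ 2 * confLap n p φ f x ^ 2)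
      (chartAt 𝔼 p).source :=
    hWc.continuousOn.mul ((contMDiffOn_confLap hφ p hf).continuousOn.pow 2)
  have hH0 : ∀ x ∉ tsupport f, carlemanWeight ε τ (φ x) ^ 2 * confLap n p φ f x ^ 2 = 0 :=
    fun x hx => by simp [confLap_eq_zero_of_notMem_tsupport hx]
  have hinvc : ContinuousOn (fun x => (volDensity n p x)⁻¹) (chartAt 𝔼 p).source :=
    (contMDiffOn_inv_volDensity p).continuousOn
  have hos := (chartAt 𝔼 p).open_source
  have i1 := integrable_of_continuousOn_of_zero (n := n) hos hfc hfs hFc hF0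
  have i2 := integrable_of_continuousOn_of_zero (n := n) hos hfc hfs (hinvc.mul hFc)
    fun x hx => mul_eq_zero_of_right _ (hF0 x hx)
  have i3 := integrable_of_continuousOn_of_zero (n := n) hos hfc hfs hHc hH0
  have i4 := integrable_of_continuousOn_of_zero (n := n) hos hfc hfs (hinvc.mul hHc)
    fun x hx => mul_eq_zero_of_right _ (hH0 x hx)
  have e1 := integral_inv_volDensity_mul (n := n) p hFc (G := fun z => carlemanWeight ε τ (φ' z) ^ 2 *
      (τ ^ 2 * pull n p f z ^ 2 + ∑ j, pderiv j (pull n p f) z ^ 2))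
    (fun x hx => hF0 x fun h => hx (hfs h)) (fun z hz => ?_) (fun z hz => ?_)
  have e2 := integral_inv_volDensity_mul (n := n) p hHc (G := fun z => carlemanWeight ε τ (φ' z) ^ 2 *
      divOp a (pull n p f) z ^ 2) (fun x hx => hH0 x fun h => hx (hfs h))
    (fun z hz => ?_) (fun z hz => ?_)
  · rw [← e1, ← e2] at main
    calc _ ≤ ∫ x, c₂ * ((volDensity n p x)⁻¹ * (carlemanWeight ε τ (φ x) ^ 2 *
          (τ ^ 2 * f x ^ 2 + ∑ j : Fin n, coordDeriv p j f x ^ 2))) ∂(riemannianVolume n U) := by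
          refine integral_mono i1 (i2.const_mul c₂) fun x => ?_
          by_cases hx : x ∈ tsupport f
          · have h0 := volDensity_pos (n := n) (hfs hx)
            have h1 : 1 ≤ c₂ * (volDensity n p x)⁻¹ := by
              rw [← div_eq_mul_inv, one_le_div h0]
              exact (hc x (hfK hx)).2
            simp only
            rw [← mul_assoc]
            exact le_mul_of_one_le_left (by positivity) h1
          · simp only [hF0 x hx, mul_zero, le_refl]
      _ ≤ c₂ * (C * ε * ∫ x, (volDensity n p x)⁻¹ * (carlemanWeight ε τ (φ x) ^ 2 *
            confLap n p φ f x ^ 2) ∂(riemannianVolume n U)) := by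
          rw [integral_const_mul]
          exact mul_le_mul_of_nonneg_left main hc₂.le
      _ ≤ c₂ * (C * ε * ∫ x, c₁⁻¹ * (carlemanWeight ε τ (φ x) ^ 2 *
            confLap n p φ f x ^ 2) ∂(riemannianVolume n U)) := by
          refine mul_le_mul_of_nonneg_left (mul_le_mul_of_nonneg_left ?_ (by positivity)) hc₂.le
          refine integral_mono i4 (i3.const_mul c₁⁻¹) fun x => ?_
          by_cases hx : x ∈ tsupport f
          · exact mul_le_mul_of_nonneg_right (inv_anti₀ hc₁ (hc x (hfK hx)).1) (by positivity)
          · simp only [hH0 x hx, mul_zero, le_refl]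
      _ = _ := by
          rw [integral_const_mul]
          ring
  · by_cases hx : (chartAt 𝔼 p).symm z ∈ tsupport f
    · have hzO : z ∈ O := ⟨hz, hKO₁ (hfK hx)⟩
      rw [hφO z hzO]
      congr 2
      refine Finset.sum_congr rfl fun j _ => ?_
      refine hcutd ((contMDiffOn_finsetSum fun k _ => (contMDiffOn_confMetric hφ p j k).mul
        (contMDiffOn_coordDeriv hos subset_rfl hf.contMDiffOn k)).mono hO₁s) z hzO j _
        fun y hy => ?_
      refine Finset.sum_congr rfl fun k _ => ?_
      rw [haO j k y hy, pderiv_pull hy.1 (hf.mdifferentiable (by simp) _)]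
      rfl
    · rw [hH0 _ hx]
      simp [divOp_eq_zero_of_notMem_tsupport a (hnot z hz hx)]
  · have hz' : z ∉ tsupport (pull n p f) := fun h => hz (hsupO h).1
    simp [divOp_eq_zero_of_notMem_tsupport a hz']
  · by_cases hx : (chartAt 𝔼 p).symm z ∈ tsupport f
    · rw [hφO z ⟨hz, hKO₁ (hfK hx)⟩, pull_apply _ hz]
      simp only [pderiv_pull hz (hf.mdifferentiable (by simp) _)]
      rfl
    · rw [hF0 _ hx]
      simp [pull_apply _ hz, image_eq_zero_of_notMem_tsupport hx,
        pderiv_eq_zero_of_notMem_tsupport (hnot z hz hx)]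
  · have hz' : z ∉ tsupport (pull n p f) := fun h => hz (hsupO h).1
    simp [image_eq_zero_of_notMem_tsupport hz', pderiv_eq_zero_of_notMem_tsupport hz']

end LocalCarleman

/-! ### Functions dominated by first-order data -/

section Domination
variable {U ι : Type*} [TopologicalSpace U] {K : Set U} {r e e' : ι → U → ℝ}

/-- The functions `e i` are bounded on `K` by a constant multiple of `r i`, uniformly in `i`. -/
def DominatedOn (K : Set U) (r e : ι → U → ℝ) : Prop :=
  ∃ C : ℝ, 0 ≤ C ∧ ∀ i, ∀ x ∈ K, |e i x| ≤ C * r i x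

theorem DominatedOn.congr (h : DominatedOn K r e) (h' : ∀ i, ∀ x ∈ K, e' i x = e i x) :
    DominatedOn K r e' := by
  obtain ⟨C, hC, hb⟩ := h
  exact ⟨C, hC, fun i x hx => by rw [h' i x hx]; exact hb i x hx⟩

theorem DominatedOn.mono (h : DominatedOn K r e) (h' : ∀ i, ∀ x ∈ K, |e' i x| ≤ |e i x|) :
    DominatedOn K r e' := by
  obtain ⟨C, hC, hb⟩ := h
  exact ⟨C, hC, fun i x hx => (h' i x hx).trans (hb i x hx)⟩

theorem DominatedOn.add (h : DominatedOn K r e) (h' : DominatedOn K r e') :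
    DominatedOn K r fun i x => e i x + e' i x := by
  obtain ⟨C, hC, hb⟩ := h
  obtain ⟨C', hC', hb'⟩ := h'
  refine ⟨C + C', add_nonneg hC hC', fun i x hx => (abs_add_le _ _).trans ?_⟩
  rw [add_mul]
  exact add_le_add (hb i x hx) (hb' i x hx)

theorem DominatedOn.sum {κ : Type*} (t : Finset κ) {e : κ → ι → U → ℝ}
    (h : ∀ k, DominatedOn K r (e k)) : DominatedOn K r fun i x => ∑ k ∈ t, e k i x := by
  classical
  induction t using Finset.induction_on with
  | empty => exact ⟨0, le_rfl, fun i x _ => by simp⟩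
  | insert k t hk ih =>
    exact ((h k).add ih).congr fun i x _ => Finset.sum_insert hk

theorem DominatedOn.mul_left (hK : IsCompact K) {c : U → ℝ} (hc : ContinuousOn c K)
    (h : DominatedOn K r e) : DominatedOn K r fun i x => c x * e i x := by
  obtain ⟨C, hC, hb⟩ := h
  obtain ⟨B, hB⟩ := hK.exists_bound_of_continuousOn hc
  refine ⟨|B| * C, by positivity, fun i x hx => ?_⟩
  rw [abs_mul, mul_assoc]
  exact mul_le_mul ((hB x hx).trans (le_abs_self B)) (hb i x hx) (abs_nonneg _) (abs_nonneg _)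

theorem DominatedOn.neg (h : DominatedOn K r e) : DominatedOn K r fun i x => -e i x :=
  h.mono fun i x _ => by rw [abs_neg]

end Domination

/-! ### Scalar components of a section -/

section LocalEstimate
variable {n : ℕ} {U : Type*} [TopologicalSpace U] [ChartedSpace (EuclideanSpace ℝ (Fin n)) U]
  [IsManifold (𝓡 n) ∞ U]
  [RiemannianBundle (fun x : U => TangentSpace (𝓡 n) x)]
  [IsContMDiffRiemannianBundle (𝓡 n) ∞ (EuclideanSpace ℝ (Fin n))
    (fun x : U => TangentSpace (𝓡 n) x)] [MeasurableSpace U] [BorelSpace U]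
  [T2Space U] [SigmaCompactSpace U]
  {F : Type*} [NormedAddCommGroup F] [NormedSpace ℝ F] [FiniteDimensional ℝ F]
  {V : U → Type*} [TopologicalSpace (TotalSpace F V)]
  [∀ x, NormedAddCommGroup (V x)] [∀ x, InnerProductSpace ℝ (V x)] [FiberBundle F V]
  [VectorBundle ℝ F V] [ContMDiffVectorBundle ∞ F V (𝓡 n)]
local notation "𝔼" => EuclideanSpace ℝ (Fin n)

variable (V) in
/-- The coefficients of a vector in the local frame at `p`, expressed by its inner products with
the frame. -/
def dualCoeff (p : U) (b : Fin (Module.finrank ℝ F)) (x : U) (v : V x) : ℝ :=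
  ∑ c, (frameGram F V p x)⁻¹ b c * inner ℝ (frame F V p c x) v

theorem eq_sum_dualCoeff {p x : U} (hx : x ∈ frameDomain n F V p) (v : V x) :
    v = ∑ b, dualCoeff (F := F) V p b x v • frame F V p b x :=
  eq_dualCombination hx v

theorem inner_eq_sum_dualCoeff {p x : U} (hx : x ∈ frameDomain n F V p) (t v : V x) :
    (inner ℝ t v : ℝ) = ∑ b, dualCoeff (F := F) V p b x v * inner ℝ t (frame F V p b x) := by
  conv_lhs => rw [eq_sum_dualCoeff (n := n) hx v]
  rw [inner_sum]
  simp only [real_inner_smul_right]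

theorem coordDeriv_sum_mul {κ : Type*} (t : Finset κ) {p : U} {j : Fin n} {f g : κ → U → ℝ} {x : U}
    (hf : ∀ i ∈ t, MDifferentiableAt (𝓡 n) 𝓘(ℝ, ℝ) (f i) x)
    (hg : ∀ i ∈ t, MDifferentiableAt (𝓡 n) 𝓘(ℝ, ℝ) (g i) x) :
    coordDeriv p j (fun y => ∑ i ∈ t, f i y * g i y) x
      = ∑ i ∈ t, (f i x * coordDeriv p j (g i) x + coordDeriv p j (f i) x * g i x) := by
  rw [coordDeriv_sum (f := fun i y => f i y * g i y) fun i hi => (hf i hi).mul (hg i hi)]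
  exact Finset.sum_congr rfl fun i hi => coordDeriv_mul (hf i hi) (hg i hi)

theorem contMDiffOn_dualCoeff (hV : IsSmoothMetric n F V) {u : Π x, V x} {p : U}
    (hu : SmoothSectionOn n F u (frameDomain n F V p)) (b : Fin (Module.finrank ℝ F)) :
    ContMDiffOn (𝓡 n) 𝓘(ℝ, ℝ) ∞ (fun x => dualCoeff (F := F) V p b x (u x))
      (frameDomain n F V p) :=
  contMDiffOn_finsetSum fun c _ => (contMDiffOn_inv_frameGram hV p b c).mul
    (hV.contMDiffOn_inner (isOpen_frameDomain p) (smoothSectionOn_frame p c) hu)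

variable (A : CovariantDerivative (𝓡 n) F V)

/-- The function `∂_k⟨e_a, e_b⟩ - ⟨e_a, A_k e_b⟩`: the coefficient of order zero in the error made
when `⟨e_a, ·⟩` is differentiated by means of the connection. It is `⟨A_k e_a, e_b⟩` for a metric
connection, but the connection is not assumed to be metric. -/
def frameDefect (p : U) (a : Fin (Module.finrank ℝ F)) (k : Fin n)
    (b : Fin (Module.finrank ℝ F)) (x : U) : ℝ :=
  coordDeriv p k (fun y => (inner ℝ (frame F V p a y) (frame F V p b y) : ℝ)) x
    - inner ℝ (frame F V p a x) (A (frame F V p b) x (coordVec p x k))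

/-- Inner products with a frame section are differentiated by means of the connection, up to a
term of order zero. -/
theorem coordDeriv_inner_frame (hV : IsSmoothMetric n F V) {u : Π x, V x}
    (hu : SmoothSectionOn n F u univ) {p x : U} (hx : x ∈ frameDomain n F V p)
    (a : Fin (Module.finrank ℝ F)) (k : Fin n) :
    coordDeriv p k (fun y => (inner ℝ (frame F V p a y) (u y) : ℝ)) x
      = inner ℝ (frame F V p a x) (A u x (coordVec p x k))
        + ∑ b, dualCoeff (F := F) V p b x (u x) * frameDefect A p a k b x := by
  have hO := isOpen_frameDomain (n := n) (F := F) (V := V) p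
  have hu' := hu.mono (subset_univ (frameDomain n F V p))
  have hc := fun b => contMDiffOn_dualCoeff hV hu' b
  have hG := fun b => hV.contMDiffOn_inner hO (smoothSectionOn_frame p a)
    (smoothSectionOn_frame (V := V) (F := F) p b)
  have hs : ∀ b, SmoothSectionOn n F
      (fun y => dualCoeff (F := F) V p b y (u y) • frame F V p b y) (frameDomain n F V p) :=
    fun b => (hc b).smul_section (smoothSectionOn_frame p b)
  have e1 : (fun y => (inner ℝ (frame F V p a y) (u y) : ℝ)) =ᶠ[𝓝 x] fun y =>
      ∑ b, dualCoeff (F := F) V p b y (u y) * inner ℝ (frame F V p a y) (frame F V p b y) :=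
    eventually_of_mem (hO.mem_nhds hx) fun y hy =>
      inner_eq_sum_dualCoeff hy _ _
  have e2 : A u x (coordVec p x k) = ∑ b, (dualCoeff (F := F) V p b x (u x) •
        A (frame F V p b) x (coordVec p x k)
      + coordDeriv p k (fun y => dualCoeff (F := F) V p b y (u y)) x • frame F V p b x) := by
    rw [covDeriv_congr A hO hx hu' (t := fun y => ∑ b, dualCoeff (F := F) V p b y (u y) •
      frame F V p b y) fun y hy => eq_sum_dualCoeff hy (u y),
      covDeriv_sum A hO hx fun b _ => hs b, sum_apply]
    exact Finset.sum_congr rfl fun b _ =>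
      covDeriv_smul A hO hx (smoothSectionOn_frame p b) (hc b) _
  rw [coordDeriv_congr e1, e2, inner_sum, ← Finset.sum_add_distrib, coordDeriv_sum_mul _
    (fun b _ => ContMDiffOn.mdifferentiableAt_of_isOpen (hc b) hO hx)
    (fun b _ => ContMDiffOn.mdifferentiableAt_of_isOpen (hG b) hO hx)]
  refine Finset.sum_congr rfl fun b _ => ?_
  rw [inner_add_right, real_inner_smul_right, real_inner_smul_right, frameDefect]
  ring

variable [CovariantDerivative.ContMDiffCovariantDerivative A ∞]

theorem contMDiffOn_frameDefect (hV : IsSmoothMetric n F V) (p : U)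
    (a : Fin (Module.finrank ℝ F)) (k : Fin n) (b : Fin (Module.finrank ℝ F)) :
    ContMDiffOn (𝓡 n) 𝓘(ℝ, ℝ) ∞ (frameDefect A p a k b) (frameDomain n F V p) :=
  (contMDiffOn_coordDeriv (isOpen_frameDomain p) inter_subset_left
    (hV.contMDiffOn_inner (isOpen_frameDomain p) (smoothSectionOn_frame p a)
      (smoothSectionOn_frame p b)) k).sub
    (hV.contMDiffOn_inner (isOpen_frameDomain p) (smoothSectionOn_frame p a)
      (smoothSectionOn_covDeriv A (isOpen_frameDomain p) (smoothSectionOn_frame p b)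
        ((contMDiffOn_coordVec p k).mono inter_subset_left)))

section Bounds
variable {ι : Type*} {K : Set U} {p : U} {r : ι → U → ℝ}

theorem dominatedOn_inner (hV : IsSmoothMetric n F V) (hK : IsCompact K) {N : Set U}
    (hN : IsOpen N) (hKN : K ⊆ N)
    {t : Π x, V x} (ht : SmoothSectionOn n F t N) {v : ι → Π x, V x}
    (hv : DominatedOn K r fun i x => ‖v i x‖) :
    DominatedOn K r fun i x => (inner ℝ (t x) (v i x) : ℝ) := by
  have hc : ContinuousOn (fun x => √(inner ℝ (t x) (t x) : ℝ)) K :=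
    ((hV.contMDiffOn_inner hN ht ht).continuousOn.mono hKN).sqrt
  refine (hv.mul_left hK hc).mono fun i x _ => ?_
  rw [← norm_eq_sqrt_real_inner, abs_mul, abs_norm, abs_norm]
  exact abs_real_inner_le_norm _ _

theorem dominatedOn_dualCoeff (hV : IsSmoothMetric n F V) (hK : IsCompact K)
    (hKp : K ⊆ frameDomain n F V p) {v : ι → Π x, V x}
    (hv : DominatedOn K r fun i x => ‖v i x‖) (b : Fin (Module.finrank ℝ F)) :
    DominatedOn K r fun i x => dualCoeff (F := F) V p b x (v i x) :=
  .sum _ fun c => .mul_left hK ((contMDiffOn_inv_frameGram hV p b c).continuousOn.mono hKp)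
    (dominatedOn_inner hV hK (isOpen_frameDomain p) hKp (smoothSectionOn_frame p c) hv)

variable {u : ι → Π x, V x}

theorem dominatedOn_coordDeriv_inner_frame (hV : IsSmoothMetric n F V) (hK : IsCompact K)
    (hKp : K ⊆ frameDomain n F V p) (hu : ∀ i, SmoothSectionOn n F (u i) univ)
    (hru : DominatedOn K r fun i x => ‖u i x‖)
    (hrA : ∀ k, DominatedOn K r fun i x => ‖A (u i) x (coordVec p x k)‖)
    (a : Fin (Module.finrank ℝ F)) (k : Fin n) :
    DominatedOn K r fun i x =>
      coordDeriv p k (fun y => (inner ℝ (frame F V p a y) (u i y) : ℝ)) x := by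
  refine ((dominatedOn_inner hV hK (isOpen_frameDomain p) hKp (smoothSectionOn_frame p a)
    (hrA k)).add (.sum Finset.univ fun b => .mul_left hK
      ((contMDiffOn_frameDefect A hV p a k b).continuousOn.mono hKp)
      (dominatedOn_dualCoeff hV hK hKp hru b))).congr fun i x hx => ?_
  rw [coordDeriv_inner_frame A hV (hu i) (hKp hx)]
  simp only [mul_comm]

theorem dominatedOn_coordDeriv_dualCoeff (hV : IsSmoothMetric n F V) (hK : IsCompact K)
    (hKp : K ⊆ frameDomain n F V p) (hu : ∀ i, SmoothSectionOn n F (u i) univ)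
    (hru : DominatedOn K r fun i x => ‖u i x‖)
    (hrA : ∀ k, DominatedOn K r fun i x => ‖A (u i) x (coordVec p x k)‖)
    (b : Fin (Module.finrank ℝ F)) (k : Fin n) :
    DominatedOn K r fun i x =>
      coordDeriv p k (fun y => dualCoeff (F := F) V p b y (u i y)) x := by
  have hO := isOpen_frameDomain (n := n) (F := F) (V := V) p
  have hG := fun c => contMDiffOn_inv_frameGram (n := n) hV p b c
  refine (DominatedOn.sum Finset.univ fun c => (DominatedOn.mul_left hK ((hG c).continuousOn.mono hKp)
    (dominatedOn_coordDeriv_inner_frame A hV hK hKp hu hru hrA c k)).add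
    (.mul_left hK ((contMDiffOn_coordDeriv hO inter_subset_left (hG c) k).continuousOn.mono hKp)
      (dominatedOn_inner hV hK hO hKp (smoothSectionOn_frame p c) hru))).congr fun i x hx => ?_
  have hf := fun c => hV.contMDiffOn_inner hO (smoothSectionOn_frame (V := V) (F := F) p c)
    ((hu i).mono (subset_univ _))
  exact coordDeriv_sum_mul _
    (fun c _ => ContMDiffOn.mdifferentiableAt_of_isOpen (hG c) hO (hKp hx))
    (fun c _ => ContMDiffOn.mdifferentiableAt_of_isOpen (hf c) hO (hKp hx))

theorem dominatedOn_flux (hV : IsSmoothMetric n F V) (hK : IsCompact K)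
    (hKp : K ⊆ frameDomain n F V p)
    (hrA : ∀ k, DominatedOn K r fun i x => ‖A (u i) x (coordVec p x k)‖)
    (a : Fin (Module.finrank ℝ F)) (j : Fin n) :
    DominatedOn K r fun i x => flux (A (u i)) p a j x :=
  .sum _ fun k => .mul_left hK ((((contMDiffOn_volDensity p).mul
    (contMDiffOn_inv_gram p j k)).continuousOn).mono (hKp.trans inter_subset_left))
    (dominatedOn_inner hV hK (isOpen_frameDomain p) hKp (smoothSectionOn_frame p a) (hrA k))

/-- By the coordinate formula for the adjoint, the divergence of the flux of `A u` is controlled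
by the adjoint and by `A u`. -/
theorem dominatedOn_div_flux (hV : IsSmoothMetric n F V) (hK : IsCompact K)
    (hKp : K ⊆ frameDomain n F V p) (hu : ∀ i, SmoothSectionOn n F (u i) univ)
    {w : ι → Π x, V x} (hw : ∀ i, IsRealAdjoint A (A (u i)) (w i))
    (hrA : ∀ k, DominatedOn K r fun i x => ‖A (u i) x (coordVec p x k)‖)
    (hrw : DominatedOn K r fun i x => ‖w i x‖) (a : Fin (Module.finrank ℝ F)) :
    DominatedOn K r fun i x => ∑ j, coordDeriv p j (flux (A (u i)) p a j) x := by
  have hO := isOpen_frameDomain (n := n) (F := F) (V := V) p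
  refine (DominatedOn.mul_left hK (((contMDiffOn_volDensity p).continuousOn).mono
    (hKp.trans inter_subset_left)) (DominatedOn.add
      (.sum Finset.univ fun j => .sum Finset.univ fun k => .mul_left hK
        ((contMDiffOn_inv_gram p j k).continuousOn.mono (hKp.trans inter_subset_left))
        (dominatedOn_inner hV hK hO hKp (smoothSectionOn_covDeriv A hO (smoothSectionOn_frame p a)
          ((contMDiffOn_coordVec p j).mono inter_subset_left)) (hrA k)))
      (dominatedOn_inner hV hK hO hKp (smoothSectionOn_frame p a) hrw).neg)).congr fun i x hx => ?_
  rw [(hw i).inner_frame_eq A hV (isSmoothForm_covDeriv A (hu i)) (hKp hx), adjointPairing]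
  have := (volDensity_pos (n := n) (hKp hx).1).ne'
  field_simp
  ring

/-- Cutting off the inner product of a section with a frame section gives a scalar function whose
conformal Laplacian is controlled by the section, its covariant derivative and the adjoint of the
latter: there are no terms of second order left, because the principal part of the connection
Laplacian is scalar. -/
theorem dominatedOn_confLap (hV : IsSmoothMetric n F V) {φ : U → ℝ} (hφ : IsLCW n φ)
    (hK : IsCompact K)
    (hKp : K ⊆ frameDomain n F V p) (hu : ∀ i, SmoothSectionOn n F (u i) univ)
    {w : ι → Π x, V x} (hw : ∀ i, IsRealAdjoint A (A (u i)) (w i))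
    (hru : DominatedOn K r fun i x => ‖u i x‖)
    (hrA : ∀ k, DominatedOn K r fun i x => ‖A (u i) x (coordVec p x k)‖)
    (hrw : DominatedOn K r fun i x => ‖w i x‖) {χ : U → ℝ}
    (hχ : ContMDiff (𝓡 n) 𝓘(ℝ, ℝ) ∞ χ) (a : Fin (Module.finrank ℝ F)) :
    DominatedOn K r fun i x =>
      confLap n p φ (fun y => χ y * inner ℝ (frame F V p a y) (u i y)) x := by
  have hO := isOpen_frameDomain (n := n) (F := F) (V := V) p
  have hs : frameDomain n F V p ⊆ (chartAt 𝔼 p).source := inter_subset_left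
  have hχO := hχ.contMDiffOn (s := frameDomain n F V p)
  set S : U → ℝ := fun x => χ x * ((gradNormSq n p φ x)⁻¹ * (volDensity n p x)⁻¹) with hSdef
  set B : Fin n → Fin (Module.finrank ℝ F) → U → ℝ := fun j b x => ∑ k, confMetric p φ j k x *
    (χ x * frameDefect A p a k b x
      + coordDeriv p k χ x * inner ℝ (frame F V p a x) (frame F V p b x)) with hBdef
  have hS : ContMDiffOn (𝓡 n) 𝓘(ℝ, ℝ) ∞ S (frameDomain n F V p) :=
    hχO.mul (((contMDiffOn_inv (contMDiffOn_gradNormSq hφ.contMDiff p) fun x hx =>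
      (gradNormSq_pos hφ.mfderiv_ne_zero hx).ne').mul (contMDiffOn_inv_volDensity p)).mono hs)
  have hB : ∀ j b, ContMDiffOn (𝓡 n) 𝓘(ℝ, ℝ) ∞ (B j b) (frameDomain n F V p) := fun j b =>
    contMDiffOn_finsetSum fun k _ => ((contMDiffOn_confMetric hφ p j k).mono hs).mul
      ((hχO.mul (contMDiffOn_frameDefect A hV p a k b)).add
        ((contMDiffOn_coordDeriv hO hs hχO k).mul
          (hV.contMDiffOn_inner hO (smoothSectionOn_frame p a) (smoothSectionOn_frame p b))))
  have hfl := fun i j => contMDiffOn_flux hV (isSmoothForm_covDeriv A (hu i)) p a j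
  have hc := fun i b => contMDiffOn_dualCoeff hV ((hu i).mono (subset_univ (frameDomain n F V p))) b
  have hf := fun i => hV.contMDiffOn_inner hO (smoothSectionOn_frame (V := V) (F := F) p a)
    ((hu i).mono (subset_univ _))
  -- the first derivatives are a smooth multiple of the flux of `A u`, up to terms of order zero
  have hin : ∀ i j, ∀ x ∈ frameDomain n F V p,
      ∑ k, confMetric p φ j k x *
        coordDeriv p k (fun y => χ y * inner ℝ (frame F V p a y) (u i y)) x
      = S x * flux (A (u i)) p a j x + ∑ b, B j b x * dualCoeff (F := F) V p b x (u i x) := by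
    intro i j x hx
    have h1 : ∑ b, B j b x * dualCoeff (F := F) V p b x (u i x) = ∑ k, confMetric p φ j k x *
        (χ x * (∑ b, dualCoeff (F := F) V p b x (u i x) * frameDefect A p a k b x)
        + coordDeriv p k χ x * inner ℝ (frame F V p a x) (u i x)) := by
      rw [inner_eq_sum_dualCoeff (n := n) hx (frame F V p a x) (u i x)]
      simp only [hBdef, Finset.sum_mul, Finset.mul_sum,
        ← Finset.sum_add_distrib]
      rw [Finset.sum_comm]
      exact Finset.sum_congr rfl fun k _ => Finset.sum_congr rfl fun b _ => by ring
    rw [h1, flux, Finset.mul_sum, ← Finset.sum_add_distrib]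
    refine Finset.sum_congr rfl fun k _ => ?_
    rw [coordDeriv_mul (ContMDiffOn.mdifferentiableAt_of_isOpen hχO hO hx)
      (ContMDiffOn.mdifferentiableAt_of_isOpen (hf i) hO hx),
      coordDeriv_inner_frame A hV (hu i) hx]
    have := (volDensity_pos (n := n) (hs hx)).ne'
    simp only [hSdef, confMetric]
    field_simp
    ring
  have hO' := fun {f : U → ℝ} (h : ContMDiffOn (𝓡 n) 𝓘(ℝ, ℝ) ∞ f (frameDomain n F V p)) {x}
    (hx : x ∈ frameDomain n F V p) => ContMDiffOn.mdifferentiableAt_of_isOpen h hO hx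
  -- so the second derivatives occur in the divergence of the flux only
  have hcl : ∀ i, ∀ x ∈ frameDomain n F V p,
      confLap n p φ (fun y => χ y * inner ℝ (frame F V p a y) (u i y)) x
      = (S x * ∑ j, coordDeriv p j (flux (A (u i)) p a j) x
        + ∑ j, coordDeriv p j S x * flux (A (u i)) p a j x)
        + ∑ j, ∑ b, (B j b x * coordDeriv p j (fun y => dualCoeff (F := F) V p b y (u i y)) x
          + coordDeriv p j (B j b) x * dualCoeff (F := F) V p b x (u i x)) := by
    intro i x hx
    rw [Finset.mul_sum, ← Finset.sum_add_distrib, ← Finset.sum_add_distrib]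
    refine Finset.sum_congr rfl fun j _ => ?_
    rw [coordDeriv_congr (eventually_of_mem (hO.mem_nhds hx) fun y hy => hin i j y hy),
      coordDeriv_add (f := fun y => S y * flux (A (u i)) p a j y)
        (g := fun y => ∑ b, B j b y * dualCoeff (F := F) V p b y (u i y))
        (hO' (hS.mul (hfl i j)) hx)
        (hO' (contMDiffOn_finsetSum fun b _ => (hB j b).mul (hc i b)) hx),
      coordDeriv_mul (hO' hS hx) (hO' (hfl i j) hx),
      coordDeriv_sum_mul _ (fun b _ => hO' (hB j b) hx) (fun b _ => hO' (hc i b) hx)]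
  have hcont := fun {f : U → ℝ} (h : ContMDiffOn (𝓡 n) 𝓘(ℝ, ℝ) ∞ f (frameDomain n F V p)) =>
    h.continuousOn.mono hKp
  refine ((((dominatedOn_div_flux A hV hK hKp hu hw hrA hrw a).mul_left hK (hcont hS)).add
    (.sum Finset.univ fun j => (dominatedOn_flux A hV hK hKp hrA a j).mul_left hK
      (hcont (contMDiffOn_coordDeriv hO hs hS j)))).add
    (.sum Finset.univ fun j => .sum Finset.univ fun b =>
      ((dominatedOn_coordDeriv_dualCoeff A hV hK hKp hu hru hrA b j).mul_left hK
        (hcont (hB j b))).add ((dominatedOn_dualCoeff hV hK hKp hru b).mul_left hK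
        (hcont (contMDiffOn_coordDeriv hO hs (hB j b) j))))).congr
    fun i x hx => hcl i x (hKp hx)

end Bounds
end LocalEstimate

/-! ### The Carleman estimate for sections -/

section SectionEstimate
variable {n : ℕ} {U : Type*} [TopologicalSpace U] [ChartedSpace (EuclideanSpace ℝ (Fin n)) U]
  [IsManifold (𝓡 n) ∞ U]
  [RiemannianBundle (fun x : U => TangentSpace (𝓡 n) x)]
  [IsContMDiffRiemannianBundle (𝓡 n) ∞ (EuclideanSpace ℝ (Fin n))
    (fun x : U => TangentSpace (𝓡 n) x)] [MeasurableSpace U] [BorelSpace U]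
  [T2Space U] [SigmaCompactSpace U]
  {F : Type*} [NormedAddCommGroup F] [NormedSpace ℝ F] [FiniteDimensional ℝ F]
  {V : U → Type*} [TopologicalSpace (TotalSpace F V)]
  [∀ x, NormedAddCommGroup (V x)] [∀ x, InnerProductSpace ℝ (V x)] [FiberBundle F V]
  [VectorBundle ℝ F V] [ContMDiffVectorBundle ∞ F V (𝓡 n)]
local notation "𝔼" => EuclideanSpace ℝ (Fin n)

theorem DominatedOn.mul {ι : Type*} {K : Set U} {r e e' : ι → U → ℝ} (h : DominatedOn K r e)
    (h' : DominatedOn K r e') :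
    DominatedOn K (fun i x => r i x ^ 2) fun i x => e i x * e' i x := by
  obtain ⟨C, hC, hb⟩ := h
  obtain ⟨C', hC', hb'⟩ := h'
  refine ⟨C * C', by positivity, fun i x hx => ?_⟩
  rw [abs_mul, show C * C' * r i x ^ 2 = C * r i x * (C' * r i x) by ring]
  exact mul_le_mul (hb i x hx) (hb' i x hx) (abs_nonneg _) ((abs_nonneg _).trans (hb i x hx))

/-- Vectors are controlled by their inner products with a local frame. -/
theorem dominatedOn_norm {ι : Type*} {K : Set U} {p : U} {r : ι → U → ℝ}
    (hV : IsSmoothMetric n F V) (hK : IsCompact K) (hKp : K ⊆ frameDomain n F V p)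
    {v : ι → Π x, V x}
    (hv : ∀ a, DominatedOn K r fun i x => (inner ℝ (frame F V p a x) (v i x) : ℝ)) :
    DominatedOn K r fun i x => ‖v i x‖ := by
  have hc : ∀ b, ContinuousOn (fun x => √(inner ℝ (frame F V p b x) (frame F V p b x) : ℝ)) K :=
    fun b => ((hV.contMDiffOn_inner (isOpen_frameDomain p) (smoothSectionOn_frame p b)
      (smoothSectionOn_frame p b)).continuousOn.mono hKp).sqrt
  have h : DominatedOn K r fun i x => ∑ b,
      √(inner ℝ (frame F V p b x) (frame F V p b x) : ℝ) * |dualCoeff (F := F) V p b x (v i x)| :=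
    .sum _ fun b => .mul_left hK (hc b) (DominatedOn.mono (e := fun i x =>
      dualCoeff (F := F) V p b x (v i x)) (.sum _ fun c => .mul_left hK
        ((contMDiffOn_inv_frameGram hV p b c).continuousOn.mono hKp) (hv c))
      fun i x _ => by rw [abs_abs])
  refine h.mono fun i x hx => ?_
  rw [abs_norm]
  refine le_trans ?_ (le_abs_self _)
  conv_lhs => rw [eq_sum_dualCoeff (n := n) (hKp hx) (v i x)]
  refine (norm_sum_le _ _).trans (Finset.sum_le_sum fun b _ => ?_)
  rw [norm_smul, ← norm_eq_sqrt_real_inner, mul_comm, Real.norm_eq_abs]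

variable (A : CovariantDerivative (𝓡 n) F V)
  [CovariantDerivative.ContMDiffCovariantDerivative A ∞]

/-- The adjoint is a local operator. -/
theorem IsRealAdjoint.eq_zero_of_notMem (hV : IsSmoothMetric n F V) {u w : Π x, V x}
    (hu : SmoothSectionOn n F u univ) (hw : IsRealAdjoint A (A u) w) {x : U}
    (hx : x ∉ secSupport u) : w x = 0 := by
  refine eq_of_inner_frame_eq (mem_frameDomain (n := n) (F := F) (V := V) x) fun a => ?_
  have h0 : ∀ᶠ y in 𝓝 x, A u y = 0 :=
    eventually_of_mem (isClosed_closure.isOpen_compl.mem_nhds hx) fun y hy =>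
      covDeriv_eq_zero_of_notMem A hu hy
  rw [hw.inner_frame_eq A hV (isSmoothForm_covDeriv A hu) (mem_frameDomain x), inner_zero_right,
    adjointPairing, h0.self_of_nhds]
  have h1 : ∀ j, coordDeriv x j (flux (A u) x a j) x = 0 := fun j => by
    rw [coordDeriv_congr (g := fun _ => (0 : ℝ)) (h0.mono fun y hy => by simp [flux, hy]),
      coordDeriv_const]
  simp [h1]

theorem continuous_carlemanWeight {φ : U → ℝ} (hφ : Continuous φ) (ε τ : ℝ) :
    Continuous fun x => carlemanWeight ε τ (φ x) :=
  Real.continuous_exp.comp ((continuous_const.mul hφ).add ((hφ.pow 2).div_const (2 * ε)))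

theorem covInner_self_nonneg' {W : Type*} [NormedAddCommGroup W] [InnerProductSpace ℝ W] {x : U}
    (α : TangentSpace (𝓡 n) x →L[ℝ] W) : 0 ≤ covInner x x α α :=
  covInner_self_nonneg (mem_chart_source 𝔼 x) α

/-- The density `|u|² + |A u|² + |w|²` that controls the scalar components of `u`. It is used for the
adjoint `w = A^* A u` of the covariant derivative. -/
def energy (u w : Π x, V x) (x : U) : ℝ :=
  ‖u x‖ ^ 2 + covInner x x (A u x) (A u x) + ‖w x‖ ^ 2

theorem continuous_norm_sq_section (hV : IsSmoothMetric n F V) {u : Π x, V x}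
    (hu : SmoothSectionOn n F u univ) : Continuous fun x => ‖u x‖ ^ 2 := by
  simp only [← real_inner_self_eq_norm_sq]
  exact (hV u u hu hu).continuous

theorem continuous_covInner_covDeriv (hV : IsSmoothMetric n F V) {u : Π x, V x}
    (hu : SmoothSectionOn n F u univ) : Continuous fun x => covInner x x (A u x) (A u x) :=
  (contMDiff_covInner hV (isSmoothForm_covDeriv A hu) (isSmoothForm_covDeriv A hu)).continuous

theorem energy_eq_zero_of_notMem (hV : IsSmoothMetric n F V) {u w : Π x, V x}
    (hu : SmoothSectionOn n F u univ) (hw : IsRealAdjoint A (A u) w) {x : U}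
    (hx : x ∉ secSupport u) : energy A u w x = 0 := by
  rw [energy, hw.eq_zero_of_notMem A hV hu hx, covDeriv_eq_zero_of_notMem A hu hx,
    eq_zero_of_notMem_secSupport hx, covInner_zero_left]
  simp

theorem integrable_carlemanWeight_energy (hV : IsSmoothMetric n F V) {φ : U → ℝ}
    (hφ : Continuous φ) (ε τ : ℝ) {u w : Π x, V x} (hu : SmoothSectionOn n F u univ)
    (hc : IsCompact (secSupport u)) (hw : IsRealAdjoint A (A u) w) :
    Integrable (fun x => carlemanWeight ε τ (φ x) ^ 2 * energy A u w x)
      (riemannianVolume n U) :=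
  integrable_of_continuousOn_of_zero isOpen_univ hc (subset_univ _)
    (((continuous_carlemanWeight hφ ε τ).pow 2).mul (((continuous_norm_sq_section hV hu).add
      (continuous_covInner_covDeriv A hV hu)).add
        (continuous_norm_sq_section hV hw.1))).continuousOn
    fun x hx => by rw [energy_eq_zero_of_notMem A hV hu hw hx, mul_zero]

theorem integrable_carlemanWeight_section (hV : IsSmoothMetric n F V) {φ : U → ℝ}
    (hφ : Continuous φ) (ε τ c : ℝ) {u : Π x, V x} (hu : SmoothSectionOn n F u univ)
    (hc : IsCompact (secSupport u)) :
    Integrable (fun x => carlemanWeight ε τ (φ x) ^ 2 *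
      (c * ‖u x‖ ^ 2 + covInner x x (A u x) (A u x))) (riemannianVolume n U) :=
  integrable_of_continuousOn_of_zero isOpen_univ hc (subset_univ _)
    (((continuous_carlemanWeight hφ ε τ).pow 2).mul
      ((continuous_const.mul (continuous_norm_sq_section hV hu)).add
      (continuous_covInner_covDeriv A hV hu))).continuousOn
    fun x hx => by
      rw [covDeriv_eq_zero_of_notMem A hu hx, eq_zero_of_notMem_secSupport hx, covInner_zero_left]
      simp

/-- The Carleman estimate for sections near a point. The left-hand side is localized, but the
right-hand side is not, so that such estimates can be added up over a finite cover. -/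
theorem carleman_estimate_near (hV : IsSmoothMetric n F V) {φ : U → ℝ} (hφ : IsLCW n φ) (p : U) :
    ∃ O : Set U, IsOpen O ∧ p ∈ O ∧ ∃ C : ℝ, 0 < C ∧ ∀ ε : ℝ, 0 < ε → ε ≤ 1 → ∃ τ₀ : ℝ, 1 ≤ τ₀ ∧
      ∀ τ, τ₀ ≤ τ → ∀ u w : Π x, V x, SmoothSectionOn n F u univ → IsCompact (secSupport u) →
        IsRealAdjoint A (A u) w →
        ∫ x in O, carlemanWeight ε τ (φ x) ^ 2 *
          (τ ^ 2 * ‖u x‖ ^ 2 + covInner x x (A u x) (A u x)) ∂(riemannianVolume n U)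
        ≤ C * ε * ∫ x, carlemanWeight ε τ (φ x) ^ 2 * energy A u w x ∂(riemannianVolume n U) := by
  have hD := isOpen_frameDomain (n := n) (F := F) (V := V) p
  obtain ⟨χ, hχ, hχc, hχs, hχ1, -⟩ := exists_smooth_cutoff n isCompact_singleton hD
    (singleton_subset_iff.2 (mem_frameDomain p))
  rw [nhdsSet_singleton] at hχ1
  obtain ⟨O₁, hO₁1, hO₁, hpO₁⟩ := eventually_nhds_iff.1 hχ1
  have : LocallyCompactSpace U := ChartedSpace.locallyCompactSpace 𝔼 U
  obtain ⟨K', hK', hpK', hK'O⟩ := exists_compact_subset hO₁ hpO₁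
  have hO₁χ : O₁ ⊆ tsupport χ := fun x hx => subset_tsupport _ (by
    rw [Function.mem_support, hO₁1 x hx]
    exact one_ne_zero)
  have hK'D : K' ⊆ frameDomain n F V p := hK'O.trans (hO₁χ.trans hχs)
  -- the families of all admissible sections and adjoints
  let ι := {s : (Π x, V x) × (Π x, V x) //
    SmoothSectionOn n F s.1 univ ∧ IsRealAdjoint A (A s.1) s.2}
  let G : ι → Fin (Module.finrank ℝ F) → U → ℝ := fun i a x =>
    χ x * inner ℝ (frame F V p a x) (i.1.1 x)
  have hGK : ∀ i a, tsupport (G i a) ⊆ tsupport χ := fun i a => tsupport_mul_subset_left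
  have hGsm : ∀ i a, ContMDiff (𝓡 n) 𝓘(ℝ, ℝ) ∞ (G i a) := fun i a =>
    contMDiff_of_contMDiffOn_of_zero hD hχc hχs (hχ.contMDiffOn.mul (hV.contMDiffOn_inner hD
      (smoothSectionOn_frame p a) (i.2.1.mono (subset_univ _)))) fun x hx => by
        simp only [G, image_eq_zero_of_notMem_tsupport hx, zero_mul]
  have hcov : ∀ (i : ι) (x : U), 0 ≤ covInner x x (A i.1.1 x) (A i.1.1 x) :=
    fun i x => covInner_self_nonneg' _
  have henergy : ∀ (i : ι) (x : U), 0 ≤ energy A i.1.1 i.1.2 x := fun i x =>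
    add_nonneg (add_nonneg (sq_nonneg _) (hcov i x)) (sq_nonneg _)
  -- the right-hand sides of the scalar estimates are controlled by the energy
  have hdom : ∀ a, DominatedOn (tsupport χ) (fun (i : ι) x => √(energy A i.1.1 i.1.2 x))
      fun i x => confLap n p φ (G i a) x := fun a => by
    refine dominatedOn_confLap A hV hφ hχc hχs (fun i => i.2.1) (fun i => i.2.2)
      ⟨1, zero_le_one, fun i x _ => ?_⟩ (fun k => ?_) ⟨1, zero_le_one, fun i x _ => ?_⟩ hχ a
    · rw [one_mul]
      refine Real.abs_le_sqrt ?_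
      rw [energy, add_assoc]
      exact le_add_of_nonneg_right (add_nonneg (hcov i x) (sq_nonneg _))
    · refine DominatedOn.mono (e := fun (i : ι) x => √(gram n p x k k) *
        √(energy A i.1.1 i.1.2 x)) (.mul_left hχc
          ((contMDiffOn_gram p k k).continuousOn.mono (hχs.trans inter_subset_left)).sqrt
            ⟨1, zero_le_one, fun i x _ => by rw [abs_of_nonneg (Real.sqrt_nonneg _), one_mul]⟩)
        fun i x hx => ?_
      have hxp := (hχs hx).1
      rw [abs_norm, ← Real.sqrt_mul' _ (henergy i x)]
      refine le_trans (Real.le_sqrt_of_sq_le ?_) (le_abs_self _)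
      refine (norm_apply_sq_le hxp _ _).trans ?_
      rw [← covInner_change (mem_chart_source 𝔼 x) hxp]
      refine mul_le_mul_of_nonneg_left ?_ real_inner_self_nonneg
      rw [energy, add_right_comm]
      exact le_add_of_nonneg_left (by positivity)
    · rw [one_mul]
      refine Real.abs_le_sqrt ?_
      exact le_add_of_nonneg_left (add_nonneg (sq_nonneg _) (hcov i x))
  -- near `p` the section is controlled by the scalar functions
  have hGd : ∀ i a, ∀ x ∈ K', (inner ℝ (frame F V p a x) (i.1.1 x) : ℝ) = G i a x :=
    fun i a x hx => by simp only [G, hO₁1 x (hK'O hx), one_mul]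
  have hGd' : ∀ i a (k : Fin n), ∀ x ∈ K',
      coordDeriv p k (fun y => (inner ℝ (frame F V p a y) (i.1.1 y) : ℝ)) x
        = coordDeriv (n := n) p k (G i a) x :=
    fun i a k x hx => coordDeriv_congr (eventually_of_mem (hO₁.mem_nhds (hK'O hx)) fun y hy => by
      simp only [G, hO₁1 y hy, one_mul])
  let r₀ : ι → U → ℝ := fun i x => √(∑ a, G i a x ^ 2)
  let r₁ : ι → U → ℝ := fun i x => √(∑ a, (G i a x ^ 2 + ∑ k, coordDeriv (n := n) p k (G i a) x ^ 2))
  have hG₀ : ∀ a, DominatedOn K' r₀ fun i x => (inner ℝ (frame F V p a x) (i.1.1 x) : ℝ) :=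
    fun a => ⟨1, zero_le_one, fun i x hx => by
      rw [one_mul]
      beta_reduce
      rw [hGd i a x hx]
      exact Real.abs_le_sqrt (Finset.single_le_sum (f := fun a => G i a x ^ 2)
        (fun a _ => sq_nonneg _) (Finset.mem_univ a))⟩
  have hG₁ : ∀ a, DominatedOn K' r₁ fun i x => (inner ℝ (frame F V p a x) (i.1.1 x) : ℝ) :=
    fun a => ⟨1, zero_le_one, fun i x hx => by
      rw [one_mul]
      beta_reduce
      rw [hGd i a x hx]
      refine Real.abs_le_sqrt (le_trans (le_add_of_nonneg_right
        (Finset.sum_nonneg fun k _ => sq_nonneg _)) (Finset.single_le_sum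
          (f := fun a => G i a x ^ 2 + ∑ k, coordDeriv (n := n) p k (G i a) x ^ 2)
        (fun a _ => by positivity) (Finset.mem_univ a)))⟩
  have hG₂ : ∀ a (k : Fin n), DominatedOn K' r₁ fun i x => coordDeriv (n := n) p k (G i a) x :=
    fun a k => ⟨1, zero_le_one, fun i x hx => by
      rw [one_mul]
      refine Real.abs_le_sqrt (le_trans (le_trans (Finset.single_le_sum
        (f := fun k => coordDeriv (n := n) p k (G i a) x ^ 2) (fun k _ => sq_nonneg _) (Finset.mem_univ k))
        (le_add_of_nonneg_left (sq_nonneg _))) (Finset.single_le_sum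
          (f := fun a => G i a x ^ 2 + ∑ k, coordDeriv (n := n) p k (G i a) x ^ 2)
        (fun a _ => by positivity) (Finset.mem_univ a)))⟩
  have hu₀ : DominatedOn K' r₀ fun i x => ‖i.1.1 x‖ := dominatedOn_norm hV hK' hK'D hG₀
  have hA₁ : ∀ k, DominatedOn K' r₁ fun i x => ‖A i.1.1 x (coordVec p x k)‖ := fun k => by
    refine dominatedOn_norm hV hK' hK'D fun a => DominatedOn.congr ((hG₂ a k).add
      (DominatedOn.neg (.sum Finset.univ fun b => .mul_left hK'
        ((contMDiffOn_frameDefect A hV p a k b).continuousOn.mono hK'D)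
        (e := fun i x => dualCoeff (F := F) V p b x (i.1.1 x)) (.sum Finset.univ fun c =>
          .mul_left hK' ((contMDiffOn_inv_frameGram hV p b c).continuousOn.mono hK'D) (hG₁ c)))))
      fun i x hx => ?_
    rw [← hGd' i a k x hx, coordDeriv_inner_frame A hV i.2.1 (hK'D hx)]
    simp only [mul_comm]
    ring
  have hcov₁ : DominatedOn K' (fun i x => r₁ i x ^ 2)
      fun i x => covInner x x (A i.1.1 x) (A i.1.1 x) := by
    have h : DominatedOn K' (fun i x => r₁ i x ^ 2) fun i x => ∑ j, ∑ k, |(gram n p x)⁻¹ j k| *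
        (‖A i.1.1 x (coordVec p x j)‖ * ‖A i.1.1 x (coordVec p x k)‖) :=
      .sum _ fun j => .sum _ fun k => .mul_left hK' ((contMDiffOn_inv_gram p j k).continuousOn.mono
        (hK'D.trans inter_subset_left)).abs ((hA₁ j).mul (hA₁ k))
    refine h.mono fun i x hx => ?_
    rw [covInner_change (mem_chart_source 𝔼 x) (hK'D hx).1]
    refine le_trans ?_ (le_abs_self _)
    refine (Finset.abs_sum_le_sum_abs _ _).trans (Finset.sum_le_sum fun j _ =>
      (Finset.abs_sum_le_sum_abs _ _).trans (Finset.sum_le_sum fun k _ => ?_))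
    rw [abs_mul]
    exact mul_le_mul_of_nonneg_left (abs_real_inner_le_norm _ _) (abs_nonneg _)
  obtain ⟨C, hC, hcarl⟩ := carleman_estimate_chart hφ p hχc (hχs.trans inter_subset_left)
  choose Ca hCa hCab using hdom
  obtain ⟨C₀, hC₀, hb₀⟩ := hu₀
  obtain ⟨C₁, hC₁, hb₁⟩ := hcov₁
  refine ⟨interior K', isOpen_interior, hpK', (C₀ ^ 2 + C₁) * C * (∑ a, Ca a ^ 2) + 1,
    by positivity, fun ε hε hε1 => ?_⟩
  obtain ⟨τ₀, hτ₀, hτ⟩ := hcarl ε hε hε1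
  refine ⟨τ₀, hτ₀, fun τ hττ u w hu huc hw => ?_⟩
  let i : ι := ⟨(u, w), hu, hw⟩
  have hφc := hφ.contMDiff.continuous
  have iE := integrable_carlemanWeight_energy A hV hφc ε τ hu huc hw
  have hWc := (continuous_carlemanWeight hφc ε τ).pow 2
  have iG : ∀ a, Integrable (fun x => carlemanWeight ε τ (φ x) ^ 2 *
      (τ ^ 2 * G i a x ^ 2 + ∑ k, coordDeriv (n := n) p k (G i a) x ^ 2)) (riemannianVolume n U) := fun a =>
    integrable_of_continuousOn_of_zero (chartAt 𝔼 p).open_source hχc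
      (hχs.trans inter_subset_left) (hWc.continuousOn.mul ((continuousOn_const.mul
        ((hGsm i a).continuous.continuousOn.pow 2)).add (continuousOn_finsetSum _ fun k _ =>
          (contMDiffOn_coordDeriv (chartAt 𝔼 p).open_source subset_rfl
            (hGsm i a).contMDiffOn k).continuousOn.pow 2))) fun x hx => by
      have hx' : x ∉ tsupport (G i a) := fun h => hx (hGK i a h)
      simp [image_eq_zero_of_notMem_tsupport hx', coordDeriv_eq_zero_of_notMem_tsupport hx']
  have iL : ∀ a, Integrable (fun x => carlemanWeight ε τ (φ x) ^ 2 *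
      confLap n p φ (G i a) x ^ 2) (riemannianVolume n U) := fun a =>
    integrable_of_continuousOn_of_zero (chartAt 𝔼 p).open_source hχc
      (hχs.trans inter_subset_left) (hWc.continuousOn.mul
        ((contMDiffOn_confLap hφ p (hGsm i a)).continuousOn.pow 2)) fun x hx => by
      have hx' : x ∉ tsupport (G i a) := fun h => hx (hGK i a h)
      simp [confLap_eq_zero_of_notMem_tsupport hx']
  have iS := integrable_finsetSum Finset.univ fun a (_ : a ∈ Finset.univ) => iG a
  have hnn : ∀ x, 0 ≤ ∑ a, carlemanWeight ε τ (φ x) ^ 2 *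
      (τ ^ 2 * G i a x ^ 2 + ∑ k, coordDeriv (n := n) p k (G i a) x ^ 2) := fun x =>
    Finset.sum_nonneg fun a _ => by positivity
  have hE0 : 0 ≤ ∫ x, carlemanWeight ε τ (φ x) ^ 2 * energy A u w x ∂(riemannianVolume n U) :=
    integral_nonneg fun x => mul_nonneg (sq_nonneg _) (henergy i x)
  calc _ ≤ ∫ x in interior K', (C₀ ^ 2 + C₁) * ∑ a, carlemanWeight ε τ (φ x) ^ 2 *
        (τ ^ 2 * G i a x ^ 2 + ∑ k, coordDeriv (n := n) p k (G i a) x ^ 2) ∂(riemannianVolume n U) := by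
        refine setIntegral_mono_on
          (integrable_carlemanWeight_section A hV hφc ε τ (τ ^ 2) hu huc).integrableOn
          (iS.const_mul _).integrableOn isOpen_interior.measurableSet fun x hx => ?_
        have hx' := interior_subset hx
        have h0 : 0 ≤ ∑ a, G i a x ^ 2 := Finset.sum_nonneg fun a _ => sq_nonneg _
        have h1 : 0 ≤ ∑ a, ∑ k, coordDeriv (n := n) p k (G i a) x ^ 2 :=
          Finset.sum_nonneg fun a _ => Finset.sum_nonneg fun k _ => sq_nonneg _
        have h2 : ‖u x‖ ^ 2 ≤ C₀ ^ 2 * ∑ a, G i a x ^ 2 := by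
          have h3 := hb₀ i x hx'
          rw [abs_norm] at h3
          refine (pow_le_pow_left₀ (norm_nonneg _) h3 2).trans_eq ?_
          rw [mul_pow, Real.sq_sqrt h0]
        have h4 : covInner x x (A u x) (A u x)
            ≤ C₁ * (∑ a, G i a x ^ 2 + ∑ a, ∑ k, coordDeriv (n := n) p k (G i a) x ^ 2) := by
          refine (le_abs_self _).trans ((hb₁ i x hx').trans_eq ?_)
          change C₁ * √(∑ a, (G i a x ^ 2 + ∑ k, coordDeriv (n := n) p k (G i a) x ^ 2)) ^ 2 = _
          rw [Real.sq_sqrt (Finset.sum_nonneg fun a _ => by positivity), Finset.sum_add_distrib]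
        have h5 : (1 : ℝ) ≤ τ ^ 2 := one_le_pow₀ (hτ₀.trans hττ)
        rw [← Finset.mul_sum, mul_left_comm, Finset.sum_add_distrib, ← Finset.mul_sum]
        refine mul_le_mul_of_nonneg_left ?_ (sq_nonneg _)
        have h6 := mul_le_mul_of_nonneg_left h2 (sq_nonneg τ)
        have h7 : C₁ * ∑ a, G i a x ^ 2 ≤ τ ^ 2 * (C₁ * ∑ a, G i a x ^ 2) :=
          le_mul_of_one_le_left (by positivity) h5
        have h8 : 0 ≤ C₀ ^ 2 * ∑ a, ∑ k, coordDeriv (n := n) p k (G i a) x ^ 2 := by positivity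
        linarith
    _ ≤ ∫ x, (C₀ ^ 2 + C₁) * ∑ a, carlemanWeight ε τ (φ x) ^ 2 *
        (τ ^ 2 * G i a x ^ 2 + ∑ k, coordDeriv (n := n) p k (G i a) x ^ 2) ∂(riemannianVolume n U) :=
        setIntegral_le_integral (iS.const_mul _)
          (Eventually.of_forall fun x => mul_nonneg (by positivity) (hnn x))
    _ = (C₀ ^ 2 + C₁) * ∑ a, ∫ x, carlemanWeight ε τ (φ x) ^ 2 *
        (τ ^ 2 * G i a x ^ 2 + ∑ k, coordDeriv (n := n) p k (G i a) x ^ 2) ∂(riemannianVolume n U) := by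
        rw [integral_const_mul, integral_finsetSum _ fun a _ => iG a]
    _ ≤ (C₀ ^ 2 + C₁) * ∑ a, C * ε * (Ca a ^ 2 *
        ∫ x, carlemanWeight ε τ (φ x) ^ 2 * energy A u w x ∂(riemannianVolume n U)) := by
        refine mul_le_mul_of_nonneg_left (Finset.sum_le_sum fun a _ => ?_) (by positivity)
        refine (hτ τ hττ _ (hGsm i a) (hGK i a)).trans
          (mul_le_mul_of_nonneg_left ?_ (by positivity))
        rw [← integral_const_mul]
        refine integral_mono (iL a) (iE.const_mul _) fun x => ?_
        by_cases hx : x ∈ tsupport χ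
        · have h1 := hCab a i x hx
          have h2 : confLap n p φ (G i a) x ^ 2 ≤ Ca a ^ 2 * energy A u w x := by
            rw [← sq_abs]
            refine (pow_le_pow_left₀ (abs_nonneg _) h1 2).trans_eq ?_
            rw [mul_pow, Real.sq_sqrt (henergy i x)]
          exact (mul_le_mul_of_nonneg_left h2 (sq_nonneg _)).trans_eq (mul_left_comm _ _ _)
        · have hx' : x ∉ tsupport (G i a) := fun h => hx (hGK i a h)
          have := henergy i x
          simp only [confLap_eq_zero_of_notMem_tsupport hx']
          have h3 : 0 ≤ Ca a ^ 2 * (carlemanWeight ε τ (φ x) ^ 2 * energy A u w x) :=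
            mul_nonneg (sq_nonneg _) (mul_nonneg (sq_nonneg _) this)
          simpa using h3
    _ ≤ _ := by
        rw [← Finset.mul_sum, ← Finset.sum_mul]
        have : 0 ≤ ε * ∫ x, carlemanWeight ε τ (φ x) ^ 2 * energy A u w x
          ∂(riemannianVolume n U) := mul_nonneg hε.le hE0
        linarith

/-- The Carleman estimate for sections supported in a fixed compact set, by summing the local
estimates over a finite cover. The first-order terms on the right-hand side carry the factor `ε`,
which is chosen small later; the constant `C` does not depend on it. -/
theorem carleman_estimate_section (hV : IsSmoothMetric n F V) {φ : U → ℝ} (hφ : IsLCW n φ)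
    {M : Set U} (hM : IsCompact M) :
    ∃ C : ℝ, 0 < C ∧ ∀ ε : ℝ, 0 < ε → ε ≤ 1 → ∃ τ₀ : ℝ, 1 ≤ τ₀ ∧
      ∀ τ, τ₀ ≤ τ → ∀ u w : Π x, V x, SmoothSectionOn n F u univ → secSupport u ⊆ M →
        IsRealAdjoint A (A u) w →
        ∫ x, carlemanWeight ε τ (φ x) ^ 2 *
          (τ ^ 2 * ‖u x‖ ^ 2 + covInner x x (A u x) (A u x)) ∂(riemannianVolume n U)
        ≤ C * ε * ∫ x, carlemanWeight ε τ (φ x) ^ 2 * energy A u w x ∂(riemannianVolume n U) := by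
  choose O hO hpO C hC hcarl using carleman_estimate_near A hV hφ
  obtain ⟨t, -, ht⟩ := hM.elim_nhds_subcover O fun p _ => (hO p).mem_nhds (hpO p)
  refine ⟨∑ p ∈ t, C p + 1, add_pos_of_nonneg_of_pos (Finset.sum_nonneg fun p _ => (hC p).le)
    one_pos, fun ε hε hε1 => ?_⟩
  choose τ₀ hτ₀ hτ using fun p => hcarl p ε hε hε1
  have hτ₀' : ∀ p, 0 ≤ τ₀ p := fun p => zero_le_one.trans (hτ₀ p)
  refine ⟨1 + ∑ p ∈ t, τ₀ p, le_add_of_nonneg_right (Finset.sum_nonneg fun p _ => hτ₀' p),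
    fun τ hττ u w hu huM hw => ?_⟩
  have huc : IsCompact (secSupport u) := hM.of_isClosed_subset isClosed_closure huM
  have hφc := hφ.contMDiff.continuous
  set g : U → ℝ := fun x => carlemanWeight ε τ (φ x) ^ 2 *
    (τ ^ 2 * ‖u x‖ ^ 2 + covInner x x (A u x) (A u x)) with hg
  have ig : Integrable g (riemannianVolume n U) :=
    integrable_carlemanWeight_section A hV hφc ε τ (τ ^ 2) hu huc
  have hg0 : ∀ x, 0 ≤ g x := fun x => mul_nonneg (sq_nonneg _)
    (add_nonneg (by positivity) (covInner_self_nonneg' _))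
  have hgM : ∀ x ∉ M, g x = 0 := fun x hx => by
    have hx' : x ∉ secSupport u := fun h => hx (huM h)
    simp only [hg, covDeriv_eq_zero_of_notMem A hu hx', eq_zero_of_notMem_secSupport hx',
      covInner_zero_left]
    simp
  have hE0 : 0 ≤ ∫ x, carlemanWeight ε τ (φ x) ^ 2 * energy A u w x ∂(riemannianVolume n U) :=
    integral_nonneg fun x => mul_nonneg (sq_nonneg _)
      (add_nonneg (add_nonneg (sq_nonneg _) (covInner_self_nonneg' _)) (sq_nonneg _))
  calc ∫ x, g x ∂(riemannianVolume n U)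
      ≤ ∫ x, ∑ p ∈ t, (O p).indicator g x ∂(riemannianVolume n U) := by
        refine integral_mono ig (integrable_finsetSum _ fun p _ =>
          ig.indicator (hO p).measurableSet) fun x => ?_
        have hnn : ∀ p ∈ t, 0 ≤ (O p).indicator g x := fun p _ =>
          indicator_nonneg (fun y _ => hg0 y) x
        by_cases hx : x ∈ M
        · obtain ⟨p, hpt, hxp⟩ := mem_iUnion₂.1 (ht hx)
          refine le_trans (le_of_eq ?_) (Finset.single_le_sum hnn hpt)
          rw [indicator_of_mem hxp]
        · rw [hgM x hx]
          exact Finset.sum_nonneg hnn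
    _ = ∑ p ∈ t, ∫ x in O p, g x ∂(riemannianVolume n U) := by
        rw [integral_finsetSum _ fun p _ => ig.indicator (hO p).measurableSet]
        exact Finset.sum_congr rfl fun p _ => integral_indicator (hO p).measurableSet
    _ ≤ ∑ p ∈ t, C p * ε * ∫ x, carlemanWeight ε τ (φ x) ^ 2 * energy A u w x
          ∂(riemannianVolume n U) := by
        refine Finset.sum_le_sum fun p hp => hτ p τ (le_trans ?_ hττ) u w hu huc hw
        exact (Finset.single_le_sum (fun q _ => hτ₀' q) hp).trans
          (le_add_of_nonneg_left zero_le_one)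
    _ ≤ _ := by
        rw [← Finset.sum_mul, ← Finset.sum_mul]
        have : 0 ≤ ε * ∫ x, carlemanWeight ε τ (φ x) ^ 2 * energy A u w x
          ∂(riemannianVolume n U) := mul_nonneg hε.le hE0
        linarith

end SectionEstimate

/-! ### Exponential weights and perturbations -/

section Perturbation
variable {n : ℕ} {U : Type*} [TopologicalSpace U] [ChartedSpace (EuclideanSpace ℝ (Fin n)) U]
  [IsManifold (𝓡 n) ∞ U]
  [RiemannianBundle (fun x : U => TangentSpace (𝓡 n) x)]
  [IsContMDiffRiemannianBundle (𝓡 n) ∞ (EuclideanSpace ℝ (Fin n))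
    (fun x : U => TangentSpace (𝓡 n) x)] [MeasurableSpace U] [BorelSpace U]
  [T2Space U] [SigmaCompactSpace U]
  {F : Type*} [NormedAddCommGroup F] [NormedSpace ℝ F] [FiniteDimensional ℝ F]
  {V : U → Type*} [TopologicalSpace (TotalSpace F V)]
  [∀ x, NormedAddCommGroup (V x)] [∀ x, InnerProductSpace ℝ (V x)] [FiberBundle F V]
  [VectorBundle ℝ F V] [ContMDiffVectorBundle ∞ F V (𝓡 n)]
local notation "𝔼" => EuclideanSpace ℝ (Fin n)

theorem exp_le_carlemanWeight {ε : ℝ} (hε : 0 < ε) (τ t : ℝ) :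
    Real.exp (τ * t) ≤ carlemanWeight ε τ t :=
  Real.exp_le_exp.2 (le_add_of_nonneg_right (by positivity))

/-- Together with `exp_le_carlemanWeight`: on a compact set the convexified weight is comparable to
the exponential weight, uniformly in the large parameter. -/
theorem carlemanWeight_le {ε : ℝ} (hε : 0 < ε) (τ : ℝ) {t m : ℝ} (ht : |t| ≤ m) :
    carlemanWeight ε τ t ≤ Real.exp (m ^ 2 / (2 * ε)) * Real.exp (τ * t) := by
  rw [← Real.exp_add, add_comm]
  refine Real.exp_le_exp.2 (add_le_add_right (div_le_div_of_nonneg_right ?_ (by positivity)) _)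
  exact sq_le_sq' (abs_le.1 ht).1 (abs_le.1 ht).2

theorem covInner_add_le {W : Type*} [NormedAddCommGroup W] [InnerProductSpace ℝ W] {x : U}
    (α β : TangentSpace (𝓡 n) x →L[ℝ] W) :
    covInner x x (α + β) (α + β) ≤ 2 * covInner x x α α + 2 * covInner x x β β := by
  have h : covInner x x (α + β) (α + β) + covInner x x (α - β) (α - β)
      = 2 * covInner x x α α + 2 * covInner x x β β := by
    simp only [covInner, Finset.mul_sum, ← Finset.sum_add_distrib]
    refine Finset.sum_congr rfl fun i _ => Finset.sum_congr rfl fun j _ => ?_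
    rw [add_apply, add_apply, sub_apply, sub_apply, inner_add_left, inner_add_right,
      inner_add_right, inner_sub_left, inner_sub_right, inner_sub_right]
    ring
  have := covInner_self_nonneg' (α - β)
  linarith

theorem covInner_smul_self {W : Type*} [NormedAddCommGroup W] [InnerProductSpace ℝ W] {x : U}
    (c : ℝ) (α : TangentSpace (𝓡 n) x →L[ℝ] W) :
    covInner x x (c • α) (c • α) = c ^ 2 * covInner x x α α := by
  simp only [covInner, Finset.mul_sum]
  refine Finset.sum_congr rfl fun i _ => Finset.sum_congr rfl fun j _ => ?_
  rw [smul_apply, smul_apply, real_inner_smul_left, real_inner_smul_right]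
  ring

theorem covInner_smulRight {W : Type*} [NormedAddCommGroup W] [InnerProductSpace ℝ W] {x : U}
    (α : TangentSpace (𝓡 n) x →L[ℝ] ℝ) (v : W) :
    covInner x x (α.smulRight v) (α.smulRight v) = ‖v‖ ^ 2 * covInner x x α α := by
  simp only [covInner, Finset.mul_sum]
  refine Finset.sum_congr rfl fun i _ => Finset.sum_congr rfl fun j _ => ?_
  rw [ContinuousLinearMap.smulRight_apply, ContinuousLinearMap.smulRight_apply,
    real_inner_smul_left, real_inner_smul_right, real_inner_self_eq_norm_sq,
    RCLike.inner_apply, conj_trivial]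
  ring

theorem continuous_covInner_mvfderiv {φ : U → ℝ} (hφ : ContMDiff (𝓡 n) 𝓘(ℝ, ℝ) ∞ φ) :
    Continuous fun x => covInner x x (mvfderiv (𝓡 n) φ x) (mvfderiv (𝓡 n) φ x) := by
  refine continuous_iff_continuousAt.2 fun p => ?_
  have hp := (chartAt 𝔼 p).open_source.mem_nhds (mem_chart_source 𝔼 p)
  refine ((contMDiffOn_gradNormSq hφ p).continuousOn.continuousAt hp).congr
    (eventually_of_mem hp fun x hx => ?_)
  change _ = covInner x x _ _
  rw [covInner_change (mem_chart_source 𝔼 x) hx, gradNormSq, covInner]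
  refine Finset.sum_congr rfl fun i _ => Finset.sum_congr rfl fun j _ => ?_
  rw [RCLike.inner_apply, conj_trivial, coordDeriv, coordDeriv]
  ring

variable (A : CovariantDerivative (𝓡 n) F V)
  [CovariantDerivative.ContMDiffCovariantDerivative A ∞]

/-- The factor `h⁻¹` from differentiating the weight falls on a term without derivatives of `u`. -/
theorem covInner_covDeriv_exp_smul_le {φ : U → ℝ} (hφ : ContMDiff (𝓡 n) 𝓘(ℝ, ℝ) ∞ φ) (h : ℝ)
    {u : Π x, V x} (hu : SmoothSectionOn n F u univ) (x : U) :
    covInner x x (A (fun y => Real.exp (φ y / h) • u y) x)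
        (A (fun y => Real.exp (φ y / h) • u y) x)
      ≤ Real.exp (φ x / h) ^ 2 * (2 * covInner x x (A u x) (A u x)
        + 2 * (h⁻¹ ^ 2 * (‖u x‖ ^ 2 *
          covInner x x (mvfderiv (𝓡 n) φ x) (mvfderiv (𝓡 n) φ x)))) := by
  have he : ContMDiff (𝓡 n) 𝓘(ℝ, ℝ) ∞ fun y => Real.exp (φ y / h) :=
    (Real.contDiff_exp.comp (contDiff_id.div_const h)).comp_contMDiff hφ
  have hd : mvfderiv (𝓡 n) (fun y => Real.exp (φ y / h)) x
      = (Real.exp (φ x / h) * h⁻¹) • mvfderiv (𝓡 n) φ x := by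
    have h1 : HasDerivAt (fun t : ℝ => Real.exp (t / h)) (Real.exp (φ x / h) * h⁻¹) (φ x) := by
      have := ((hasDerivAt_id (φ x)).div_const h).exp
      simpa [div_eq_mul_inv] using this
    have h2 := (hφ.mdifferentiable (by simp) x).hasMFDerivAt
    ext v
    refine (DFunLike.congr_fun (HasMFDerivAt.comp x h1.hasFDerivAt.hasMFDerivAt h2).mfderiv
      v).trans ?_
    exact mul_comm (mvfderiv (𝓡 n) φ x v) _
  have hA : A (fun y => Real.exp (φ y / h) • u y) x = Real.exp (φ x / h) •
      (A u x + h⁻¹ • (mvfderiv (𝓡 n) φ x).smulRight (u x)) := by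
    ext X
    rw [covDeriv_smul A isOpen_univ (mem_univ x) hu he.contMDiffOn, hd]
    simp only [smul_apply, add_apply, ContinuousLinearMap.smulRight_apply, smul_add, smul_smul,
      smul_eq_mul, mul_assoc]
  rw [hA, covInner_smul_self]
  refine mul_le_mul_of_nonneg_left ((covInner_add_le _ _).trans_eq ?_) (sq_nonneg _)
  rw [covInner_smul_self, covInner_smulRight]

/-- The Carleman estimate with the exponential weight, stable under perturbations that are
pointwise controlled by the section and its covariant derivative: the convexity of the weight
provides a small constant `ε` on the right, with which they are absorbed. -/
theorem carleman_estimate_perturbed (hV : IsSmoothMetric n F V) {φ : U → ℝ} (hφ : IsLCW n φ)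
    {M : Set U} (hM : IsCompact M) {c : ℝ} (hc : 0 ≤ c) :
    ∃ C : ℝ, 0 < C ∧ ∃ h₀ : ℝ, 0 < h₀ ∧ ∀ h : ℝ, 0 < h → h ≤ h₀ → ∀ u w R : Π x, V x,
      SmoothSectionOn n F u univ → secSupport u ⊆ M → IsRealAdjoint A (A u) w →
      (∀ x ∈ M, ‖R x‖ ^ 2 ≤ c * (‖u x‖ ^ 2 + covInner x x (A u x) (A u x))) →
      ContinuousOn (fun x => ‖w x + R x‖) M →
      ∫ x in M, Real.exp (φ x / h) ^ 2 * (‖u x‖ ^ 2 + h ^ 2 * covInner x x (A u x) (A u x))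
        ∂(riemannianVolume n U)
      ≤ C * h ^ 2 * ∫ x in M, Real.exp (φ x / h) ^ 2 * ‖w x + R x‖ ^ 2
        ∂(riemannianVolume n U) := by
  obtain ⟨C, hC, hcarl⟩ := carleman_estimate_section A hV hφ hM
  have hφc := hφ.contMDiff.continuous
  obtain ⟨m, hm⟩ := hM.exists_bound_of_continuousOn hφc.continuousOn
  -- the first-order terms of the energy and of `R` together have the factor `C ε (1 + 2c) ≤ 1/2`
  set ε : ℝ := min 1 (2 * C * (1 + 2 * c))⁻¹ with hεdef
  have hε : 0 < ε := lt_min one_pos (by positivity)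
  have hε1 : ε ≤ 1 := min_le_left _ _
  have hεC : C * ε * (1 + 2 * c) ≤ 1 / 2 := by
    have h1 : ε ≤ (2 * C * (1 + 2 * c))⁻¹ := min_le_right _ _
    calc C * ε * (1 + 2 * c) ≤ C * (2 * C * (1 + 2 * c))⁻¹ * (1 + 2 * c) := by gcongr
      _ = 1 / 2 := by
        have : 1 + 2 * c ≠ 0 := by positivity
        field_simp
  clear_value ε
  obtain ⟨τ₀, hτ₀, hτ⟩ := hcarl ε hε hε1
  -- `B` is the cost of comparing the weights on `M`
  set B : ℝ := Real.exp (m ^ 2 / (2 * ε)) with hB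
  refine ⟨4 * C * B ^ 2, by positivity, τ₀⁻¹, by positivity,
    fun h hh hh₀ u w R hu huM hw hR hwR => ?_⟩
  have hτh : τ₀ ≤ h⁻¹ := by
    rw [le_inv_comm₀ (by positivity) hh]
    exact hh₀
  have huc : IsCompact (secSupport u) := hM.of_isClosed_subset isClosed_closure huM
  have hn0 : ∀ x ∉ M, u x = 0 ∧ A u x = 0 ∧ w x = 0 := fun x hx => by
    have hx' : x ∉ secSupport u := fun h => hx (huM h)
    exact ⟨eq_zero_of_notMem_secSupport hx', covDeriv_eq_zero_of_notMem A hu hx',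
      hw.eq_zero_of_notMem A hV hu hx'⟩
  have key := hτ h⁻¹ hτh u w hu huM hw
  have iL := integrable_carlemanWeight_section A hV hφc ε h⁻¹ (h⁻¹ ^ 2) hu huc
  have iE := integrable_carlemanWeight_energy A hV hφc ε h⁻¹ hu huc hw
  have hcov : ∀ x, 0 ≤ covInner x x (A u x) (A u x) := fun x => covInner_self_nonneg' _
  have hMm : MeasurableSet M := hM.measurableSet
  have iR : ∀ {g : U → ℝ}, Continuous g → IntegrableOn (fun x => g x ^ 2 * ‖w x + R x‖ ^ 2) M
      (riemannianVolume n U) := fun {g} hg =>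
    ((hg.pow 2).continuousOn.mul (hwR.pow 2)).integrableOn_compact hM
  have hWc := continuous_carlemanWeight hφc ε h⁻¹
  have hec : Continuous fun x => Real.exp (φ x / h) :=
    Real.continuous_exp.comp (hφc.div_const h)
  have hτe : ∀ x, Real.exp (φ x / h) = Real.exp (h⁻¹ * φ x) := fun x => by
    rw [div_eq_inv_mul]
  set I : ℝ := ∫ x in M, carlemanWeight ε h⁻¹ (φ x) ^ 2 *
      (h⁻¹ ^ 2 * ‖u x‖ ^ 2 + covInner x x (A u x) (A u x)) ∂(riemannianVolume n U) with hI
  have hI' : I = ∫ x, carlemanWeight ε h⁻¹ (φ x) ^ 2 *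
      (h⁻¹ ^ 2 * ‖u x‖ ^ 2 + covInner x x (A u x) (A u x)) ∂(riemannianVolume n U) :=
    setIntegral_eq_integral_of_forall_compl_eq_zero fun x hx => by
      obtain ⟨h1, h2, -⟩ := hn0 x hx
      simp [h1, h2, covInner_zero_left]
  have hE' : ∫ x, carlemanWeight ε h⁻¹ (φ x) ^ 2 * energy A u w x ∂(riemannianVolume n U)
      = ∫ x in M, carlemanWeight ε h⁻¹ (φ x) ^ 2 * energy A u w x ∂(riemannianVolume n U) :=
    (setIntegral_eq_integral_of_forall_compl_eq_zero fun x hx => by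
      obtain ⟨h1, h2, h3⟩ := hn0 x hx
      simp [energy, h1, h2, h3, covInner_zero_left]).symm
  have hE : ∫ x in M, carlemanWeight ε h⁻¹ (φ x) ^ 2 * energy A u w x ∂(riemannianVolume n U)
      ≤ (1 + 2 * c) * I + 2 * ∫ x in M, carlemanWeight ε h⁻¹ (φ x) ^ 2 * ‖w x + R x‖ ^ 2
        ∂(riemannianVolume n U) := by
    rw [hI, ← integral_const_mul, ← integral_const_mul,
      ← integral_add (iL.integrableOn.const_mul _) ((iR hWc).const_mul _)]
    refine setIntegral_mono_on iE.integrableOn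
      ((iL.integrableOn.const_mul _).add ((iR hWc).const_mul _)) hMm fun x hx => ?_
    have h1 : ‖w x‖ ^ 2 ≤ 2 * ‖w x + R x‖ ^ 2 + 2 * ‖R x‖ ^ 2 := by
      have h2 : ‖w x‖ ≤ ‖w x + R x‖ + ‖R x‖ := by
        simpa using norm_sub_le (w x + R x) (R x)
      nlinarith [norm_nonneg (w x), sq_nonneg (‖w x + R x‖ - ‖R x‖),
        pow_le_pow_left₀ (norm_nonneg (w x)) h2 2]
    have h3 := hR x hx
    have h4 : ‖u x‖ ^ 2 ≤ h⁻¹ ^ 2 * ‖u x‖ ^ 2 :=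
      le_mul_of_one_le_left (sq_nonneg _) (one_le_pow₀ (hτ₀.trans hτh))
    have h5 : energy A u w x ≤ (1 + 2 * c) *
        (h⁻¹ ^ 2 * ‖u x‖ ^ 2 + covInner x x (A u x) (A u x)) + 2 * ‖w x + R x‖ ^ 2 := by
      have h6 := mul_le_mul_of_nonneg_left h4 (by positivity : 0 ≤ 1 + 2 * c)
      rw [energy]
      linarith
    refine (mul_le_mul_of_nonneg_left h5 (sq_nonneg _)).trans_eq ?_
    ring
  have hmain : I ≤ 4 * C * ∫ x in M, carlemanWeight ε h⁻¹ (φ x) ^ 2 * ‖w x + R x‖ ^ 2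
        ∂(riemannianVolume n U) := by
    rw [← hI', hE'] at key
    have hI0 : 0 ≤ I := integral_nonneg fun x => mul_nonneg (sq_nonneg _)
      (add_nonneg (by positivity) (hcov x))
    have hR0 : 0 ≤ ∫ x in M, carlemanWeight ε h⁻¹ (φ x) ^ 2 * ‖w x + R x‖ ^ 2
        ∂(riemannianVolume n U) := integral_nonneg fun x => by positivity
    have h1 := mul_le_mul_of_nonneg_left hE (by positivity : 0 ≤ C * ε)
    have h2 := mul_le_mul_of_nonneg_right hεC hI0
    have h3 := mul_le_mul_of_nonneg_right (mul_le_of_le_one_right hC.le hε1) hR0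
    linarith
  calc ∫ x in M, Real.exp (φ x / h) ^ 2 * (‖u x‖ ^ 2 + h ^ 2 * covInner x x (A u x) (A u x))
        ∂(riemannianVolume n U)
      ≤ ∫ x in M, h ^ 2 * (carlemanWeight ε h⁻¹ (φ x) ^ 2 *
          (h⁻¹ ^ 2 * ‖u x‖ ^ 2 + covInner x x (A u x) (A u x))) ∂(riemannianVolume n U) := by
        refine setIntegral_mono_on ?_ (iL.integrableOn.const_mul _) hMm fun x hx => ?_
        · exact ((hec.pow 2).mul ((continuous_norm_sq_section hV hu).add
            (continuous_const.mul (continuous_covInner_covDeriv A hV hu)))).continuousOn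
            |>.integrableOn_compact hM
        · have h1 : h ^ 2 * (h⁻¹ ^ 2 * ‖u x‖ ^ 2 + covInner x x (A u x) (A u x))
              = ‖u x‖ ^ 2 + h ^ 2 * covInner x x (A u x) (A u x) := by
            field_simp
          rw [mul_left_comm, h1, hτe]
          exact mul_le_mul_of_nonneg_right (pow_le_pow_left₀ (Real.exp_nonneg _)
            (exp_le_carlemanWeight hε _ _) 2) (add_nonneg (sq_nonneg _)
              (mul_nonneg (sq_nonneg _) (hcov x)))
    _ = h ^ 2 * I := integral_const_mul _ _
    _ ≤ h ^ 2 * (4 * C * ∫ x in M, carlemanWeight ε h⁻¹ (φ x) ^ 2 * ‖w x + R x‖ ^ 2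
        ∂(riemannianVolume n U)) := mul_le_mul_of_nonneg_left hmain (sq_nonneg _)
    _ ≤ h ^ 2 * (4 * C * ∫ x in M, B ^ 2 * (Real.exp (φ x / h) ^ 2 * ‖w x + R x‖ ^ 2)
        ∂(riemannianVolume n U)) := by
        refine mul_le_mul_of_nonneg_left (mul_le_mul_of_nonneg_left ?_ (by positivity))
          (sq_nonneg _)
        refine setIntegral_mono_on (iR hWc) ((iR hec).const_mul _) hMm fun x hx => ?_
        rw [← mul_assoc, hτe]
        refine mul_le_mul_of_nonneg_right ?_ (sq_nonneg _)
        rw [← mul_pow]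
        exact pow_le_pow_left₀ (Real.exp_nonneg _) (carlemanWeight_le hε _ (hm x hx)) 2
    _ = _ := by
        rw [integral_const_mul]
        ring

/-- The semiclassical Carleman estimate for sections of a real metric bundle, with the weight inside
the `H¹` norm. -/
theorem semiclassical_carleman_estimate (hV : IsSmoothMetric n F V) {φ : U → ℝ} (hφ : IsLCW n φ)
    {M : Set U} (hM : IsCompact M) {c : ℝ} (hc : 0 ≤ c) :
    ∃ C : ℝ, 0 < C ∧ ∃ h₀ : ℝ, 0 < h₀ ∧ ∀ h : ℝ, 0 < h → h ≤ h₀ → ∀ u w R : Π x, V x,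
      SmoothSectionOn n F u univ → secSupport u ⊆ M → IsRealAdjoint A (A u) w →
      (∀ x ∈ M, ‖R x‖ ^ 2 ≤ c * (‖u x‖ ^ 2 + covInner x x (A u x) (A u x))) →
      ContinuousOn (fun x => ‖w x + R x‖) M →
      √((∫ x in M, ‖Real.exp (φ x / h) • u x‖ ^ 2 ∂(riemannianVolume n U))
        + h ^ 2 * ∫ x in M, covInner x x (A (fun y => Real.exp (φ y / h) • u y) x)
          (A (fun y => Real.exp (φ y / h) • u y) x) ∂(riemannianVolume n U))
      ≤ C * h * √(∫ x in M, ‖Real.exp (φ x / h) • (w x + R x)‖ ^ 2 ∂(riemannianVolume n U)) := by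
  obtain ⟨C, hC, h₀, hh₀, hmain⟩ := carleman_estimate_perturbed A hV hφ hM hc
  have hφc := hφ.contMDiff.continuous
  obtain ⟨D, hD⟩ := hM.exists_bound_of_continuousOn
    (continuous_covInner_mvfderiv hφ.contMDiff).continuousOn
  refine ⟨√((2 + 2 * |D|) * C), by positivity, h₀, hh₀, fun h hh hhh u w R hu huM hw hR hwR => ?_⟩
  have key := hmain h hh hhh u w R hu huM hw hR hwR
  have hMm : MeasurableSet M := hM.measurableSet
  have hec : Continuous fun x => Real.exp (φ x / h) :=
    Real.continuous_exp.comp (hφc.div_const h)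
  have hesm : ContMDiff (𝓡 n) 𝓘(ℝ, ℝ) ∞ fun y => Real.exp (φ y / h) :=
    (Real.contDiff_exp.comp (contDiff_id.div_const h)).comp_contMDiff hφ.contMDiff
  have heu : SmoothSectionOn n F (fun y => Real.exp (φ y / h) • u y) univ :=
    hesm.contMDiffOn.smul_section hu
  have hns : ∀ (x : U) (v : V x), ‖Real.exp (φ x / h) • v‖ ^ 2
      = Real.exp (φ x / h) ^ 2 * ‖v‖ ^ 2 := fun x v => by
    rw [norm_smul, mul_pow, Real.norm_eq_abs, sq_abs]
  have i1 : IntegrableOn (fun x => ‖Real.exp (φ x / h) • u x‖ ^ 2) M (riemannianVolume n U) :=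
    (continuous_norm_sq_section hV heu).continuousOn.integrableOn_compact hM
  have i2 : IntegrableOn (fun x => covInner x x (A (fun y => Real.exp (φ y / h) • u y) x)
      (A (fun y => Real.exp (φ y / h) • u y) x)) M (riemannianVolume n U) :=
    (continuous_covInner_covDeriv A hV heu).continuousOn.integrableOn_compact hM
  have i3 : IntegrableOn (fun x => Real.exp (φ x / h) ^ 2 *
      (‖u x‖ ^ 2 + h ^ 2 * covInner x x (A u x) (A u x))) M (riemannianVolume n U) :=
    ((hec.pow 2).mul ((continuous_norm_sq_section hV hu).add
      (continuous_const.mul (continuous_covInner_covDeriv A hV hu)))).continuousOn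
      |>.integrableOn_compact hM
  simp only [hns _ (w _ + R _)]
  rw [← Real.sqrt_sq hh.le, ← Real.sqrt_mul (by positivity), ← Real.sqrt_mul (by positivity),
    Real.sqrt_sq hh.le]
  refine Real.sqrt_le_sqrt ?_
  calc _ ≤ ∫ x in M, (2 + 2 * |D|) * (Real.exp (φ x / h) ^ 2 *
      (‖u x‖ ^ 2 + h ^ 2 * covInner x x (A u x) (A u x))) ∂(riemannianVolume n U) := by
        rw [← integral_const_mul, ← integral_add i1 (i2.const_mul _)]
        refine setIntegral_mono_on (i1.add (i2.const_mul _)) (i3.const_mul _) hMm fun x hx => ?_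
        have h1 := mul_le_mul_of_nonneg_left
          (covInner_covDeriv_exp_smul_le A hφ.contMDiff h hu x) (sq_nonneg h)
        have h2 : covInner x x (mvfderiv (𝓡 n) φ x) (mvfderiv (𝓡 n) φ x) ≤ |D| :=
          (le_abs_self _).trans ((hD x hx).trans (le_abs_self D))
        have h3 := mul_le_mul_of_nonneg_left h2 (by positivity :
          0 ≤ 2 * (Real.exp (φ x / h) ^ 2 * ‖u x‖ ^ 2))
        have h4 : 0 ≤ Real.exp (φ x / h) ^ 2 * ‖u x‖ ^ 2 := by positivity
        have h5 : 0 ≤ |D| * (Real.exp (φ x / h) ^ 2 *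
            (h ^ 2 * covInner x x (A u x) (A u x))) :=
          mul_nonneg (abs_nonneg _) (mul_nonneg (sq_nonneg _)
            (mul_nonneg (sq_nonneg _) (covInner_self_nonneg' _)))
        have h6 : h ^ 2 * (Real.exp (φ x / h) ^ 2 * (2 * covInner x x (A u x) (A u x)
            + 2 * (h⁻¹ ^ 2 * (‖u x‖ ^ 2 *
              covInner x x (mvfderiv (𝓡 n) φ x) (mvfderiv (𝓡 n) φ x)))))
            = 2 * (Real.exp (φ x / h) ^ 2 * (h ^ 2 * covInner x x (A u x) (A u x)))
              + 2 * (Real.exp (φ x / h) ^ 2 * ‖u x‖ ^ 2) *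
              covInner x x (mvfderiv (𝓡 n) φ x) (mvfderiv (𝓡 n) φ x) := by
          field_simp
        rw [h6] at h1
        rw [hns]
        linarith
    _ = (2 + 2 * |D|) * ∫ x in M, Real.exp (φ x / h) ^ 2 *
      (‖u x‖ ^ 2 + h ^ 2 * covInner x x (A u x) (A u x)) ∂(riemannianVolume n U) :=
        integral_const_mul _ _
    _ ≤ (2 + 2 * |D|) * _ := mul_le_mul_of_nonneg_left key (by positivity)
    _ = _ := by ring

end Perturbation

/-! ### Sections smooth on a closed domain -/

section BoundaryRegularity
variable {n : ℕ} {U : Type*} [TopologicalSpace U] [ChartedSpace (EuclideanSpace ℝ (Fin n)) U]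
  [IsManifold (𝓡 n) ∞ U]
  [RiemannianBundle (fun x : U => TangentSpace (𝓡 n) x)]
  [IsContMDiffRiemannianBundle (𝓡 n) ∞ (EuclideanSpace ℝ (Fin n))
    (fun x : U => TangentSpace (𝓡 n) x)] [MeasurableSpace U] [BorelSpace U]
  [T2Space U] [SigmaCompactSpace U]
  {F : Type*} [NormedAddCommGroup F] [NormedSpace ℝ F] [FiniteDimensional ℝ F]
  {V : U → Type*} [TopologicalSpace (TotalSpace F V)]
  [∀ x, NormedAddCommGroup (V x)] [∀ x, InnerProductSpace ℝ (V x)] [FiberBundle F V]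
  [VectorBundle ℝ F V] [ContMDiffVectorBundle ∞ F V (𝓡 n)]

/-- The norm of a section that is smooth on an arbitrary set `M`, such as a compact domain, is
continuous on `M`. Sections over `M` need not extend, so that smoothness of the metric is only applied
to the local frames. -/
theorem continuousOn_norm_section (hV : IsSmoothMetric n F V) {t : Π x, V x} {M : Set U}
    (ht : SmoothSectionOn n F t M) : ContinuousOn (fun x => ‖t x‖) M := by
  have h : ContinuousOn (fun x => ‖t x‖ ^ 2) M := by
    intro p hp
    have hO := isOpen_frameDomain (n := n) (F := F) (V := V) p
    have hpO := mem_frameDomain (n := n) (F := F) (V := V) p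
    have hc : ∀ a, ContinuousWithinAt (fun x => (Module.finBasis ℝ F).repr
        (trivializationAt F V p ⟨x, t x⟩).2 a) M p := fun a =>
      (LinearMap.continuous_of_finiteDimensional
        ((Module.finBasis ℝ F).coord a)).continuousAt.comp_continuousWithinAt
          (contMDiffWithinAt_section.1 (ht p hp)).continuousWithinAt
    have hG : ∀ a b, ContinuousWithinAt (fun x => (inner ℝ (frame F V p a x)
        (frame F V p b x) : ℝ)) M p := fun a b =>
      ((hV.contMDiffOn_inner hO (smoothSectionOn_frame p a)
        (smoothSectionOn_frame p b)).continuousOn.continuousAt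
          (hO.mem_nhds hpO)).continuousWithinAt
    have hf : ContinuousWithinAt (fun x => ∑ a, ∑ b, (Module.finBasis ℝ F).repr
        (trivializationAt F V p ⟨x, t x⟩).2 a * ((Module.finBasis ℝ F).repr
        (trivializationAt F V p ⟨x, t x⟩).2 b *
          (inner ℝ (frame F V p b x) (frame F V p a x) : ℝ))) M p :=
      tendsto_finsetSum _ fun a _ => tendsto_finsetSum _ fun b _ =>
        (hc a).mul ((hc b).mul (hG b a))
    have he : ∀ x ∈ frameDomain n F V p, ‖t x‖ ^ 2 = ∑ a, ∑ b, (Module.finBasis ℝ F).repr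
        (trivializationAt F V p ⟨x, t x⟩).2 a * ((Module.finBasis ℝ F).repr
        (trivializationAt F V p ⟨x, t x⟩).2 b *
          (inner ℝ (frame F V p b x) (frame F V p a x) : ℝ)) := fun x hx => by
      have h1 : ∀ a, frameCoeff n F V p a x (t x) = (Module.finBasis ℝ F).repr
          (trivializationAt F V p ⟨x, t x⟩).2 a := fun a =>
        (trivializationAt F V p).localFrameCoeff_eq_coeff hx.2
      simp only [← h1]
      rw [← real_inner_self_eq_norm_sq]
      conv_lhs => rw [eq_sum_frameCoeff hx (t x)]
      rw [inner_sum]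
      refine Finset.sum_congr rfl fun a _ => ?_
      rw [sum_inner]
      refine Finset.sum_congr rfl fun b _ => ?_
      rw [real_inner_smul_left, real_inner_smul_right]
      ring
    exact hf.congr_of_eventuallyEq (eventually_nhdsWithin_of_eventually_nhds
      (eventually_of_mem (hO.mem_nhds hpO) he)) (he p hpO)
  exact h.sqrt.congr fun x _ => (Real.sqrt_sq (norm_nonneg _)).symm

theorem smoothSectionOn_clm_apply {M : Set U} {Q : Π x, V x →L[ℝ] V x}
    (hQ : ContMDiffOn (𝓡 n) ((𝓡 n).prod 𝓘(ℝ, F →L[ℝ] F)) ∞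
      (fun x => TotalSpace.mk' (F →L[ℝ] F) (E := fun x => V x →L[ℝ] V x) x (Q x)) M)
    {u : Π x, V x} (hu : SmoothSectionOn n F u M) :
    SmoothSectionOn n F (fun x => Q x (u x)) M :=
  ContMDiffOn.clm_bundle_apply hQ hu

/-- A smooth endomorphism field on a compact set is uniformly bounded. -/
theorem exists_bound_endomorphism (hV : IsSmoothMetric n F V) {M : Set U} (hM : IsCompact M)
    {Q : Π x, V x →L[ℝ] V x}
    (hQ : ContMDiffOn (𝓡 n) ((𝓡 n).prod 𝓘(ℝ, F →L[ℝ] F)) ∞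
      (fun x => TotalSpace.mk' (F →L[ℝ] F) (E := fun x => V x →L[ℝ] V x) x (Q x)) M) :
    ∃ c : ℝ, 0 ≤ c ∧ ∀ x ∈ M, ∀ v, ‖Q x v‖ ≤ c * ‖v‖ := by
  suffices h : ∃ c : ℝ, ∀ x ∈ M, ∀ v, ‖Q x v‖ ≤ c * ‖v‖ by
    obtain ⟨c, hc⟩ := h
    exact ⟨|c|, abs_nonneg c, fun x hx v => (hc x hx v).trans
      (mul_le_mul_of_nonneg_right (le_abs_self c) (norm_nonneg v))⟩
  suffices h : ∀ p ∈ M, ∃ c : ℝ, ∀ᶠ x in 𝓝[M] p, ∀ v, ‖Q x v‖ ≤ c * ‖v‖ by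
    refine hM.induction_on (p := fun S => ∃ c : ℝ, ∀ x ∈ S, ∀ v, ‖Q x v‖ ≤ c * ‖v‖)
      ⟨0, fun x hx => hx.elim⟩ (fun S T hST ⟨c, hc⟩ => ⟨c, fun x hx => hc x (hST hx)⟩)
      (fun S T ⟨c, hc⟩ ⟨d, hd⟩ => ⟨max c d, fun x hx v => ?_⟩) fun p hp => ?_
    · rcases hx with hx | hx
      · exact (hc x hx v).trans (mul_le_mul_of_nonneg_right (le_max_left _ _) (norm_nonneg v))
      · exact (hd x hx v).trans (mul_le_mul_of_nonneg_right (le_max_right _ _) (norm_nonneg v))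
    · obtain ⟨c, hc⟩ := h p hp
      exact ⟨_, hc, c, fun x hx => hx⟩
  intro p hp
  have hO := isOpen_frameDomain (n := n) (F := F) (V := V) p
  have hpO := mem_frameDomain (n := n) (F := F) (V := V) p
  have hsub : M ∩ frameDomain n F V p ⊆ M := inter_subset_left
  set B : U → ℝ := fun x => ∑ b, (∑ c, |(frameGram F V p x)⁻¹ b c| * ‖frame F V p c x‖) *
    ‖Q x (frame F V p b x)‖ with hB
  have hBc : ContinuousOn B (M ∩ frameDomain n F V p) :=
    continuousOn_finsetSum _ fun b _ => (continuousOn_finsetSum _ fun c _ =>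
      ((contMDiffOn_inv_frameGram hV p b c).continuousOn.mono inter_subset_right).abs.mul
        (continuousOn_norm_section hV ((smoothSectionOn_frame p c).mono inter_subset_right))).mul
      (continuousOn_norm_section hV (smoothSectionOn_clm_apply (hQ.mono hsub)
        ((smoothSectionOn_frame p b).mono inter_subset_right)))
  have hBp := hBc p ⟨hp, hpO⟩
  rw [ContinuousWithinAt, nhdsWithin_inter_of_mem' (nhdsWithin_le_nhds (hO.mem_nhds hpO))] at hBp
  refine ⟨B p + 1, ?_⟩
  filter_upwards [hBp.eventually (gt_mem_nhds (lt_add_one (B p))),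
    nhdsWithin_le_nhds (hO.mem_nhds hpO)] with x hx hxO v
  refine le_trans ?_ (mul_le_mul_of_nonneg_right hx.le (norm_nonneg v))
  conv_lhs => rw [eq_sum_dualCoeff (n := n) hxO v, map_sum]
  rw [hB, Finset.sum_mul]
  refine (norm_sum_le _ _).trans (Finset.sum_le_sum fun b _ => ?_)
  rw [map_smul, norm_smul, mul_right_comm]
  refine mul_le_mul_of_nonneg_right ?_ (norm_nonneg _)
  rw [dualCoeff, Finset.sum_mul]
  refine (norm_sum_le _ _).trans (Finset.sum_le_sum fun c _ => ?_)
  rw [norm_mul, Real.norm_eq_abs, mul_assoc]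
  exact mul_le_mul_of_nonneg_left (abs_real_inner_le_norm _ _) (abs_nonneg _)

end BoundaryRegularity

/-! ### Hermitian bundles -/

section Hermitian
attribute [local instance] InnerProductSpace.complexToReal
variable {n : ℕ} {U : Type*} [TopologicalSpace U] [ChartedSpace (EuclideanSpace ℝ (Fin n)) U]
  [IsManifold (𝓡 n) ∞ U]
  [RiemannianBundle (fun x : U => TangentSpace (𝓡 n) x)]
  [IsContMDiffRiemannianBundle (𝓡 n) ∞ (EuclideanSpace ℝ (Fin n))
    (fun x : U => TangentSpace (𝓡 n) x)] [MeasurableSpace U] [BorelSpace U]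
  [T2Space U] [SigmaCompactSpace U]
  {F : Type*} [NormedAddCommGroup F] [NormedSpace ℂ F] [FiniteDimensional ℂ F]
  {V : U → Type*} [TopologicalSpace (TotalSpace F V)]
  [∀ x, NormedAddCommGroup (V x)] [∀ x, InnerProductSpace ℂ (V x)] [FiberBundle F V]
  [VectorBundle ℂ F V] [VectorBundle ℝ F V] [ContMDiffVectorBundle ∞ F V (𝓡 n)]

theorem re_formInner {W : Type*} [NormedAddCommGroup W] [InnerProductSpace ℂ W] {x : U}
    (α β : TangentSpace (𝓡 n) x →L[ℝ] W) : (formInner x α β).re = covInner x x α β := by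
  simp only [formInner, covInner, Complex.re_sum, Complex.re_ofReal_mul]
  rfl

theorem IsSmoothHermitian.isSmoothMetric (hV : IsSmoothHermitian n F V) :
    IsSmoothMetric n F V := fun s t hs ht => by
  have := hV s t (contMDiffOn_univ.1 hs) (contMDiffOn_univ.1 ht)
  exact Complex.reCLM.contMDiff.comp this

theorem SmoothSection.I_smul {v : Π x, V x} (hv : SmoothSection n F v) :
    SmoothSection n F fun x => Complex.I • v x := by
  intro p
  rw [contMDiffAt_section]
  have h := (contMDiffAt_section p).1 (hv p)
  have hI : ContDiff ℝ ∞ fun y : F => Complex.I • y := contDiff_const_smul _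
  refine (hI.contMDiff.contMDiffAt.comp p h).congr_of_eventuallyEq ?_
  filter_upwards [(trivializationAt F V p).open_baseSet.mem_nhds
    (mem_baseSet_trivializationAt F V p)] with x hx
  exact ((trivializationAt F V p).linear ℂ hx).map_smul Complex.I (v x)

theorem secSupport_I_smul (v : Π x, V x) :
    secSupport (fun x => Complex.I • v x) = secSupport v := by
  simp [secSupport]

theorem inner_I_smul_left {W : Type*} [NormedAddCommGroup W] [InnerProductSpace ℂ W] (v w : W) :
    (inner ℂ (Complex.I • v) w).re = (inner ℂ v w).im := by
  rw [inner_smul_left]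
  simp

theorem formInner_I_smul_left {W : Type*} [NormedAddCommGroup W] [InnerProductSpace ℂ W] {x : U}
    {α α' : TangentSpace (𝓡 n) x →L[ℝ] W} (h : ∀ X, α' X = Complex.I • α X)
    (β : TangentSpace (𝓡 n) x →L[ℝ] W) : (formInner x α' β).re = (formInner x α β).im := by
  simp only [formInner, Complex.re_sum, Complex.im_sum, Complex.re_ofReal_mul,
    Complex.im_ofReal_mul, h, inner_I_smul_left]

theorem integral_eq_of_re_im {X : Type*} [MeasurableSpace X] {μ : Measure X} {f : X → ℂ}
    (hre : Integrable (fun x => (f x).re) μ) (him : Integrable (fun x => (f x).im) μ) :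
    ∫ x, f x ∂μ = ⟨∫ x, (f x).re ∂μ, ∫ x, (f x).im ∂μ⟩ := by
  have hf : Integrable f μ := by
    have := hre.ofReal (𝕜 := ℂ).add (him.ofReal (𝕜 := ℂ).mul_const Complex.I)
    refine this.congr (Eventually.of_forall fun x => ?_)
    exact Complex.re_add_im (f x)
  refine Complex.ext ?_ ?_
  · exact (integral_re hf).symm
  · exact (integral_im hf).symm

variable {A : CovariantDerivative (𝓡 n) F V}
  [CovariantDerivative.ContMDiffCovariantDerivative A ∞]

/-- Testing the real part of the Hermitian pairing is enough, because test sections may be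
multiplied by `i`. -/
theorem isFormalAdjointOf_iff (hV : IsSmoothHermitian n F V) (hA : IsComplexLinear A)
    {α : Π x, TangentSpace (𝓡 n) x →L[ℝ] V x} (hα : IsSmoothForm F α) {w : Π x, V x} :
    IsFormalAdjointOf A α w ↔ IsRealAdjoint A α w := by
  have hV' := hV.isSmoothMetric
  have hI : ∀ v : Π x, V x, SmoothSection n F v → ∀ x X,
      A (fun y => Complex.I • v y) x X = Complex.I • A v x X := fun v hv x X =>
    hA v x ((hv x).mdifferentiableAt (by simp)) X
  have key : ∀ v : Π x, V x, SmoothSection n F v → IsCompact (secSupport v) →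
      SmoothSection n F w →
      (∫ x, (inner ℂ (v x) (w x) : ℂ) ∂(riemannianVolume n U)
        = ⟨∫ x, (inner ℝ (v x) (w x) : ℝ) ∂(riemannianVolume n U),
          ∫ x, (inner ℝ (Complex.I • v x) (w x) : ℝ) ∂(riemannianVolume n U)⟩) ∧
      (∫ x, formInner x (A v x) (α x) ∂(riemannianVolume n U)
        = ⟨∫ x, covInner x x (A v x) (α x) ∂(riemannianVolume n U),
          ∫ x, covInner x x (A (fun y => Complex.I • v y) x) (α x)
            ∂(riemannianVolume n U)⟩) := by
    intro v hv hc hw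
    have hv' := contMDiffOn_univ.2 hv
    have hIv := contMDiffOn_univ.2 hv.I_smul
    have hIc : IsCompact (secSupport fun x => Complex.I • v x) := by
      rwa [secSupport_I_smul]
    have e1 : ∀ x, (inner ℂ (v x) (w x) : ℂ).im = (inner ℝ (Complex.I • v x) (w x) : ℝ) :=
      fun x => (inner_I_smul_left (v x) (w x)).symm
    have e2 : ∀ x, (formInner x (A v x) (α x)).im
        = covInner x x (A (fun y => Complex.I • v y) x) (α x) := fun x => by
      rw [← formInner_I_smul_left (hI v hv x), re_formInner]
    have i1 := integrable_inner_section hV' isOpen_univ hv' (contMDiffOn_univ.2 hw) hc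
      (subset_univ _)
    have i2 := integrable_inner_section hV' isOpen_univ hIv (contMDiffOn_univ.2 hw) hIc
      (subset_univ _)
    have i3 := integrable_covInner A hV' hα hv' hc
    have i4 := integrable_covInner A hV' hα hIv hIc
    constructor
    · rw [integral_eq_of_re_im (f := fun x => (inner ℂ (v x) (w x) : ℂ)) i1
        (by simpa only [e1] using i2)]
      simp only [e1]
      rfl
    · rw [integral_eq_of_re_im (f := fun x => formInner x (A v x) (α x))
        (by simpa only [re_formInner] using i3) (by simpa only [e2] using i4)]
      simp only [e2, re_formInner]
  constructor
  · rintro ⟨hw, h⟩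
    refine ⟨contMDiffOn_univ.2 hw, fun v hv hc => ?_⟩
    have hv' := contMDiffOn_univ.1 hv
    obtain ⟨k1, k2⟩ := key v hv' hc hw
    have := h v hv' hc
    rw [k1, k2] at this
    exact congrArg Complex.re this
  · rintro ⟨hw, h⟩
    have hw' := contMDiffOn_univ.1 hw
    refine ⟨hw', fun v hv hc => ?_⟩
    obtain ⟨k1, k2⟩ := key v hv hc hw'
    rw [k1, k2, h v (contMDiffOn_univ.2 hv) hc, h _ (contMDiffOn_univ.2 hv.I_smul)
      (by rwa [secSupport_I_smul])]

/-- The formal adjoint is chosen among the weak ones if there are any, and there are by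
`exists_isRealAdjoint`. -/
theorem isRealAdjoint_connLaplacian (hV : IsSmoothHermitian n F V) (hA : IsComplexLinear A)
    {u : Π x, V x} (hu : SmoothSection n F u) : IsRealAdjoint A (A u) (connLaplacian A u) := by
  have hα := isSmoothForm_covDeriv A (contMDiffOn_univ.2 hu)
  have hw : ∃ w, IsFormalAdjointOf A (A u) w := by
    obtain ⟨w, hw⟩ := exists_isRealAdjoint A hV.isSmoothMetric hα
    exact ⟨w, (isFormalAdjointOf_iff hV hA hα).2 hw⟩
  rw [connLaplacian, formalAdjoint, dif_pos hw]
  exact (isFormalAdjointOf_iff hV hA hα).1 hw.choose_spec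

theorem h1sclNorm_eq (h : ℝ) (M : Set U) (s : Π x, V x)
    (ds : Π x, TangentSpace (𝓡 n) x →L[ℝ] V x) :
    h1sclNorm h M s ds = √((∫ x in M, ‖s x‖ ^ 2 ∂(riemannianVolume n U))
      + h ^ 2 * ∫ x in M, covInner x x (ds x) (ds x) ∂(riemannianVolume n U)) := by
  rw [h1sclNorm, l2Norm, l2NormForm, Real.sq_sqrt (integral_nonneg fun _ => sq_nonneg _),
    Real.sq_sqrt (integral_nonneg fun x => by
      simp only [re_formInner]
      exact covInner_self_nonneg' _)]
  simp only [re_formInner]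

/-- The Carleman estimate for connection Laplacians on Hermitian bundles. -/
theorem carleman_estimate_connLaplacian (hV : IsSmoothHermitian n F V) (hA : IsComplexLinear A)
    {φ : U → ℝ} (hφ : IsLCW n φ) {M : Set U} (hM : IsCompact M) {Q : Π x, V x →L[ℂ] V x}
    (hQ : ContMDiffOn (𝓡 n) ((𝓡 n).prod 𝓘(ℝ, F →L[ℝ] F)) ∞
      (fun x => TotalSpace.mk' (F →L[ℝ] F) (E := fun x => V x →L[ℝ] V x) x
        ((Q x).restrictScalars ℝ)) M) :
    ∃ C : ℝ, 0 < C ∧ ∃ h₀ : ℝ, 0 < h₀ ∧ ∀ h : ℝ, 0 < h → h ≤ h₀ → ∀ u : Π x, V x,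
      SmoothSection n F u → secSupport u ⊆ M →
      h1sclNorm h M (fun x => Real.exp (φ x / h) • u x) (A fun x => Real.exp (φ x / h) • u x) ≤
        C * h * l2Norm n M (fun x => Real.exp (φ x / h) •
          (connLaplacian A u x + Q x (u x))) := by
  have hV' := hV.isSmoothMetric
  obtain ⟨c, -, hcQ⟩ := exists_bound_endomorphism hV' hM hQ
  obtain ⟨C, hC, h₀, hh₀, hmain⟩ :=
    semiclassical_carleman_estimate A hV' hφ hM (sq_nonneg c)
  refine ⟨C, hC, h₀, hh₀, fun h hh hhh u hu huM => ?_⟩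
  have hw := isRealAdjoint_connLaplacian hV hA hu
  rw [h1sclNorm_eq, l2Norm]
  refine hmain h hh hhh u (connLaplacian A u) (fun x => Q x (u x)) (contMDiffOn_univ.2 hu) huM hw
    (fun x hx => ?_) (continuousOn_norm_section hV' ?_)
  · refine (pow_le_pow_left₀ (norm_nonneg _) (hcQ x hx (u x)) 2).trans ?_
    rw [mul_pow]
    exact mul_le_mul_of_nonneg_left (le_add_of_nonneg_right (covInner_self_nonneg' _))
      (sq_nonneg _)
  · exact (hw.1.mono (subset_univ _)).add_section
      (smoothSectionOn_clm_apply hQ ((contMDiffOn_univ.2 hu).mono (subset_univ _)))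

end Hermitian

/-! ### The trivial bundle and the Laplacian -/

section TrivialBundle
variable {n : ℕ} {U : Type*} [TopologicalSpace U] [ChartedSpace (EuclideanSpace ℝ (Fin n)) U]
  [IsManifold (𝓡 n) ∞ U]
  {W : Type*} [NormedAddCommGroup W] [InnerProductSpace ℝ W] [FiniteDimensional ℝ W]
local notation "𝔼" => EuclideanSpace ℝ (Fin n)

theorem smoothSectionOn_trivial_iff {u : U → W} {N : Set U} :
    SmoothSectionOn n W (V := Bundle.Trivial U W) u N ↔
      ContMDiffOn (𝓡 n) 𝓘(ℝ, W) ∞ u N :=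
  forall₂_congr fun _ _ => contMDiffWithinAt_section

theorem isSmoothMetric_trivial : IsSmoothMetric n W (Bundle.Trivial U W) := fun s t hs ht => by
  have hs' : ContMDiff (𝓡 n) 𝓘(ℝ, W) ∞ s := contMDiffOn_univ.1 (smoothSectionOn_trivial_iff.1 hs)
  have ht' : ContMDiff (𝓡 n) 𝓘(ℝ, W) ∞ t := contMDiffOn_univ.1 (smoothSectionOn_trivial_iff.1 ht)
  exact contDiff_inner.comp_contMDiff (hs'.prodMk_space ht')

theorem mdifferentiableAt_of_trivial {u : U → W} {x : U}
    (hu : MDifferentiableAt (𝓡 n) ((𝓡 n).prod 𝓘(ℝ, W))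
      (fun y => TotalSpace.mk' W (E := Bundle.Trivial U W) y (u y)) x) :
    MDifferentiableAt (𝓡 n) 𝓘(ℝ, W) u x :=
  (mdifferentiableAt_section (F := W) (E := Bundle.Trivial U W) (𝓡 n) u).1 hu

variable (n U W) in
/-- The trivial connection `d` on the trivial bundle. -/
def trivialConnection : CovariantDerivative (𝓡 n) W (Bundle.Trivial U W) where
  toFun u := mvfderiv (𝓡 n) (u : U → W)
  isCovariantDerivativeOnUniv :=
    { add := fun hs ht _ =>
        mvfderiv_add (mdifferentiableAt_of_trivial hs) (mdifferentiableAt_of_trivial ht)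
      leibniz := fun hs hg _ => mvfderiv_smul hg (mdifferentiableAt_of_trivial hs) }

theorem trivialConnection_apply (u : U → W) (x : U) :
    trivialConnection n U W u x = mvfderiv (𝓡 n) u x := rfl

instance : CovariantDerivative.ContMDiffCovariantDerivative (trivialConnection n U W) ∞ where
  contMDiff :=
    { contMDiff := fun {σ} hσ x₀ _ => by
        have hσ' : ContMDiffAt (𝓡 n) 𝓘(ℝ, W) ∞ (σ : U → W) x₀ :=
          (smoothSectionOn_trivial_iff.1 (hσ.of_le (by simp))).contMDiffAt univ_mem
        refine ContMDiffAt.contMDiffWithinAt (contMDiffAt_hom_bundle _ |>.2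
          ⟨contMDiffAt_id, (hσ'.mfderiv_const (m := ∞) (by simp)).congr_of_eventuallyEq
            (Eventually.of_forall fun x => ?_)⟩)
        ext v
        simp only [inTangentCoordinates, ContinuousLinearMap.inCoordinates,
          TangentBundle.continuousLinearMapAt_model_space]
        have e : (trivializationAt W (Bundle.Trivial U W) x₀).continuousLinearMapAt ℝ x
            = ContinuousLinearMap.id ℝ W :=
          Bundle.Trivial.continuousLinearMapAt_trivialization ℝ U W x
        change ((trivializationAt W (Bundle.Trivial U W) x₀).continuousLinearMapAt ℝ x) _ = _
        rw [e]
        rfl }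

theorem frame_trivial (p : U) (a : Fin (Module.finrank ℝ W)) :
    frame W (Bundle.Trivial U W) p a = fun _ => Module.finBasis ℝ W a := by
  funext x
  rw [frame, Trivialization.localFrame_apply_of_mem_baseSet _ _ (mem_univ x)]
  simp only [Trivialization.basisAt, Module.Basis.map_apply]
  exact Bundle.Trivial.trivialization_symm_apply U W x _

theorem coordDeriv_clm {W' : Type*} [NormedAddCommGroup W'] [NormedSpace ℝ W'] (L : W →L[ℝ] W')
    {f : U → W} {p x : U} (hf : MDifferentiableAt (𝓡 n) 𝓘(ℝ, W) f x) (j : Fin n) :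
    coordDeriv p j (fun y => L (f y)) x = L (coordDeriv p j f x) :=
  DFunLike.congr_fun (HasMFDerivAt.comp x L.hasMFDerivAt hf.hasMFDerivAt).mfderiv _

variable [RiemannianBundle (fun x : U => TangentSpace (𝓡 n) x)]
  [IsContMDiffRiemannianBundle (𝓡 n) ∞ (EuclideanSpace ℝ (Fin n))
    (fun x : U => TangentSpace (𝓡 n) x)]

theorem mdifferentiableAt_gradient {u : U → W} (hu : ContMDiff (𝓡 n) 𝓘(ℝ, W) ∞ u) (x : U)
    (j : Fin n) : MDifferentiableAt (𝓡 n) 𝓘(ℝ, W)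
      (fun y => volDensity n x y • ∑ k, (gram n x y)⁻¹ j k • coordDeriv x k u y) x :=
  ContMDiffOn.mdifferentiableAt_of_isOpen ((contMDiffOn_volDensity x).smul
    (contMDiffOn_finsetSum fun k _ => (contMDiffOn_inv_gram x j k).smul
      (contMDiffOn_coordDeriv (chartAt 𝔼 x).open_source subset_rfl hu.contMDiffOn k)))
    (chartAt 𝔼 x).open_source (mem_chart_source 𝔼 x)

/-- The Laplacian in terms of coordinate derivatives on the manifold. -/
theorem laplacian_eq {u : U → W} (hu : ContMDiff (𝓡 n) 𝓘(ℝ, W) ∞ u) (x : U) :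
    laplacian (n := n) u x = (-(volDensity n x x)⁻¹) • ∑ j, coordDeriv x j
      (fun y => volDensity n x y • ∑ k, (gram n x y)⁻¹ j k • coordDeriv x k u y) x := by
  have hx := mem_chart_source 𝔼 x
  have hg : metricAt (n := n) x (chartAt 𝔼 x x) = gram n x x := by
    rw [metricAt, (chartAt 𝔼 x).left_inv hx]
  simp only [laplacian, hg]
  refine congrArg _ (Finset.sum_congr rfl fun j _ => ?_)
  rw [coordDeriv, mvfderiv_coordVec hx (mdifferentiableAt_gradient hu x j) j]
  refine pderiv_congr ?_ j
  filter_upwards [(chartAt 𝔼 x).open_target.mem_nhds ((chartAt 𝔼 x).map_source hx)] with z hz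
  have hz' := (chartAt 𝔼 x).map_target hz
  refine congrArg _ (Finset.sum_congr rfl fun k _ => congrArg _ ?_)
  rw [coordDeriv, mvfderiv_coordVec hz' (hu.mdifferentiable (by simp) _) k,
    (chartAt 𝔼 x).right_inv hz]
  rfl

variable [MeasurableSpace U] [BorelSpace U] [T2Space U] [SigmaCompactSpace U]

/-- On functions with values in a vector space, the Laplacian is `d^* d`: both are given by the same
coordinate formula, since the frame is constant. -/
theorem isRealAdjoint_laplacian {u : U → W} (hu : ContMDiff (𝓡 n) 𝓘(ℝ, W) ∞ u) :
    IsRealAdjoint (trivialConnection n U W) (trivialConnection n U W u)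
      (laplacian (n := n) u) := by
  have hV := isSmoothMetric_trivial (n := n) (U := U) (W := W)
  have hu' : SmoothSectionOn n W (V := Bundle.Trivial U W) u univ :=
    smoothSectionOn_trivial_iff.2 hu.contMDiffOn
  have hα := isSmoothForm_covDeriv (trivialConnection n U W) hu'
  obtain ⟨w, hw⟩ := exists_isRealAdjoint (trivialConnection n U W) hV hα
  suffices h : w = laplacian (n := n) u by rwa [← h]
  funext x
  have hx := mem_frameDomain (n := n) (F := W) (V := Bundle.Trivial U W) x
  refine eq_of_inner_frame_eq hx fun a => ?_
  rw [hw.inner_frame_eq _ hV hα hx a, laplacian_eq hu, adjointPairing]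
  set c : W := Module.finBasis ℝ W a with hc
  have h0 : ∀ X : TangentSpace (𝓡 n) x, trivialConnection n U W (frame W (Bundle.Trivial U W) x a) x X = 0 := by
    intro X
    rw [frame_trivial, trivialConnection_apply, mvfderiv_const]
    rfl
  simp only [h0, inner_zero_left, mul_zero, Finset.sum_const_zero, zero_sub]
  rw [frame_trivial]
  change _ = (inner ℝ c _ : ℝ)
  rw [real_inner_smul_right, inner_sum, neg_mul]
  refine congrArg (fun t => -(_ * t)) (Finset.sum_congr rfl fun j _ => ?_)
  refine Eq.trans ?_ (coordDeriv_clm (innerSL ℝ c) (mdifferentiableAt_gradient hu x j) j)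
  refine congrArg (fun f => coordDeriv x j f x) (funext fun y => ?_)
  rw [innerSL_apply_apply, real_inner_smul_right, inner_sum, Finset.mul_sum, flux]
  refine Finset.sum_congr rfl fun k _ => ?_
  rw [real_inner_smul_right, frame_trivial, mul_assoc]
  rfl

end TrivialBundle

/-! ### Systems with complex first-order coefficients -/

section Systems
attribute [local instance] InnerProductSpace.complexToReal
variable {n : ℕ} {U : Type*} [TopologicalSpace U] [ChartedSpace (EuclideanSpace ℝ (Fin n)) U]
  [IsManifold (𝓡 n) ∞ U]
local notation "𝔼" => EuclideanSpace ℝ (Fin n)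

theorem continuousOn_mvfderiv_apply {W : Type*} [NormedAddCommGroup W] [NormedSpace ℝ W]
    {f : U → W} (hf : ContMDiff (𝓡 n) 𝓘(ℝ, W) ∞ f) {X : Π x : U, TangentSpace (𝓡 n) x} {M : Set U}
    (hX : ContMDiffOn (𝓡 n) (𝓡 n).tangent ∞
      (fun x => (⟨x, X x⟩ : TangentBundle (𝓡 n) U)) M) :
    ContinuousOn (fun x => mvfderiv (𝓡 n) f x (X x)) M := by
  have h1 : ContMDiff (𝓡 n).tangent 𝓘(ℝ, W).tangent ∞ (tangentMap (𝓡 n) 𝓘(ℝ, W) f) :=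
    hf.contMDiff_tangentMap (by simp)
  have h2 := (contMDiff_snd_tangentBundle_modelSpace W 𝓘(ℝ, W) (n := ∞)).comp_contMDiffOn
    (h1.comp_contMDiffOn hX)
  exact h2.continuousOn

variable [RiemannianBundle (fun x : U => TangentSpace (𝓡 n) x)]
  [IsContMDiffRiemannianBundle (𝓡 n) ∞ (EuclideanSpace ℝ (Fin n))
    (fun x : U => TangentSpace (𝓡 n) x)]

theorem continuousOn_sqrt_inner_self {X : Π x : U, TangentSpace (𝓡 n) x} {M : Set U}
    (hX : ContMDiffOn (𝓡 n) (𝓡 n).tangent ∞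
      (fun x => (⟨x, X x⟩ : TangentBundle (𝓡 n) U)) M) :
    ContinuousOn (fun x => √(inner ℝ (X x) (X x))) M := by
  have h : ContMDiffOn (𝓡 n) 𝓘(ℝ, ℝ) ∞ (fun x => (inner ℝ (X x) (X x) : ℝ)) M :=
    ContMDiffOn.inner_bundle hX hX
  exact h.continuousOn.sqrt

variable [MeasurableSpace U] [BorelSpace U] [T2Space U] [SigmaCompactSpace U]

theorem norm_apply_le_formInner {W : Type*} [NormedAddCommGroup W] [InnerProductSpace ℂ W] {x : U}
    (α : TangentSpace (𝓡 n) x →L[ℝ] W) (X : TangentSpace (𝓡 n) x) (t : ℝ) :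
    ‖α X‖ ≤ √(inner ℝ X X) * √(t ^ 2 + (formInner x α α).re) := by
  rw [← Real.sqrt_mul real_inner_self_nonneg, re_formInner]
  refine Real.le_sqrt_of_sq_le ((norm_apply_sq_le (mem_chart_source 𝔼 x) α X).trans ?_)
  exact mul_le_mul_of_nonneg_left (le_add_of_nonneg_left (sq_nonneg t)) real_inner_self_nonneg

theorem norm_le_sqrt_add_formInner {W : Type*} [NormedAddCommGroup W] [InnerProductSpace ℂ W]
    {x : U} (α : TangentSpace (𝓡 n) x →L[ℝ] W) (w : W) :
    ‖w‖ ≤ √(‖w‖ ^ 2 + (formInner x α α).re) := by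
  refine Real.le_sqrt_of_sq_le (le_add_of_nonneg_right ?_)
  rw [re_formInner]
  exact covInner_self_nonneg' _

/-- The Carleman estimate for the Laplacian on vector-valued functions, with a perturbation that
is pointwise controlled by the function and its differential. -/
theorem carleman_estimate_laplacian_add (W : Type*) [NormedAddCommGroup W] [InnerProductSpace ℂ W]
    [FiniteDimensional ℂ W] {φ : U → ℝ} (hφ : IsLCW n φ) {M : Set U} (hM : IsCompact M) (c : ℝ) :
    ∃ C : ℝ, 0 < C ∧ ∃ h₀ : ℝ, 0 < h₀ ∧ ∀ h : ℝ, 0 < h → h ≤ h₀ → ∀ u R : U → W,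
      ContMDiff (𝓡 n) 𝓘(ℝ, W) ∞ u → tsupport u ⊆ M →
      (∀ x ∈ M, ‖R x‖ ≤ c * √(‖u x‖ ^ 2
        + (formInner x (mvfderiv (𝓡 n) u x) (mvfderiv (𝓡 n) u x)).re)) →
      ContinuousOn R M →
      h1sclNorm h M (fun x => Real.exp (φ x / h) • u x)
          (mvfderiv (𝓡 n) (fun x => Real.exp (φ x / h) • u x)) ≤
        C * h * l2Norm n M (fun x => Real.exp (φ x / h) • (laplacian (n := n) u x + R x)) := by
  obtain ⟨C, hC, h₀, hh₀, hmain⟩ := semiclassical_carleman_estimate (trivialConnection n U W)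
    (isSmoothMetric_trivial (n := n) (U := U) (W := W)) hφ hM (sq_nonneg c)
  refine ⟨C, hC, h₀, hh₀, fun h hh hhh u R hu huM hR hRc => ?_⟩
  have hw := isRealAdjoint_laplacian hu
  rw [h1sclNorm_eq, l2Norm]
  refine hmain h hh hhh u (laplacian (n := n) u) R (smoothSectionOn_trivial_iff.2 hu.contMDiffOn)
    huM hw (fun x hx => ?_) ?_
  · have h0 : 0 ≤ ‖u x‖ ^ 2 + (formInner x (mvfderiv (𝓡 n) u x) (mvfderiv (𝓡 n) u x)).re := by
      rw [re_formInner]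
      exact add_nonneg (sq_nonneg _) (covInner_self_nonneg' _)
    refine (pow_le_pow_left₀ (norm_nonneg _) (hR x hx) 2).trans_eq ?_
    rw [mul_pow, Real.sq_sqrt h0, re_formInner]
    rfl
  · exact ((contMDiffOn_univ.1 (smoothSectionOn_trivial_iff.1 hw.1)).continuous.continuousOn.add
      hRc).norm

end Systems

section MatrixSystems
variable {n m : ℕ} {U : Type*} [TopologicalSpace U] [ChartedSpace (EuclideanSpace ℝ (Fin n)) U]
  [IsManifold (𝓡 n) ∞ U]

theorem euclidean_norm_le_sum (v : EuclideanSpace ℂ (Fin m)) : ‖v‖ ≤ ∑ k, ‖v k‖ := by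
  have h : v = ∑ k, EuclideanSpace.single k (v k) := by
    ext j
    simp [Pi.single_apply]
  conv_lhs => rw [h]
  exact (norm_sum_le _ _).trans_eq (Finset.sum_congr rfl fun k _ => by simp)

theorem mvfderiv_component {u : U → EuclideanSpace ℂ (Fin m)}
    (hu : ContMDiff (𝓡 n) 𝓘(ℝ, EuclideanSpace ℂ (Fin m)) ∞ u) (l : Fin m) (x : U)
    (X : TangentSpace (𝓡 n) x) :
    mvfderiv (𝓡 n) (fun y => u y l) x X = (mvfderiv (𝓡 n) u x X : EuclideanSpace ℂ (Fin m)) l :=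
  DFunLike.congr_fun (HasMFDerivAt.comp x
    ((EuclideanSpace.proj l : EuclideanSpace ℂ (Fin m) →L[ℂ] ℂ).restrictScalars ℝ).hasMFDerivAt
    (hu.mdifferentiable (by simp) x).hasMFDerivAt).mfderiv X

theorem contMDiff_component {u : U → EuclideanSpace ℂ (Fin m)}
    (hu : ContMDiff (𝓡 n) 𝓘(ℝ, EuclideanSpace ℂ (Fin m)) ∞ u) (l : Fin m) :
    ContMDiff (𝓡 n) 𝓘(ℝ, ℂ) ∞ fun y => u y l :=
  ((EuclideanSpace.proj l : EuclideanSpace ℂ (Fin m) →L[ℂ] ℂ).restrictScalars ℝ).contMDiff.comp hu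

variable {M : Set U} {Y Z : Fin m → Fin m → Π x : U, TangentSpace (𝓡 n) x}
  {q : U → Matrix (Fin m) (Fin m) ℂ}

theorem continuousOn_firstOrderTerm
    (hY : ∀ k l, ContMDiffOn (𝓡 n) (𝓡 n).tangent ∞
      (fun x => (⟨x, Y k l x⟩ : TangentBundle (𝓡 n) U)) M)
    (hZ : ∀ k l, ContMDiffOn (𝓡 n) (𝓡 n).tangent ∞
      (fun x => (⟨x, Z k l x⟩ : TangentBundle (𝓡 n) U)) M)
    (hq : ∀ k l, ContMDiffOn (𝓡 n) 𝓘(ℝ, ℂ) ∞ (fun x => q x k l) M)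
    {u : U → EuclideanSpace ℂ (Fin m)}
    (hu : ContMDiff (𝓡 n) 𝓘(ℝ, EuclideanSpace ℂ (Fin m)) ∞ u) :
    ContinuousOn (fun x => vecFieldAction Y Z u x + potentialAction q u x) M := by
  refine ContinuousOn.add ?_ ?_
  · refine (PiLp.continuous_toLp 2 _).comp_continuousOn (continuousOn_pi.2 fun k =>
      continuousOn_finsetSum _ fun l _ => ?_)
    exact (continuousOn_mvfderiv_apply (contMDiff_component hu l) (hY k l)).add
      (continuousOn_const.mul (continuousOn_mvfderiv_apply (contMDiff_component hu l) (hZ k l)))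
  · refine (PiLp.continuous_toLp 2 _).comp_continuousOn (continuousOn_pi.2 fun k => ?_)
    change ContinuousOn (fun x => ∑ l, q x k l * u x l) M
    exact continuousOn_finsetSum _ fun l _ => (hq k l).continuousOn.mul
      (contMDiff_component hu l).continuous.continuousOn

variable [RiemannianBundle (fun x : U => TangentSpace (𝓡 n) x)]
variable [IsContMDiffRiemannianBundle (𝓡 n) ∞ (EuclideanSpace ℝ (Fin n))
    (fun x : U => TangentSpace (𝓡 n) x)]
  [MeasurableSpace U] [BorelSpace U] [T2Space U] [SigmaCompactSpace U]

/-- A first-order term is bounded by the length of the 1-jet, with the sum of the lengths of its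
coefficients as the constant. -/
theorem norm_firstOrderTerm_le {u : U → EuclideanSpace ℂ (Fin m)}
    (hu : ContMDiff (𝓡 n) 𝓘(ℝ, EuclideanSpace ℂ (Fin m)) ∞ u) (x : U) :
    ‖vecFieldAction Y Z u x + potentialAction q u x‖ ≤
      (∑ k, ∑ l, (√(inner ℝ (Y k l x) (Y k l x)) + √(inner ℝ (Z k l x) (Z k l x)) + ‖q x k l‖)) *
        √(‖u x‖ ^ 2 + (formInner x (mvfderiv (𝓡 n) u x) (mvfderiv (𝓡 n) u x)).re) := by
  set r := √(‖u x‖ ^ 2 + (formInner x (mvfderiv (𝓡 n) u x) (mvfderiv (𝓡 n) u x)).re) with hr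
  have h1 : ∀ (l : Fin m) (X : TangentSpace (𝓡 n) x),
      ‖mvfderiv (𝓡 n) (fun y => u y l) x X‖ ≤ √(inner ℝ X X) * r := fun l X => by
    rw [mvfderiv_component hu]
    exact (PiLp.norm_apply_le _ l).trans (norm_apply_le_formInner _ X _)
  have h2 : ∀ l, ‖u x l‖ ≤ r := fun l => (PiLp.norm_apply_le _ l).trans
    (norm_le_sqrt_add_formInner _ _)
  refine (euclidean_norm_le_sum _).trans ?_
  rw [Finset.sum_mul]
  refine Finset.sum_le_sum fun k _ => ?_
  have h3 : (vecFieldAction Y Z u x + potentialAction q u x) k = ∑ l,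
      (mvfderiv (𝓡 n) (fun y => u y l) x (Y k l x)
        + Complex.I * mvfderiv (𝓡 n) (fun y => u y l) x (Z k l x) + q x k l * u x l) := by
    rw [Finset.sum_add_distrib]
    rfl
  rw [h3, Finset.sum_mul]
  refine (norm_sum_le _ _).trans (Finset.sum_le_sum fun l _ => ?_)
  rw [add_mul, add_mul]
  refine (norm_add₃_le).trans (add_le_add (add_le_add (h1 l _) ?_) ?_)
  · rw [norm_mul, Complex.norm_I, one_mul]
    exact h1 l _
  · rw [norm_mul]
    exact mul_le_mul_of_nonneg_left (h2 l) (norm_nonneg _)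

/-- The Carleman estimate for systems with scalar principal part. -/
theorem carleman_estimate_system {φ : U → ℝ} (hφ : IsLCW n φ) (hM : IsCompact M)
    (hY : ∀ k l, ContMDiffOn (𝓡 n) (𝓡 n).tangent ∞
      (fun x => (⟨x, Y k l x⟩ : TangentBundle (𝓡 n) U)) M)
    (hZ : ∀ k l, ContMDiffOn (𝓡 n) (𝓡 n).tangent ∞
      (fun x => (⟨x, Z k l x⟩ : TangentBundle (𝓡 n) U)) M)
    (hq : ∀ k l, ContMDiffOn (𝓡 n) 𝓘(ℝ, ℂ) ∞ (fun x => q x k l) M) :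
    ∃ C : ℝ, 0 < C ∧ ∃ h₀ : ℝ, 0 < h₀ ∧ ∀ h : ℝ, 0 < h → h ≤ h₀ → ∀ u : U → EuclideanSpace ℂ (Fin m),
      ContMDiff (𝓡 n) 𝓘(ℝ, EuclideanSpace ℂ (Fin m)) ∞ u → tsupport u ⊆ M →
      h1sclNorm h M (fun x => Real.exp (φ x / h) • u x)
          (mvfderiv (𝓡 n) (fun x => Real.exp (φ x / h) • u x)) ≤
        C * h * l2Norm n M (fun x => Real.exp (φ x / h) •
          (laplacian (n := n) u x + vecFieldAction Y Z u x + potentialAction q u x)) := by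
  have hb : ContinuousOn (fun x => ∑ k, ∑ l, (√(inner ℝ (Y k l x) (Y k l x))
      + √(inner ℝ (Z k l x) (Z k l x)) + ‖q x k l‖)) M :=
    continuousOn_finsetSum _ fun k _ => continuousOn_finsetSum _ fun l _ =>
      ((continuousOn_sqrt_inner_self (hY k l)).add (continuousOn_sqrt_inner_self (hZ k l))).add
        (hq k l).continuousOn.norm
  obtain ⟨B, hB⟩ := hM.exists_bound_of_continuousOn hb
  obtain ⟨C, hC, h₀, hh₀, hmain⟩ :=
    carleman_estimate_laplacian_add (EuclideanSpace ℂ (Fin m)) hφ hM B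
  refine ⟨C, hC, h₀, hh₀, fun h hh hhh u hu huM => ?_⟩
  simp only [add_assoc]
  exact hmain h hh hhh u (fun x => vecFieldAction Y Z u x + potentialAction q u x) hu huM
    (fun x hx => (norm_firstOrderTerm_le hu x).trans (mul_le_mul_of_nonneg_right
      ((le_abs_self _).trans (hB x hx)) (Real.sqrt_nonneg _)))
    (continuousOn_firstOrderTerm hY hZ hq hu)

end MatrixSystems

end Carleman

end

open Carleman in
theorem theorem3p1
    -- the open Riemannian manifold `(U, g)` of dimension `n`
    {n : ℕ} {U : Type*} [TopologicalSpace U] [T2Space U] [SigmaCompactSpace U]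
    [ChartedSpace (EuclideanSpace ℝ (Fin n)) U] [IsManifold (𝓡 n) ∞ U]
    [MeasurableSpace U] [BorelSpace U]
    [RiemannianBundle (fun x : U => TangentSpace (𝓡 n) x)]
    [IsContMDiffRiemannianBundle (𝓡 n) ∞ (EuclideanSpace ℝ (Fin n))
      (fun x : U => TangentSpace (𝓡 n) x)]
    -- the weight and the compact domain `M` in `U`
    (φ : U → ℝ) (hφ : IsLCW n φ)
    (M : Set U) (hM : IsCompact M) (hM' : IsSmoothDomain n M) :
    -- systems with values in `ℂ^m`
    (∀ (m : ℕ) (Y Z : Fin m → Fin m → Π x : U, TangentSpace (𝓡 n) x)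
        (q : U → Matrix (Fin m) (Fin m) ℂ),
      (∀ k l, ContMDiffOn (𝓡 n) (𝓡 n).tangent ∞
        (fun x => (⟨x, Y k l x⟩ : TangentBundle (𝓡 n) U)) M) →
      (∀ k l, ContMDiffOn (𝓡 n) (𝓡 n).tangent ∞
        (fun x => (⟨x, Z k l x⟩ : TangentBundle (𝓡 n) U)) M) →
      (∀ k l, ContMDiffOn (𝓡 n) 𝓘(ℝ, ℂ) ∞ (fun x => q x k l) M) →
      ∃ C : ℝ, 0 < C ∧ ∃ h₀ : ℝ, 0 < h₀ ∧ ∀ h : ℝ, 0 < h → h ≤ h₀ → ∀ u : U → EuclideanSpace ℂ (Fin m),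
        ContMDiff (𝓡 n) 𝓘(ℝ, EuclideanSpace ℂ (Fin m)) ∞ u → HasCompactSupport u →
        tsupport u ⊆ interior M →
        h1sclNorm h M (fun x => Real.exp (φ x / h) • u x)
            (mvfderiv (𝓡 n) (fun x => Real.exp (φ x / h) • u x)) ≤
          C * h * l2Norm n M (fun x => Real.exp (φ x / h) •
            (laplacian (n := n) u x + vecFieldAction Y Z u x + potentialAction q u x))) ∧
    -- sections of a Hermitian bundle `V` with a connection `A`
    (∀ (F : Type*) [NormedAddCommGroup F] [NormedSpace ℂ F] [FiniteDimensional ℂ F]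
        (V : U → Type*) [TopologicalSpace (TotalSpace F V)]
        [∀ x, NormedAddCommGroup (V x)] [∀ x, InnerProductSpace ℂ (V x)]
        [FiberBundle F V] [VectorBundle ℂ F V] [VectorBundle ℝ F V]
        [ContMDiffVectorBundle ∞ F V (𝓡 n)]
        (A : CovariantDerivative (𝓡 n) F V) [CovariantDerivative.ContMDiffCovariantDerivative A ∞]
        (Q : Π x, V x →L[ℂ] V x),
      IsSmoothHermitian n F V →
      IsComplexLinear A →
      ContMDiffOn (𝓡 n) ((𝓡 n).prod 𝓘(ℝ, F →L[ℝ] F)) ∞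
        (fun x => TotalSpace.mk' (F →L[ℝ] F) (E := fun x => V x →L[ℝ] V x) x
          ((Q x).restrictScalars ℝ)) M →
      ∃ C : ℝ, 0 < C ∧ ∃ h₀ : ℝ, 0 < h₀ ∧ ∀ h : ℝ, 0 < h → h ≤ h₀ → ∀ u : Π x, V x,
        SmoothSection n F u → IsCompact (secSupport u) → secSupport u ⊆ interior M →
        h1sclNorm h M (fun x => Real.exp (φ x / h) • u x)
            (A fun x => Real.exp (φ x / h) • u x) ≤
          C * h * l2Norm n M (fun x => Real.exp (φ x / h) •
            (connLaplacian A u x + Q x (u x)))) := by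
  refine ⟨fun m Y Z q hY hZ hq => ?_, fun F _ _ _ V _ _ _ _ _ _ _ A _ Q hV hA hQ => ?_⟩
  · obtain ⟨C, hC, h₀, hh₀, H⟩ := carleman_estimate_system hφ hM hY hZ hq
    exact ⟨C, hC, h₀, hh₀, fun h hh hhh u hu _ hs =>
      H h hh hhh u hu (hs.trans interior_subset)⟩
  · obtain ⟨C, hC, h₀, hh₀, H⟩ := carleman_estimate_connLaplacian (A := A) hV hA hφ hM hQ
    exact ⟨C, hC, h₀, hh₀, fun h hh hhh u hu _ hs =>
      H h hh hhh u hu (hs.trans interior_subset)⟩
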